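/- Let $-3<\kappa<0$ and let $B(v-u,\omega)=|v-u|^{\kappa}\beta(\theta)$, where $\theta\in[0,\pi]$ is the angle between $v-u$ and $\omega\in\mathbb S^2$, and $\beta$ is measurable, satisfies $0\le\beta(\theta)\le\beta_0|\cos\theta|$ on $[0,\pi]$ for some constant $\beta_0>0$, and is not almost everywhere zero on $[0,\pi]$. With $u'=u+[(v-u)\cdot\omega]\omega$ and $v'=v-[(v-u)\cdot\omega]\omega$ put $$Q(F_1,F_2)(v)=\iint_{\mathbb R^3\times\mathbb S^2}B(v-u,\omega)F_1(u')F_2(v')\,d\omega du-\iint_{\mathbb R^3\times\mathbb S^2}B(v-u,\omega)F_1(u)F_2(v)\,d\omega du .$$ Let $\rho>0$, $\mathfrak u\in\mathbb R^3$, $T>0$, and $$\mu(v)=\frac{\rho}{(2\pi T)^{3/2}}e^{-\frac{|v-\mathfrak u|^2}{2T}},\qquad \nu(v)=\iint_{\mathbb R^3\times\mathbb S^2} B(v-u,\omega)\mu(u)\,d\omega du,$$ $$\mathbf L h=-\frac1{\sqrt\mu}\{Q(\mu,\sqrt\mu h)+Q(\sqrt\mu h,\mu)\}.$$ Let $\mathcal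 N\subset L^2(\mathbb R^3)$ be the null space of $\mathbf L$, let $\mathcal N^\perp$ be its orthogonal complement in $L^2(\mathbb R^3)$, and let $\mathbf L^{-1}=(\mathbf L|_{\mathcal N^\perp})^{-1}$ be the pseudo-inverse: $h=\mathbf L^{-1}\mathfrak g$ means $h\in\mathcal N^\perp$ and $\mathbf L h=\mathfrak g$ almost everywhere. Let $N\ge 2$ be an integer and $0<q'<1$. There are constants $C_1,C_2>0$, depending only on $\rho,\mathfrak u,T,q',N$ and on the collision kernel (that is, on $\kappa$ and $\beta$), such that the following holds for every $0<q<q'$. Let $\mathfrak g\in\mathcal N^\perp$ have weak derivatives $\partial_v^\alpha\mathfrak g$ for all $|\alpha|\le N$, with $$\sum_{|\alpha|\le N}\|\nu^{-1}\mu^{-\frac{q'}2}\partial_v^\alpha\mathfrak g\|_{L^2_v}<\infty .$$ Then $\mathbf L^{-1}\mathfrak g$ exists, is unique up to null sets and has a continuous representative; $\mu^{-\frac q2}\mathbf L^{-1}\mathfrak g$ has weak derivatives of all orders $|\alpha|\le N$; and, for the continuous representative and every $v\in\mathbb R^3$, $$|\mu^{-\frac q2}\mathbf L^{-1}\mathfrak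 g(v)|\le C_1\sum_{|\alpha|\le N}\|\partial_v^\alpha(\mu^{-\frac q2}\mathbf L^{-1}\mathfrak g)\|_{L^2_v}\le C_2\sum_{|\alpha|\le N}\|\nu^{-1}\mu^{-\frac{q'}2}\partial_v^\alpha\mathfrak g\|_{L^2_v}.$$ -/

import Mathlib

open MeasureTheory

noncomputable section

namespace Boltzmann

/-- The velocity space `ℝ³` with its Euclidean norm. -/
abbrev Vel : Type := EuclideanSpace ℝ (Fin 3)

/-- The unit sphere `𝕊²` of the velocity space. -/
abbrev S2 : Type := Metric.sphere (0 : Vel) 1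

/-- The product measure `du dω` on `ℝ³ × 𝕊²`, where `dω` is the surface measure. -/
def collMeasure : Measure (Vel × S2) :=
  (volume : Measure Vel).prod (volume : Measure Vel).toSphere

/-- `v' = v - [(v - u) · ω] ω`. -/
def vPost (v u : Vel) (ω : S2) : Vel := v - (inner ℝ (v - u) (ω : Vel)) • (ω : Vel)

/-- `u' = u + [(v - u) · ω] ω`. -/
def uPost (v u : Vel) (ω : S2) : Vel := u + (inner ℝ (v - u) (ω : Vel)) • (ω : Vel)

/-- The collision kernel `B(v - u, ω) = |v - u|^κ β(θ)` as a function of the relative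
velocity `z = v - u`, where `θ ∈ [0, π]` is the angle between `z` and `ω`. -/
def kernelB (κ : ℝ) (β : ℝ → ℝ) (z : Vel) (ω : S2) : ℝ :=
  ‖z‖ ^ κ * β (InnerProductGeometry.angle z (ω : Vel))

/-- The gain term `Q₊(F₁, F₂)`. -/
def Qplus (κ : ℝ) (β : ℝ → ℝ) (F₁ F₂ : Vel → ℝ) (v : Vel) : ℝ :=
  ∫ p : Vel × S2,
    kernelB κ β (v - p.1) p.2 * F₁ (uPost v p.1 p.2) * F₂ (vPost v p.1 p.2) ∂collMeasure

/-- The loss term `Q₋(F₁, F₂)`. -/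
def Qminus (κ : ℝ) (β : ℝ → ℝ) (F₁ F₂ : Vel → ℝ) (v : Vel) : ℝ :=
  ∫ p : Vel × S2, kernelB κ β (v - p.1) p.2 * F₁ p.1 * F₂ v ∂collMeasure

/-- The Boltzmann collision operator. -/
def Q (κ : ℝ) (β : ℝ → ℝ) (F₁ F₂ : Vel → ℝ) (v : Vel) : ℝ :=
  Qplus κ β F₁ F₂ v - Qminus κ β F₁ F₂ v

/-- The Maxwellian `μ` with density `ρ`, bulk velocity `𝔲` and temperature `T`. -/
def maxwellian (ρ : ℝ) (𝔲 : Vel) (T : ℝ) (v : Vel) : ℝ :=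
  ρ / (2 * Real.pi * T) ^ (3 / 2 : ℝ) * Real.exp (-(‖v - 𝔲‖ ^ 2 / (2 * T)))

/-- The collision frequency `ν(v) = ∬ B(v - u, ω) μ(u) dω du`. -/
def nu (κ : ℝ) (β : ℝ → ℝ) (ρ : ℝ) (𝔲 : Vel) (T : ℝ) (v : Vel) : ℝ :=
  ∫ p : Vel × S2, kernelB κ β (v - p.1) p.2 * maxwellian ρ 𝔲 T p.1 ∂collMeasure

/-- The linearized collision operator
`L h = - μ^{-1/2} { Q(μ, √μ h) + Q(√μ h, μ) }`. -/
def linL (κ : ℝ) (β : ℝ → ℝ) (ρ : ℝ) (𝔲 : Vel) (T : ℝ) (h : Vel → ℝ) (v : Vel) : ℝ :=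
  -(1 / Real.sqrt (maxwellian ρ 𝔲 T v)) *
    (Q κ β (maxwellian ρ 𝔲 T) (fun w => Real.sqrt (maxwellian ρ 𝔲 T w) * h w) v +
      Q κ β (fun w => Real.sqrt (maxwellian ρ 𝔲 T w) * h w) (maxwellian ρ 𝔲 T) v)

/-- `f` belongs to the null space `𝒩 ⊆ L²(ℝ³)` of `L`. -/
def InNull (κ : ℝ) (β : ℝ → ℝ) (ρ : ℝ) (𝔲 : Vel) (T : ℝ) (f : Vel → ℝ) : Prop :=
  MemLp f 2 volume ∧ linL κ β ρ 𝔲 T f =ᵐ[volume] 0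

/-- `f` belongs to the orthogonal complement `𝒩^⊥` of the null space in `L²(ℝ³)`. -/
def InNullPerp (κ : ℝ) (β : ℝ → ℝ) (ρ : ℝ) (𝔲 : Vel) (T : ℝ) (f : Vel → ℝ) : Prop :=
  MemLp f 2 volume ∧ ∀ χ : Vel → ℝ, InNull κ β ρ 𝔲 T χ → ∫ v, f v * χ v = 0

/-- `h` is (a representative of) `L⁻¹ g`, where `L⁻¹ = (L|_{𝒩^⊥})⁻¹` is the pseudo-inverse:
`h ∈ 𝒩^⊥` and `L h = g` almost everywhere. -/
def IsLinv (κ : ℝ) (β : ℝ → ℝ) (ρ : ℝ) (𝔲 : Vel) (T : ℝ) (g h : Vel → ℝ) : Prop :=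
  InNullPerp κ β ρ 𝔲 T h ∧ linL κ β ρ 𝔲 T h =ᵐ[volume] g

/-- The classical partial derivative `∂_{v_i} φ`. -/
def partialD (i : Fin 3) (φ : Vel → ℝ) : Vel → ℝ :=
  fun v => fderiv ℝ φ v (EuclideanSpace.single i 1)

/-- The classical derivative `∂_v^α φ = ∂_{v_1}^{α_1} ∂_{v_2}^{α_2} ∂_{v_3}^{α_3} φ`. -/
def multiD (α : Fin 3 → ℕ) (φ : Vel → ℝ) : Vel → ℝ :=
  (partialD 0)^[α 0] ((partialD 1)^[α 1] ((partialD 2)^[α 2] φ))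

/-- `f'` is the weak derivative `∂_v^α f` of `f` on `ℝ³`. -/
def IsWeakDeriv (α : Fin 3 → ℕ) (f f' : Vel → ℝ) : Prop :=
  LocallyIntegrable f volume ∧ LocallyIntegrable f' volume ∧
    ∀ φ : Vel → ℝ, ContDiff ℝ ((⊤ : ℕ∞) : WithTop ℕ∞) φ → HasCompactSupport φ →
      ∫ v, f v * multiD α φ v = (-1 : ℝ) ^ (∑ i, α i) * ∫ v, f' v * φ v

/-- The multi-indices `α ∈ ℕ³` with `|α| ≤ N`. -/
def multiIdx (N : ℕ) : Finset (Fin 3 → ℕ) :=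
  (Fintype.piFinset fun _ => Finset.range (N + 1)).filter fun α => ∑ i, α i ≤ N

end Boltzmann

end

open Boltzmann

open scoped ENNReal

/-! With u = v + z and ξ = (z, ω), `Admissible.linL_eq` writes L = ν − K, where K is a sum of three
operators f ↦ ∫ P(v, ξ) f(v + y(ξ)) dξ, the displacement y being v' − v, u' − v or u − v. Since ν is
comparable with (1 + |v − 𝔲|²)^{κ/2} (`Admissible.exists_nu_le`, `Admissible.exists_le_nu`), it
decays at infinity and inverting L costs a factor ν⁻¹. The estimates are therefore made on the
equation multiplied by the smooth weight `mW`, comparable with ν⁻¹.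

The variables ξ have two advantages. The singular factor of the kernel depends on ξ alone, so a
derivative in v falls only on the Maxwellian factors and on f, and commutators with derivatives are
operators of the same kind (`smoothOp_prodKer`). And reversing a collision is an involution of the
parameters, which yields both the symmetry of K and the column bounds in Schur's test.

Compactness. All kernels are dominated by `maj`. Schur's test (`lintegral_majOp_sq_le`) bounds the
majorant operators, which are small for large velocities and for small displacements; the remaining
core maps L² to L^∞ of a ball and is Hilbert–Schmidt. Hence the operators are norm limits of finite
rank operators (`KerBdd.mem_closure_finRank`). The displacement u' − v is reduced to v' − v by the
identity `lintegral_sphere_swap`, which exchanges the components of z along and across ω.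

Existence. S = ν^{-1/2} K ν^{-1/2} is compact and self-adjoint on L², so the Fredholm alternative
applies to f − S f = ν^{-1/2} g. It only places ν^{1/2} times the solution in L². The rest comes
from `Admissible.exists_decay`: test the equation with a truncation of μ^{-p}, p = q'/2 < 1/2;
energy conservation lets the weight pass through the kernel, and the far part of the majorant
operators is absorbed. This also shows that null functions found by the Fredholm alternative do lie
in L². Projecting off 𝒩 and applying the decay estimate again gives the pseudo-inverse with its
bound (`Admissible.exists_solution`).

Regularity. H = μ^{-p} L⁻¹g satisfies mW ν H = K_p H + G with K_p again a limit of finite rank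
operators and G = mW μ^{-p} g. For small c > 0 the operator 1 − c mW ν is a strict contraction;
replacing K_p by K_p − F, where F has finite rank with test functions as building blocks, keeps it
one. So H is a fixed point of a contraction with source cFH + cG, and such equations inherit Sobolev
regularity because the contraction has good commutators with derivatives
(`SmoothOp.exists_regularity`).

Source. Derivatives of mW μ^{-p} g involve growing factors v_j − 𝔲_j coming from the weight. The
Hardy inequality `exists_hardy` pays for each of them with one derivative of g.

Conclusion. μ^{-q/2} L⁻¹g = μ^{(q'−q)/2} H, and the derivatives of the multiplier are bounded
uniformly in 0 < q < q' (`Admissible.exists_derivBdd_rpow`). The pointwise bound is the embedding H²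
⊂ C⁰ ∩ L^∞, obtained from an explicit square integrable kernel (`green_identity`,
`exists_sobolev_embedding`). -/

namespace Boltzmann

/-! ### Finite rank approximation, compactness and the Fredholm alternative in a Hilbert space. -/

section Operators

variable {E : Type*} [NormedAddCommGroup E] [InnerProductSpace ℝ E]

/-- The rank one operator `x ↦ ⟪ψ, x⟫ φ`. -/
noncomputable def rankOne (ψ φ : E) : E →L[ℝ] E := (innerSL ℝ ψ).smulRight φ

/-- The finite rank operators built from vectors of `D`. -/
noncomputable def finRank (D : Set E) : Submodule ℝ (E →L[ℝ] E) :=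
  Submodule.span ℝ {F | ∃ ψ ∈ D, ∃ φ ∈ D, F = rankOne ψ φ}

@[simp] lemma rankOne_apply (ψ φ x : E) : rankOne ψ φ x = (inner ℝ ψ x) • φ := by
  simp [rankOne]

lemma continuous_rankOne : Continuous fun p : E × E => rankOne p.1 p.2 := by
  have h : (fun p : E × E => rankOne p.1 p.2) =
      fun p => ContinuousLinearMap.smulRightL ℝ E E (innerSL ℝ p.1) p.2 := by
    ext p x; simp
  rw [h]; fun_prop

/-- A rank one operator depends continuously on its pair of vectors, and D × D is dense in the
product. Applied with test functions, this makes approximating operators smoothing. -/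
lemma finRank_univ_le_closure {D : Set E} (hD : Dense D) :
    (finRank (Set.univ : Set E) : Set (E →L[ℝ] E)) ⊆ closure (finRank D : Set (E →L[ℝ] E)) := by
  have : finRank (Set.univ : Set E) ≤ (finRank D).topologicalClosure := by
    refine Submodule.span_le.2 ?_
    rintro _ ⟨ψ, -, φ, -, rfl⟩
    have h1 : (ψ, φ) ∈ closure (D ×ˢ D) := by
      rw [closure_prod_eq, hD.closure_eq]; simp
    have h2 := image_closure_subset_closure_image (continuous_rankOne (E := E))
      (Set.mem_image_of_mem _ h1)
    refine closure_mono ?_ h2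
    rintro _ ⟨⟨a, b⟩, hab, rfl⟩
    exact Submodule.subset_span ⟨a, hab.1, b, hab.2, rfl⟩
  exact this

lemma exists_finRank_approx {D : Set E} (hD : Dense D) {T : E →L[ℝ] E}
    (hT : T ∈ closure (finRank (Set.univ : Set E) : Set (E →L[ℝ] E))) {ε : ℝ} (hε : 0 < ε) :
    ∃ F ∈ finRank D, ‖T - F‖ < ε := by
  have h : T ∈ closure (finRank D : Set (E →L[ℝ] E)) :=
    closure_minimal (finRank_univ_le_closure hD) isClosed_closure hT
  obtain ⟨F, hF, h'⟩ := Metric.mem_closure_iff.1 h ε hε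
  exact ⟨F, hF, by rwa [dist_eq_norm] at h'⟩

lemma isCompactOperator_of_mem_closure_finRank [CompleteSpace E] {T : E →L[ℝ] E}
    (hT : T ∈ closure (finRank (Set.univ : Set E) : Set (E →L[ℝ] E))) : IsCompactOperator T := by
  have hle : ∀ F ∈ finRank (Set.univ : Set E), IsCompactOperator F := by
    intro F hF
    induction hF using Submodule.span_induction with
    | mem F h =>
      obtain ⟨ψ, -, φ, -, rfl⟩ := h
      have h1 : IsCompactOperator (ContinuousLinearMap.toSpanSingleton ℝ φ) :=
        isCompactOperator_of_locallyCompactSpace_rng (ContinuousLinearMap.toSpanSingleton ℝ φ)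
      convert! h1.comp_clm (innerSL ℝ ψ) using 1
    | zero => exact isCompactOperator_zero
    | add F G _ _ hF hG => exact hF.add hG
    | smul a F _ hF => exact hF.smul a
  have hcl : IsClosed {f : E →L[ℝ] E | IsCompactOperator f} := isClosed_setOfPred_isCompactOperator
  exact hcl.closure_subset_iff.2 (fun f hf => hle f hf) hT

/-- Hilbert–Schmidt operators: cutting the basis expansion to a finite set leaves an error which
Cauchy–Schwarz and Bessel's inequality bound by the tail of Σ ‖T bᵢ‖². -/
lemma mem_closure_finRank_of_summable {ι : Type*} (b : HilbertBasis ι ℝ E)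
    {T : E →L[ℝ] E} (hs : Summable fun i => ‖T (b i)‖ ^ 2) :
    T ∈ closure (finRank (Set.univ : Set E) : Set (E →L[ℝ] E)) := by
  classical
  rw [Metric.mem_closure_iff]
  intro ε hε
  obtain ⟨s, hs'⟩ := summable_iff_vanishing_norm.1 hs ((ε / 2) ^ 2) (by positivity)
  refine ⟨∑ i ∈ s, rankOne (b i) (T (b i)), Submodule.sum_mem _ fun i _ =>
    Submodule.subset_span ⟨_, trivial, _, trivial, rfl⟩, ?_⟩
  rw [dist_eq_norm]
  refine lt_of_le_of_lt (ContinuousLinearMap.opNorm_le_bound _ (by positivity : 0 ≤ ε / 2)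
    fun x => ?_) (by linarith)
  have h1 : HasSum (fun i => inner ℝ (b i) x • T (b i)) (T x) := by
    have := (b.hasSum_repr x).mapL T
    simpa [b.repr_apply_apply] using this
  have h2 : Filter.Tendsto (fun t : Finset ι => ‖∑ i ∈ t, inner ℝ (b i) x • T (b i)
      - ∑ i ∈ s, inner ℝ (b i) x • T (b i)‖) Filter.atTop
      (nhds ‖T x - ∑ i ∈ s, inner ℝ (b i) x • T (b i)‖) :=
    (Filter.Tendsto.sub_const h1 _).norm
  have h3 : (T - ∑ i ∈ s, rankOne (b i) (T (b i))) x
      = T x - ∑ i ∈ s, inner ℝ (b i) x • T (b i) := by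
    simp
  rw [h3]
  -- The bound is shown for all finite partial sums over t ⊇ s and passes to the limit.
  refine le_of_tendsto h2 ?_
  filter_upwards [Filter.eventually_ge_atTop s] with t hst
  rw [← Finset.sum_sdiff hst, add_sub_cancel_right]
  have h4 := hs' (t \ s) Finset.sdiff_disjoint
  rw [Real.norm_of_nonneg (by positivity)] at h4
  calc ‖∑ i ∈ t \ s, inner ℝ (b i) x • T (b i)‖
      ≤ ∑ i ∈ t \ s, |inner ℝ (b i) x| * ‖T (b i)‖ := by
        refine (norm_sum_le _ _).trans_eq ?_
        simp [norm_smul]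
    _ ≤ √(∑ i ∈ t \ s, |inner ℝ (b i) x| ^ 2) * √(∑ i ∈ t \ s, ‖T (b i)‖ ^ 2) :=
        Real.sum_mul_le_sqrt_mul_sqrt _ _ _
    _ ≤ ‖x‖ * (ε / 2) := by
        refine mul_le_mul ?_ ?_ (by positivity) (by positivity)
        · refine Real.sqrt_le_iff.2 ⟨by positivity, ?_⟩
          exact b.orthonormal.sum_inner_products_le x
        · exact Real.sqrt_le_iff.2 ⟨by positivity, h4.le⟩
    _ = ε / 2 * ‖x‖ := mul_comm _ _

/-- The Fredholm alternative for a compact self-adjoint operator. -/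
lemma exists_fredholm_solution [CompleteSpace E] {S : E →L[ℝ] E} (hS : IsCompactOperator S)
    (hsa : ∀ x y, inner ℝ (S x) y = inner ℝ x (S y)) :
    ∃ C : ℝ, 0 < C ∧ ∀ G : E, (∀ f, S f = f → inner ℝ G f = 0) →
      ∃ f, f - S f = G ∧ ‖f‖ ≤ C * ‖G‖ := by
  set N : Submodule ℝ E := LinearMap.ker ((ContinuousLinearMap.id ℝ E - S : E →L[ℝ] E) : E →ₗ[ℝ] E)
    with hN
  have hmem : ∀ f, f ∈ N ↔ S f = f := fun f => by
    rw [hN, LinearMap.mem_ker]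
    change f - S f = 0 ↔ _
    rw [sub_eq_zero, eq_comm]
  set V := Nᗮ
  have hV : ∀ x ∈ V, S x ∈ V := by
    intro x hx
    rw [Submodule.mem_orthogonal] at hx ⊢
    intro u hu
    rw [← hsa, (hmem u).1 hu]; exact hx u hu
  have hVc : IsClosed (V : Set E) := Submodule.isClosed_orthogonal _
  -- On the orthogonal complement of the fixed vectors S is still compact, and 1 is no longer an
  -- eigenvalue, hence lies in the resolvent set. The norm of the inverse supplies the uniform
  -- constant.
  let SV : V →L[ℝ] V := (S.comp V.subtypeL).codRestrict V (fun x => hV _ x.2)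
  have hc : IsCompactOperator SV := by
    have h1 : IsCompactOperator (S.comp V.subtypeL) := hS.comp_clm V.subtypeL
    exact IsCompactOperator.codRestrict h1 (fun x => hV _ x.2) hVc
  have : CompleteSpace V := hVc.completeSpace_coe
  have hres : (1 : ℝ) ∈ resolventSet ℝ SV := by
    refine (hc.hasEigenvalue_or_mem_resolventSet one_ne_zero).resolve_left ?_
    intro hev
    obtain ⟨x, hx⟩ := hev.exists_hasEigenvector
    have h1 : SV x = x := by simpa using hx.apply_eq_smul
    have h2 : S x = x := congrArg Subtype.val h1
    have h3 : inner ℝ (x : E) x = 0 := (Submodule.mem_orthogonal _ _).1 x.2 x ((hmem _).2 h2)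
    exact hx.2 (Subtype.ext (inner_self_eq_zero.1 h3))
  rw [spectrum.mem_resolventSet_iff] at hres
  obtain ⟨U, hU⟩ := hres
  refine ⟨‖(↑U⁻¹ : V →L[ℝ] V)‖ + 1, by positivity, fun G hG => ?_⟩
  have hGV : G ∈ V := by
    rw [Submodule.mem_orthogonal']
    exact fun u hu => hG u ((hmem u).1 hu)
  refine ⟨((↑U⁻¹ : V →L[ℝ] V) ⟨G, hGV⟩ : V), ?_, ?_⟩
  · have h1 : (U : V →L[ℝ] V) ((↑U⁻¹ : V →L[ℝ] V) ⟨G, hGV⟩) = ⟨G, hGV⟩ := by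
      exact congrArg (fun A : V →L[ℝ] V => A ⟨G, hGV⟩) (Units.mul_inv U)
    rw [hU] at h1
    have h2 := congrArg Subtype.val h1
    simp only [map_one] at h2
    exact h2
  · have h1 := (↑U⁻¹ : V →L[ℝ] V).le_opNorm ⟨G, hGV⟩
    have h2 : ‖(⟨G, hGV⟩ : V)‖ = ‖G‖ := rfl
    rw [h2] at h1
    refine le_trans h1 ?_
    gcongr; linarith

end Operators

/-! ### Pointwise bounded operators on L² are Hilbert–Schmidt. -/

section HilbertSchmidt

variable {X : Type*} [MeasurableSpace X] {μ : Measure X}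

lemma norm_sq_eq_integral (f : Lp ℝ 2 μ) : ‖f‖ ^ 2 = ∫ v, f v ^ 2 ∂μ := by
  rw [← real_inner_self_eq_norm_sq, L2.inner_def]
  simp [pow_two]

/-- For each v the functional `ev v` has norm at most c(v), so Bessel's inequality gives Σ |ev v
bᵢ|² ≤ c(v)². Integrating in v bounds the Hilbert–Schmidt norm by ‖c‖. -/
lemma mem_closure_finRank_of_pointwise_bound {T : Lp ℝ 2 μ →L[ℝ] Lp ℝ 2 μ}
    (ev : X → Lp ℝ 2 μ →ₗ[ℝ] ℝ) {c : X → ℝ} (hc : MemLp c 2 μ)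
    (hev : ∀ v f, |ev v f| ≤ c v * ‖f‖) (hT : ∀ f, T f =ᵐ[μ] fun v => ev v f) :
    T ∈ closure (finRank (Set.univ : Set (Lp ℝ 2 μ)) : Set (Lp ℝ 2 μ →L[ℝ] Lp ℝ 2 μ)) := by
  obtain ⟨w, b, -⟩ := exists_hilbertBasis ℝ (Lp ℝ 2 μ)
  refine mem_closure_finRank_of_summable b (summable_of_sum_le (c := ∫ v, c v ^ 2 ∂μ)
    (fun i => by positivity) fun s => ?_)
  have hint : ∀ f : Lp ℝ 2 μ, Integrable (fun v => (f v) ^ 2) μ := fun f =>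
    (Lp.memLp f).integrable_sq
  simp_rw [norm_sq_eq_integral]
  rw [← integral_finsetSum _ fun i _ => hint _]
  refine integral_mono_ae (integrable_finsetSum _ fun i _ => hint _) hc.integrable_sq ?_
  have h1 : ∀ᵐ v ∂μ, ∀ i ∈ s, T (b i) v = ev v (b i) :=
    (Finset.eventually_all s).2 fun i _ => hT (b i)
  filter_upwards [h1] with v hv
  change ∑ i ∈ s, (T (b i)) v ^ 2 ≤ c v ^ 2
  rw [Finset.sum_congr rfl fun i hi => by rw [hv i hi]]
  set S := ∑ i ∈ s, (ev v (b i)) ^ 2 with hSdef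
  have hS0 : 0 ≤ S := by positivity
  -- For this f one has ev v f = ‖f‖² = S, so the hypothesis on `ev` reads ‖f‖² ≤ c(v) ‖f‖.
  set f : Lp ℝ 2 μ := ∑ i ∈ s, (ev v (b i)) • (b i) with hf
  have hef : ev v f = S := by
    simp [hf, hSdef, map_sum, pow_two]
  have hnf : ‖f‖ ^ 2 = S := by
    rw [← real_inner_self_eq_norm_sq, hf, b.orthonormal.inner_sum]
    simp [hSdef, pow_two]
  have h2 := hev v f
  rw [hef, abs_of_nonneg hS0] at h2
  rcases eq_or_lt_of_le hS0 with h0 | h0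
  · rw [← h0]; positivity
  · have hfpos : 0 < ‖f‖ := by
      rcases eq_or_lt_of_le (norm_nonneg f) with h | h
      · rw [← h] at hnf; simp at hnf; linarith
      · exact h
    rw [← hnf] at h2 ⊢
    have : ‖f‖ ≤ c v := by
      by_contra hlt
      push Not at hlt
      nlinarith
    gcongr

end HilbertSchmidt


/-! ### Classical partial derivatives. -/

/-- Smooth functions on the velocity space. -/
abbrev Smooth (a : Vel → ℝ) : Prop := ContDiff ℝ ((⊤ : ℕ∞) : WithTop ℕ∞) a

/-- The Hilbert space `L²(ℝ³)`. -/
abbrev L2V : Type := Lp ℝ 2 (volume : Measure Vel)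

section Classical

variable {a b : Vel → ℝ} {i : Fin 3}

lemma Smooth.pd (ha : Smooth a) (i : Fin 3) : Smooth (partialD i a) := by
  have h : Smooth a := ha
  unfold partialD
  have h1 : ContDiff ℝ ((⊤ : ℕ∞) : WithTop ℕ∞) (fderiv ℝ a) :=
    h.fderiv_right (m := ((⊤ : ℕ∞) : WithTop ℕ∞)) (by simp)
  exact h1.clm_apply contDiff_const

lemma hasCompactSupport_partialD (ha : HasCompactSupport a) (i : Fin 3) :
    HasCompactSupport (partialD i a) := by
  unfold partialD
  exact (ha.fderiv (𝕜 := ℝ)).comp_left (g := fun L : Vel →L[ℝ] ℝ => L (EuclideanSpace.single i 1))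
    (by simp)

lemma Smooth.differentiable (ha : Smooth a) : Differentiable ℝ a :=
  ContDiff.differentiable ha (by simp)

lemma partialD_mul (ha : Differentiable ℝ a) (hb : Differentiable ℝ b) (i : Fin 3) :
    partialD i (fun v => a v * b v) = fun v => a v * partialD i b v + partialD i a v * b v := by
  ext v
  simp only [partialD]
  rw [fderiv_fun_mul (ha v) (hb v)]
  simp [mul_comm]

lemma partialD_add (ha : Differentiable ℝ a) (hb : Differentiable ℝ b) (i : Fin 3) :
    partialD i (fun v => a v + b v) = fun v => partialD i a v + partialD i b v := by
  ext v
  simp only [partialD]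
  rw [fderiv_fun_add (ha v) (hb v)]
  simp

lemma partialD_const_mul (c : ℝ) (ha : Differentiable ℝ a) (i : Fin 3) :
    partialD i (fun v => c * a v) = fun v => c * partialD i a v := by
  ext v
  simp only [partialD]
  rw [fderiv_const_mul (ha v)]
  simp

lemma partialD_const (c : ℝ) (i : Fin 3) : partialD i (fun _ => c) = fun _ => 0 := by
  ext v
  simp [partialD]

lemma partialD_comp_add (a : Vel → ℝ) (w : Vel) (i : Fin 3) :
    partialD i (fun v => a (v + w)) = fun v => partialD i a (v + w) := by
  ext v
  simp only [partialD]
  rw [fderiv_comp_add_right]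

lemma Smooth.comp_add (ha : Smooth a) (w : Vel) : Smooth fun v => a (v + w) :=
  ContDiff.comp ha (contDiff_id.add contDiff_const)

lemma HasCompactSupport.comp_add_const (ha : HasCompactSupport a) (w : Vel) :
    HasCompactSupport fun v => a (v + w) :=
  ha.comp_homeomorph (Homeomorph.addRight w)

end Classical

/-! ### Weak first order derivatives and their duality with test functions. -/

/-- `f'` is the weak partial derivative `∂_i f`. -/
def WDer (i : Fin 3) (f f' : Vel → ℝ) : Prop :=
  LocallyIntegrable f volume ∧ LocallyIntegrable f' volume ∧
    ∀ φ : Vel → ℝ, Smooth φ → HasCompactSupport φ →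
      ∫ v, f v * partialD i φ v = -∫ v, f' v * φ v

section WDer

variable {i : Fin 3} {f f' g g' : Vel → ℝ}

lemma integrable_mul_test (hf : LocallyIntegrable f volume) {φ : Vel → ℝ} (h : Continuous φ)
    (hc : HasCompactSupport φ) : Integrable (fun v => f v * φ v) volume := by
  simpa [mul_comm] using hf.integrable_smul_left_of_hasCompactSupport h hc

lemma memLp_test {φ : Vel → ℝ} (h : Continuous φ) (hc : HasCompactSupport φ) (p : ℝ≥0∞) :
    MemLp φ p (volume : Measure Vel) := h.memLp_of_hasCompactSupport hc

lemma L2V.locallyIntegrable (f : L2V) : LocallyIntegrable (f : Vel → ℝ) volume :=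
  (Lp.memLp f).locallyIntegrable (by norm_num)

lemma WDer.congr (h : WDer i f f') (hf : f =ᵐ[volume] g) (hf' : f' =ᵐ[volume] g') :
    WDer i g g' := by
  refine ⟨h.1.congr hf, h.2.1.congr hf', fun φ hφ hc => ?_⟩
  rw [← integral_congr_ae (hf.mono fun v hv => by simp only [hv] :
      (fun v => f v * partialD i φ v) =ᵐ[volume] fun v => g v * partialD i φ v),
    ← integral_congr_ae (hf'.mono fun v hv => by simp only [hv] :
      (fun v => f' v * φ v) =ᵐ[volume] fun v => g' v * φ v)]
  exact h.2.2 φ hφ hc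

lemma WDer.add (h : WDer i f f') (h' : WDer i g g') :
    WDer i (fun v => f v + g v) (fun v => f' v + g' v) := by
  refine ⟨h.1.add h'.1, h.2.1.add h'.2.1, fun φ hφ hc => ?_⟩
  have c1 := (hφ.pd i).continuous
  have s1 := hasCompactSupport_partialD hc i
  simp only [add_mul]
  rw [integral_add (integrable_mul_test h.1 c1 s1) (integrable_mul_test h'.1 c1 s1),
    integral_add (integrable_mul_test h.2.1 hφ.continuous hc)
      (integrable_mul_test h'.2.1 hφ.continuous hc), h.2.2 φ hφ hc, h'.2.2 φ hφ hc]
  ring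

lemma WDer.const_mul (c : ℝ) (h : WDer i f f') :
    WDer i (fun v => c * f v) (fun v => c * f' v) := by
  refine ⟨h.1.smul c, h.2.1.smul c, fun φ hφ hc => ?_⟩
  simp only [mul_assoc]
  rw [integral_const_mul, integral_const_mul, h.2.2 φ hφ hc]
  ring

lemma WDer.mul_smooth (h : WDer i f f') {a : Vel → ℝ} (ha : Smooth a) :
    WDer i (fun v => a v * f v) (fun v => a v * f' v + partialD i a v * f v) := by
  have hda := (ha.pd i).continuous
  have l1 : LocallyIntegrable (fun v => a v * f' v) volume := by
    simpa using h.2.1.continuous_smul ha.continuous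
  have l2 : LocallyIntegrable (fun v => partialD i a v * f v) volume := by
    simpa using h.1.continuous_smul hda
  refine ⟨by simpa using h.1.continuous_smul ha.continuous, l1.add l2, fun φ hφ hc => ?_⟩
  have h1 := h.2.2 (fun v => a v * φ v) (ContDiff.mul ha hφ) hc.mul_left
  rw [partialD_mul ha.differentiable hφ.differentiable] at h1
  have i1 : Integrable (fun v => f v * (a v * partialD i φ v)) volume :=
    integrable_mul_test h.1 (ha.continuous.mul (hφ.pd i).continuous)
      (hasCompactSupport_partialD hc i).mul_left
  have i2 : Integrable (fun v => f v * (partialD i a v * φ v)) volume :=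
    integrable_mul_test h.1 (hda.mul hφ.continuous) hc.mul_left
  have i3 : Integrable (fun v => f' v * (a v * φ v)) volume :=
    integrable_mul_test h.2.1 (ha.continuous.mul hφ.continuous) hc.mul_left
  simp only [mul_add] at h1
  rw [integral_add i1 i2] at h1
  have e1 : ∫ v, a v * f v * partialD i φ v = ∫ v, f v * (a v * partialD i φ v) :=
    integral_congr_ae (.of_forall fun v => by ring)
  have e2 : ∫ v, (a v * f' v + partialD i a v * f v) * φ v =
      (∫ v, f' v * (a v * φ v)) + ∫ v, f v * (partialD i a v * φ v) := by
    rw [← integral_add i3 i2]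
    exact integral_congr_ae (.of_forall fun v => by ring)
  rw [e1, e2]
  linarith

lemma integral_by_parts_smooth {φ ψ : Vel → ℝ} (hφ : Smooth φ) (hψ : Smooth ψ)
    (hc : HasCompactSupport ψ) (i : Fin 3) :
    ∫ v, φ v * partialD i ψ v = -∫ v, partialD i φ v * ψ v := by
  have c1 := (hφ.pd i).continuous
  have c2 := (hψ.pd i).continuous
  exact integral_mul_fderiv_eq_neg_fderiv_mul_of_integrable
    ((c1.mul hψ.continuous).integrable_of_hasCompactSupport hc.mul_left)
    ((hφ.continuous.mul c2).integrable_of_hasCompactSupport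
      (hasCompactSupport_partialD hc i).mul_left)
    ((hφ.continuous.mul hψ.continuous).integrable_of_hasCompactSupport hc.mul_left)
    (fun x _ => hφ.differentiable x) (fun x _ => hψ.differentiable x)

lemma Smooth.wder {φ : Vel → ℝ} (hφ : Smooth φ) (i : Fin 3) : WDer i φ (partialD i φ) :=
  ⟨hφ.continuous.locallyIntegrable, (hφ.pd i).continuous.locallyIntegrable,
    fun _ hψ hc => integral_by_parts_smooth hφ hψ hc i⟩

/-- The class of a test function in `L²`. -/
noncomputable def testL2 {φ : Vel → ℝ} (h : Smooth φ) (hc : HasCompactSupport φ) : L2V :=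
  (memLp_test h.continuous hc 2).toLp φ

lemma testL2_ae {φ : Vel → ℝ} (h : Smooth φ) (hc : HasCompactSupport φ) :
    testL2 h hc =ᵐ[volume] φ := MemLp.coeFn_toLp _

lemma inner_testL2 {φ : Vel → ℝ} (h : Smooth φ) (hc : HasCompactSupport φ) (f : L2V) :
    inner ℝ (testL2 h hc) f = ∫ v, f v * φ v := by
  rw [L2.inner_def]
  refine integral_congr_ae ((testL2_ae h hc).mono fun v hv => ?_)
  simp [hv]

lemma WDer.inner_eq {f f' : L2V} (h : WDer i f f') {φ : Vel → ℝ} (hφ : Smooth φ)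
    (hc : HasCompactSupport φ) :
    inner ℝ (testL2 (hφ.pd i) (hasCompactSupport_partialD hc i)) f =
      -inner ℝ (testL2 hφ hc) f' := by
  rw [inner_testL2, inner_testL2, h.2.2 φ hφ hc]

lemma wder_of_inner {f f' : L2V} (h : ∀ (φ : Vel → ℝ) (hφ : Smooth φ) (hc : HasCompactSupport φ),
    inner ℝ (testL2 (hφ.pd i) (hasCompactSupport_partialD hc i)) f =
      -inner ℝ (testL2 hφ hc) f') : WDer i f f' := by
  refine ⟨L2V.locallyIntegrable f, L2V.locallyIntegrable f', fun φ hφ hc => ?_⟩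
  have := h φ hφ hc
  rwa [inner_testL2, inner_testL2] at this

/-- The weak derivative is a closed operator, since its definition only involves inner products with
fixed test functions. -/
lemma WDer.of_tendsto {F F' : ℕ → L2V} {f f' : L2V} (h : ∀ k, WDer i (F k) (F' k))
    (hF : Filter.Tendsto F Filter.atTop (nhds f)) (hF' : Filter.Tendsto F' Filter.atTop (nhds f')) :
    WDer i f f' := by
  refine wder_of_inner fun φ hφ hc => ?_
  have h1 := (Filter.Tendsto.inner (𝕜 := ℝ) tendsto_const_nhds hF :
    Filter.Tendsto (fun k => inner ℝ (testL2 (hφ.pd i) (hasCompactSupport_partialD hc i))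
      (F k)) _ _)
  have h2 := (Filter.Tendsto.inner (𝕜 := ℝ) tendsto_const_nhds hF' :
    Filter.Tendsto (fun k => inner ℝ (testL2 hφ hc) (F' k)) _ _).neg
  refine tendsto_nhds_unique h1 (h2.congr fun k => ?_)
  rw [(h k).inner_eq hφ hc]

lemma WDer.addL {f f' g g' : L2V} (h : WDer i f f') (h' : WDer i g g') :
    WDer i (f + g : L2V) (f' + g' : L2V) :=
  (h.add h').congr (Lp.coeFn_add f g).symm (Lp.coeFn_add f' g').symm

lemma WDer.smulL {f f' : L2V} (c : ℝ) (h : WDer i f f') :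
    WDer i (c • f : L2V) (c • f' : L2V) :=
  (h.const_mul c).congr (Lp.coeFn_smul c f).symm (Lp.coeFn_smul c f').symm

lemma wder_zeroL : WDer i (0 : L2V) (0 : L2V) :=
  wder_of_inner fun φ hφ hc => by simp

end WDer

/-! ### Sobolev classes, commutators with derivatives, and regularity of fixed points. -/

/-- `f` has weak derivatives up to order `n`, all of them bounded by `C` in `L²`. -/
def SobE : ℕ → L2V → ℝ → Prop
  | 0, f, C => ‖f‖ ≤ C
  | n + 1, f, C => ‖f‖ ≤ C ∧ ∀ i, ∃ f' : L2V, WDer i f f' ∧ SobE n f' C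

/-- Operators on `L²` that commute with derivatives up to operators of the same kind. -/
def SmoothOp : ℕ → (L2V →L[ℝ] L2V) → Prop
  | 0, _ => True
  | n + 1, T => ∀ i, ∃ T' : L2V →L[ℝ] L2V, SmoothOp n T' ∧
      ∀ f f' : L2V, WDer i f f' → WDer i (T f) (T f' + T' f : L2V)

section SobE

variable {n : ℕ} {f g : L2V} {C D : ℝ}

lemma SobE.norm_le (h : SobE n f C) : ‖f‖ ≤ C := by
  cases n with
  | zero => exact h
  | succ n => exact h.1

lemma SobE.of_succ (h : SobE (n + 1) f C) : SobE n f C := by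
  induction n generalizing f with
  | zero => exact h.1
  | succ n ih => exact ⟨h.1, fun i => (h.2 i).imp fun f' h' => ⟨h'.1, ih h'.2⟩⟩

lemma SobE.mono (h : SobE n f C) (hCD : C ≤ D) : SobE n f D := by
  induction n generalizing f with
  | zero => exact le_trans h hCD
  | succ n ih => exact ⟨h.1.trans hCD, fun i => (h.2 i).imp fun f' h' => ⟨h'.1, ih h'.2⟩⟩

lemma SobE.add (h : SobE n f C) (h' : SobE n g D) : SobE n (f + g) (C + D) := by
  induction n generalizing f g with
  | zero => exact (norm_add_le _ _).trans (add_le_add h h')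
  | succ n ih =>
    refine ⟨(norm_add_le _ _).trans (add_le_add h.1 h'.1), fun i => ?_⟩
    obtain ⟨f', hf, hf'⟩ := h.2 i
    obtain ⟨g', hg, hg'⟩ := h'.2 i
    exact ⟨f' + g', hf.addL hg, ih hf' hg'⟩

lemma SobE.smul (c : ℝ) (h : SobE n f C) : SobE n (c • f) (|c| * C) := by
  induction n generalizing f with
  | zero =>
    change ‖c • f‖ ≤ _
    rw [norm_smul, Real.norm_eq_abs]
    exact mul_le_mul_of_nonneg_left h (abs_nonneg c)
  | succ n ih =>
    refine ⟨?_, fun i => ?_⟩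
    · rw [norm_smul, Real.norm_eq_abs]
      exact mul_le_mul_of_nonneg_left h.1 (abs_nonneg c)
    · obtain ⟨f', hf, hf'⟩ := h.2 i
      exact ⟨c • f', hf.smulL c, ih hf'⟩

lemma sobE_testL2 (n : ℕ) {φ : Vel → ℝ} (h : Smooth φ) (hc : HasCompactSupport φ) :
    ∃ C, SobE n (testL2 h hc) C := by
  induction n generalizing φ with
  | zero => exact ⟨_, le_rfl⟩
  | succ n ih =>
    choose K hK using fun i => ih (h.pd i) (hasCompactSupport_partialD hc i)
    refine ⟨‖testL2 h hc‖ + ∑ i, |K i|, le_add_of_nonneg_right (by positivity), fun i => ?_⟩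
    refine ⟨testL2 (h.pd i) (hasCompactSupport_partialD hc i),
      (h.wder i).congr (testL2_ae h hc).symm (testL2_ae _ _).symm, (hK i).mono ?_⟩
    have := Finset.single_le_sum (fun j _ => abs_nonneg (K j)) (Finset.mem_univ i)
    linarith [le_abs_self (K i), norm_nonneg (testL2 h hc)]

end SobE

section SmoothOp

variable {n : ℕ} {T U : L2V →L[ℝ] L2V}

lemma SmoothOp.of_succ (h : SmoothOp (n + 1) T) : SmoothOp n T := by
  induction n generalizing T with
  | zero => trivial
  | succ n ih =>
    intro i
    obtain ⟨T', h1, h2⟩ := h i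
    exact ⟨T', ih h1, h2⟩

lemma SmoothOp.add (hT : SmoothOp n T) (hU : SmoothOp n U) : SmoothOp n (T + U) := by
  induction n generalizing T U with
  | zero => trivial
  | succ n ih =>
    intro i
    obtain ⟨T', h1, h2⟩ := hT i
    obtain ⟨U', h3, h4⟩ := hU i
    refine ⟨T' + U', ih h1 h3, fun f f' h => ?_⟩
    convert! (h2 f f' h).addL (h4 f f' h) using 2
    simp; abel

lemma SmoothOp.smul (c : ℝ) (hT : SmoothOp n T) : SmoothOp n (c • T) := by
  induction n generalizing T with
  | zero => trivial
  | succ n ih =>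
    intro i
    obtain ⟨T', h1, h2⟩ := hT i
    refine ⟨c • T', ih h1, fun f f' h => ?_⟩
    convert! (h2 f f' h).smulL c using 2
    simp

lemma smoothOp_zero (n : ℕ) : SmoothOp n 0 := by
  induction n with
  | zero => trivial
  | succ n ih => exact fun i => ⟨0, ih, fun f f' _ => by simpa using wder_zeroL⟩

lemma smoothOp_id (n : ℕ) : SmoothOp n (ContinuousLinearMap.id ℝ L2V) := by
  cases n with
  | zero => trivial
  | succ n => exact fun i => ⟨0, smoothOp_zero n, fun f f' h => by simpa using h⟩

lemma SmoothOp.sub (hT : SmoothOp n T) (hU : SmoothOp n U) : SmoothOp n (T - U) := by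
  have := hT.add (hU.smul (-1))
  simpa [sub_eq_add_neg] using this

/-- The classes of test functions. -/
def testSet : Set L2V := {f | ∃ (φ : Vel → ℝ) (h : Smooth φ) (hc : HasCompactSupport φ),
  f = testL2 h hc}

lemma dense_testSet : Dense testSet := by
  have := MeasureTheory.Lp.dense_hasCompactSupport_contDiff (E := Vel) (F := ℝ)
    (μ := (volume : Measure Vel)) (p := 2) (by norm_num)
  refine this.mono ?_
  rintro f ⟨g, hfg, hg, hg'⟩
  exact ⟨g, hg', hg, Lp.ext (hfg.trans (testL2_ae hg' hg).symm)⟩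


/-- The commutator with ∂ᵢ is again a sum of rank one operators: one term differentiates φ, and
integration by parts in the coefficient ⟪ψ, f'⟫ produces the one with ∂ᵢψ. -/
lemma smoothOp_rankOne (n : ℕ) {φ ψ : Vel → ℝ} (hφ : Smooth φ) (cφ : HasCompactSupport φ)
    (hψ : Smooth ψ) (cψ : HasCompactSupport ψ) :
    SmoothOp n (rankOne (testL2 hψ cψ) (testL2 hφ cφ)) := by
  induction n generalizing φ ψ with
  | zero => trivial
  | succ n ih =>
    intro i
    have sφ := hasCompactSupport_partialD cφ i
    have sψ := hasCompactSupport_partialD cψ i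
    refine ⟨_, (ih (hφ.pd i) sφ hψ cψ).add (ih hφ cφ (hψ.pd i) sψ), fun f f' h => ?_⟩
    have h1 : WDer i (testL2 hφ cφ) (testL2 (hφ.pd i) sφ) :=
      (hφ.wder i).congr (testL2_ae _ _).symm (testL2_ae _ _).symm
    have h2 := h.inner_eq hψ cψ
    have h3 : rankOne (testL2 hψ cψ) (testL2 hφ cφ) f' +
        (rankOne (testL2 hψ cψ) (testL2 (hφ.pd i) sφ) +
          rankOne (testL2 (hψ.pd i) sψ) (testL2 hφ cφ)) f =
        (inner ℝ (testL2 hψ cψ) f) • testL2 (hφ.pd i) sφ := by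
      simp only [rankOne_apply, add_apply, h2, neg_smul]
      rw [add_left_comm, add_neg_cancel, add_zero]
    rw [h3, rankOne_apply]
    exact h1.smulL (inner ℝ (testL2 hψ cψ) f)

lemma smoothOp_of_mem_finRank (n : ℕ) {F : L2V →L[ℝ] L2V} (hF : F ∈ finRank testSet) :
    SmoothOp n F := by
  induction hF using Submodule.span_induction with
  | mem F h =>
    obtain ⟨_, ⟨ψ, hψ, cψ, rfl⟩, _, ⟨φ, hφ, cφ, rfl⟩, rfl⟩ := h
    exact smoothOp_rankOne n hφ cφ hψ cψ
  | zero => exact smoothOp_zero n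
  | add F G _ _ hF hG => exact hF.add hG
  | smul c F _ hF => exact hF.smul c

/-- The range is spanned by test functions, so every derivative of F f is controlled by ‖f‖ alone.
-/
lemma exists_sobE_of_mem_finRank (n : ℕ) {F : L2V →L[ℝ] L2V} (hF : F ∈ finRank testSet) :
    ∃ M, 0 ≤ M ∧ ∀ f, SobE n (F f) (M * ‖f‖) := by
  induction hF using Submodule.span_induction with
  | mem F h =>
    obtain ⟨_, ⟨ψ, hψ, cψ, rfl⟩, _, ⟨φ, hφ, cφ, rfl⟩, rfl⟩ := h
    obtain ⟨C, hC⟩ := sobE_testL2 n hφ cφ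
    have hC0 : 0 ≤ C := (norm_nonneg _).trans hC.norm_le
    refine ⟨‖testL2 hψ cψ‖ * C, by positivity, fun f => ?_⟩
    rw [rankOne_apply]
    refine (hC.smul _).mono ?_
    have := abs_real_inner_le_norm (testL2 hψ cψ) f
    calc _ ≤ ‖testL2 hψ cψ‖ * ‖f‖ * C := by gcongr
      _ = _ := by ring
  | zero => exact ⟨0, le_rfl, fun f => by
      have : ∀ m, SobE m 0 0 := fun m => by
        induction m with
        | zero => simp [SobE]
        | succ m ih => exact ⟨by simp, fun i => ⟨0, wder_zeroL, ih⟩⟩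
      simpa using this n⟩
  | add F G _ _ hF hG =>
    obtain ⟨M, hM, h1⟩ := hF
    obtain ⟨K, hK, h2⟩ := hG
    exact ⟨M + K, by positivity, fun f => ((h1 f).add (h2 f)).mono (by linarith)⟩
  | smul c F _ hF =>
    obtain ⟨M, hM, h1⟩ := hF
    exact ⟨|c| * M, by positivity, fun f => ((h1 f).smul c).mono (by linarith)⟩

/-- Induction on the order through ∂ᵢ(T f) = T ∂ᵢf + T' f, where T' only has to act on one
derivative fewer. -/
lemma SmoothOp.exists_sobE (hT : SmoothOp n T) :
    ∃ M, 0 ≤ M ∧ ∀ f C, SobE n f C → SobE n (T f) (M * C) := by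
  induction n generalizing T with
  | zero => exact ⟨‖T‖, norm_nonneg _, fun f C h => (T.le_opNorm f).trans
      (mul_le_mul_of_nonneg_left h (norm_nonneg _))⟩
  | succ n ih =>
    obtain ⟨M, hM, h1⟩ := ih hT.of_succ
    choose T' hT' hW using hT
    choose K hK h2 using fun i => ih (hT' i)
    refine ⟨‖T‖ + M + ∑ i, K i, by positivity [Finset.sum_nonneg fun i (_ : i ∈ Finset.univ) => hK i],
      fun f C h => ?_⟩
    have hC : 0 ≤ C := (norm_nonneg _).trans h.norm_le
    have hs : 0 ≤ ∑ i, K i := Finset.sum_nonneg fun i _ => hK i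
    refine ⟨(T.le_opNorm f).trans ?_, fun i => ?_⟩
    · have := h.norm_le
      calc ‖T‖ * ‖f‖ ≤ ‖T‖ * C := by gcongr
        _ ≤ _ := by gcongr; linarith
    · obtain ⟨f', hf, hf'⟩ := h.2 i
      refine ⟨_, hW i f f' hf, ((h1 f' C hf').add (h2 i f C h.of_succ)).mono ?_⟩
      have := Finset.single_le_sum (fun j _ => hK j) (Finset.mem_univ i)
      nlinarith [norm_nonneg T]

lemma norm_le_of_contraction {A : L2V →L[ℝ] L2V} {θ : ℝ} (hA : ‖A‖ ≤ θ) (hθ : θ < 1) {f G : L2V}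
    (h : f = A f + G) : ‖f‖ ≤ (1 - θ)⁻¹ * ‖G‖ := by
  have h1 : ‖f‖ ≤ θ * ‖f‖ + ‖G‖ := by
    conv_lhs => rw [h]
    refine (norm_add_le _ _).trans ?_
    gcongr
    exact A.le_of_opNorm_le hA f
  rw [← div_eq_inv_mul, le_div_iff₀ (by linarith)]
  linarith

lemma exists_fixed {A : L2V →L[ℝ] L2V} (hA : ‖A‖ < 1) (G : L2V) : ∃ f, f = A f + G := by
  refine ⟨(↑(Units.oneSub A hA)⁻¹ : L2V →L[ℝ] L2V) G, ?_⟩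
  have h1 := congrArg (fun B : L2V →L[ℝ] L2V => B G) (Units.mul_inv (Units.oneSub A hA))
  simp only [Units.val_oneSub] at h1
  change (_ : L2V) - A _ = G at h1
  exact (sub_eq_iff_eq_add'.1 h1)

/-- A fixed point of a contraction commuting with `∂_i` up to a bounded operator is weakly
differentiable as soon as the inhomogeneity is. -/
lemma WDer.fixed {A A' : L2V →L[ℝ] L2V} (hA : ‖A‖ < 1) {i : Fin 3}
    (hW : ∀ f f' : L2V, WDer i f f' → WDer i (A f) (A f' + A' f : L2V)) {f G G' d : L2V}
    (hf : f = A f + G) (hG : WDer i G G') (hd : d = A d + (A' f + G')) : WDer i f d := by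
  -- θ is taken positive even if A vanishes, because it is divided by below.
  obtain ⟨θ, hθ0, hθ, hθ1⟩ : ∃ θ, 0 < θ ∧ ‖A‖ ≤ θ ∧ θ < 1 :=
    ⟨(‖A‖ + 1) / 2, by positivity, by linarith, by linarith⟩
  -- Picard iteration for the equation together with its formal derivative, started at zero so that
  -- each second component is the weak derivative of the first.
  let s : ℕ → L2V × L2V := fun k =>
    (fun p : L2V × L2V => (A p.1 + G, A p.2 + (A' p.1 + G')))^[k] (0, 0)
  have hs : ∀ k, s (k + 1) = (A (s k).1 + G, A (s k).2 + (A' (s k).1 + G')) := fun k => by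
    simp only [s, Function.iterate_succ_apply']
  have h1 : ∀ k, WDer i (s k).1 (s k).2 := by
    intro k
    induction k with
    | zero => exact wder_zeroL
    | succ k ih =>
      rw [hs]
      have := (hW _ _ ih).addL hG
      rwa [add_assoc] at this
  have h2 : ∀ k, ‖(s k).1 - f‖ ≤ ‖f‖ * θ ^ k := by
    intro k
    induction k with
    | zero => simp [s]
    | succ k ih =>
      have e : (s (k + 1)).1 - f = A ((s k).1 - f) := by
        rw [hs, map_sub]; nth_rewrite 1 [hf]; exact add_sub_add_right_eq_sub _ _ _
      rw [e]
      calc ‖A ((s k).1 - f)‖ ≤ θ * (‖f‖ * θ ^ k) := (A.le_of_opNorm_le hθ _).trans (by gcongr)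
        _ = _ := by ring
  -- The second iteration is driven by the error of the first, so it converges at the rate k θ^k
  -- instead of θ^k.
  have h3 : ∀ k : ℕ, ‖(s k).2 - d‖ ≤ (‖d‖ + k * (‖A'‖ * ‖f‖ / θ)) * θ ^ k := by
    intro k
    induction k with
    | zero => simp [s]
    | succ k ih =>
      have e : (s (k + 1)).2 - d = A ((s k).2 - d) + A' ((s k).1 - f) := by
        rw [hs, map_sub, map_sub]; nth_rewrite 1 [hd]
        change A _ + (A' _ + G') - _ = _
        rw [add_sub_add_comm, add_sub_add_right_eq_sub]
      rw [e]
      calc ‖A ((s k).2 - d) + A' ((s k).1 - f)‖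
          ≤ θ * ((‖d‖ + k * (‖A'‖ * ‖f‖ / θ)) * θ ^ k) + ‖A'‖ * (‖f‖ * θ ^ k) :=
            (norm_add_le _ _).trans (add_le_add ((A.le_of_opNorm_le hθ _).trans (by gcongr))
              ((A'.le_opNorm _).trans (by gcongr; exact h2 k)))
        _ = _ := by
            push_cast
            field_simp
            ring
  refine WDer.of_tendsto h1 ?_ ?_
  · rw [tendsto_iff_norm_sub_tendsto_zero]
    refine squeeze_zero (fun _ => norm_nonneg _) h2 ?_
    simpa using (tendsto_pow_atTop_nhds_zero_of_lt_one hθ0.le hθ1).const_mul ‖f‖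
  · rw [tendsto_iff_norm_sub_tendsto_zero]
    refine squeeze_zero (fun _ => norm_nonneg _) h3 ?_
    have t1 := (tendsto_pow_atTop_nhds_zero_of_lt_one hθ0.le hθ1).const_mul ‖d‖
    have t2 := (tendsto_self_mul_const_pow_of_lt_one hθ0.le hθ1).const_mul (‖A'‖ * ‖f‖ / θ)
    have t3 := t1.add t2
    simp only [mul_zero, add_zero] at t3
    exact t3.congr fun k => by ring

/-- Differentiating the equation gives d = A d + (A' f + ∂ᵢG), of the same type with a source of one
order less. The contraction property produces d, and `WDer.fixed` identifies it with ∂ᵢf. -/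
lemma SmoothOp.exists_regularity (n : ℕ) {A : L2V →L[ℝ] L2V} (hA : ‖A‖ < 1) (hs : SmoothOp n A) :
    ∃ M, 0 ≤ M ∧ ∀ f G C, f = A f + G → SobE n G C → SobE n f (M * C) := by
  induction n with
  | zero =>
    refine ⟨(1 - ‖A‖)⁻¹, inv_nonneg.2 (by linarith), fun f G C hf hG => ?_⟩
    refine (norm_le_of_contraction le_rfl hA hf).trans ?_
    exact mul_le_mul_of_nonneg_left hG (inv_nonneg.2 (by linarith))
  | succ n ih =>
    obtain ⟨M, hM, h1⟩ := ih hs.of_succ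
    choose A' hA' hW using hs
    choose K hK h2 using fun i => (hA' i).exists_sobE
    have hs0 : 0 ≤ ∑ i, K i := Finset.sum_nonneg fun i _ => hK i
    refine ⟨M + M * ((∑ i, K i) * M + 1), by positivity, fun f G C hf hG => ?_⟩
    have hC : 0 ≤ C := (norm_nonneg _).trans hG.norm_le
    have h3 := h1 f G C hf hG.of_succ
    refine ⟨h3.norm_le.trans ?_, fun i => ?_⟩
    · gcongr
      have : 0 ≤ M * ((∑ i, K i) * M + 1) := by positivity
      linarith
    · obtain ⟨G', hG', hG''⟩ := hG.2 i
      obtain ⟨d, hd⟩ := exists_fixed hA (A' i f + G')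
      refine ⟨d, WDer.fixed hA (hW i) hf hG' hd, ?_⟩
      have h4 := (h2 i f _ h3).add hG''
      refine (h1 d _ _ hd h4).mono ?_
      have := Finset.single_le_sum (fun j _ => hK j) (Finset.mem_univ i)
      have h5 : K i * (M * C) + C ≤ ((∑ i, K i) * M + 1) * C := by
        have := mul_le_mul_of_nonneg_right this (by positivity : 0 ≤ M * C)
        linarith
      have h6 := mul_le_mul_of_nonneg_left h5 hM
      nlinarith [mul_nonneg hM hC]

end SmoothOp


/-! ### Bounded operators on L² from formulas valid almost everywhere. -/

section Constructor

/-- Linearity is required almost everywhere only: an integral operator may fail to be additive on a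
null set that depends on the functions. -/
lemma exists_clm_of_ae (Φ : L2V → Vel → ℝ) (hm : ∀ f, AEStronglyMeasurable (Φ f) volume)
    (hadd : ∀ f g : L2V, Φ (f + g) =ᵐ[volume] fun v => Φ f v + Φ g v)
    (hsmul : ∀ (c : ℝ) (f : L2V), Φ (c • f) =ᵐ[volume] fun v => c * Φ f v) {C : ℝ} (hC : 0 ≤ C)
    (hb : ∀ f : L2V, eLpNorm (Φ f) 2 volume ≤ ENNReal.ofReal C * eLpNorm f 2 volume) :
    ∃ T : L2V →L[ℝ] L2V, (∀ f, T f =ᵐ[volume] Φ f) ∧ ‖T‖ ≤ C := by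
  have hL : ∀ f, MemLp (Φ f) 2 volume := fun f => ⟨hm f, (hb f).trans_lt
    (ENNReal.mul_lt_top ENNReal.ofReal_lt_top (Lp.memLp f).2)⟩
  let T0 : L2V →ₗ[ℝ] L2V :=
    { toFun := fun f => (hL f).toLp
      map_add' := fun f g => by
        refine Lp.ext ?_
        filter_upwards [(hL (f + g)).coeFn_toLp, hadd f g, (hL f).coeFn_toLp, (hL g).coeFn_toLp,
          Lp.coeFn_add (hL f).toLp (hL g).toLp] with v h1 h2 h3 h4 h5
        rw [h1, h2, h5, Pi.add_apply, h3, h4]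
      map_smul' := fun c f => by
        refine Lp.ext ?_
        filter_upwards [(hL (c • f)).coeFn_toLp, hsmul c f, (hL f).coeFn_toLp,
          Lp.coeFn_smul c (hL f).toLp] with v h1 h2 h3 h4
        simp only [RingHom.id_apply]
        rw [h1, h2, h4, Pi.smul_apply, h3, smul_eq_mul] }
  have hbd : ∀ f, ‖T0 f‖ ≤ C * ‖f‖ := fun f => by
    change ‖(hL f).toLp‖ ≤ _
    rw [Lp.norm_toLp, Lp.norm_def]
    refine ENNReal.toReal_le_of_le_ofReal (by positivity) ((hb f).trans_eq ?_)
    rw [ENNReal.ofReal_mul hC, ENNReal.ofReal_toReal (Lp.memLp f).2.ne]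
  exact ⟨T0.mkContinuous C hbd, fun f => (hL f).coeFn_toLp,
    LinearMap.mkContinuous_norm_le _ hC _⟩

lemma eLpNorm_mul_le {a f : Vel → ℝ} {C : ℝ} (h : ∀ᵐ v, |a v| ≤ C) (p : ℝ≥0∞) :
    eLpNorm (fun v => a v * f v) p volume ≤ ENNReal.ofReal C * eLpNorm f p volume := by
  refine eLpNorm_le_mul_eLpNorm_of_ae_le_mul (h.mono fun v hv => ?_) p
  rw [norm_mul]
  exact mul_le_mul_of_nonneg_right hv (norm_nonneg _)

lemma exists_mulOp {a : Vel → ℝ} (ha : AEStronglyMeasurable a volume) {C : ℝ} (hC : 0 ≤ C)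
    (hb : ∀ᵐ v, |a v| ≤ C) :
    ∃ T : L2V →L[ℝ] L2V, (∀ f : L2V, T f =ᵐ[volume] fun v => a v * f v) ∧ ‖T‖ ≤ C := by
  refine exists_clm_of_ae (fun f v => a v * f v) (fun f => ha.mul (Lp.memLp f).1) (fun f g => ?_)
    (fun c f => ?_) hC fun f => eLpNorm_mul_le hb 2
  · filter_upwards [Lp.coeFn_add f g] with v h
    rw [h, Pi.add_apply]; ring
  · filter_upwards [Lp.coeFn_smul c f] with v h
    rw [h, Pi.smul_apply, smul_eq_mul]; ring

end Constructor

/-! ### Translations, difference quotients and the energy identity. -/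

section Translation

/-- The translation `f ↦ f(· + w)` on `L²`. -/
noncomputable def transl (w : Vel) (f : L2V) : L2V :=
  Lp.compMeasurePreserving (fun v => v + w) (measurePreserving_add_right volume w) f

lemma transl_ae (w : Vel) (f : L2V) : transl w f =ᵐ[volume] fun v => f (v + w) :=
  Lp.coeFn_compMeasurePreserving f (measurePreserving_add_right volume w)

lemma continuous_transl (f : L2V) : Continuous fun w => transl w f := by
  have h : Continuous fun w : Vel => (⟨fun v => v + w, by fun_prop⟩ : C(Vel, Vel)) := by
    refine ContinuousMap.continuous_of_continuous_uncurry _ ?_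
    change Continuous fun p : Vel × Vel => p.2 + p.1
    fun_prop
  exact (continuous_const (y := f)).compMeasurePreservingLp h
    (fun w => measurePreserving_add_right volume w) (by norm_num)

@[simp] lemma transl_zero (f : L2V) : transl 0 f = f := by
  refine Lp.ext ((transl_ae 0 f).trans ?_)
  simp only [add_zero]; rfl

lemma norm_transl (w : Vel) (f : L2V) : ‖transl w f‖ = ‖f‖ :=
  Lp.norm_compMeasurePreserving f (measurePreserving_add_right volume w)

/-- The unit coordinate vectors. -/
noncomputable abbrev stdE (i : Fin 3) : Vel := EuclideanSpace.single i (1 : ℝ)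

lemma inner_transl {φ : Vel → ℝ} (hφ : Smooth φ) (hc : HasCompactSupport φ) (w : Vel) (f : L2V) :
    inner ℝ (testL2 hφ hc) (transl w f) = ∫ v, f v * φ (v - w) := by
  rw [inner_testL2, ← integral_add_right_eq_self (fun v => f v * φ (v - w)) w]
  refine integral_congr_ae ((transl_ae w f).mono fun v hv => ?_)
  simp [hv]

/-- The integral is the convolution of g with the reflected test function, evaluated along the line
t ↦ t eᵢ. -/
lemma hasDerivAt_integral_translate {g : Vel → ℝ} (hg : LocallyIntegrable g volume) {φ : Vel → ℝ}
    (hφ : Smooth φ) (hc : HasCompactSupport φ) (i : Fin 3) (t : ℝ) :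
    HasDerivAt (fun t : ℝ => ∫ v, g v * φ (v - t • stdE i))
      (-∫ v, g v * partialD i φ (v - t • stdE i)) t := by
  set ψ : Vel → ℝ := fun w => φ (-w) with hψ
  have hψs : Smooth ψ := ContDiff.comp hφ contDiff_neg
  have hψc : HasCompactSupport ψ := hc.comp_homeomorph (Homeomorph.neg Vel)
  have h1 := hψc.hasFDerivAt_convolution_right (μ := (volume : Measure Vel))
    (ContinuousLinearMap.mul ℝ ℝ) hg (hψs.of_le (by exact_mod_cast le_top)) (t • stdE i)
  have h2 : HasDerivAt (fun t : ℝ => t • stdE i) (stdE i) t := by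
    simpa using (hasDerivAt_id t).smul_const (stdE i)
  have h3 := h1.comp_hasDerivAt t h2
  have e0 : (fun t : ℝ => ∫ v, g v * φ (v - t • stdE i)) =
      (MeasureTheory.convolution g ψ (ContinuousLinearMap.mul ℝ ℝ) volume) ∘ fun t : ℝ => t • stdE i := by
    ext t
    simp [MeasureTheory.convolution, hψ]
  rw [e0]
  convert! h3 using 1
  rw [convolution_precompR_apply _ hg (hψc.fderiv (𝕜 := ℝ)) ((hψs.fderiv_right (m := 0)
    (by norm_num)).continuous)]
  simp only [MeasureTheory.convolution, ContinuousLinearMap.mul_apply']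
  rw [← integral_neg]
  refine integral_congr_ae (.of_forall fun v => ?_)
  have : fderiv ℝ ψ (t • stdE i - v) = -fderiv ℝ φ (-(t • stdE i - v)) := by
    have h4 := ((Smooth.differentiable hφ (-(t • stdE i - v))).hasFDerivAt.comp (t • stdE i - v)
      (hasFDerivAt_id (𝕜 := ℝ) (t • stdE i - v)).neg).fderiv
    change fderiv ℝ (φ ∘ fun w => -w) _ = _
    refine h4.trans ?_
    ext w; simp
  simp only [this, partialD, neg_sub]
  simp

lemma norm_le_of_test {x : L2V} {K : ℝ}
    (h : ∀ (φ : Vel → ℝ) (hφ : Smooth φ) (hc : HasCompactSupport φ),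
      |inner ℝ (testL2 hφ hc) x| ≤ K * ‖testL2 hφ hc‖) : ‖x‖ ≤ K := by
  have hcl : IsClosed {y : L2V | |inner ℝ y x| ≤ K * ‖y‖} :=
    isClosed_le (by fun_prop) (by fun_prop)
  have h1 : ∀ y : L2V, |inner ℝ y x| ≤ K * ‖y‖ := fun y => by
    have h0 : testSet ⊆ {y : L2V | |inner ℝ y x| ≤ K * ‖y‖} := by
      rintro _ ⟨φ, hφ, hc, rfl⟩; exact h φ hφ hc
    have := closure_minimal h0 hcl
    rw [dense_testSet.closure_eq] at this
    exact this trivial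
  have h2 := h1 x
  rw [real_inner_self_eq_norm_sq, abs_of_nonneg (by positivity)] at h2
  by_contra hlt
  push Not at hlt
  -- The sign of K is not prescribed; when x = 0, a test function that is not null excludes K < 0.
  rcases eq_or_lt_of_le (norm_nonneg x) with h0 | h0
  · rw [← h0] at hlt
    have h3 : ∀ y : L2V, 0 ≤ K * ‖y‖ := fun y => (abs_nonneg _).trans (h1 y)
    obtain ⟨b⟩ : Nonempty (ContDiffBump (0 : Vel)) := ⟨⟨1, 2, by norm_num, by norm_num⟩⟩
    have hy := h3 (testL2 (φ := b) b.contDiff b.hasCompactSupport)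
    have hz : testL2 (φ := b) b.contDiff b.hasCompactSupport = 0 := by
      rw [← norm_eq_zero]
      by_contra hne
      have := lt_of_le_of_ne (norm_nonneg _) (Ne.symm hne)
      nlinarith
    have h4 := testL2_ae (φ := b) b.contDiff b.hasCompactSupport
    rw [hz] at h4
    have h5 := b.integral_pos (μ := (volume : Measure Vel))
    rw [← integral_congr_ae h4, integral_congr_ae (Lp.coeFn_zero ℝ 2 volume)] at h5
    simp at h5
  · nlinarith

/-- Difference quotients converge strongly to the weak derivative. -/
lemma WDer.tendsto_quotient {i : Fin 3} {f f' : L2V} (h : WDer i f f') :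
    Filter.Tendsto (fun t : ℝ => t⁻¹ • (transl (t • stdE i) f - f)) (nhdsWithin 0 (Set.Ioi 0))
      (nhds f') := by
  have hct : Continuous fun t : ℝ => transl (t • stdE i) f' :=
    (continuous_transl f').comp (by fun_prop)
  rw [Metric.tendsto_nhdsWithin_nhds]
  intro ε hε
  have h0 := hct.tendsto 0
  simp only [zero_smul, transl_zero] at h0
  obtain ⟨δ, hδ, hδ'⟩ := Metric.tendsto_nhds_nhds.1 h0 (ε / 2) (by positivity)
  refine ⟨δ, hδ, fun t ht htd => ?_⟩
  have ht0 : 0 < t := ht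
  rw [Real.dist_eq, sub_zero, abs_of_pos ht0] at htd
  rw [dist_eq_norm]
  -- By duality: for a fixed test function the map s ↦ ⟪φ, f(· + s eᵢ)⟫ − s ⟪φ, f'⟫ has derivative
  -- ⟪φ, f'(· + s eᵢ) − f'⟫, small by the strong continuity of translations. The mean value
  -- inequality then applies, uniformly for ‖φ‖ ≤ 1.
  have key : ‖transl (t • stdE i) f - f - t • f'‖ ≤ ε / 2 * t := by
    refine norm_le_of_test fun φ hφ hc => ?_
    have hd : ∀ s : ℝ, HasDerivAt (fun s : ℝ => (∫ v, f v * φ (v - s • stdE i))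
        - s * inner ℝ (testL2 hφ hc) f') (inner ℝ (testL2 hφ hc) (transl (s • stdE i) f' - f'))
        s := by
      intro s
      have h1 := hasDerivAt_integral_translate h.1 hφ hc i s
      have h2 := h.2.2 (fun v => φ (v + -(s • stdE i))) (hφ.comp_add _)
        (HasCompactSupport.comp_add_const hc _)
      rw [partialD_comp_add] at h2
      simp only [← sub_eq_add_neg] at h2
      rw [h2, neg_neg] at h1
      have h3 := h1.sub ((hasDerivAt_id s).mul_const (inner ℝ (testL2 hφ hc) f'))
      rw [inner_sub_right, inner_transl]
      rw [one_mul] at h3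
      exact h3
    have hb : ∀ s ∈ Set.Icc 0 t, ‖inner ℝ (testL2 hφ hc) (transl (s • stdE i) f' - f')‖ ≤
        ε / 2 * ‖testL2 hφ hc‖ := by
      intro s hs
      have h1 : dist s 0 < δ := by
        rw [Real.dist_eq, sub_zero, abs_of_nonneg hs.1]; linarith [hs.2]
      have h2 := hδ' h1
      rw [dist_eq_norm] at h2
      refine (norm_inner_le_norm _ _).trans ?_
      rw [mul_comm]
      gcongr
    have hm := Convex.norm_image_sub_le_of_norm_hasDerivWithin_le (s := Set.Icc 0 t)
      (fun s _ => (hd s).hasDerivWithinAt) hb (convex_Icc 0 t) (Set.left_mem_Icc.2 ht0.le)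
      (Set.right_mem_Icc.2 ht0.le)
    have e : inner ℝ (testL2 hφ hc) (transl (t • stdE i) f - f - t • f') =
        (∫ v, f v * φ (v - t • stdE i)) - t * inner ℝ (testL2 hφ hc) f' -
        ((∫ v, f v * φ (v - (0 : ℝ) • stdE i)) - 0 * inner ℝ (testL2 hφ hc) f') := by
      rw [inner_sub_right, inner_sub_right, inner_transl, inner_testL2 hφ hc f,
        inner_smul_right]
      simp; ring
    rw [e]
    refine (Real.norm_eq_abs _ ▸ hm).trans_eq ?_
    rw [sub_zero, Real.norm_of_nonneg ht0.le]
    ring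
  have e2 : t⁻¹ • (transl (t • stdE i) f - f) - f' =
      t⁻¹ • (transl (t • stdE i) f - f - t • f') := by
    rw [smul_sub t⁻¹ _ (t • f'), inv_smul_smul₀ ht0.ne']
  rw [e2, norm_smul, norm_inv, Real.norm_of_nonneg ht0.le, ← div_eq_inv_mul, div_lt_iff₀ ht0]
  nlinarith

/-- This is ∂ᵢ(f²) = 2 f f' in weak form. The difference quotient of f² factors as the quotient of
f, which converges strongly in L², times f(· + t eᵢ) + f; no mollification is needed. -/
lemma WDer.energyL {i : Fin 3} {f f' : L2V} (h : WDer i f f') {ψ : Vel → ℝ} (hψ : Smooth ψ)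
    (hc : HasCompactSupport ψ) :
    2 * ∫ v, ψ v * (f v * f' v) = -∫ v, partialD i ψ v * f v ^ 2 := by
  obtain ⟨B, hB⟩ := hψ.continuous.bounded_above_of_compact_support hc
  obtain ⟨M, hM, -⟩ := exists_mulOp (a := ψ) hψ.continuous.aestronglyMeasurable
    (C := |B|) (abs_nonneg B) (.of_forall fun v => (hB v).trans (le_abs_self B))
  have hct : Continuous fun t : ℝ => transl (t • stdE i) f :=
    (continuous_transl f).comp (by fun_prop)
  have l1 : Filter.Tendsto (fun t : ℝ => transl (t • stdE i) f + f) (nhdsWithin 0 (Set.Ioi 0))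
      (nhds (f + f)) := by
    have := (hct.tendsto 0).mono_left (nhdsWithin_le_nhds (s := Set.Ioi 0))
    simp only [zero_smul, transl_zero] at this
    exact this.add_const f
  have l2 := Filter.Tendsto.inner (𝕜 := ℝ) h.tendsto_quotient ((M.continuous.tendsto _).comp l1)
  have hsq : LocallyIntegrable (fun v => f v ^ 2) volume :=
    (Lp.memLp f).integrable_sq.locallyIntegrable
  have l3 := (hasDerivAt_integral_translate hsq hψ hc i 0).tendsto_slope_zero_right
  have e : (fun t : ℝ => inner ℝ (t⁻¹ • (transl (t • stdE i) f - f))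
      ((M ∘ fun t : ℝ => transl (t • stdE i) f + f) t)) = fun t : ℝ =>
      t⁻¹ • ((∫ v, f v ^ 2 * ψ (v - (0 + t) • stdE i)) -
        ∫ v, f v ^ 2 * ψ (v - (0 : ℝ) • stdE i)) := by
    ext t
    rw [inner_smul_left, L2.inner_def, zero_add]
    simp only [conj_trivial, smul_eq_mul, zero_smul, sub_zero, Function.comp]
    congr 1
    rw [← integral_add_right_eq_self (fun v => f v ^ 2 * ψ (v - t • stdE i)) (t • stdE i)]
    simp only [add_sub_cancel_right]
    have i1 : Integrable (fun v => f (v + t • stdE i) ^ 2 * ψ v) volume := by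
      refine integrable_mul_test ?_ hψ.continuous hc
      exact ((Lp.memLp f).integrable_sq.comp_add_right (t • stdE i)).locallyIntegrable
    rw [← integral_sub i1 (integrable_mul_test hsq hψ.continuous hc)]
    refine integral_congr_ae ?_
    filter_upwards [transl_ae (t • stdE i) f, hM (transl (t • stdE i) f + f),
      Lp.coeFn_add (transl (t • stdE i) f) f, Lp.coeFn_sub (transl (t • stdE i) f) f]
      with v h1 h2 h3 h4
    simp only [RCLike.inner_apply, conj_trivial]
    rw [h2, h3, h4, Pi.add_apply, Pi.sub_apply, h1]
    ring
  rw [e] at l2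
  have h5 := tendsto_nhds_unique l2 l3
  simp only [zero_smul, sub_zero] at h5
  have h6 : inner ℝ f' (M (f + f)) = 2 * ∫ v, ψ v * (f v * f' v) := by
    rw [L2.inner_def, ← integral_const_mul]
    refine integral_congr_ae ?_
    filter_upwards [hM (f + f), Lp.coeFn_add f f] with v h1 h2
    simp only [RCLike.inner_apply, conj_trivial]
    rw [h1, h2, Pi.add_apply]
    ring
  rw [← h6, h5]
  simp only [mul_comm]

end Translation


/-! ### Weighted Sobolev classes and pointwise bounds of derivatives. -/

/-- `f` has weak derivatives up to order `n`, all of them bounded by `C` in the weighted space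
`L²(W² dv)`. -/
def SobW (W : Vel → ℝ) : ℕ → (Vel → ℝ) → ℝ≥0∞ → Prop
  | 0, f, C => AEStronglyMeasurable f volume ∧ eLpNorm (fun v => W v * f v) 2 volume ≤ C
  | n + 1, f, C => (AEStronglyMeasurable f volume ∧ eLpNorm (fun v => W v * f v) 2 volume ≤ C) ∧
      ∀ i, ∃ f' : Vel → ℝ, WDer i f f' ∧ SobW W n f' C

/-- All derivatives of `a` up to order `n` are bounded by `B * m`. -/
def DerivBdd (m : Vel → ℝ) : ℕ → (Vel → ℝ) → ℝ → Prop
  | 0, a, B => ∀ v, |a v| ≤ B * m v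
  | n + 1, a, B => (∀ v, |a v| ≤ B * m v) ∧ ∀ i, DerivBdd m n (partialD i a) B

section DerivBdd

variable {m : Vel → ℝ} {n : ℕ} {a b : Vel → ℝ} {A B : ℝ}

lemma DerivBdd.of_succ (h : DerivBdd m (n + 1) a B) : DerivBdd m n a B := by
  induction n generalizing a with
  | zero => exact h.1
  | succ n ih => exact ⟨h.1, fun i => ih (h.2 i)⟩

lemma DerivBdd.mono (hm : ∀ v, 0 ≤ m v) (h : DerivBdd m n a A) (hAB : A ≤ B) :
    DerivBdd m n a B := by
  induction n generalizing a with
  | zero => exact fun v => (h v).trans (mul_le_mul_of_nonneg_right hAB (hm v))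
  | succ n ih => exact ⟨fun v => (h.1 v).trans (mul_le_mul_of_nonneg_right hAB (hm v)),
      fun i => ih (h.2 i)⟩

end DerivBdd

section SobW

variable {W : Vel → ℝ} {n : ℕ} {f g : Vel → ℝ} {C D : ℝ≥0∞}

lemma SobW.base (h : SobW W n f C) :
    AEStronglyMeasurable f volume ∧ eLpNorm (fun v => W v * f v) 2 volume ≤ C := by
  cases n with
  | zero => exact h
  | succ n => exact h.1

lemma SobW.of_succ (h : SobW W (n + 1) f C) : SobW W n f C := by
  induction n generalizing f with
  | zero => exact h.1
  | succ n ih => exact ⟨h.1, fun i => (h.2 i).imp fun f' h' => ⟨h'.1, ih h'.2⟩⟩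

lemma SobW.mono (h : SobW W n f C) (hCD : C ≤ D) : SobW W n f D := by
  induction n generalizing f with
  | zero => exact ⟨h.1, h.2.trans hCD⟩
  | succ n ih => exact ⟨⟨h.1.1, h.1.2.trans hCD⟩,
      fun i => (h.2 i).imp fun f' h' => ⟨h'.1, ih h'.2⟩⟩

lemma SobW.add (hW : Continuous W) (h : SobW W n f C) (h' : SobW W n g D) :
    SobW W n (fun v => f v + g v) (C + D) := by
  have hb : ∀ {f g : Vel → ℝ}, AEStronglyMeasurable f volume →
      AEStronglyMeasurable g volume → eLpNorm (fun v => W v * f v) 2 volume ≤ C →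
      eLpNorm (fun v => W v * g v) 2 volume ≤ D →
      AEStronglyMeasurable (fun v => f v + g v) volume ∧
        eLpNorm (fun v => W v * (f v + g v)) 2 volume ≤ C + D := by
    intro f g hf hg h1 h2
    refine ⟨hf.add hg, ?_⟩
    simp only [mul_add]
    exact (eLpNorm_add_le (hW.aestronglyMeasurable.mul hf) (hW.aestronglyMeasurable.mul hg)
      (by norm_num)).trans (add_le_add h1 h2)
  induction n generalizing f g with
  | zero => exact hb h.1 h'.1 h.2 h'.2
  | succ n ih =>
    refine ⟨hb h.1.1 h'.1.1 h.1.2 h'.1.2, fun i => ?_⟩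
    obtain ⟨f', hf, hf'⟩ := h.2 i
    obtain ⟨g', hg, hg'⟩ := h'.2 i
    exact ⟨_, hf.add hg, ih hf' hg'⟩

/-- Each differentiation splits into two Leibniz terms, whence 2^n. The constant involves the
multiplier through B only, which later gives uniformity in q. -/
lemma SobW.mul {a : Vel → ℝ} (ha : Smooth a) {B : ℝ} (hB : DerivBdd (fun _ => 1) n a B)
    (hW : Continuous W) (h : SobW W n f C) :
    SobW W n (fun v => a v * f v) (2 ^ n * ENNReal.ofReal B * C) := by
  have hb : ∀ {a f : Vel → ℝ}, Smooth a → (∀ v, |a v| ≤ B * 1) → AEStronglyMeasurable f volume →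
      eLpNorm (fun v => W v * f v) 2 volume ≤ C → ∀ k : ℕ,
      AEStronglyMeasurable (fun v => a v * f v) volume ∧
        eLpNorm (fun v => W v * (a v * f v)) 2 volume ≤ 2 ^ k * ENNReal.ofReal B * C := by
    intro a f ha hb hf h k
    refine ⟨ha.continuous.aestronglyMeasurable.mul hf, ?_⟩
    have e : (fun v => W v * (a v * f v)) = fun v => a v * (W v * f v) := by ext v; ring
    rw [e]
    refine (eLpNorm_mul_le (C := B) (.of_forall fun v => by simpa using hb v) 2).trans ?_
    have h1 : (1 : ℝ≥0∞) ≤ 2 ^ k := one_le_pow₀ (by norm_num)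
    calc ENNReal.ofReal B * _ ≤ 1 * ENNReal.ofReal B * C := by rw [one_mul]; gcongr
      _ ≤ _ := by gcongr
  induction n generalizing a f with
  | zero => exact hb ha hB h.1 h.2 0
  | succ n ih =>
    refine ⟨hb ha hB.1 h.1.1 h.1.2 _, fun i => ?_⟩
    obtain ⟨f', hf, hf'⟩ := h.2 i
    refine ⟨_, hf.mul_smooth ha, ?_⟩
    refine (SobW.add hW (ih ha hB.of_succ hf') (ih (ha.pd i) (hB.2 i) h.of_succ)).mono ?_
    rw [pow_succ]
    apply le_of_eq
    ring

lemma SobW.sobE (h : SobW (fun _ => 1) n f C) (hC : C ≠ ⊤) {F : L2V} (hF : F =ᵐ[volume] f) :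
    SobE n F C.toReal := by
  have hb : ∀ {f : Vel → ℝ}, eLpNorm (fun v => 1 * f v) 2 volume ≤ C → ∀ F : L2V,
      F =ᵐ[volume] f → ‖F‖ ≤ C.toReal := by
    intro f hf F hF
    simp only [one_mul] at hf
    rw [Lp.norm_def, eLpNorm_congr_ae hF]
    exact ENNReal.toReal_mono hC hf
  induction n generalizing f F with
  | zero => exact hb h.2 F hF
  | succ n ih =>
    refine ⟨hb h.1.2 F hF, fun i => ?_⟩
    obtain ⟨f', hf, hf'⟩ := h.2 i
    have h1 := hf'.base
    simp only [one_mul] at h1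
    have hm : MemLp f' 2 volume := ⟨h1.1, h1.2.trans_lt hC.lt_top⟩
    exact ⟨hm.toLp, hf.congr hF.symm hm.coeFn_toLp.symm, ih hf' hm.coeFn_toLp⟩

lemma SobE.sobW {F : L2V} {K : ℝ} (h : SobE n F K) :
    SobW (fun _ => 1) n F (ENNReal.ofReal K) := by
  have hb : ∀ {F : L2V}, ‖F‖ ≤ K → AEStronglyMeasurable F volume ∧
      eLpNorm (fun v => 1 * F v) 2 volume ≤ ENNReal.ofReal K := by
    intro F hF
    refine ⟨(Lp.memLp F).1, ?_⟩
    simp only [one_mul]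
    rw [Lp.norm_def] at hF
    exact ENNReal.le_ofReal_iff_toReal_le (Lp.memLp F).2.ne
      (ENNReal.toReal_nonneg.trans hF) |>.2 hF
  induction n generalizing F with
  | zero => exact hb h
  | succ n ih =>
    refine ⟨hb h.1, fun i => ?_⟩
    obtain ⟨f', hf, hf'⟩ := h.2 i
    exact ⟨f', hf, ih hf'⟩

end SobW

/-! ### A Hardy inequality for exponentially growing weights. -/

section Hardy

/-- The cutoff is identically 1 near each point where ψ does not vanish, so its gradient vanishes
there too. It serves to replace g by θ g in integrals against ψ. -/
lemma exists_bump_eq_one {ψ : Vel → ℝ} (hc : HasCompactSupport ψ) :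
    ∃ θ : Vel → ℝ, Smooth θ ∧ HasCompactSupport θ ∧
      ∀ v, ψ v ≠ 0 → θ v = 1 ∧ ∀ i, partialD i θ v = 0 := by
  obtain ⟨R, hR⟩ := hc.isCompact.isBounded.subset_closedBall (0 : Vel)
  let b : ContDiffBump (0 : Vel) := ⟨|R| + 1, |R| + 2, by positivity, by linarith⟩
  refine ⟨b, b.contDiff, b.hasCompactSupport, fun v hv => ?_⟩
  have h1 : v ∈ Metric.ball (0 : Vel) (|R| + 1) := by
    have := hR (subset_tsupport ψ hv)
    rw [Metric.mem_closedBall] at this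
    rw [Metric.mem_ball]
    linarith [le_abs_self R]
  refine ⟨b.one_of_mem_closedBall (Metric.ball_subset_closedBall h1), fun i => ?_⟩
  have h2 : (b : Vel → ℝ) =ᶠ[nhds v] fun _ => 1 := by
    filter_upwards [Metric.isOpen_ball.mem_nhds h1] with w hw
    exact b.one_of_mem_closedBall (Metric.ball_subset_closedBall hw)
  rw [partialD, h2.fderiv_eq]
  simp

/-- Both sides only see g near the support of ψ, so g may be multiplied by a cutoff, after which
`WDer.energyL` applies; local square integrability is enough. -/
lemma WDer.energy {i : Fin 3} {g g' : Vel → ℝ} (h : WDer i g g')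
    (hg : ∀ θ, Smooth θ → HasCompactSupport θ → MemLp (fun v => θ v * g v) 2 volume)
    (hg' : ∀ θ, Smooth θ → HasCompactSupport θ → MemLp (fun v => θ v * g' v) 2 volume)
    {ψ : Vel → ℝ} (hψ : Smooth ψ) (hc : HasCompactSupport ψ) :
    2 * ∫ v, ψ v * (g v * g' v) = -∫ v, partialD i ψ v * g v ^ 2 := by
  obtain ⟨θ, hθ, cθ, h1⟩ := exists_bump_eq_one hc
  obtain ⟨θ₂, -, -, h2⟩ := exists_bump_eq_one (hasCompactSupport_partialD hc i)
  have m1 := hg θ hθ cθ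
  have m2 := (hg' θ hθ cθ).add (hg _ (hθ.pd i) (hasCompactSupport_partialD cθ i))
  have h3 := ((h.mul_smooth hθ).congr m1.coeFn_toLp.symm m2.coeFn_toLp.symm).energyL hψ hc
  have e1 : ∫ v, ψ v * (g v * g' v) = ∫ v, ψ v * ((m1.toLp _ : L2V) v * (m2.toLp _ : L2V) v) := by
    refine integral_congr_ae ?_
    filter_upwards [m1.coeFn_toLp, m2.coeFn_toLp] with v a1 a2
    rw [a1, a2]
    by_cases hv : ψ v = 0
    · simp [hv]
    · simp [(h1 v hv).1, (h1 v hv).2 i]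
  have e2 : ∫ v, partialD i ψ v * g v ^ 2 = ∫ v, partialD i ψ v * (m1.toLp _ : L2V) v ^ 2 := by
    refine integral_congr_ae ?_
    filter_upwards [m1.coeFn_toLp] with v a1
    rw [a1]
    by_cases hv : partialD i ψ v = 0
    · simp [hv]
    -- Where ∂ᵢψ ≠ 0 the function ψ itself may vanish, but v still lies in its closed support, and
    -- the set where θ = 1 is closed.
    · have hcl : v ∈ tsupport ψ := by
        have : v ∈ tsupport (fderiv ℝ ψ) := by
          refine subset_tsupport _ ?_
          intro h0
          exact hv (by rw [partialD, h0]; rfl)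
        exact tsupport_fderiv_subset ℝ this
      have h4 : θ v = 1 := by
        have hcl2 : IsClosed {w | θ w = 1} := isClosed_eq hθ.continuous continuous_const
        exact closure_minimal (fun w hw => (h1 w hw).1) hcl2 hcl
      simp [h4]
  rw [e1, e2, h3]

/-- The centered coordinate functions. -/
noncomputable def coord (c : Vel) (j : Fin 3) : Vel → ℝ := fun v => v j - c j

lemma smooth_coord (c : Vel) (j : Fin 3) : Smooth (coord c j) := by
  have : Smooth fun v : Vel => v j := (EuclideanSpace.proj (𝕜 := ℝ) j).contDiff
  exact ContDiff.sub this contDiff_const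

lemma partialD_coord (c : Vel) (i j : Fin 3) :
    partialD i (coord c j) = fun _ => if i = j then 1 else 0 := by
  ext v
  have h : HasFDerivAt (coord c j) (EuclideanSpace.proj j : Vel →L[ℝ] ℝ) v :=
    ((EuclideanSpace.proj j : Vel →L[ℝ] ℝ).hasFDerivAt).sub_const (c j)
  rw [partialD, h.fderiv]
  simp [eq_comm]

/-- One bump function dilated by k + 1: its gradient is divided by k + 1, so a single bound serves
all k. -/
lemma exists_cutoff (c : Vel) : ∃ B : ℝ, 0 ≤ B ∧ ∀ k : ℕ, ∃ χ : Vel → ℝ, Smooth χ ∧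
    HasCompactSupport χ ∧ (∀ v, 0 ≤ χ v ∧ χ v ≤ 1) ∧ (∀ v, ‖v - c‖ ≤ k + 1 → χ v = 1) ∧
    ∀ i v, |partialD i χ v| ≤ B := by
  let b : ContDiffBump (0 : Vel) := ⟨1, 2, by norm_num, by norm_num⟩
  have hbs : Smooth b := b.contDiff
  choose B hB using fun i => (hbs.pd i).continuous.bounded_above_of_compact_support
    (hasCompactSupport_partialD b.hasCompactSupport i)
  refine ⟨∑ i, |B i|, by positivity, fun k => ?_⟩
  have hk : (0 : ℝ) < k + 1 := by positivity
  have hk1 : ((k : ℝ) + 1)⁻¹ ≤ 1 := inv_le_one_of_one_le₀ (by linarith [(Nat.cast_nonneg k : (0:ℝ) ≤ k)])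
  let L : Vel → Vel := fun v => ((k : ℝ) + 1)⁻¹ • (v - c)
  have hL : ∀ v, HasFDerivAt L (((k : ℝ) + 1)⁻¹ • ContinuousLinearMap.id ℝ Vel) v := fun v =>
    ((hasFDerivAt_id (𝕜 := ℝ) v).sub_const c).const_smul (((k : ℝ) + 1)⁻¹)
  have hLs : ContDiff ℝ ((⊤ : ℕ∞) : WithTop ℕ∞) L := by
    change ContDiff ℝ _ fun v : Vel => ((k : ℝ) + 1)⁻¹ • (v - c)
    fun_prop
  refine ⟨fun v => b (L v), hbs.comp hLs, ?_, fun v => ⟨b.nonneg, b.le_one⟩, fun v hv => ?_,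
    fun i v => ?_⟩
  · refine HasCompactSupport.intro (isCompact_closedBall c (2 * (k + 1))) fun v hv => ?_
    refine b.zero_of_le_dist ?_
    rw [Metric.mem_closedBall, dist_eq_norm, not_le] at hv
    rw [dist_zero_right, norm_smul, norm_inv, Real.norm_of_nonneg hk.le, ← div_eq_inv_mul,
      le_div_iff₀ hk]
    exact hv.le
  · refine b.one_of_mem_closedBall ?_
    rw [Metric.mem_closedBall, dist_zero_right, norm_smul, norm_inv, Real.norm_of_nonneg hk.le,
      ← div_eq_inv_mul, div_le_iff₀ hk]
    change ‖v - c‖ ≤ 1 * ((k : ℝ) + 1)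
    rwa [one_mul]
  · have h1 := (hbs.differentiable (L v)).hasFDerivAt.comp v (hL v)
    have h2 : partialD i (fun v => b (L v)) v = ((k : ℝ) + 1)⁻¹ * partialD i b (L v) := by
      rw [partialD]
      erw [h1.fderiv]
      simp [partialD]
    rw [h2, abs_mul, abs_of_nonneg (by positivity)]
    have h3 := hB i (L v)
    rw [Real.norm_eq_abs] at h3
    have h4 := Finset.single_le_sum (fun j _ => abs_nonneg (B j)) (Finset.mem_univ i)
    calc _ ≤ 1 * |partialD i b (L v)| := by gcongr
      _ ≤ _ := by rw [one_mul]; linarith [le_abs_self (B i)]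

lemma eLpNorm_two_sq (f : Vel → ℝ) :
    eLpNorm f 2 volume ^ 2 = ∫⁻ v, ENNReal.ofReal (f v ^ 2) := by
  have h := eLpNorm_nnreal_pow_eq_lintegral (f := f) (μ := (volume : Measure Vel)) (p := 2)
    (by norm_num)
  simp only [NNReal.coe_ofNat, ENNReal.coe_ofNat] at h
  have h2 := h
  rw [show ((2 : ℝ)) = ((2 : ℕ) : ℝ) by norm_num, ENNReal.rpow_natCast] at h2
  rw [h2]
  refine lintegral_congr fun v => ?_
  rw [ENNReal.rpow_natCast, Real.enorm_eq_ofReal_abs, ← ENNReal.ofReal_pow (abs_nonneg _), sq_abs]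

/-- A Hardy type inequality for weights whose logarithm has gradient `ρ (v - c)` with
`ρ ≥ c₀ > 0`. -/
lemma exists_hardy {W ρ : Vel → ℝ} (c : Vel) (hW : Smooth W) (hWpos : ∀ v, 0 < W v)
    (hWρ : ∀ j v, partialD j W v = W v * (ρ v * coord c j v)) {c₀ : ℝ} (hc₀ : 0 < c₀)
    (hρ : ∀ v, c₀ ≤ ρ v) :
    ∃ K : ℝ≥0∞, K ≠ ⊤ ∧ ∀ (j : Fin 3) (g g' : Vel → ℝ) (Y : ℝ≥0∞), Y ≠ ⊤ → WDer j g g' →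
      AEStronglyMeasurable g volume → AEStronglyMeasurable g' volume →
      eLpNorm (fun v => W v * g v) 2 volume ≤ Y → eLpNorm (fun v => W v * g' v) 2 volume ≤ Y →
      eLpNorm (fun v => W v * (coord c j v * g v)) 2 volume ≤ K * Y := by
  obtain ⟨B, hB0, hB⟩ := exists_cutoff c
  refine ⟨ENNReal.ofReal (c₀⁻¹ * (2 + 2 * B ^ 2)), ENNReal.ofReal_ne_top,
    fun j g g' Y hY h hgm hgm' hgY hgY' => ?_⟩
  have mg : MemLp (fun v => W v * g v) 2 volume :=
    ⟨hW.continuous.aestronglyMeasurable.mul hgm, hgY.trans_lt hY.lt_top⟩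
  have mg' : MemLp (fun v => W v * g' v) 2 volume :=
    ⟨hW.continuous.aestronglyMeasurable.mul hgm', hgY'.trans_lt hY.lt_top⟩
  have hloc : ∀ {u : Vel → ℝ}, MemLp (fun v => W v * u v) 2 volume → ∀ θ, Continuous θ →
      HasCompactSupport θ → MemLp (fun v => θ v * u v) 2 volume := by
    intro u hu θ hθ cθ
    have hcont : Continuous fun v => θ v * (W v)⁻¹ :=
      hθ.mul (hW.continuous.inv₀ fun v => (hWpos v).ne')
    obtain ⟨A, hA⟩ := hcont.bounded_above_of_compact_support cθ.mul_right
    have e : (fun v => θ v * u v) = fun v => (θ v * (W v)⁻¹) * (W v * u v) := by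
      ext v
      have := (hWpos v).ne'
      field_simp
    rw [e]
    refine ⟨hcont.aestronglyMeasurable.mul hu.1, ?_⟩
    exact (eLpNorm_mul_le (C := A) (.of_forall fun v => hA v) 2).trans_lt
      (ENNReal.mul_lt_top ENNReal.ofReal_lt_top hu.2)
  -- F collects what multiplies the unknown P k in the error terms: those with g' and those where
  -- the cutoff is differentiated.
  set F : Vel → ℝ := fun v => c₀⁻¹ * (|W v * g' v| + B * |W v * g v|) with hF
  have hFi : Integrable (fun v => F v ^ 2) volume := by
    have : MemLp F 2 volume := by
      have h1 : MemLp (fun v => |W v * g' v|) 2 volume := mg'.abs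
      have h2 : MemLp (fun v => |W v * g v|) 2 volume := mg.abs
      exact (h1.add (h2.const_mul B)).const_mul c₀⁻¹
    exact this.integrable_sq
  choose χ hχs hχc hχ01 hχ1 hχd using hB
  set P : ℕ → Vel → ℝ := fun k v => coord c j v * χ k v * W v * g v with hP
  have hPm : ∀ k, MemLp (P k) 2 volume := fun k => by
    refine hloc mg _ ?_ ?_
    · exact ((smooth_coord c j).continuous.mul (hχs k).continuous).mul hW.continuous
    · exact ((hχc k).mul_left).mul_right
  -- Energy identity with ψ = x_j (χ W)². The derivative of W contributes 2ρP² ≥ 2c₀P²; the square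
  -- from ∂_j x_j = 1 has the good sign; all other terms are at most 2c₀|P|F ≤ c₀(P² + F²), half of
  -- which is absorbed.
  have key : ∀ k, ∫ v, P k v ^ 2 ≤ ∫ v, F v ^ 2 := by
    intro k
    set ψ : Vel → ℝ := fun v => coord c j v * ((χ k v * W v) * (χ k v * W v)) with hψ
    have s1 : Smooth fun v => χ k v * W v := (hχs k).mul hW
    have s2 : Smooth fun v => (χ k v * W v) * (χ k v * W v) := ContDiff.mul s1 s1
    have hψs : Smooth ψ := (smooth_coord c j).mul s2
    have hψc : HasCompactSupport ψ := ((hχc k).mul_right.mul_right).mul_left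
    have hen := h.energy (fun θ a b => hloc mg θ a.continuous b)
      (fun θ a b => hloc mg' θ a.continuous b) hψs hψc
    have hψd : ∀ v, partialD j ψ v = (χ k v * W v) ^ 2 +
        2 * coord c j v * (χ k v * W v) * (χ k v * (W v * (ρ v * coord c j v))
          + partialD j (χ k) v * W v) := by
      intro v
      rw [hψ, partialD_mul (smooth_coord c j).differentiable s2.differentiable,
        partialD_mul s1.differentiable s1.differentiable,
        partialD_mul (hχs k).differentiable hW.differentiable, partialD_coord]
      simp only [if_true, hWρ]
      ring
    obtain ⟨θ, hθ, cθ, hθ1⟩ := exists_bump_eq_one hψc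
    have hlg := hloc mg θ hθ.continuous cθ
    have i1 : Integrable (fun v => ψ v * (g v * g' v)) volume := by
      have h1 : Integrable (fun v => (ψ v * g v) * (θ v * g' v)) volume :=
        (hloc mg ψ hψs.continuous hψc).integrable_mul (hloc mg' θ hθ.continuous cθ)
      refine h1.congr (.of_forall fun v => ?_)
      by_cases hv : ψ v = 0
      · simp [hv]
      · simp only [(hθ1 v hv).1]; ring
    obtain ⟨θ₂, hθ₂, cθ₂, hθ₂1⟩ := exists_bump_eq_one (hasCompactSupport_partialD hψc j)
    have i2 : Integrable (fun v => partialD j ψ v * g v ^ 2) volume := by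
      have h1 : Integrable (fun v => (partialD j ψ v * g v) * (θ₂ v * g v)) volume :=
        (hloc mg _ (hψs.pd j).continuous (hasCompactSupport_partialD hψc j)).integrable_mul
          (hloc mg θ₂ hθ₂.continuous cθ₂)
      refine h1.congr (.of_forall fun v => ?_)
      by_cases hv : partialD j ψ v = 0
      · simp [hv]
      · simp only [(hθ₂1 v hv).1]; ring
    have i3 : Integrable (fun v => P k v ^ 2) volume := (hPm k).integrable_sq
    have h0 : ∫ v, (c₀ * P k v ^ 2 - c₀ * F v ^ 2) ≤
        ∫ v, (2 * (ψ v * (g v * g' v)) + partialD j ψ v * g v ^ 2) := by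
      refine integral_mono ((i3.const_mul _).sub (hFi.const_mul _)) ((i1.const_mul 2).add i2)
        fun v => ?_
      simp only [hψd v]
      have hx := hχ01 k v
      have hd := hχd k j v
      have hr := hρ v
      have e1 : 2 * (ψ v * (g v * g' v)) + ((χ k v * W v) ^ 2 +
        2 * coord c j v * (χ k v * W v) * (χ k v * (W v * (ρ v * coord c j v))
          + partialD j (χ k) v * W v)) * g v ^ 2 =
          2 * P k v * (χ k v * (W v * g' v)) + (χ k v * W v * g v) ^ 2 + 2 * ρ v * P k v ^ 2 +
          2 * P k v * (partialD j (χ k) v * (W v * g v)) := by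
        simp only [hP, hψ]; ring
      rw [e1]
      have e2 : |P k v * (χ k v * (W v * g' v))| ≤ |P k v| * |W v * g' v| := by
        rw [abs_mul, abs_mul (χ k v), abs_of_nonneg hx.1]
        gcongr
        exact mul_le_of_le_one_left (abs_nonneg _) hx.2
      have e3 : |P k v * (partialD j (χ k) v * (W v * g v))| ≤ |P k v| * (B * |W v * g v|) := by
        rw [abs_mul, abs_mul (partialD j (χ k) v)]
        gcongr
      have e4 : |W v * g' v| + B * |W v * g v| = c₀ * F v := by
        simp only [hF]; field_simp
      have e5 : |P k v| * |W v * g' v| + |P k v| * (B * |W v * g v|) = c₀ * (|P k v| * F v) := by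
        rw [← mul_add, e4]; ring
      have e6 := neg_abs_le (P k v * (χ k v * (W v * g' v)))
      have e7 := neg_abs_le (P k v * (partialD j (χ k) v * (W v * g v)))
      have e8 : 2 * (|P k v| * F v) ≤ P k v ^ 2 + F v ^ 2 := by
        rw [← sq_abs (P k v)]; nlinarith [sq_nonneg (|P k v| - F v)]
      have e9 : 2 * c₀ * P k v ^ 2 ≤ 2 * ρ v * P k v ^ 2 := by gcongr
      nlinarith [sq_nonneg (χ k v * W v * g v), mul_le_mul_of_nonneg_left e8 hc₀.le]
    rw [integral_sub (i3.const_mul _) (hFi.const_mul _), integral_add (i1.const_mul 2) i2,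
      integral_const_mul, integral_const_mul, integral_const_mul, hen] at h0
    nlinarith
  -- Fatou's lemma removes the cutoff, so that the finiteness of the norm of x_j g is a conclusion
  -- and not an assumption.
  have hlim : ∫⁻ v, ENNReal.ofReal ((W v * (coord c j v * g v)) ^ 2) ≤
      ENNReal.ofReal (∫ v, F v ^ 2) := by
    have hpt : ∀ v, Filter.Tendsto (fun k => ENNReal.ofReal (P k v ^ 2)) Filter.atTop
        (nhds (ENNReal.ofReal ((W v * (coord c j v * g v)) ^ 2))) := by
      intro v
      refine tendsto_const_nhds.congr' ?_
      obtain ⟨k₀, hk₀⟩ := exists_nat_ge ‖v - c‖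
      filter_upwards [Filter.eventually_ge_atTop k₀] with k hk
      have : χ k v = 1 := hχ1 k v (by
        have : (k₀ : ℝ) ≤ k := by exact_mod_cast hk
        linarith)
      simp only [hP, this]
      congr 1; ring
    have hfat := lintegral_liminf_le' (u := Filter.atTop) (μ := (volume : Measure Vel))
      (f := fun k v => ENNReal.ofReal (P k v ^ 2)) (fun k =>
        ((hPm k).1.aemeasurable.pow_const 2).ennreal_ofReal)
    have e : ∀ v, Filter.liminf (fun k => ENNReal.ofReal (P k v ^ 2)) Filter.atTop =
        ENNReal.ofReal ((W v * (coord c j v * g v)) ^ 2) := fun v => (hpt v).liminf_eq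
    simp only [e] at hfat
    refine hfat.trans ?_
    refine (Filter.liminf_le_liminf (v := fun _ : ℕ => ENNReal.ofReal (∫ v, F v ^ 2))
      (.of_forall fun k => ?_)).trans (by simp)
    rw [← ofReal_integral_eq_lintegral_ofReal (hPm k).integrable_sq
      (.of_forall fun v => by positivity)]
    exact ENNReal.ofReal_le_ofReal (key k)
  rw [← eLpNorm_two_sq, ofReal_integral_eq_lintegral_ofReal hFi
    (.of_forall fun v => by positivity), ← eLpNorm_two_sq] at hlim
  have hF2 : eLpNorm F 2 volume ≤ ENNReal.ofReal (c₀⁻¹ * (2 + 2 * B ^ 2)) * Y := by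
    have h1 : eLpNorm F 2 volume ≤ ENNReal.ofReal c₀⁻¹ *
        eLpNorm (fun v => |W v * g' v| + B * |W v * g v|) 2 volume :=
      eLpNorm_mul_le (a := fun _ => c₀⁻¹) (.of_forall fun v => (abs_of_pos (by positivity)).le) 2
    have h2 : eLpNorm (fun v => |W v * g' v| + B * |W v * g v|) 2 volume ≤
        Y + ENNReal.ofReal B * Y := by
      refine (eLpNorm_add_le mg'.abs.1 (mg.abs.1.const_mul B) (by norm_num)).trans ?_
      refine add_le_add ?_ ?_
      · exact (eLpNorm_norm (fun v => W v * g' v)).trans_le hgY'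
      · refine (eLpNorm_mul_le (a := fun _ => B) (C := B)
          (.of_forall fun v => (abs_of_nonneg hB0).le) 2).trans ?_
        gcongr
        exact (eLpNorm_norm (fun v => W v * g v)).trans_le hgY
    refine h1.trans ?_
    rw [ENNReal.ofReal_mul (by positivity), mul_assoc]
    gcongr
    refine h2.trans ?_
    have : Y + ENNReal.ofReal B * Y = ENNReal.ofReal (1 + B) * Y := by
      rw [ENNReal.ofReal_add (by norm_num) hB0]; simp [add_mul]
    rw [this]
    exact mul_le_mul' (ENNReal.ofReal_le_ofReal (by nlinarith [sq_nonneg (B - 1)])) le_rfl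
  refine le_trans ?_ hF2
  exact (ENNReal.pow_le_pow_left_iff (two_ne_zero)).1 hlim

end Hardy


/-! ### Coordinate factors and weights in Sobolev norms. -/

section WeightedSobolev

variable {W ρ : Vel → ℝ} (c : Vel) (hW : Smooth W) (hWpos : ∀ v, 0 < W v)
    (hWρ : ∀ j v, partialD j W v = W v * (ρ v * coord c j v)) {c₀ : ℝ} (hc₀ : 0 < c₀)
    (hρ : ∀ v, c₀ ≤ ρ v)

include hW hWpos hWρ hc₀ hρ

/-- A coordinate factor costs one derivative by the Hardy inequality; the induction runs through
∂ᵢ(x_j g) = x_j ∂ᵢg + δᵢⱼ g. -/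
lemma exists_sobW_coord (n : ℕ) : ∃ K : ℝ≥0∞, K ≠ ⊤ ∧ ∀ (j : Fin 3) (g : Vel → ℝ) (Y : ℝ≥0∞),
    Y ≠ ⊤ → SobW W (n + 1) g Y → SobW W n (fun v => coord c j v * g v) (K * Y) := by
  obtain ⟨K₀, hK₀, h0⟩ := exists_hardy c hW hWpos hWρ hc₀ hρ
  have hbase : ∀ n (j : Fin 3) (g : Vel → ℝ) (Y : ℝ≥0∞), Y ≠ ⊤ → SobW W (n + 1) g Y →
      AEStronglyMeasurable (fun v => coord c j v * g v) volume ∧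
      eLpNorm (fun v => W v * (coord c j v * g v)) 2 volume ≤ K₀ * Y := by
    intro n j g Y hY h
    obtain ⟨g', hg, hg'⟩ := h.2 j
    exact ⟨(smooth_coord c j).continuous.aestronglyMeasurable.mul h.1.1,
      h0 j g g' Y hY hg h.1.1 hg'.base.1 h.1.2 hg'.base.2⟩
  induction n with
  | zero => exact ⟨K₀, hK₀, fun j g Y hY h => hbase 0 j g Y hY h⟩
  | succ n ih =>
    obtain ⟨K, hK, h1⟩ := ih
    refine ⟨K₀ + (K + 1), by simp [hK₀, hK], fun j g Y hY h => ?_⟩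
    have hb := hbase _ j g Y hY h
    refine ⟨⟨hb.1, hb.2.trans (by gcongr; exact le_self_add)⟩, fun i => ?_⟩
    obtain ⟨g', hg, hg'⟩ := h.2 i
    refine ⟨_, hg.mul_smooth (smooth_coord c j), ?_⟩
    have h2 := h1 j g' Y hY hg'
    have h3 : SobW W n (fun v => partialD i (coord c j) v * g v) Y := by
      rw [partialD_coord]
      by_cases hij : i = j
      · simpa [hij] using h.of_succ.of_succ
      · have : ∀ m, SobW W m (fun _ => 0) Y := fun m => by
          induction m with
          | zero => simp [SobW, aestronglyMeasurable_const]
          | succ m ihm =>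
            refine ⟨by simp [aestronglyMeasurable_const], fun k => ⟨fun _ => 0, ?_, ihm⟩⟩
            exact ⟨locallyIntegrable_zero, locallyIntegrable_zero, by simp⟩
        simpa [hij] using this n
    refine (SobW.add hW.continuous h2 h3).mono ?_
    rw [add_mul, add_mul, one_mul]
    exact le_add_self

/-- ∂ᵢ(W g) = W (∂ᵢg + ρ xᵢ g). The factor xᵢ costs one derivative, which is available because only
the order n is needed for the bracket. -/
lemma exists_sobW_weight (n : ℕ) (hρs : Smooth ρ) (hρB : ∀ n, ∃ B, DerivBdd (fun _ => 1) n ρ B) :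
    ∃ K : ℝ≥0∞, K ≠ ⊤ ∧ ∀ (g : Vel → ℝ) (Y : ℝ≥0∞),
      Y ≠ ⊤ → SobW W n g Y → SobW (fun _ => 1) n (fun v => W v * g v) (K * Y) := by
  have hbase : ∀ n (g : Vel → ℝ) (Y : ℝ≥0∞), SobW W n g Y →
      AEStronglyMeasurable (fun v => W v * g v) volume ∧
      eLpNorm (fun v => 1 * (W v * g v)) 2 volume ≤ Y := by
    intro n g Y h
    simp only [one_mul]
    exact ⟨hW.continuous.aestronglyMeasurable.mul h.base.1, h.base.2⟩
  induction n with
  | zero => exact ⟨1, by simp, fun g Y _ h => by rw [one_mul]; exact hbase 0 g Y h⟩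
  | succ n ih =>
    obtain ⟨K, hK, h1⟩ := ih
    obtain ⟨K₁, hK₁, h2⟩ := exists_sobW_coord c hW hWpos hWρ hc₀ hρ n
    obtain ⟨B, hB⟩ := hρB n
    set M := 2 ^ n * ENNReal.ofReal B * K₁ with hM
    have hMt : M ≠ ⊤ := by simp [hM, ENNReal.mul_eq_top, hK₁]
    refine ⟨1 + K * (1 + M), by simp [ENNReal.mul_eq_top, hK, hMt], fun g Y hY h => ?_⟩
    have hb := hbase _ g Y h
    refine ⟨⟨hb.1, hb.2.trans (by rw [add_mul, one_mul]; exact le_self_add)⟩, fun i => ?_⟩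
    obtain ⟨g', hg, hg'⟩ := h.2 i
    have h3 := (h2 i g Y hY h).mul hρs hB hW.continuous
    have h4 := SobW.add hW.continuous hg' h3
    have h5 := h1 _ _ (by simp [ENNReal.mul_eq_top, hY, hK₁]) h4
    refine ⟨_, hg.mul_smooth hW, ?_⟩
    have e : (fun v => W v * g' v + partialD i W v * g v) =
        fun v => W v * (g' v + ρ v * (coord c i v * g v)) := by
      ext v; rw [hWρ]; ring
    rw [e]
    refine h5.mono ?_
    have : K * (Y + 2 ^ n * ENNReal.ofReal B * (K₁ * Y)) = K * (1 + M) * Y := by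
      rw [hM]; ring
    rw [this, add_mul]
    exact le_add_self

end WeightedSobolev

/-! ### Multi-index derivatives versus iterated first order derivatives. -/

section MultiIndex

lemma partialD_comm {φ : Vel → ℝ} (hφ : Smooth φ) (i j : Fin 3) :
    partialD i (partialD j φ) = partialD j (partialD i φ) := by
  have hd : ∀ (k l : Fin 3) v, partialD k (partialD l φ) v =
      fderiv ℝ (fderiv ℝ φ) v (stdE k) (stdE l) := by
    intro k l v
    have h1 : DifferentiableAt ℝ (fderiv ℝ φ) v := by
      have : ContDiff ℝ 1 (fderiv ℝ φ) := hφ.fderiv_right (by norm_cast)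
      exact (this.differentiable (by norm_num)) v
    have h2 : HasFDerivAt (partialD l φ)
        ((ContinuousLinearMap.apply ℝ ℝ (stdE l)).comp (fderiv ℝ (fderiv ℝ φ) v)) v :=
      (ContinuousLinearMap.apply ℝ ℝ (stdE l)).hasFDerivAt.comp v h1.hasFDerivAt
    rw [partialD, h2.fderiv]
    rfl
  ext v
  rw [hd, hd]
  exact (hφ.contDiffAt.isSymmSndFDerivAt (by
    simp only [minSmoothness_of_isRCLikeNormedField]
    exact WithTop.coe_le_coe.2 (le_top : (2 : ℕ∞) ≤ ⊤))).eq _ _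

lemma Smooth.iterate_pd {φ : Vel → ℝ} (hφ : Smooth φ) (i : Fin 3) (k : ℕ) :
    Smooth ((partialD i)^[k] φ) := by
  induction k with
  | zero => exact hφ
  | succ k ih => rw [Function.iterate_succ_apply']; exact ih.pd i

lemma HasCompactSupport.iterate_pd {φ : Vel → ℝ} (hφ : HasCompactSupport φ) (i : Fin 3) (k : ℕ) :
    HasCompactSupport ((partialD i)^[k] φ) := by
  induction k with
  | zero => exact hφ
  | succ k ih => rw [Function.iterate_succ_apply']; exact hasCompactSupport_partialD ih i

lemma iterate_partialD_comm {φ : Vel → ℝ} (hφ : Smooth φ) (i j : Fin 3) (k : ℕ) :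
    (partialD i)^[k] (partialD j φ) = partialD j ((partialD i)^[k] φ) := by
  induction k with
  | zero => rfl
  | succ k ih =>
    rw [Function.iterate_succ_apply', ih, Function.iterate_succ_apply',
      partialD_comm (hφ.iterate_pd i k)]

lemma multiD_partialD {φ : Vel → ℝ} (hφ : Smooth φ) (α : Fin 3 → ℕ) (i : Fin 3) :
    multiD α (partialD i φ) = multiD (α + Pi.single i 1) φ := by
  have h2 := hφ.iterate_pd 2 (α 2)
  have h1 := h2.iterate_pd 1 (α 1)
  unfold multiD
  fin_cases i
  · simp only [Fin.zero_eta, Pi.add_apply, Pi.single_eq_same, iterate_partialD_comm hφ,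
      iterate_partialD_comm h2, Function.iterate_succ_apply]
    simp [iterate_partialD_comm h1]
  · simp only [Fin.mk_one, Pi.add_apply, Pi.single_eq_same, Function.iterate_succ_apply]
    simp [iterate_partialD_comm hφ, iterate_partialD_comm h2]
  · simp only [Fin.reduceFinMk, Pi.add_apply, Pi.single_eq_same, Function.iterate_succ_apply]
    simp [iterate_partialD_comm hφ, iterate_partialD_comm h2]

/-- A family of weak derivatives indexed by multi-indices is a chain of first order weak
derivatives. -/
lemma IsWeakDeriv.wder {α : Fin 3 → ℕ} {i : Fin 3} {f fα fβ : Vel → ℝ}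
    (h : IsWeakDeriv α f fα) (h' : IsWeakDeriv (α + Pi.single i 1) f fβ) : WDer i fα fβ := by
  refine ⟨h.2.1, h'.2.1, fun φ hφ hc => ?_⟩
  have h1 := h.2.2 (partialD i φ) (hφ.pd i) (hasCompactSupport_partialD hc i)
  have h2 := h'.2.2 φ hφ hc
  rw [multiD_partialD hφ, h2] at h1
  have h3 : ∑ j, (α + Pi.single i 1 : Fin 3 → ℕ) j = (∑ j, α j) + 1 := by
    simp [Finset.sum_add_distrib]
  rw [h3, pow_succ] at h1
  have h4 : (-1 : ℝ) ^ (∑ j, α j) ≠ 0 := by simp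
  apply mul_left_cancel₀ h4
  linarith

lemma mem_multiIdx {N : ℕ} {α : Fin 3 → ℕ} : α ∈ multiIdx N ↔ ∑ i, α i ≤ N := by
  simp only [multiIdx, Finset.mem_filter, Fintype.mem_piFinset, Finset.mem_range]
  refine ⟨fun h => h.2, fun h => ⟨fun i => ?_, h⟩⟩
  have := Finset.single_le_sum (f := α) (fun j _ => Nat.zero_le _) (Finset.mem_univ i)
  omega

/-- From a family of multi-index derivatives to iterated first order derivatives. -/
lemma sobW_of_isWeakDeriv {N : ℕ} {W g : Vel → ℝ} {dg : (Fin 3 → ℕ) → Vel → ℝ} {Y : ℝ≥0∞}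
    (h : ∀ α ∈ multiIdx N, IsWeakDeriv α g (dg α))
    (hY : ∀ α ∈ multiIdx N, eLpNorm (fun v => W v * dg α v) 2 volume ≤ Y) :
    SobW W N g Y := by
  have key : ∀ (n : ℕ) (α : Fin 3 → ℕ), (∑ i, α i) + n ≤ N → SobW W n (dg α) Y := by
    intro n
    induction n with
    | zero =>
      intro α hα
      have hm : α ∈ multiIdx N := mem_multiIdx.2 (by omega)
      exact ⟨(h α hm).2.1.aestronglyMeasurable, hY α hm⟩
    | succ n ih =>
      intro α hα
      have hm : α ∈ multiIdx N := mem_multiIdx.2 (by omega)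
      refine ⟨⟨(h α hm).2.1.aestronglyMeasurable, hY α hm⟩, fun i => ?_⟩
      have hs : ∑ j, (α + Pi.single i 1 : Fin 3 → ℕ) j = (∑ j, α j) + 1 := by
        simp [Finset.sum_add_distrib]
      have hm' : α + Pi.single i 1 ∈ multiIdx N := mem_multiIdx.2 (by omega)
      exact ⟨_, (h α hm).wder (h _ hm'), ih _ (by omega)⟩
  have h0 : (0 : Fin 3 → ℕ) ∈ multiIdx N := mem_multiIdx.2 (by simp)
  have hw := h 0 h0
  -- The family is not assumed to start with g; its member of order zero agrees with g only almost
  -- everywhere.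
  have hae : dg 0 =ᵐ[volume] g := by
    refine Filter.EventuallyEq.symm (f := g)
      (ae_eq_of_integral_contDiff_smul_eq hw.1 hw.2.1 fun φ hφ hc => ?_)
    have := hw.2.2 φ hφ hc
    simpa [multiD, mul_comm] using this
  have h1 := key N 0 (by simp)
  have hcongr : ∀ n, SobW W n (dg 0) Y → SobW W n g Y := by
    intro n hn
    have hb : AEStronglyMeasurable g volume ∧ eLpNorm (fun v => W v * g v) 2 volume ≤ Y := by
      refine ⟨hn.base.1.congr hae, ?_⟩
      rw [← eLpNorm_congr_ae (hae.mono fun v hv => by simp only [hv] :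
        (fun v => W v * dg 0 v) =ᵐ[volume] fun v => W v * g v)]
      exact hn.base.2
    cases n with
    | zero => exact hb
    | succ n => exact ⟨hb, fun i => (hn.2 i).imp fun f' h' => ⟨h'.1.congr hae .rfl, h'.2⟩⟩
  exact hcongr N h1

/-- From iterated first order derivatives to a family of multi-index derivatives. -/
lemma SobW.exists_isWeakDeriv {N : ℕ} {f : Vel → ℝ} {Y : ℝ≥0∞}
    (h : SobW (fun _ => 1) N f Y) (hY : Y ≠ ⊤) {α : Fin 3 → ℕ} (hα : α ∈ multiIdx N) :
    ∃ f', IsWeakDeriv α f f' ∧ MemLp f' 2 volume ∧ eLpNorm f' 2 volume ≤ Y := by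
  have hchain : ∀ (i : Fin 3) (k n : ℕ) (f : Vel → ℝ), SobW (fun _ => 1) (n + k) f Y →
      ∃ f', SobW (fun _ => 1) n f' Y ∧ LocallyIntegrable f volume ∧
        LocallyIntegrable f' volume ∧ ∀ φ, Smooth φ → HasCompactSupport φ →
        ∫ v, f v * (partialD i)^[k] φ v = (-1) ^ k * ∫ v, f' v * φ v := by
    intro i k
    induction k with
    | zero =>
      intro n f hf
      have hb := hf.base
      simp only [one_mul] at hb
      have hm : MemLp f 2 volume := ⟨hb.1, hb.2.trans_lt hY.lt_top⟩
      exact ⟨f, hf, hm.locallyIntegrable (by norm_num), hm.locallyIntegrable (by norm_num),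
        by simp⟩
    | succ k ih =>
      intro n f hf
      obtain ⟨f₁, hf₁, hs⟩ := hf.2 i
      obtain ⟨f', hf', -, l2, h3⟩ := ih n f₁ hs
      refine ⟨f', hf', hf₁.1, l2, fun φ hφ hc => ?_⟩
      rw [Function.iterate_succ_apply', hf₁.2.2 _ (hφ.iterate_pd i k)
        (HasCompactSupport.iterate_pd hc i k), h3 φ hφ hc]
      ring
  rw [mem_multiIdx, Fin.sum_univ_three] at hα
  -- In `multiD` the derivatives in direction 0 are outermost, so they are the first to be moved off
  -- the test function. Each chain leaves the orders needed by the next ones.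
  obtain ⟨f₀, hf₀, l0, -, e0⟩ := hchain 0 (α 0) (α 1 + α 2 + (N - (α 0 + α 1 + α 2))) f
    (by convert! h using 1; omega)
  obtain ⟨f₁, hf₁, l1, -, e1⟩ := hchain 1 (α 1) (α 2 + (N - (α 0 + α 1 + α 2))) f₀
    (by convert! hf₀ using 1; omega)
  obtain ⟨f₂, hf₂, -, l2, e2⟩ := hchain 2 (α 2) (N - (α 0 + α 1 + α 2)) f₁
    (by convert! hf₁ using 1; omega)
  have hb := hf₂.base
  simp only [one_mul] at hb
  refine ⟨f₂, ⟨l0, l2, fun φ hφ hc => ?_⟩, ⟨hb.1, hb.2.trans_lt hY.lt_top⟩, hb.2⟩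
  have s2 := Smooth.iterate_pd hφ 2 (α 2)
  have c2 := HasCompactSupport.iterate_pd hc 2 (α 2)
  have s1 := s2.iterate_pd 1 (α 1)
  have c1 := HasCompactSupport.iterate_pd c2 1 (α 1)
  rw [multiD, e0 _ s1 c1, e1 _ s2 c2, e2 φ hφ hc, Fin.sum_univ_three, pow_add, pow_add]
  ring

end MultiIndex


/-! ### Polar coordinates. -/

/-- The surface measure on the unit sphere. -/
noncomputable abbrev sphereM : Measure S2 := (volume : Measure Vel).toSphere

section Polar

lemma lintegral_polar {f : Vel → ℝ≥0∞} (hf : Measurable f) :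
    ∫⁻ z, f z = ∫⁻ ω : S2, ∫⁻ r in Set.Ioi (0 : ℝ), ENNReal.ofReal (r ^ 2) * f (r • (ω : Vel))
      ∂volume ∂sphereM := by
  have h := (volume : Measure Vel).measurePreserving_homeomorphUnitSphereProd
  have e1 : ∫⁻ z, f z = ∫⁻ x : ({(0)}ᶜ : Set Vel), f x ∂((volume : Measure Vel).comap (↑)) := by
    rw [lintegral_subtype_comap (measurableSet_singleton _).compl, restrict_compl_singleton]
  have e2 : ∫⁻ x : ({(0)}ᶜ : Set Vel), f x ∂((volume : Measure Vel).comap (↑)) =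
      ∫⁻ p : S2 × Set.Ioi (0 : ℝ), f ((p.2 : ℝ) • (p.1 : Vel))
        ∂(sphereM.prod (Measure.volumeIoiPow 2)) := by
    have h2 := h.lintegral_comp_emb (Homeomorph.measurableEmbedding _)
      (fun p : S2 × Set.Ioi (0 : ℝ) => f ((p.2 : ℝ) • (p.1 : Vel)))
    have hd : Module.finrank ℝ Vel - 1 = 2 := by simp
    rw [hd] at h2
    rw [← h2]
    refine lintegral_congr fun x => ?_
    congr 1
    have hx : (x : Vel) ≠ 0 := x.2
    simp [smul_inv_smul₀ (norm_ne_zero_iff.2 hx)]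
  rw [e1, e2, lintegral_prod _ (by fun_prop)]
  refine lintegral_congr fun ω => ?_
  rw [Measure.volumeIoiPow, lintegral_withDensity_eq_lintegral_mul _ (by fun_prop) (by fun_prop),
    ← lintegral_subtype_comap measurableSet_Ioi]
  rfl

lemma integral_polar {f : Vel → ℝ} (hf : Integrable f volume) :
    ∫ z, f z = ∫ ω : S2, ∫ r in Set.Ioi (0 : ℝ), r ^ 2 * f (r • (ω : Vel)) ∂volume ∂sphereM := by
  have h := (volume : Measure Vel).measurePreserving_homeomorphUnitSphereProd
  have hd : Module.finrank ℝ Vel - 1 = 2 := by simp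
  rw [hd] at h
  have e1 : ∫ z, f z = ∫ x : ({(0)}ᶜ : Set Vel), f x ∂((volume : Measure Vel).comap (↑)) := by
    rw [integral_subtype_comap (measurableSet_singleton _).compl, restrict_compl_singleton]
  have e0 : ∀ x : ({(0)}ᶜ : Set Vel), f x = f ((((homeomorphUnitSphereProd Vel) x).2 : ℝ) •
      ((((homeomorphUnitSphereProd Vel) x).1 : S2) : Vel)) := fun x => by
    have hx : (x : Vel) ≠ 0 := x.2
    simp [smul_inv_smul₀ (norm_ne_zero_iff.2 hx)]
  have e2 : ∫ x : ({(0)}ᶜ : Set Vel), f x ∂((volume : Measure Vel).comap (↑)) =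
      ∫ p : S2 × Set.Ioi (0 : ℝ), f ((p.2 : ℝ) • (p.1 : Vel))
        ∂(sphereM.prod (Measure.volumeIoiPow 2)) := by
    rw [← h.integral_comp (Homeomorph.measurableEmbedding _)
      (fun p : S2 × Set.Ioi (0 : ℝ) => f ((p.2 : ℝ) • (p.1 : Vel)))]
    exact integral_congr_ae (.of_forall e0)
  have hi : Integrable (fun p : S2 × Set.Ioi (0 : ℝ) => f ((p.2 : ℝ) • (p.1 : Vel)))
      (sphereM.prod (Measure.volumeIoiPow 2)) := by
    rw [← h.integrable_comp_emb (Homeomorph.measurableEmbedding _)]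
    have : Integrable (fun x : ({(0)}ᶜ : Set Vel) => f x) ((volume : Measure Vel).comap (↑)) := by
      have h3 : IntegrableOn f ({(0)}ᶜ : Set Vel) volume := hf.integrableOn
      exact (integrableOn_iff_comap_subtypeVal (measurableSet_singleton _).compl).1 h3
    exact this.congr (.of_forall e0)
  rw [e1, e2, integral_prod _ hi]
  refine integral_congr_ae (.of_forall fun ω => ?_)
  simp only [Measure.volumeIoiPow, ENNReal.ofReal]
  rw [integral_withDensity_eq_integral_smul (by fun_prop),
    integral_subtype_comap measurableSet_Ioi
      (fun a : ℝ => Real.toNNReal (a ^ 2) • f (a • (ω : Vel)))]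
  refine setIntegral_congr_fun measurableSet_Ioi fun x hx => ?_
  simp only [NNReal.smul_def, Real.coe_toNNReal _ (sq_nonneg x), smul_eq_mul]

end Polar

/-! ### A Green type representation of test functions. -/

section SobolevEmbedding

/-- The radial kernel `e^{-|z|}/|z|`. -/
noncomputable def kerY (z : Vel) : ℝ := Real.exp (-‖z‖) / ‖z‖

/-- The components of the unit vector `z/|z|`. -/
noncomputable def unitC (i : Fin 3) (z : Vel) : ℝ := z i / ‖z‖

lemma abs_coord_le (z : Vel) (i : Fin 3) : |z i| ≤ ‖z‖ := by
  simpa using PiLp.norm_apply_le z i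

lemma abs_unitC_le (i : Fin 3) (z : Vel) : |unitC i z| ≤ 1 := by
  rw [unitC, abs_div, abs_norm]
  exact div_le_one_of_le₀ (abs_coord_le z i) (norm_nonneg _)

lemma measurable_coordinate (i : Fin 3) : Measurable fun z : Vel => z i :=
  ((EuclideanSpace.proj i : Vel →L[ℝ] ℝ).continuous).measurable

lemma measurable_unitC (i : Fin 3) : Measurable (unitC i) := by
  unfold unitC
  exact (measurable_coordinate i).div measurable_norm

lemma measurable_kerY : Measurable kerY := by
  unfold kerY; fun_prop

/-- In polar coordinates r² (e^{-r}/r)² = e^{-2r}: in dimension three the volume factor cancels the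
singularity exactly. -/
lemma memLp_kerY : MemLp kerY 2 (volume : Measure Vel) := by
  rw [memLp_two_iff_integrable_sq measurable_kerY.aestronglyMeasurable]
  have h := (integrable_fun_norm_addHaar (volume : Measure Vel)
    (f := fun r : ℝ => (Real.exp (-r) / r) ^ 2)).2 ?_
  · exact h
  · have h1 : IntegrableOn (fun r : ℝ => Real.exp (-2 * r)) (Set.Ioi 0) :=
      integrableOn_exp_mul_Ioi (by norm_num) 0
    refine h1.congr_fun (fun r hr => ?_) measurableSet_Ioi
    have hr0 : r ≠ 0 := (Set.mem_Ioi.1 hr).ne'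
    simp only [finrank_euclideanSpace_fin, smul_eq_mul, div_pow, ← Real.exp_nat_mul]
    field_simp
    ring_nf

lemma memLp_kerY_mul {a : Vel → ℝ} (ha : Measurable a) (hb : ∀ z, |a z| ≤ 1) :
    MemLp (fun z => a z * kerY z) 2 (volume : Measure Vel) := by
  refine ⟨(ha.mul measurable_kerY).aestronglyMeasurable, ?_⟩
  exact (eLpNorm_mul_le (C := 1) (.of_forall hb) 2).trans_lt
    (ENNReal.mul_lt_top ENNReal.ofReal_lt_top memLp_kerY.2)

/-- Second order representation of a test function by a Green type kernel. -/
lemma green_identity {φ : Vel → ℝ} (hφ : Smooth φ) (hc : HasCompactSupport φ) (w : Vel)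
    (hi : Integrable (fun z => kerY z * (φ (w + z) - 2 * ∑ i, unitC i z * partialD i φ (w + z) +
      ∑ i, ∑ j, unitC i z * unitC j z * partialD j (partialD i φ) (w + z))) volume) :
    ∫ z, kerY z * (φ (w + z) - 2 * ∑ i, unitC i z * partialD i φ (w + z) +
      ∑ i, ∑ j, unitC i z * unitC j z * partialD j (partialD i φ) (w + z)) =
      sphereM.real Set.univ * φ w := by
  rw [integral_polar hi]
  have key : ∀ ω : S2, ∫ r in Set.Ioi (0 : ℝ), r ^ 2 * (kerY (r • (ω : Vel)) *
      (φ (w + r • (ω : Vel)) - 2 * ∑ i, unitC i (r • (ω : Vel)) * partialD i φ (w + r • (ω : Vel)) +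
      ∑ i, ∑ j, unitC i (r • (ω : Vel)) * unitC j (r • (ω : Vel)) *
        partialD j (partialD i φ) (w + r • (ω : Vel)))) = φ w := by
    intro ω
    have hω : ‖(ω : Vel)‖ = 1 := by simp
    have hder : ∀ {u : Vel → ℝ}, Smooth u → ∀ r : ℝ, HasDerivAt (fun r : ℝ => u (w + r • (ω : Vel)))
        (∑ i, (ω : Vel) i * partialD i u (w + r • (ω : Vel))) r := by
      intro u hu r
      have h1 : HasDerivAt (fun r : ℝ => w + r • (ω : Vel)) (ω : Vel) r := by
        simpa using ((hasDerivAt_id r).smul_const (ω : Vel)).const_add w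
      have h2 := (hu.differentiable (w + r • (ω : Vel))).hasFDerivAt.comp_hasDerivAt r h1
      convert! h2 using 1
      have h3 : (ω : Vel) = ∑ i, (ω : Vel) i • stdE i := by
        ext j
        simp [Finset.sum_apply, Pi.single_apply]
      have h4 : ∀ L : Vel →L[ℝ] ℝ, L (ω : Vel) = ∑ i, (ω : Vel) i * L (stdE i) := fun L => by
        conv_lhs => rw [h3, map_sum]
        simp
      rw [h4]
      rfl
    set γ : ℝ → ℝ := fun r => φ (w + r • (ω : Vel)) with hγ
    set γ₁ : ℝ → ℝ := fun r => ∑ i, (ω : Vel) i * partialD i φ (w + r • (ω : Vel)) with hγ₁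
    set γ₂ : ℝ → ℝ := fun r => ∑ i, (ω : Vel) i * ∑ j, (ω : Vel) j *
      partialD j (partialD i φ) (w + r • (ω : Vel)) with hγ₂
    have d0 : ∀ r, HasDerivAt γ (γ₁ r) r := hder hφ
    have d1 : ∀ r, HasDerivAt γ₁ (γ₂ r) r := fun r =>
      HasDerivAt.fun_sum fun i _ => (hder (hφ.pd i) r).const_mul _
    have hcl : Continuous fun r : ℝ => w + r • (ω : Vel) := by fun_prop
    have hsupp : ∀ {u : Vel → ℝ}, HasCompactSupport u → ∃ R : ℝ, ∀ r, R < r →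
        u (w + r • (ω : Vel)) = 0 := by
      intro u hu
      obtain ⟨R, hR⟩ := hu.isCompact.isBounded.subset_closedBall (0 : Vel)
      refine ⟨R + ‖w‖, fun r hr => ?_⟩
      by_contra hne
      have h1 := hR (subset_tsupport u hne)
      rw [mem_closedBall_zero_iff] at h1
      have h2 : ‖r • (ω : Vel)‖ ≤ ‖w + r • (ω : Vel)‖ + ‖w‖ := by
        have := norm_sub_le (w + r • (ω : Vel)) w
        simpa using this
      rw [norm_smul, hω, mul_one, Real.norm_eq_abs] at h2
      linarith [le_abs_self r]
    -- P is an explicit primitive of r e^{-r}(γ − 2γ' + γ''). It vanishes for large r, and the only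
    -- boundary term is −P(0) = γ(0) = φ(w).
    set P : ℝ → ℝ := fun r => r * (Real.exp (-r) * (γ₁ r - γ r)) - Real.exp (-r) * γ r with hP
    set p : ℝ → ℝ := fun r => r * (Real.exp (-r) * (γ r - 2 * γ₁ r + γ₂ r)) with hp
    have dP : ∀ r, HasDerivAt P (p r) r := by
      intro r
      have he : HasDerivAt (fun r : ℝ => Real.exp (-r)) (-Real.exp (-r)) r := by
        simpa using (hasDerivAt_id r).neg.exp
      have := ((hasDerivAt_id r).mul (he.mul ((d1 r).sub (d0 r)))).sub (he.mul (d0 r))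
      refine this.congr_deriv ?_
      simp only [hp, id, Pi.mul_apply, Pi.sub_apply]
      ring
    have z0 := hsupp hc
    have z1 := fun i => hsupp (hasCompactSupport_partialD hc i)
    have z2 := fun i j => hsupp (hasCompactSupport_partialD (hasCompactSupport_partialD hc i) j)
    obtain ⟨R0, hR0⟩ := z0
    choose R1 hR1 using z1
    choose R2 hR2 using z2
    have hev : ∀ᶠ r in Filter.atTop, γ r = 0 ∧ γ₁ r = 0 ∧ γ₂ r = 0 := by
      have e1 : ∀ᶠ r : ℝ in Filter.atTop, ∀ i, R1 i < r :=
        Filter.eventually_all.2 fun i => Filter.eventually_gt_atTop _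
      have e2 : ∀ᶠ r : ℝ in Filter.atTop, ∀ i j, R2 i j < r :=
        Filter.eventually_all.2 fun i => Filter.eventually_all.2 fun j =>
          Filter.eventually_gt_atTop _
      filter_upwards [Filter.eventually_gt_atTop R0, e1, e2] with r h0 h1 h2
      refine ⟨hR0 r h0, ?_, ?_⟩
      · simp only [hγ₁]
        exact Finset.sum_eq_zero fun i _ => by rw [hR1 i r (h1 i), mul_zero]
      · simp only [hγ₂]
        exact Finset.sum_eq_zero fun i _ => by
          rw [Finset.sum_eq_zero fun j _ => by rw [hR2 i j r (h2 i j), mul_zero], mul_zero]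
    have hlim : Filter.Tendsto P Filter.atTop (nhds 0) := by
      refine tendsto_const_nhds.congr' (hev.mono fun r hr => ?_)
      simp [hP, hr.1, hr.2.1]
    have hpc : Continuous p := by
      have c0 : Continuous γ := hφ.continuous.comp hcl
      have c1 : Continuous γ₁ := continuous_finsetSum _ fun i _ =>
        continuous_const.mul ((hφ.pd i).continuous.comp hcl)
      have c2 : Continuous γ₂ := continuous_finsetSum _ fun i _ =>
        continuous_const.mul (continuous_finsetSum _ fun j _ =>
          continuous_const.mul (((hφ.pd i).pd j).continuous.comp hcl))
      fun_prop
    have hpi : IntegrableOn p (Set.Ioi 0) := by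
      obtain ⟨R, hR⟩ := Filter.eventually_atTop.1 hev
      have h1 : IntegrableOn p (Set.Icc 0 (|R|)) := hpc.integrableOn_Icc
      have h2 : IntegrableOn p (Set.Ioi |R|) := by
        refine IntegrableOn.congr_fun (f := fun _ => 0) integrableOn_zero (fun r hr => ?_)
          measurableSet_Ioi
        have := hR r ((le_abs_self R).trans (Set.mem_Ioi.1 hr).le)
        simp [hp, this.1, this.2.1, this.2.2]
      refine (h1.union h2).mono_set fun r hr => ?_
      rcases le_or_gt r |R| with h | h
      · exact Or.inl ⟨(Set.mem_Ioi.1 hr).le, h⟩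
      · exact Or.inr h
    have hft := integral_Ioi_of_hasDerivAt_of_tendsto' (fun r _ => dP r) hpi hlim
    have e3 : (0 : ℝ) - P 0 = φ w := by simp [hP, hγ]
    rw [← e3, ← hft]
    refine setIntegral_congr_fun measurableSet_Ioi fun r hr => ?_
    have hr0 : 0 < r := hr
    have hn : ‖r • (ω : Vel)‖ = r := by rw [norm_smul, hω, mul_one, Real.norm_of_nonneg hr0.le]
    have hu : ∀ i, unitC i (r • (ω : Vel)) = (ω : Vel) i := fun i => by
      rw [unitC, hn]; simp; field_simp
    simp only [hu, kerY, hn, hp, hγ, hγ₁, hγ₂, Finset.mul_sum, mul_assoc]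
    field_simp
  simp_rw [key]
  simp

end SobolevEmbedding


/-! ### Correlations of L² functions and their pairing with test functions. -/

section Correlation

/-- For each v, Cauchy–Schwarz and translation invariance bound the inner integral by ‖k‖ ‖G‖
|φ(v)|. This justifies the exchanges of integrals below. -/
lemma integrable_corr (k G : L2V) {φ : Vel → ℝ} (hφ : Continuous φ) (hc : HasCompactSupport φ) :
    Integrable (fun p : Vel × Vel => k p.2 * G (p.2 + p.1) * φ p.1) (volume.prod volume) := by
  have mk := (Lp.stronglyMeasurable k).measurable
  have mG := (Lp.stronglyMeasurable G).measurable
  have hm : Measurable fun p : Vel × Vel => k p.2 * G (p.2 + p.1) * φ p.1 :=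
    ((mk.comp measurable_snd).mul (mG.comp (measurable_snd.add measurable_fst))).mul
      (hφ.measurable.comp measurable_fst)
  have hL : ∀ v : Vel, MemLp (fun z => G (z + v)) 2 volume := fun v =>
    (Lp.memLp G).comp_measurePreserving (measurePreserving_add_right volume v)
  rw [integrable_prod_iff hm.aestronglyMeasurable]
  refine ⟨.of_forall fun v => ((Lp.memLp k).integrable_mul (hL v)).mul_const (φ v), ?_⟩
  have hbd : ∀ v, ∫ z, ‖k z * G (z + v) * φ v‖ ≤ ‖k‖ * ‖G‖ * |φ v| := by
    intro v
    simp only [norm_mul, Real.norm_eq_abs]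
    rw [integral_mul_const]
    gcongr
    have h1 : ∫ z, |k z| * |G (z + v)| = inner ℝ |k| (transl v |G|) := by
      rw [L2.inner_def]
      have h2 := (measurePreserving_add_right (volume : Measure Vel) v).quasiMeasurePreserving.ae
        (Lp.coeFn_abs G)
      refine integral_congr_ae ?_
      filter_upwards [Lp.coeFn_abs k, transl_ae v |G|, h2] with z a1 a2 a3
      simp only [RCLike.inner_apply, conj_trivial]
      rw [a1, a2, a3]; ring
    rw [h1]
    refine (real_inner_le_norm _ _).trans_eq ?_
    rw [norm_transl, norm_abs_eq_norm, norm_abs_eq_norm]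
  refine Integrable.mono' ((hφ.abs.integrable_of_hasCompactSupport hc.abs).const_mul (‖k‖ * ‖G‖))
    hm.norm.aestronglyMeasurable.integral_prod_right' (.of_forall fun v => ?_)
  rw [Real.norm_of_nonneg (integral_nonneg fun z => norm_nonneg _)]
  exact hbd v

lemma inner_transl_eq (k G : L2V) (v : Vel) :
    inner ℝ k (transl v G) = ∫ z, k z * G (z + v) := by
  rw [L2.inner_def]
  refine integral_congr_ae ((transl_ae v G).mono fun z hz => ?_)
  simp only [RCLike.inner_apply, conj_trivial]
  rw [hz, mul_comm]

lemma integral_corr_eq (k G : L2V) {φ : Vel → ℝ} (hφ : Continuous φ) (hc : HasCompactSupport φ) :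
    ∫ v, inner ℝ k (transl v G) * φ v = ∫ z, k z * ∫ w, G w * φ (w - z) := by
  have h := integral_integral_swap (f := fun v z => k z * G (z + v) * φ v)
    (integrable_corr k G hφ hc)
  simp only [inner_transl_eq, ← integral_mul_const]
  rw [h]
  refine integral_congr_ae (.of_forall fun z => ?_)
  simp only [mul_assoc]
  rw [integral_const_mul, ← integral_add_left_eq_self (fun w => G w * φ (w - z)) z]
  simp

lemma integrable_corr_shear (k G : L2V) {φ : Vel → ℝ} (hφ : Continuous φ)
    (hc : HasCompactSupport φ) :
    Integrable (fun p : Vel × Vel => k (p.2 - p.1) * G p.2 * φ p.1) (volume.prod volume) := by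
  have h := (measurePreserving_prod_add (volume : Measure Vel) volume).integrable_comp_emb
    (MeasurableEquiv.shearAddRight Vel).measurableEmbedding
    (g := fun p : Vel × Vel => k (p.2 - p.1) * G p.2 * φ p.1)
  refine h.1 ?_
  convert! integrable_corr k G hφ hc using 1
  ext p
  simp [add_comm]

lemma conv_eq (k : L2V) (φ : Vel → ℝ) (w : Vel) :
    ∫ v, k (w - v) * φ v = ∫ z, k z * φ (w - z) := by
  rw [← integral_sub_left_eq_self (fun z => k z * φ (w - z)) volume w]
  simp

lemma integrable_mul_conv (k G : L2V) {φ : Vel → ℝ} (hφ : Continuous φ)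
    (hc : HasCompactSupport φ) : Integrable (fun w => G w * ∫ z, k z * φ (w - z)) volume := by
  refine (integrable_corr_shear k G hφ hc).integral_prod_right.congr (.of_forall fun w => ?_)
  simp only
  rw [← conv_eq, ← integral_const_mul]
  exact integral_congr_ae (.of_forall fun v => by ring)

lemma integral_corr_eq' (k G : L2V) {φ : Vel → ℝ} (hφ : Continuous φ) (hc : HasCompactSupport φ) :
    ∫ z, k z * ∫ w, G w * φ (w - z) = ∫ w, G w * ∫ z, k z * φ (w - z) := by
  rw [← integral_corr_eq k G hφ hc]
  have h := integral_integral_swap (f := fun v w => k (w - v) * G w * φ v)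
    (integrable_corr_shear k G hφ hc)
  have e : ∀ v, inner ℝ k (transl v G) * φ v = ∫ w, k (w - v) * G w * φ v := fun v => by
    rw [inner_transl_eq, integral_mul_const,
      ← integral_add_right_eq_self (fun w => k (w - v) * G w) v]
    simp
  simp only [e]
  rw [h]
  refine integral_congr_ae (.of_forall fun w => ?_)
  simp only
  rw [← conv_eq, ← integral_const_mul]
  exact integral_congr_ae (.of_forall fun v => by ring)

/-- The derivative is moved from G to φ separately for each z, so no regularity of k is used. -/
lemma WDer.integral_conv {i : Fin 3} {G G' : L2V} (h : WDer i G G') (k : L2V) {φ : Vel → ℝ}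
    (hφ : Smooth φ) (hc : HasCompactSupport φ) :
    ∫ w, G' w * ∫ z, k z * φ (w - z) = -∫ w, G w * ∫ z, k z * partialD i φ (w - z) := by
  rw [← integral_corr_eq' k G' hφ.continuous hc,
    ← integral_corr_eq' k G (hφ.pd i).continuous (hasCompactSupport_partialD hc i), ← integral_neg]
  refine integral_congr_ae (.of_forall fun z => ?_)
  have h1 := h.2.2 (fun w => φ (w + -z)) (hφ.comp_add _) (HasCompactSupport.comp_add_const hc _)
  rw [partialD_comp_add] at h1
  simp only [← sub_eq_add_neg] at h1
  simp only [h1]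
  ring

lemma integral_inner_transl_mul (k G : L2V) {φ : Vel → ℝ} (hφ : Smooth φ)
    (hc : HasCompactSupport φ) :
    ∫ v, inner ℝ k (transl v G) * φ v = ∫ w, G w * ∫ z, k z * φ (w - z) := by
  rw [integral_corr_eq k G hφ.continuous hc, integral_corr_eq' k G hφ.continuous hc]

end Correlation

/-! ### The Sobolev embedding by duality with the representation formula. -/

section SobolevEmbedding

lemma sphereM_real_pos : 0 < sphereM.real Set.univ := by
  rw [Measure.real, ENNReal.toReal_pos_iff]
  refine ⟨?_, measure_lt_top _ _⟩
  rw [pos_iff_ne_zero, Ne, Measure.measure_univ_eq_zero]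
  exact Measure.toSphere_ne_zero volume

lemma integrable_L2V_mul_test (k : L2V) {ψ : Vel → ℝ} (hψ : Continuous ψ)
    (hψc : HasCompactSupport ψ) (w : Vel) : Integrable (fun z => k z * ψ (w - z)) volume := by
  have h : MemLp (fun z => ψ (w - z)) 2 (volume : Measure Vel) :=
    (memLp_test hψ hψc 2).comp_measurePreserving (Measure.measurePreserving_sub_left volume w)
  exact (Lp.memLp k).integrable_mul h

/-- A representation formula for test functions passes to `f` by duality. -/
lemma ae_eq_sum_inner_transl {ι : Type*} [Fintype ι] (k G : ι → L2V) (f : L2V)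
    (Ψ : ι → (Vel → ℝ) → Vel → ℝ)
    (hΨ : ∀ a φ, Smooth φ → HasCompactSupport φ →
      Continuous (Ψ a φ) ∧ HasCompactSupport (Ψ a φ))
    (hG : ∀ a φ, Smooth φ → HasCompactSupport φ →
      ∫ w, G a w * ∫ z, k a z * φ (w - z) = ∫ w, f w * ∫ z, k a z * Ψ a φ (w - z))
    (hid : ∀ φ, Smooth φ → HasCompactSupport φ →
      ∀ w, ∑ a, ∫ z, k a z * Ψ a φ (w - z) = φ w) :
    (fun v => ∑ a, inner ℝ (k a) (transl v (G a))) =ᵐ[volume] f := by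
  have hcont : ∀ a, Continuous fun v => inner ℝ (k a) (transl v (G a)) := fun a =>
    continuous_const.inner (continuous_transl (G a))
  refine ae_eq_of_integral_contDiff_smul_eq
    (continuous_finsetSum _ fun a _ => hcont a).locallyIntegrable (L2V.locallyIntegrable f)
    fun φ hφ hc => ?_
  have hφ' : Smooth φ := hφ
  simp only [smul_eq_mul]
  calc ∫ v, φ v * ∑ a, inner ℝ (k a) (transl v (G a))
      = ∫ v, ∑ a, inner ℝ (k a) (transl v (G a)) * φ v := by
        refine integral_congr_ae (.of_forall fun v => ?_)
        simp only [Finset.mul_sum, mul_comm]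
    _ = ∑ a, ∫ v, inner ℝ (k a) (transl v (G a)) * φ v :=
        integral_finsetSum _ fun a _ =>
          integrable_mul_test (hcont a).locallyIntegrable hφ'.continuous hc
    _ = ∑ a, ∫ w, f w * ∫ z, k a z * Ψ a φ (w - z) :=
        Finset.sum_congr rfl fun a _ => by
          rw [integral_inner_transl_mul _ _ hφ' hc, hG a φ hφ' hc]
    _ = ∫ w, ∑ a, f w * ∫ z, k a z * Ψ a φ (w - z) :=
        (integral_finsetSum _ fun a _ =>
          integrable_mul_conv (k a) f (hΨ a φ hφ' hc).1 (hΨ a φ hφ' hc).2).symm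
    _ = ∫ v, φ v * f v := by
        refine integral_congr_ae (.of_forall fun w => ?_)
        simp only [← Finset.mul_sum, hid φ hφ' hc w]
        ring

/-- The kernels of the representation formula of `green_identity`. -/
noncomputable def sobKer : Unit ⊕ (Fin 3 ⊕ (Fin 3 × Fin 3)) → Vel → ℝ :=
  Sum.elim (fun _ z => (sphereM.real Set.univ)⁻¹ * (1 * kerY z))
    (Sum.elim (fun i z => (2 * (sphereM.real Set.univ)⁻¹) * (unitC i z * kerY z))
      fun ij z => (sphereM.real Set.univ)⁻¹ * ((unitC ij.1 z * unitC ij.2 z) * kerY z))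

/-- The derivatives of the test function in the representation formula. -/
noncomputable def sobDer (φ : Vel → ℝ) : Unit ⊕ (Fin 3 ⊕ (Fin 3 × Fin 3)) → Vel → ℝ :=
  Sum.elim (fun _ => φ) (Sum.elim (fun i => partialD i φ)
    fun ij => partialD ij.2 (partialD ij.1 φ))

lemma memLp_sobKer (a) : MemLp (sobKer a) 2 volume := by
  rcases a with a | a | a
  · exact (memLp_kerY_mul measurable_const (fun z => by simp)).const_mul _
  · exact (memLp_kerY_mul (measurable_unitC a) (abs_unitC_le a)).const_mul _
  · refine (memLp_kerY_mul ((measurable_unitC a.1).mul (measurable_unitC a.2))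
      fun z => ?_).const_mul _
    rw [Pi.mul_apply, abs_mul]
    exact mul_le_one₀ (abs_unitC_le _ z) (abs_nonneg _) (abs_unitC_le _ z)

lemma sobDer_cont {φ : Vel → ℝ} (hφ : Smooth φ) (hc : HasCompactSupport φ) (a) :
    Continuous (sobDer φ a) ∧ HasCompactSupport (sobDer φ a) := by
  rcases a with a | a | a
  · exact ⟨hφ.continuous, hc⟩
  · exact ⟨(hφ.pd a).continuous, hasCompactSupport_partialD hc a⟩
  · exact ⟨((hφ.pd _).pd _).continuous,
      hasCompactSupport_partialD (hasCompactSupport_partialD hc _) _⟩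

lemma sum_sobKer_conv {k : Unit ⊕ (Fin 3 ⊕ (Fin 3 × Fin 3)) → L2V}
    (hk : ∀ a, k a =ᵐ[volume] sobKer a) {φ : Vel → ℝ} (hφ : Smooth φ)
    (hc : HasCompactSupport φ) (w : Vel) : ∑ a, ∫ z, k a z * sobDer φ a (w - z) = φ w := by
  set σ := sphereM.real Set.univ with hσ
  have hσ0 : 0 < σ := sphereM_real_pos
  have hi : ∀ a, Integrable (fun z => k a z * sobDer φ a (w - z)) volume := fun a =>
    integrable_L2V_mul_test (k a) (sobDer_cont hφ hc a).1 (sobDer_cont hφ hc a).2 w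
  -- The identity of `green_identity` is used at −z. Only the first order kernel is odd, hence its
  -- coefficient +2 in `sobKer`.
  have hae : (fun z => ∑ a, k a z * sobDer φ a (w - z)) =ᵐ[volume] fun z =>
      σ⁻¹ * (kerY (-z) * (φ (w + -z) - 2 * ∑ i, unitC i (-z) * partialD i φ (w + -z) +
      ∑ i, ∑ j, unitC i (-z) * unitC j (-z) * partialD j (partialD i φ) (w + -z))) := by
    filter_upwards [ae_all_iff.2 hk] with z hz
    have e1 : kerY (-z) = kerY z := by simp [kerY]
    have e2 : ∀ i, unitC i (-z) = -unitC i z := fun i => by simp [unitC, neg_div]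
    simp only [hz, Fintype.sum_sum_type, Fintype.sum_prod_type, sobKer, sobDer, Sum.elim_inl,
      Sum.elim_inr, e1, e2, ← sub_eq_add_neg, Fin.sum_univ_three, Finset.univ_unique,
      Finset.sum_singleton, ← hσ]
    ring
  rw [← integral_finsetSum _ fun a _ => hi a, integral_congr_ae hae, integral_const_mul,
    integral_neg_eq_self fun z => kerY z *
        (φ (w + z) - 2 * ∑ i, unitC i z * partialD i φ (w + z) +
      ∑ i, ∑ j, unitC i z * unitC j z * partialD j (partialD i φ) (w + z)),
    green_identity hφ hc w]
  · rw [← hσ]; field_simp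
  · have h1 := ((integrable_finsetSum Finset.univ fun a _ => hi a).congr hae).const_mul σ
    have hneg := (Measure.measurePreserving_neg (volume : Measure Vel)).integrable_comp_emb
      (MeasurableEquiv.neg Vel).measurableEmbedding (g := fun z => kerY z *
        (φ (w + z) - 2 * ∑ i, unitC i z * partialD i φ (w + z) +
      ∑ i, ∑ j, unitC i z * unitC j z * partialD j (partialD i φ) (w + z)))
    refine hneg.1 (h1.congr (.of_forall fun z => ?_))
    simp only [Function.comp]
    rw [← mul_assoc, mul_inv_cancel₀ hσ0.ne', one_mul]

/-- The embedding `H²(ℝ³) ⊂ C⁰ ∩ L^∞`. -/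
lemma exists_sobolev_embedding : ∃ C : ℝ, 0 < C ∧ ∀ (f : L2V) (f₁ : Fin 3 → L2V)
    (f₂ : Fin 3 → Fin 3 → L2V), (∀ i, WDer i f (f₁ i)) → (∀ i j, WDer j (f₁ i) (f₂ i j)) →
    ∃ F : Vel → ℝ, Continuous F ∧ F =ᵐ[volume] f ∧
      ∀ v, |F v| ≤ C * (‖f‖ + ∑ i, ‖f₁ i‖ + ∑ i, ∑ j, ‖f₂ i j‖) := by
  obtain ⟨k, hk⟩ : ∃ k : Unit ⊕ (Fin 3 ⊕ (Fin 3 × Fin 3)) → L2V,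
      ∀ a, k a =ᵐ[volume] sobKer a :=
    ⟨fun a => (memLp_sobKer a).toLp _, fun a => (memLp_sobKer a).coeFn_toLp⟩
  refine ⟨(∑ a, ‖k a‖) + 1, by positivity, fun f f₁ f₂ h1 h2 => ?_⟩
  -- The minus sign on the first derivatives is that of a single integration by parts; it cancels
  -- for second derivatives.
  obtain ⟨G, hG0⟩ : ∃ G : Unit ⊕ (Fin 3 ⊕ (Fin 3 × Fin 3)) → L2V, G =
    Sum.elim (fun _ => f) (Sum.elim (fun i => -f₁ i) fun ij => f₂ ij.1 ij.2) := ⟨_, rfl⟩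
  have hGn : ‖f‖ + ∑ i, ‖f₁ i‖ + ∑ i, ∑ j, ‖f₂ i j‖ = ∑ a, ‖G a‖ := by
    simp [hG0, Fintype.sum_sum_type, Fintype.sum_prod_type, add_assoc]
  -- The representative is a sum of inner products of fixed L² kernels with translates: continuity
  -- is that of translations in L², and the bound is Cauchy–Schwarz.
  refine ⟨fun v => ∑ a, inner ℝ (k a) (transl v (G a)),
    continuous_finsetSum _ fun a _ => continuous_const.inner (continuous_transl (G a)),
    ae_eq_sum_inner_transl k G f (fun a φ => sobDer φ a)
      (fun a φ hφ hc => sobDer_cont hφ hc a) ?_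
      (fun φ hφ hc => sum_sobKer_conv hk hφ hc), fun v => ?_⟩
  · rintro (a | a | ⟨a, b⟩) φ hφ hc
    · rw [hG0]; rfl
    · have e := (h1 a).integral_conv (k (Sum.inr (Sum.inl a))) hφ hc
      have e' : ∫ w, (-f₁ a : L2V) w * ∫ z, k (Sum.inr (Sum.inl a)) z * φ (w - z) =
          -∫ w, f₁ a w * ∫ z, k (Sum.inr (Sum.inl a)) z * φ (w - z) := by
        rw [← integral_neg]
        refine integral_congr_ae ((Lp.coeFn_neg (f₁ a)).mono fun w hw => ?_)
        simp only [hw, Pi.neg_apply, neg_mul]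
      rw [hG0]
      simp only [Sum.elim_inr, Sum.elim_inl, sobDer]
      rw [e', e, neg_neg]
    · rw [hG0]
      simp only [Sum.elim_inr, sobDer]
      rw [(h2 a b).integral_conv _ hφ hc,
        (h1 a).integral_conv _ (hφ.pd b) (hasCompactSupport_partialD hc b), neg_neg,
        partialD_comm hφ a b]
  · rw [hGn]
    have n1 : 0 ≤ ∑ a, ‖G a‖ := Finset.sum_nonneg fun _ _ => norm_nonneg _
    calc |∑ a, inner ℝ (k a) (transl v (G a))|
        ≤ ∑ a, |inner ℝ (k a) (transl v (G a))| := Finset.abs_sum_le_sum_abs _ _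
      _ ≤ ∑ a, ‖k a‖ * ∑ a, ‖G a‖ := by
          refine Finset.sum_le_sum fun a _ => (abs_real_inner_le_norm _ _).trans ?_
          rw [norm_transl]
          gcongr
          exact Finset.single_le_sum (f := fun a => ‖G a‖) (fun _ _ => norm_nonneg _)
            (Finset.mem_univ a)
      _ ≤ _ := by rw [← Finset.sum_mul]; nlinarith

end SobolevEmbedding


/-! ### Cartesian and cylindrical coordinates. -/

section Coordinates

/-- The point `(s, p)` of `ℝ × ℝ²`. -/
def cylV (s : ℝ) (p : ℝ × ℝ) : Vel := !₂[s, p.1, p.2]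

/-- The first basis vector. -/
noncomputable def axis : Vel := EuclideanSpace.single 0 1

@[fun_prop]
lemma measurable_cylV : Measurable fun x : ℝ × (ℝ × ℝ) => cylV x.1 x.2 := by
  refine (MeasurableEquiv.toLp 2 (Fin 3 → ℝ)).measurable.comp (measurable_pi_iff.2 fun i => ?_)
  fin_cases i <;> simp <;> fun_prop

lemma norm_cylV_sq (s : ℝ) (p : ℝ × ℝ) : ‖cylV s p‖ ^ 2 = s ^ 2 + (p.1 ^ 2 + p.2 ^ 2) := by
  rw [EuclideanSpace.norm_sq_eq]
  simp [cylV, Fin.sum_univ_three, add_assoc]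

lemma norm_axis : ‖axis‖ = 1 := by simp [axis]

lemma inner_axis (x : Vel) : inner ℝ axis x = x 0 := by
  simp [axis, EuclideanSpace.inner_single_left]

lemma lintegral_coords {f : Vel → ℝ≥0∞} (hf : Measurable f) :
    ∫⁻ z, f z = ∫⁻ s : ℝ, ∫⁻ p : ℝ × ℝ, f (cylV s p) := by
  have h1 := (EuclideanSpace.volume_preserving_symm_measurableEquiv_toLp (Fin 3)).symm
  have h2 := (volume_preserving_piFinSuccAbove (fun _ : Fin 3 => ℝ) 0).symm
  have h3 := (volume_preserving_finTwoArrow ℝ).symm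
  have h4 : MeasurePreserving (fun x : ℝ × (ℝ × ℝ) => cylV x.1 x.2) volume volume := by
    have := h1.comp (h2.comp ((MeasurePreserving.id (volume : Measure ℝ)).prod h3))
    convert! this using 1
    funext x
    simp only [Function.comp, MeasurableEquiv.symm_symm, cylV]
    congr 1
    funext i
    fin_cases i <;> rfl
  rw [← h4.lintegral_comp hf, Measure.volume_eq_prod,
    lintegral_prod (fun x : ℝ × (ℝ × ℝ) => f (cylV x.1 x.2)) (hf.comp measurable_cylV).aemeasurable]

lemma lintegral_plane_polar {f : ℝ × ℝ → ℝ≥0∞} (hf : Measurable f) :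
    ∫⁻ p, f p = ∫⁻ r in Set.Ioi (0 : ℝ), ∫⁻ θ in Set.Ioo (-Real.pi) Real.pi,
      ENNReal.ofReal r * f (r * Real.cos θ, r * Real.sin θ) := by
  rw [← lintegral_comp_polarCoord_symm f, polarCoord_target, Measure.volume_eq_prod,
    ← Measure.prod_restrict, lintegral_prod]
  · rfl
  · simp only [smul_eq_mul, polarCoord_symm_apply]
    fun_prop

end Coordinates

/-! ### Rotation invariance of the surface measure. -/

section Rotation

/-- The action of a linear isometry on the sphere. -/
noncomputable def sphereMap (e : Vel ≃ₗᵢ[ℝ] Vel) (ω : S2) : S2 :=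
  ⟨e ω, by simp⟩

lemma continuous_sphereMap (e : Vel ≃ₗᵢ[ℝ] Vel) : Continuous (sphereMap e) :=
  (e.continuous.comp continuous_subtype_val).subtype_mk _

open scoped Pointwise in
lemma measurePreserving_sphereMap (e : Vel ≃ₗᵢ[ℝ] Vel) :
    MeasurePreserving (sphereMap e) sphereM sphereM := by
  refine ⟨(continuous_sphereMap e).measurable, Measure.ext fun s hs => ?_⟩
  have hs' := (continuous_sphereMap e).measurable hs
  rw [Measure.map_apply (continuous_sphereMap e).measurable hs, sphereM,
    Measure.toSphere_apply' _ hs, Measure.toSphere_apply' _ hs',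
    ← e.measurePreserving.measure_preimage_equiv (f := e.toMeasurableEquiv)
      (Set.Ioo (0 : ℝ) 1 • ((↑) '' s : Set Vel))]
  congr 2
  ext x
  simp only [Set.mem_smul, Set.mem_image, Subtype.exists, Set.mem_preimage]
  have hx : e.toMeasurableEquiv x = e x := rfl
  rw [hx]
  constructor
  · rintro ⟨r, hr, y, ⟨a, ha, h1, rfl⟩, h2⟩
    refine ⟨r, hr, e a, ⟨e a, by simpa using ha, h1, rfl⟩, ?_⟩
    rw [← h2, e.map_smul]
  · rintro ⟨r, hr, y, ⟨a, ha, h1, rfl⟩, h2⟩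
    refine ⟨r, hr, e.symm a, ⟨e.symm a, by simpa using ha, ?_, rfl⟩, ?_⟩
    · simpa [sphereMap] using h1
    · apply e.injective
      rw [e.map_smul, e.apply_symm_apply]
      exact h2

/-- A linear isometry mapping `z` to the first axis. -/
lemma exists_isometry_axis (z : Vel) : ∃ e : Vel ≃ₗᵢ[ℝ] Vel, e z = ‖z‖ • axis := by
  refine ⟨Submodule.reflection (ℝ ∙ (z - ‖z‖ • axis))ᗮ, Submodule.reflection_sub ?_⟩
  rw [norm_smul, norm_axis]; simp

lemma measurePreserving_neg_sphere : MeasurePreserving (fun ω : S2 => -ω) sphereM sphereM := by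
  have := measurePreserving_sphereMap (LinearIsometryEquiv.neg ℝ)
  exact this

end Rotation

/-! ### Sphere integrals as Gaussian integrals, and the exchange of axial and radial variables. -/

section Radial

lemma lintegral_radial {φ : ℝ → ℝ≥0∞} (hφ : Measurable φ) {Φ : Vel → ℝ≥0∞} (hΦ : Measurable Φ) :
    ∫⁻ x : Vel, φ ‖x‖ * Φ (‖x‖⁻¹ • x) =
      (∫⁻ r in Set.Ioi (0 : ℝ), ENNReal.ofReal (r ^ 2) * φ r) * ∫⁻ ω : S2, Φ ω ∂sphereM := by
  rw [lintegral_polar (by fun_prop), ← lintegral_const_mul _ (by fun_prop)]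
  refine lintegral_congr fun ω => ?_
  rw [← lintegral_mul_const _ (by fun_prop)]
  refine setLIntegral_congr_fun measurableSet_Ioi fun r hr => ?_
  have hr' : (0 : ℝ) < r := hr
  have hω : ‖(ω : Vel)‖ = 1 := by simp
  have hn : ‖r • (ω : Vel)‖ = r := by rw [norm_smul, hω, mul_one, Real.norm_of_nonneg hr'.le]
  simp only [hn, smul_smul, inv_mul_cancel₀ hr'.ne', one_smul, mul_assoc]

/-- Integrating the extension of degree zero against a Gaussian reproduces the sphere integral up to
a finite positive factor. Identities on the sphere can thus be proved in coordinates of ℝ³. -/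
lemma exists_lintegral_sphere : ∃ c : ℝ≥0∞, c ≠ 0 ∧ c ≠ ⊤ ∧ ∀ Φ : Vel → ℝ≥0∞, Measurable Φ →
    ∫⁻ x : Vel, ENNReal.ofReal (Real.exp (-‖x‖ ^ 2)) * Φ (‖x‖⁻¹ • x) =
      c * ∫⁻ ω : S2, Φ ω ∂sphereM := by
  refine ⟨_, ?_, ?_, fun Φ hΦ => lintegral_radial
    (φ := fun r => ENNReal.ofReal (Real.exp (-r ^ 2))) (by fun_prop) hΦ⟩
  · have : ∫⁻ r in Set.Ioi (0 : ℝ), ENNReal.ofReal (r ^ 2) *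
        ENNReal.ofReal (Real.exp (-r ^ 2)) ≠ 0 := by
      rw [Ne, lintegral_eq_zero_iff (by fun_prop)]
      intro h
      have h2 := (ae_restrict_iff' measurableSet_Ioi).1 h
      have h3 : volume (Set.Ioi (0 : ℝ)) = 0 := by
        refine measure_mono_null (fun r hr => ?_) h2
        have hr' : (0 : ℝ) < r := hr
        simp only [Set.mem_compl_iff, Set.mem_ofPred_eq]
        intro h4
        have := h4 hr
        simp only [Pi.zero_apply, mul_eq_zero, ENNReal.ofReal_eq_zero] at this
        rcases this with h | h
        · nlinarith [pow_pos hr' 2]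
        · linarith [Real.exp_pos (-r ^ 2)]
      simp at h3
    exact this
  · have h := integrable_rpow_mul_exp_neg_mul_sq (b := 1) one_pos (s := 2) (by norm_num)
    have h1 : Integrable (fun r : ℝ => r ^ 2 * Real.exp (-r ^ 2)) := by
      refine h.congr (.of_forall fun r => ?_)
      simp
    have h2 := h1.integrableOn (s := Set.Ioi 0)
    refine ne_of_lt (lt_of_le_of_lt (lintegral_mono fun r => ?_) h2.2)
    rw [← ENNReal.ofReal_mul (by positivity), ← ofReal_norm, Real.norm_of_nonneg
      (by positivity)]

/-- With p in polar coordinates of radius r, and s folded to s > 0, the measure |s| ds dp becomes s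
r ds dr dθ, symmetric in s and r. The minus signs are removed by p ↦ −p. -/
lemma lintegral_swap_aux {G : ℝ × ℝ × ℝ × ℝ → ℝ≥0∞}
    (hG : Measurable G) :
    ∫⁻ s : ℝ, ∫⁻ p : ℝ × ℝ, ENNReal.ofReal |s| * G (s ^ 2 + (p.1 ^ 2 + p.2 ^ 2), s ^ 2, s * p.1, s * p.2) =
    ∫⁻ s : ℝ, ∫⁻ p : ℝ × ℝ, ENNReal.ofReal |s| * G (s ^ 2 + (p.1 ^ 2 + p.2 ^ 2), p.1 ^ 2 + p.2 ^ 2, -(s * p.1), -(s * p.2)) := by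
  have fold : ∀ f : ℝ → ℝ≥0∞, Measurable f → (∀ s, f (-s) = f s) →
      ∫⁻ s, f s = 2 * ∫⁻ s in Set.Ioi (0 : ℝ), f s := by
    intro f hf he
    have h1 : ∫⁻ s in Set.Iio (0 : ℝ), f s = ∫⁻ s in Set.Ioi (0 : ℝ), f s := by
      have := ((Measure.measurePreserving_neg (volume : Measure ℝ)).restrict_preimage
        (measurableSet_Iio (a := (0 : ℝ)))).lintegral_comp hf
      rw [← this]
      simp [he]
    rw [← lintegral_add_compl f (measurableSet_Ioi (a := (0 : ℝ))), Set.compl_Ioi,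
      ← setLIntegral_congr Iio_ae_eq_Iic, h1, two_mul]
  have hneg : ∀ f : ℝ × ℝ → ℝ≥0∞, Measurable f → ∫⁻ p, f (-p) = ∫⁻ p, f p := fun f hf =>
    (Measure.measurePreserving_neg (volume : Measure (ℝ × ℝ))).lintegral_comp hf
  rw [fold _ (Measurable.lintegral_prod_right' (f := fun x : ℝ × (ℝ × ℝ) =>
      ENNReal.ofReal |x.1| * G (x.1 ^ 2 + (x.2.1 ^ 2 + x.2.2 ^ 2), x.1 ^ 2, x.1 * x.2.1, x.1 * x.2.2)) (by fun_prop)),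
    fold _ (Measurable.lintegral_prod_right' (f := fun x : ℝ × (ℝ × ℝ) =>
      ENNReal.ofReal |x.1| * G (x.1 ^ 2 + (x.2.1 ^ 2 + x.2.2 ^ 2), x.2.1 ^ 2 + x.2.2 ^ 2, -(x.1 * x.2.1), -(x.1 * x.2.2))) (by fun_prop))]
  · congr 1
    have e1 : ∀ s ∈ Set.Ioi (0 : ℝ), ∫⁻ p : ℝ × ℝ, ENNReal.ofReal |s| *
        G (s ^ 2 + (p.1 ^ 2 + p.2 ^ 2), s ^ 2, s * p.1, s * p.2) =
        ∫⁻ r in Set.Ioi (0 : ℝ), ∫⁻ θ in Set.Ioo (-Real.pi) Real.pi,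
          ENNReal.ofReal (r * s) * (G (s ^ 2 + r ^ 2, s ^ 2, s * r * Real.cos θ, s * r * Real.sin θ)) := by
      intro s hs
      rw [lintegral_plane_polar (by fun_prop)]
      refine setLIntegral_congr_fun measurableSet_Ioi fun r hr => lintegral_congr fun θ => ?_
      have hcs : (r * Real.cos θ) ^ 2 + (r * Real.sin θ) ^ 2 = r ^ 2 := by
        linear_combination r ^ 2 * Real.sin_sq_add_cos_sq θ
      simp only [hcs, abs_of_pos (Set.mem_Ioi.1 hs), ENNReal.ofReal_mul (Set.mem_Ioi.1 hr).le,
        mul_assoc]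
    have e2 : ∀ s ∈ Set.Ioi (0 : ℝ), ∫⁻ p : ℝ × ℝ, ENNReal.ofReal |s| *
        G (s ^ 2 + (p.1 ^ 2 + p.2 ^ 2), p.1 ^ 2 + p.2 ^ 2, -(s * p.1), -(s * p.2)) =
        ∫⁻ r in Set.Ioi (0 : ℝ), ∫⁻ θ in Set.Ioo (-Real.pi) Real.pi,
          ENNReal.ofReal (s * r) * (G (r ^ 2 + s ^ 2, r ^ 2, r * s * Real.cos θ, r * s * Real.sin θ)) := by
      intro s hs
      rw [← hneg _ (by fun_prop), lintegral_plane_polar (by fun_prop)]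
      refine setLIntegral_congr_fun measurableSet_Ioi fun r hr => lintegral_congr fun θ => ?_
      have hcs : (r * Real.cos θ) ^ 2 + (r * Real.sin θ) ^ 2 = r ^ 2 := by
        linear_combination r ^ 2 * Real.sin_sq_add_cos_sq θ
      simp only [Prod.fst_neg, Prod.snd_neg, neg_sq, hcs, abs_of_pos (Set.mem_Ioi.1 hs),
        mul_neg, neg_neg, mul_comm s r, ENNReal.ofReal_mul (Set.mem_Ioi.1 hr).le,
        add_comm (r ^ 2), ← mul_assoc]
    rw [setLIntegral_congr_fun measurableSet_Ioi e1, setLIntegral_congr_fun measurableSet_Ioi e2]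
    rw [lintegral_lintegral_swap]
    refine (Measurable.lintegral_prod_right' (f := fun x : (ℝ × ℝ) × ℝ =>
      ENNReal.ofReal (x.1.2 * x.1.1) * (G (x.1.1 ^ 2 + x.1.2 ^ 2, x.1.1 ^ 2, x.1.1 * x.1.2 * Real.cos x.2, x.1.1 * x.1.2 * Real.sin x.2)))
            ?_).aemeasurable
    fun_prop
  · intro s
    rw [← hneg _ (by fun_prop)]
    simp
  · intro s
    rw [← hneg _ (by fun_prop)]
    simp

end Radial


/-! ### Exchange of parallel and orthogonal components, angular integrals, and integrals along
lines. -/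

section SphereIdentities

/-- The component of `ξ.1` in the direction `ξ.2`. -/
noncomputable def parC (ξ : Vel × S2) : Vel := (inner ℝ ξ.1 (ξ.2 : Vel)) • (ξ.2 : Vel)

lemma norm_S2 (ω : S2) : ‖(ω : Vel)‖ = 1 := by simp

lemma lintegral_sphere_eq_of_cyl {Φ Φ' : Vel → ℝ≥0∞} (hΦ : Measurable Φ) (hΦ' : Measurable Φ')
    (h : ∫⁻ x : Vel, ENNReal.ofReal (Real.exp (-‖x‖ ^ 2)) * Φ (‖x‖⁻¹ • x) =
      ∫⁻ x : Vel, ENNReal.ofReal (Real.exp (-‖x‖ ^ 2)) * Φ' (‖x‖⁻¹ • x)) :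
    ∫⁻ ω : S2, Φ ω ∂sphereM = ∫⁻ ω : S2, Φ' ω ∂sphereM := by
  obtain ⟨c, h0, ht, hc⟩ := exists_lintegral_sphere
  rw [hc _ hΦ, hc _ hΦ'] at h
  exact (ENNReal.mul_right_inj h0 ht).1 h

/-- For ω = (s, p)/|(s, p)| one has ω₀ω = (s², s p)/|(s, p)|² and e₀ − ω₀ω = (|p|², −s p)/|(s, p)|².
Exchanging s and |p| and reversing p carries the first into the second, and `lintegral_swap_aux`
says that this preserves the measure with density |ω₀|. -/
lemma lintegral_sphere_swap_axis {G : Vel → ℝ≥0∞} (hG : Measurable G) :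
    ∫⁻ ω : S2, ENNReal.ofReal |(ω : Vel) 0| * G ((ω : Vel) 0 • (ω : Vel)) ∂sphereM =
      ∫⁻ ω : S2, ENNReal.ofReal |(ω : Vel) 0| *
        G (axis - (ω : Vel) 0 • (ω : Vel)) ∂sphereM := by
  have m0 : Measurable fun x : Vel => x 0 := measurable_coordinate 0
  refine lintegral_sphere_eq_of_cyl (Φ := fun x => ENNReal.ofReal |x 0| * G (x 0 • x))
    (Φ' := fun x => ENNReal.ofReal |x 0| * G (axis - x 0 • x)) (by fun_prop) (by fun_prop) ?_
  rw [lintegral_coords (by fun_prop), lintegral_coords (by fun_prop)]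
  have h := lintegral_swap_aux
    (G := fun y => ENNReal.ofReal (Real.exp (-y.1) * (Real.sqrt y.1)⁻¹) *
      G (y.1⁻¹ • cylV y.2.1 y.2.2)) (by fun_prop)
  have hx : ∀ (s : ℝ) (p : ℝ × ℝ), ‖cylV s p‖ = Real.sqrt (s ^ 2 + (p.1 ^ 2 + p.2 ^ 2)) :=
    fun s p => by rw [← norm_cylV_sq, Real.sqrt_sq (norm_nonneg _)]
  have key : ∀ (s : ℝ) (p : ℝ × ℝ) (y : Vel), ENNReal.ofReal |s| *
      (ENNReal.ofReal (Real.exp (-(s ^ 2 + (p.1 ^ 2 + p.2 ^ 2))) *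
        (Real.sqrt (s ^ 2 + (p.1 ^ 2 + p.2 ^ 2)))⁻¹) * G y) =
      ENNReal.ofReal (Real.exp (-‖cylV s p‖ ^ 2)) *
        (ENNReal.ofReal |(‖cylV s p‖⁻¹ • cylV s p) 0| * G y) := by
    intro s p y
    have e0 : (‖cylV s p‖⁻¹ • cylV s p) 0 = ‖cylV s p‖⁻¹ * s := by simp [cylV]
    rw [e0, abs_mul, abs_of_nonneg (inv_nonneg.2 (norm_nonneg _)), norm_cylV_sq, ← hx, ← mul_assoc, ← mul_assoc, ← ENNReal.ofReal_mul (abs_nonneg _),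
      ← ENNReal.ofReal_mul (Real.exp_nonneg _)]
    congr 2
    ring
  have a1 : ∀ (s : ℝ) (p : ℝ × ℝ), (‖cylV s p‖⁻¹ • cylV s p) 0 • ‖cylV s p‖⁻¹ • cylV s p =
      (s ^ 2 + (p.1 ^ 2 + p.2 ^ 2))⁻¹ • cylV (s ^ 2) (s * p.1, s * p.2) := by
    intro s p
    have e0 : (‖cylV s p‖⁻¹ • cylV s p) 0 = ‖cylV s p‖⁻¹ * s := by simp [cylV]
    have e1 : cylV (s ^ 2) (s * p.1, s * p.2) = s • cylV s p := by
      ext i; fin_cases i <;> simp [cylV, sq]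
    rw [e0, e1, smul_smul, smul_smul, ← norm_cylV_sq]
    congr 1
    ring
  have a2 : ∀ (s : ℝ) (p : ℝ × ℝ), s ^ 2 + (p.1 ^ 2 + p.2 ^ 2) ≠ 0 →
      axis - (‖cylV s p‖⁻¹ • cylV s p) 0 • ‖cylV s p‖⁻¹ • cylV s p =
      (s ^ 2 + (p.1 ^ 2 + p.2 ^ 2))⁻¹ • cylV (p.1 ^ 2 + p.2 ^ 2) (-(s * p.1), -(s * p.2)) := by
    intro s p ht
    rw [a1]
    ext i
    fin_cases i <;> simp [cylV, axis]
    field_simp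
    ring
  refine Eq.trans ?_ (h.trans ?_) <;>
    refine lintegral_congr fun s => lintegral_congr fun p => ?_ <;> rw [key]
  · rw [a1]
  · by_cases ht : s ^ 2 + (p.1 ^ 2 + p.2 ^ 2) = 0
    · have h0 : cylV s p = 0 := by rw [← norm_eq_zero, hx, ht, Real.sqrt_zero]
      simp [h0]
    · rw [a2 s p ht]

/-- The change of variables in the sphere which exchanges the components of `z` parallel and
orthogonal to `ω`. -/
lemma lintegral_sphere_swap {G : Vel → ℝ≥0∞} (hG : Measurable G) (z : Vel) :
    ∫⁻ ω : S2, ENNReal.ofReal |inner ℝ z (ω : Vel)| * G (parC (z, ω)) ∂sphereM =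
      ∫⁻ ω : S2, ENNReal.ofReal |inner ℝ z (ω : Vel)| * G (z - parC (z, ω)) ∂sphereM := by
  obtain ⟨e, he⟩ := exists_isometry_axis z
  have mp := measurePreserving_sphereMap e.symm
  have i1 : ∀ ω : S2, inner ℝ z ((sphereMap e.symm ω : S2) : Vel) = ‖z‖ * (ω : Vel) 0 := by
    intro ω
    rw [← e.inner_map_map, he, inner_smul_left]
    simp [sphereMap, inner_axis]
  have i2 : ∀ ω : S2, parC (z, sphereMap e.symm ω) =
      e.symm (‖z‖ • ((ω : Vel) 0 • (ω : Vel))) := by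
    intro ω
    rw [parC, i1, smul_smul, e.symm.map_smul]
    rfl
  have i3 : ∀ ω : S2, z - parC (z, sphereMap e.symm ω) =
      e.symm (‖z‖ • (axis - (ω : Vel) 0 • (ω : Vel))) := by
    intro ω
    rw [i2, smul_sub, map_sub, ← he, e.symm_apply_apply]
  have mpar : Measurable fun ω : S2 => parC (z, ω) := by unfold parC; fun_prop
  rw [← mp.lintegral_comp (f := fun ω : S2 => ENNReal.ofReal |inner ℝ z (ω : Vel)| *
      G (parC (z, ω))) (by fun_prop),
    ← mp.lintegral_comp (f := fun ω : S2 => ENNReal.ofReal |inner ℝ z (ω : Vel)| *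
      G (z - parC (z, ω))) (by fun_prop)]
  have i2' : ∀ ω : S2, G (parC (z, sphereMap e.symm ω)) =
      G (e.symm (‖z‖ • ((ω : Vel) 0 • (ω : Vel)))) := fun ω => by rw [i2]
  have i3' : ∀ ω : S2, G (z - parC (z, sphereMap e.symm ω)) =
      G (e.symm (‖z‖ • (axis - (ω : Vel) 0 • (ω : Vel)))) := fun ω => by rw [i3]
  simp only [i1, i2', i3', abs_mul, ENNReal.ofReal_mul (abs_nonneg _), mul_assoc]
  have hGe : Measurable fun y => G (e.symm (‖z‖ • y)) :=
    hG.comp (e.symm.continuous.measurable.comp (measurable_const_smul _))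
  have m0 : Measurable fun x : Vel => x 0 := measurable_coordinate 0
  rw [lintegral_const_mul _ (by fun_prop), lintegral_const_mul _ (by fun_prop)]
  congr 1
  exact lintegral_sphere_swap_axis hGe

/-- A function of the angle between `z` and `ω` has the same integral over the sphere for all
`z ≠ 0`. -/
lemma lintegral_sphere_angle {Φ : ℝ → ℝ≥0∞} (hΦ : Measurable Φ) {z : Vel} (hz : z ≠ 0) :
    ∫⁻ ω : S2, Φ (InnerProductGeometry.angle z (ω : Vel)) ∂sphereM =
      ∫⁻ ω : S2, Φ (Real.arccos ((ω : Vel) 0)) ∂sphereM := by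
  obtain ⟨e, he⟩ := exists_isometry_axis z
  have mp := measurePreserving_sphereMap e.symm
  have i1 : ∀ ω : S2, InnerProductGeometry.angle z ((sphereMap e.symm ω : S2) : Vel) =
      Real.arccos ((ω : Vel) 0) := by
    intro ω
    rw [InnerProductGeometry.angle, ← e.inner_map_map, he, inner_smul_left]
    simp [sphereMap, inner_axis, hz]
  have hm : Measurable fun ω : S2 => InnerProductGeometry.angle z (ω : Vel) := by
    unfold InnerProductGeometry.angle
    fun_prop
  rw [← mp.lintegral_comp (f := fun ω : S2 => Φ (InnerProductGeometry.angle z (ω : Vel)))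
    (hΦ.comp hm)]
  simp only [i1]

/-- The zero set of a function of the angle is determined by the null sets in `[0, π]`. -/
lemma ae_angle_of_lintegral_eq_zero {β : ℝ → ℝ} (hβ : Measurable β)
    (h : ∫⁻ ω : S2, ENNReal.ofReal |β (Real.arccos ((ω : Vel) 0))| ∂sphereM = 0) :
    ∀ᵐ θ ∂(volume.restrict (Set.Icc 0 Real.pi)), β θ = 0 := by
  obtain ⟨c, h0, ht, hc⟩ := exists_lintegral_sphere
  have m0 : Measurable fun x : Vel => x 0 := measurable_coordinate 0
  have h1 := hc (fun x => ENNReal.ofReal |β (Real.arccos (x 0))|) (by fun_prop)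
  have hm : Measurable fun x : ℝ × (ℝ × ℝ) => ENNReal.ofReal (Real.exp (-‖cylV x.1 x.2‖ ^ 2)) *
      ENNReal.ofReal |β (Real.arccos ((‖cylV x.1 x.2‖⁻¹ • cylV x.1 x.2) 0))| := by
    have : Measurable fun x : Vel => ENNReal.ofReal (Real.exp (-‖x‖ ^ 2)) *
      ENNReal.ofReal |β (Real.arccos ((‖x‖⁻¹ • x) 0))| := by fun_prop
    exact this.comp measurable_cylV
  rw [h, mul_zero, lintegral_coords (by fun_prop), lintegral_lintegral_swap hm.aemeasurable,
    lintegral_eq_zero_iff (Measurable.lintegral_prod_left' hm)] at h1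
  have hne : ∀ᵐ p : ℝ × ℝ, p ≠ 0 := by
    rw [ae_iff]; simp
  -- Along the line through a fixed p ≠ 0 the angle is π/2 − arctan(s/r) and covers (0, π). This map
  -- is differentiable, so it sends null sets to null sets; the endpoints 0 and π are discarded
  -- separately.
  obtain ⟨p, hp, hp0⟩ := (h1.and hne).exists
  set r := Real.sqrt (p.1 ^ 2 + p.2 ^ 2) with hr
  have hr2 : 0 < p.1 ^ 2 + p.2 ^ 2 := by
    have : p.1 ≠ 0 ∨ p.2 ≠ 0 := by
      by_contra! hcon
      exact hp0 (Prod.ext hcon.1 hcon.2)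
    rcases this with h | h <;> positivity
  have hr0 : 0 < r := Real.sqrt_pos.2 hr2
  have hsq : r ^ 2 = p.1 ^ 2 + p.2 ^ 2 := Real.sq_sqrt hr2.le
  have harc : ∀ s : ℝ, Real.arccos ((‖cylV s p‖⁻¹ • cylV s p) 0) =
      Real.pi / 2 - Real.arctan (s / r) := by
    intro s
    rw [Real.arctan_eq_arcsin, Real.arccos]
    congr 2
    have e0 : (‖cylV s p‖⁻¹ • cylV s p) 0 = ‖cylV s p‖⁻¹ * s := by simp [cylV]
    have e1 : ‖cylV s p‖ = r * Real.sqrt (1 + (s / r) ^ 2) := by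
      rw [← Real.sqrt_sq (norm_nonneg (cylV s p)), norm_cylV_sq, ← hsq,
        ← Real.sqrt_sq hr0.le, ← Real.sqrt_mul (sq_nonneg _), Real.sqrt_sq hr0.le]
      congr 1
      field_simp
      ring
    rw [e0, e1]
    field_simp
  have h2 : ∀ᵐ s : ℝ, β (Real.pi / 2 - Real.arctan (s / r)) = 0 := by
    have hp' := (lintegral_eq_zero_iff
      (hm.comp ((measurable_id (α := ℝ)).prodMk (measurable_const (a := p))))).1 hp
    filter_upwards [hp'] with s hs
    simp only [Function.comp, id] at hs
    rw [harc] at hs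
    have hs' : Real.exp (-‖cylV s p‖ ^ 2) ≤ 0 ∨ β (Real.pi / 2 - Real.arctan (s / r)) = 0 := by
      simpa using hs
    exact hs'.resolve_left (not_le.2 (Real.exp_pos _))
  rw [ae_restrict_iff' measurableSet_Icc]
  have hnull : volume ((fun s : ℝ => Real.pi / 2 - Real.arctan (s / r)) ''
      {s | ¬ β (Real.pi / 2 - Real.arctan (s / r)) = 0}) = 0 := by
    refine addHaar_image_eq_zero_of_differentiableOn_of_addHaar_eq_zero _ ?_ h2
    exact ((Real.differentiable_arctan.comp (differentiable_id.div_const r)).const_sub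
      _).differentiableOn
  have h3 : ∀ᵐ θ : ℝ, θ ∉ (fun s : ℝ => Real.pi / 2 - Real.arctan (s / r)) ''
      {s | ¬ β (Real.pi / 2 - Real.arctan (s / r)) = 0} := measure_eq_zero_iff_ae_notMem.1 hnull
  have h4 : ∀ᵐ θ : ℝ, θ ≠ 0 := by rw [ae_iff]; simp
  have h5 : ∀ᵐ θ : ℝ, θ ≠ Real.pi := by rw [ae_iff]; simp
  filter_upwards [h3, h4, h5] with θ h3 h4 h5 hθ
  by_contra hne
  refine h3 ⟨r * Real.tan (Real.pi / 2 - θ), ?_, ?_⟩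
  all_goals
    have e : Real.pi / 2 - Real.arctan (r * Real.tan (Real.pi / 2 - θ) / r) = θ := by
      rw [mul_div_cancel_left₀ _ hr0.ne', Real.arctan_tan]
      · ring
      · have := lt_of_le_of_ne hθ.2 h5; linarith
      · have := lt_of_le_of_ne hθ.1 h4.symm; linarith
  · simpa only [Set.mem_ofPred_eq, e] using hne
  · exact e

/-- After a rotation taking ω to the first axis the Gaussian factorizes, and the two transversal
variables integrate out. -/
lemma lintegral_cyl_gauss {δ : ℝ} {H : ℝ → ℝ≥0∞} (hH : Measurable H) (ω : S2) :
    ∫⁻ z : Vel, ENNReal.ofReal (Real.exp (-(δ * ‖z‖ ^ 2))) * H (inner ℝ z (ω : Vel)) =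
      (∫⁻ p : ℝ × ℝ, ENNReal.ofReal (Real.exp (-(δ * (p.1 ^ 2 + p.2 ^ 2))))) *
        ∫⁻ s : ℝ, ENNReal.ofReal (Real.exp (-(δ * s ^ 2))) * H s := by
  obtain ⟨e, he⟩ := exists_isometry_axis (ω : Vel)
  have m0 : Measurable fun x : Vel => x 0 := measurable_coordinate 0
  have h1 : ∀ z : Vel, inner ℝ (e.symm z) (ω : Vel) = z 0 := by
    intro z
    rw [← e.inner_map_map, he, e.apply_symm_apply, norm_S2, one_smul, real_inner_comm, inner_axis]
  rw [← e.symm.measurePreserving.lintegral_comp (by fun_prop)]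
  simp only [h1, LinearIsometryEquiv.norm_map]
  rw [lintegral_coords (by fun_prop), ← lintegral_const_mul _ (by fun_prop)]
  refine lintegral_congr fun s => ?_
  rw [mul_comm, ← lintegral_const_mul _ (by fun_prop)]
  refine lintegral_congr fun p => ?_
  rw [norm_cylV_sq, mul_add, neg_add, Real.exp_add, ENNReal.ofReal_mul (Real.exp_nonneg _)]
  simp only [cylV]
  simp
  ring

/-- The factor 2 arises because ω and −ω describe the same line. -/
lemma lintegral_line_sphere {F : Vel → ℝ≥0∞} (hF : Measurable F) :
    ∫⁻ ω : S2, (∫⁻ s : ℝ, ENNReal.ofReal (s ^ 2) * F (s • (ω : Vel)) ∂volume) ∂sphereM =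
      2 * ∫⁻ x : Vel, F x := by
  have hm : Measurable fun x : S2 × ℝ => ENNReal.ofReal (x.2 ^ 2) * F (x.2 • (x.1 : Vel)) := by
    fun_prop
  have hsplit : ∀ ω : S2, ∫⁻ s : ℝ, ENNReal.ofReal (s ^ 2) * F (s • (ω : Vel)) =
      (∫⁻ s in Set.Ioi (0 : ℝ), ENNReal.ofReal (s ^ 2) * F (s • (ω : Vel))) +
      ∫⁻ s in Set.Ioi (0 : ℝ), ENNReal.ofReal (s ^ 2) * F (s • ((-ω : S2) : Vel)) := by
    intro ω
    have m1 : Measurable fun s : ℝ => ENNReal.ofReal (s ^ 2) * F (s • (ω : Vel)) := by fun_prop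
    rw [← lintegral_add_compl _ (measurableSet_Ioi (a := (0 : ℝ))), Set.compl_Ioi,
      ← setLIntegral_congr Iio_ae_eq_Iic]
    congr 1
    rw [← ((Measure.measurePreserving_neg (volume : Measure ℝ)).restrict_preimage
        (measurableSet_Iio (a := (0 : ℝ)))).lintegral_comp m1]
    simp
  have hI : Measurable fun ω : S2 =>
      ∫⁻ s in Set.Ioi (0 : ℝ), ENNReal.ofReal (s ^ 2) * F (s • (ω : Vel)) :=
    hm.lintegral_prod_right'
  simp only [hsplit]
  rw [lintegral_add_left hI, measurePreserving_neg_sphere.lintegral_comp hI, ← two_mul,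
    ← lintegral_polar hF]

end SphereIdentities


/-! ### Gaussian integrals with a singular power. -/

section Gaussian

lemma exists_rpow_le_exp {a c : ℝ} (hc : 0 < c) :
    ∃ C : ℝ, 0 < C ∧ ∀ t : ℝ, 0 ≤ t → (1 + t) ^ a ≤ C * Real.exp (c * t) := by
  set n := ⌈a⌉₊ with hn
  refine ⟨n.factorial * (c ^ n)⁻¹ * Real.exp c, by positivity, fun t ht => ?_⟩
  have h1 : (1 + t) ^ a ≤ (1 + t) ^ n := by
    rw [← Real.rpow_natCast]
    exact Real.rpow_le_rpow_of_exponent_le (by linarith) (Nat.le_ceil a)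
  have h2 := Real.pow_div_factorial_le_exp (c * (1 + t)) (by positivity) n
  rw [div_le_iff₀ (by positivity), mul_pow, mul_add, mul_one, Real.exp_add] at h2
  have hcn : 0 < c ^ n := by positivity
  calc (1 + t) ^ a ≤ (1 + t) ^ n := h1
    _ = (c ^ n)⁻¹ * (c ^ n * (1 + t) ^ n) := by field_simp
    _ ≤ (c ^ n)⁻¹ * (Real.exp c * Real.exp (c * t) * n.factorial) := by gcongr
    _ = _ := by ring

lemma integrable_gauss {δ : ℝ} (hδ : 0 < δ) :
    Integrable (fun z : Vel => Real.exp (-(δ * ‖z‖ ^ 2))) volume := by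
  by_contra h
  have h1 := GaussianFourier.integral_rexp_neg_mul_sq_norm (V := Vel) hδ
  have h2 : ∫ v : Vel, Real.exp (-δ * ‖v‖ ^ 2) = 0 :=
    integral_undef (by simpa only [neg_mul] using h)
  rw [h2] at h1
  have : 0 < (Real.pi / δ) ^ ((Module.finrank ℝ Vel : ℝ) / 2) := by positivity
  linarith

lemma lintegral_gauss_ne_top {δ : ℝ} (hδ : 0 < δ) :
    ∫⁻ z : Vel, ENNReal.ofReal (Real.exp (-(δ * ‖z‖ ^ 2))) ≠ ⊤ := by
  have := (integrable_gauss hδ).2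
  rw [hasFiniteIntegral_iff_ofReal (.of_forall fun _ => Real.exp_nonneg _)] at this
  exact this.ne

lemma lintegral_rpow_ball_ne_top {γ : ℝ} (hγ : -3 < γ) :
    ∫⁻ z : Vel, (Set.Iio (1 : ℝ)).indicator (fun r => ENNReal.ofReal (r ^ γ)) ‖z‖ ≠ ⊤ := by
  have h := lintegral_radial (φ := (Set.Iio (1 : ℝ)).indicator (fun r => ENNReal.ofReal (r ^ γ)))
    ((by fun_prop : Measurable fun r : ℝ => ENNReal.ofReal (r ^ γ)).indicator measurableSet_Iio)
    (Φ := fun _ => 1) measurable_const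
  simp only [mul_one, lintegral_const, one_mul] at h
  rw [h]
  refine ENNReal.mul_ne_top ?_ (measure_ne_top _ _)
  have h1 : IntegrableOn (fun r : ℝ => r ^ (γ + 2)) (Set.Ioo 0 1) volume :=
    (intervalIntegrable_iff_integrableOn_Ioo_of_le zero_le_one).1
      (intervalIntegral.intervalIntegrable_rpow' (by linarith))
  have h2 : ∫⁻ r in Set.Ioi (0 : ℝ), ENNReal.ofReal (r ^ 2) *
      (Set.Iio (1 : ℝ)).indicator (fun r => ENNReal.ofReal (r ^ γ)) r =
      ∫⁻ r in Set.Ioo (0 : ℝ) 1, ‖r ^ (γ + 2)‖ₑ := by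
    rw [← Set.Ioi_inter_Iio, Set.inter_comm, ← Measure.restrict_restrict measurableSet_Iio,
      ← lintegral_indicator measurableSet_Iio]
    refine setLIntegral_congr_fun measurableSet_Ioi fun r hr => ?_
    have hr' : (0 : ℝ) < r := hr
    by_cases h : r ∈ Set.Iio (1 : ℝ)
    · simp only [Set.indicator_of_mem h]
      rw [← ENNReal.ofReal_mul (by positivity), ← ofReal_norm, Real.norm_of_nonneg (by positivity),
        Real.rpow_add hr', mul_comm]
      norm_num
    · simp only [Set.indicator_of_notMem h, mul_zero]
  rw [h2]
  exact h1.2.ne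

/-- Peetre's inequality, which transfers polynomial weights between the velocities of a collision.
-/
lemma one_add_norm_sq_le (x z : Vel) :
    1 + ‖x‖ ^ 2 ≤ 2 * ((1 + ‖z‖ ^ 2) * (1 + ‖x + z‖ ^ 2)) := by
  have h : ‖x‖ ≤ ‖x + z‖ + ‖z‖ := by simpa using norm_sub_le (x + z) z
  nlinarith [norm_nonneg x, norm_nonneg z, norm_nonneg (x + z), sq_nonneg (‖x + z‖ - ‖z‖),
    mul_nonneg (sq_nonneg ‖z‖) (sq_nonneg ‖x + z‖)]

lemma rpow_mul_rpow_le {γ : ℝ} (hγ0 : γ ≤ 0) (r : ℝ) (hr : 0 ≤ r) :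
    r ^ γ * (1 + r ^ 2) ^ (-(γ / 2)) ≤
      2 ^ (-(γ / 2)) * (1 + (Set.Iio (1 : ℝ)).indicator (fun r => r ^ γ) r) := by
  by_cases h : r ∈ Set.Iio (1 : ℝ)
  · rw [Set.indicator_of_mem h]
    have h1 : (1 + r ^ 2) ^ (-(γ / 2)) ≤ 2 ^ (-(γ / 2)) :=
      Real.rpow_le_rpow (by positivity) (by nlinarith [Set.mem_Iio.1 h]) (by linarith)
    have h2 : 0 ≤ r ^ γ := Real.rpow_nonneg hr γ
    have h3 : (0 : ℝ) < 2 ^ (-(γ / 2)) := by positivity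
    nlinarith
  · rw [Set.indicator_of_notMem h, add_zero, mul_one]
    have hr1 : 1 ≤ r := not_lt.1 h
    have h1 : (1 + r ^ 2) ^ (-(γ / 2)) ≤ (2 * r ^ 2) ^ (-(γ / 2)) :=
      Real.rpow_le_rpow (by positivity) (by nlinarith) (by linarith)
    have h0 : 0 < r := by linarith
    calc r ^ γ * (1 + r ^ 2) ^ (-(γ / 2)) ≤ r ^ γ * (2 * r ^ 2) ^ (-(γ / 2)) := by gcongr
      _ = 2 ^ (-(γ / 2)) * (r ^ γ * r ^ (-γ)) := by
        rw [Real.mul_rpow (by norm_num) (by positivity), ← Real.rpow_natCast, ← Real.rpow_mul hr]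
        push_cast
        rw [show (2 : ℝ) * -(γ / 2) = -γ by ring]
        ring
      _ = _ := by rw [← Real.rpow_add h0]; simp

/-- Peetre's inequality extracts (1 + |x|²)^{γ/2}. What remains is |z|^γ (1 + |z|²)^{-γ/2}, bounded
away from 0 and integrable near it because γ > −3, and a power of 1 + |x + z|² absorbed by half of
the Gaussian. -/
lemma exists_lintegral_rpow_gauss {γ δ : ℝ} (hγ : -3 < γ) (hγ0 : γ ≤ 0) (hδ : 0 < δ) :
    ∃ C : ℝ≥0∞, C ≠ ⊤ ∧ ∀ x : Vel, ∫⁻ z : Vel, ENNReal.ofReal (‖z‖ ^ γ) *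
      ENNReal.ofReal (Real.exp (-(δ * ‖x + z‖ ^ 2))) ≤
        C * ENNReal.ofReal ((1 + ‖x‖ ^ 2) ^ (γ / 2)) := by
  obtain ⟨C₀, hC₀, h0⟩ := exists_rpow_le_exp (a := -(γ / 2)) (half_pos hδ)
  set A := 2 ^ (-(γ / 2)) * (2 ^ (-(γ / 2)) * C₀) with hA
  have hA0 : 0 < A := by positivity
  set K := ∫⁻ z : Vel, (Set.Iio (1 : ℝ)).indicator (fun r => ENNReal.ofReal (r ^ γ)) ‖z‖ with hK
  set G := ∫⁻ z : Vel, ENNReal.ofReal (Real.exp (-(δ / 2 * ‖z‖ ^ 2))) with hG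
  refine ⟨ENNReal.ofReal A * (G + K), ENNReal.mul_ne_top ENNReal.ofReal_ne_top
    (ENNReal.add_ne_top.2 ⟨lintegral_gauss_ne_top (half_pos hδ), lintegral_rpow_ball_ne_top hγ⟩),
    fun x => ?_⟩
  set X := (1 + ‖x‖ ^ 2) ^ (γ / 2) with hX
  have hX0 : 0 < X := by positivity
  have hmeas : Measurable ((Set.Iio (1 : ℝ)).indicator (fun r => ENNReal.ofReal (r ^ γ))) :=
    (by fun_prop : Measurable fun r : ℝ => ENNReal.ofReal (r ^ γ)).indicator measurableSet_Iio
  have key : ∀ z : Vel, ENNReal.ofReal (‖z‖ ^ γ) *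
      ENNReal.ofReal (Real.exp (-(δ * ‖x + z‖ ^ 2))) ≤ ENNReal.ofReal (X * A) *
        (ENNReal.ofReal (Real.exp (-(δ / 2 * ‖x + z‖ ^ 2))) +
          (Set.Iio (1 : ℝ)).indicator (fun r => ENNReal.ofReal (r ^ γ)) ‖z‖) := by
    intro z
    have e1 : ‖z‖ ^ γ * Real.exp (-(δ * ‖x + z‖ ^ 2)) ≤ X * A *
        ((1 + (Set.Iio (1 : ℝ)).indicator (fun r => r ^ γ) ‖z‖) *
          Real.exp (-(δ / 2 * ‖x + z‖ ^ 2))) := by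
      have a1 : 1 ≤ X * (2 ^ (-(γ / 2)) * ((1 + ‖z‖ ^ 2) ^ (-(γ / 2)) *
          (1 + ‖x + z‖ ^ 2) ^ (-(γ / 2)))) := by
        rw [← Real.mul_rpow (by positivity) (by positivity),
          ← Real.mul_rpow (by positivity) (by positivity)]
        have := Real.rpow_le_rpow (by positivity) (one_add_norm_sq_le x z)
          (by linarith : 0 ≤ -(γ / 2))
        calc 1 = X * (1 + ‖x‖ ^ 2) ^ (-(γ / 2)) := by
              rw [hX, ← Real.rpow_add (by positivity)]; simp
          _ ≤ _ := by gcongr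
      have a2 := rpow_mul_rpow_le hγ0 ‖z‖ (norm_nonneg z)
      have a3 := h0 (‖x + z‖ ^ 2) (by positivity)
      have a4 : Real.exp (-(δ * ‖x + z‖ ^ 2)) = Real.exp (-(δ / 2 * ‖x + z‖ ^ 2)) *
          Real.exp (-(δ / 2 * ‖x + z‖ ^ 2)) := by rw [← Real.exp_add]; ring_nf
      have a5 : Real.exp (δ / 2 * ‖x + z‖ ^ 2) * Real.exp (-(δ / 2 * ‖x + z‖ ^ 2)) = 1 := by
        rw [← Real.exp_add]; simp
      set E := Real.exp (-(δ / 2 * ‖x + z‖ ^ 2)) with hE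
      have hE0 : 0 < E := Real.exp_pos _
      rw [a4]
      have hz : 0 ≤ ‖z‖ ^ γ := Real.rpow_nonneg (norm_nonneg z) γ
      have hi : 0 ≤ (Set.Iio (1 : ℝ)).indicator (fun r => r ^ γ) ‖z‖ := by
        by_cases h : ‖z‖ ∈ Set.Iio (1 : ℝ)
        · rwa [Set.indicator_of_mem h]
        · rw [Set.indicator_of_notMem h]
      calc ‖z‖ ^ γ * (E * E) ≤ ‖z‖ ^ γ * (E * E) * (X * (2 ^ (-(γ / 2)) *
            ((1 + ‖z‖ ^ 2) ^ (-(γ / 2)) * (1 + ‖x + z‖ ^ 2) ^ (-(γ / 2))))) :=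
            le_mul_of_one_le_right (by positivity) a1
        _ = X * 2 ^ (-(γ / 2)) * (‖z‖ ^ γ * (1 + ‖z‖ ^ 2) ^ (-(γ / 2))) *
            ((1 + ‖x + z‖ ^ 2) ^ (-(γ / 2)) * E) * E := by ring
        _ ≤ X * 2 ^ (-(γ / 2)) * (2 ^ (-(γ / 2)) *
            (1 + (Set.Iio (1 : ℝ)).indicator (fun r => r ^ γ) ‖z‖)) *
            ((C₀ * Real.exp (δ / 2 * ‖x + z‖ ^ 2)) * E) * E := by gcongr
        _ = _ := by rw [mul_assoc C₀, a5, hA]; ring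
    have hi : ENNReal.ofReal ((Set.Iio (1 : ℝ)).indicator (fun r => r ^ γ) ‖z‖) =
        (Set.Iio (1 : ℝ)).indicator (fun r => ENNReal.ofReal (r ^ γ)) ‖z‖ := by
      by_cases h : ‖z‖ ∈ Set.Iio (1 : ℝ)
      · rw [Set.indicator_of_mem h, Set.indicator_of_mem h]
      · rw [Set.indicator_of_notMem h, Set.indicator_of_notMem h, ENNReal.ofReal_zero]
    rw [← ENNReal.ofReal_mul (Real.rpow_nonneg (norm_nonneg z) γ)]
    refine (ENNReal.ofReal_le_ofReal e1).trans ?_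
    rw [ENNReal.ofReal_mul (by positivity), add_mul, one_mul]
    gcongr
    refine ENNReal.ofReal_add_le.trans ?_
    gcongr
    rw [← hi]
    refine ENNReal.ofReal_le_ofReal (mul_le_of_le_one_right ?_ ?_)
    · by_cases h : ‖z‖ ∈ Set.Iio (1 : ℝ)
      · rw [Set.indicator_of_mem h]; exact Real.rpow_nonneg (norm_nonneg z) γ
      · rw [Set.indicator_of_notMem h]
    · exact Real.exp_le_one_iff.2 (by have := hδ.le; simp only [Left.neg_nonpos_iff]; positivity)
  refine (lintegral_mono key).trans ?_
  rw [lintegral_const_mul _ (by fun_prop), lintegral_add_left (by fun_prop),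
    ENNReal.ofReal_mul hX0.le]
  have htr : ∫⁻ z : Vel, ENNReal.ofReal (Real.exp (-(δ / 2 * ‖x + z‖ ^ 2))) = G :=
    lintegral_add_left_eq_self
      (fun z : Vel => ENNReal.ofReal (Real.exp (-(δ / 2 * ‖z‖ ^ 2)))) x
  rw [htr]
  exact le_of_eq (by ring)

lemma lintegral_mul_le_sqrt {f g : Vel → ℝ≥0∞} (hf : AEMeasurable f volume)
    (hg : AEMeasurable g volume) :
    ∫⁻ x, f x * g x ≤ (∫⁻ x, f x ^ 2) ^ (1 / 2 : ℝ) * (∫⁻ x, g x ^ 2) ^ (1 / 2 : ℝ) := by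
  have := ENNReal.lintegral_mul_le_Lp_mul_Lq volume Real.HolderConjugate.two_two hf hg
  simpa using this

/-- For fixed ω the integrand sees z through the Gaussian and its projection on the line ℝω, so two
variables integrate out. Off the ball of radius ε the missing Jacobian s² costs only ε⁻²;
integrating over ω gives an integral over ℝ³, to which Cauchy–Schwarz applies. -/
lemma exists_line_bound {δ ε : ℝ} (hδ : 0 < δ) (hε : 0 < ε) :
    ∃ C : ℝ≥0∞, C ≠ ⊤ ∧ ∀ F : Vel → ℝ≥0∞, Measurable F →
      ∫⁻ ω : S2, (∫⁻ z : Vel, ENNReal.ofReal (Real.exp (-(δ * ‖z‖ ^ 2))) *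
        ({y : Vel | ε ≤ ‖y‖}.indicator F (parC (z, ω))) ∂volume) ∂sphereM ≤
        C * (∫⁻ x, F x ^ 2) ^ (1 / 2 : ℝ) := by
  set P := ∫⁻ p : ℝ × ℝ, ENNReal.ofReal (Real.exp (-(δ * (p.1 ^ 2 + p.2 ^ 2)))) with hP
  have hPt : P ≠ ⊤ := by
    have h1 : ∫⁻ s : ℝ, ENNReal.ofReal (Real.exp (-(δ * s ^ 2))) ≠ ⊤ := by
      have := (integrable_exp_neg_mul_sq hδ).2
      rw [hasFiniteIntegral_iff_ofReal (.of_forall fun _ => Real.exp_nonneg _)] at this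
      simpa only [neg_mul] using this.ne
    have h2 : P = ∫⁻ p : ℝ × ℝ, ENNReal.ofReal (Real.exp (-(δ * p.1 ^ 2))) *
        ENNReal.ofReal (Real.exp (-(δ * p.2 ^ 2))) := by
      refine lintegral_congr fun p => ?_
      rw [← ENNReal.ofReal_mul (Real.exp_nonneg _), ← Real.exp_add]
      ring_nf
    rw [h2, Measure.volume_eq_prod, lintegral_prod_mul
      (f := fun s : ℝ => ENNReal.ofReal (Real.exp (-(δ * s ^ 2))))
      (g := fun s : ℝ => ENNReal.ofReal (Real.exp (-(δ * s ^ 2)))) (by fun_prop) (by fun_prop)]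
    exact ENNReal.mul_ne_top h1 h1
  set D := ENNReal.ofReal ((ε ^ 2)⁻¹) with hD
  set Q := (∫⁻ x : Vel, ENNReal.ofReal (Real.exp (-(δ * ‖x‖ ^ 2))) ^ 2) ^ (1 / 2 : ℝ) with hQ
  have hQt : Q ≠ ⊤ := by
    refine ENNReal.rpow_ne_top_of_nonneg (by norm_num) ?_
    have : ∫⁻ x : Vel, ENNReal.ofReal (Real.exp (-(δ * ‖x‖ ^ 2))) ^ 2 =
        ∫⁻ x : Vel, ENNReal.ofReal (Real.exp (-(2 * δ * ‖x‖ ^ 2))) := by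
      refine lintegral_congr fun x => ?_
      rw [sq, ← ENNReal.ofReal_mul (Real.exp_nonneg _), ← Real.exp_add]
      ring_nf
    rw [this]
    exact lintegral_gauss_ne_top (by positivity)
  refine ⟨P * (D * (2 * Q)), ?_, fun F hF => ?_⟩
  · exact ENNReal.mul_ne_top hPt (ENNReal.mul_ne_top ENNReal.ofReal_ne_top
      (ENNReal.mul_ne_top (by simp) hQt))
  have hI : Measurable ({y : Vel | ε ≤ ‖y‖}.indicator F) :=
    hF.indicator (measurableSet_le measurable_const measurable_norm)
  have e1 : ∀ ω : S2, ∫⁻ z : Vel, ENNReal.ofReal (Real.exp (-(δ * ‖z‖ ^ 2))) *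
        ({y : Vel | ε ≤ ‖y‖}.indicator F (parC (z, ω))) ≤
      P * (D * ∫⁻ s : ℝ, ENNReal.ofReal (s ^ 2) *
        (ENNReal.ofReal (Real.exp (-(δ * ‖s • (ω : Vel)‖ ^ 2))) * F (s • (ω : Vel)))) := by
    intro ω
    have := lintegral_cyl_gauss (δ := δ)
      (H := fun s => {y : Vel | ε ≤ ‖y‖}.indicator F (s • (ω : Vel))) (by fun_prop) ω
    simp only [parC]
    rw [this]
    gcongr
    rw [← lintegral_const_mul _ (by fun_prop)]
    refine lintegral_mono fun s => ?_
    have hn : ‖s • (ω : Vel)‖ = |s| := by rw [norm_smul, norm_S2, mul_one, Real.norm_eq_abs]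
    by_cases h : s • (ω : Vel) ∈ {y : Vel | ε ≤ ‖y‖}
    · rw [Set.indicator_of_mem h, hn, sq_abs, ← mul_assoc, hD,
        ← ENNReal.ofReal_mul (by positivity)]
      refine le_mul_of_one_le_left' ?_
      rw [ENNReal.one_le_ofReal]
      have h' : ε ≤ |s| := hn ▸ h
      rw [inv_mul_eq_div, one_le_div (by positivity), ← sq_abs s]
      gcongr
    · rw [Set.indicator_of_notMem h, mul_zero]
      exact zero_le
  refine (lintegral_mono e1).trans ?_
  have hm : Measurable fun ω : S2 => ∫⁻ s : ℝ, ENNReal.ofReal (s ^ 2) *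
      (ENNReal.ofReal (Real.exp (-(δ * ‖s • (ω : Vel)‖ ^ 2))) * F (s • (ω : Vel))) :=
    Measurable.lintegral_prod_right' (f := fun x : S2 × ℝ => ENNReal.ofReal (x.2 ^ 2) *
      (ENNReal.ofReal (Real.exp (-(δ * ‖x.2 • (x.1 : Vel)‖ ^ 2))) * F (x.2 • (x.1 : Vel))))
      (by fun_prop)
  rw [lintegral_const_mul _ (by fun_prop), lintegral_const_mul _ hm,
    lintegral_line_sphere (F := fun x => ENNReal.ofReal (Real.exp (-(δ * ‖x‖ ^ 2))) * F x)
      (by fun_prop)]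
  calc _ ≤ P * (D * (2 * (Q * (∫⁻ x, F x ^ 2) ^ (1 / 2 : ℝ)))) := by
        gcongr
        exact lintegral_mul_le_sqrt (by fun_prop) hF.aemeasurable
    _ = _ := by ring

end Gaussian


/-! ### Collision displacements and the reversal of collisions. -/

/-- A displacement `y(z, ω)` of the velocity in a collision, with the involution of the
collision variables which reverses the collision. -/
structure Shift where
  /-- the displacement -/
  y : Vel × S2 → Vel
  /-- the reversal of the collision -/
  ρ : Vel × S2 → Vel × S2
  meas : Measurable y
  mp : MeasurePreserving ρ collMeasure collMeasure
  -- Energy conservation in disguise: y lies on the sphere with diameter [0, z].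
  inner_y : ∀ ξ, inner ℝ ξ.1 (y ξ) = ‖y ξ‖ ^ 2
  ρ_fst : ∀ ξ, (ρ ξ).1 = ξ.1 - (2 : ℝ) • y ξ
  y_ρ : ∀ ξ, y (ρ ξ) = -y ξ
  inner_ρ : ∀ ξ, inner ℝ (ρ ξ).1 ((ρ ξ).2 : Vel) = inner ℝ ξ.1 (ξ.2 : Vel)

section Shifts

variable (s : Shift)

lemma Shift.norm_ρ (ξ : Vel × S2) : ‖(s.ρ ξ).1‖ = ‖ξ.1‖ := by
  have h : ‖(s.ρ ξ).1‖ ^ 2 = ‖ξ.1‖ ^ 2 := by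
    rw [s.ρ_fst, norm_sub_sq_real, inner_smul_right, s.inner_y, norm_smul]
    norm_num
    ring
  exact (pow_left_inj₀ (norm_nonneg _) (norm_nonneg _) two_ne_zero).1 h

lemma Shift.norm_y_le (ξ : Vel × S2) : ‖s.y ξ‖ ≤ ‖ξ.1‖ := by
  have h := real_inner_le_norm ξ.1 (s.y ξ)
  rw [s.inner_y] at h
  by_contra! hlt
  nlinarith [norm_nonneg ξ.1]

/-- Conservation of energy. -/
lemma Shift.energy (v c : Vel) (ξ : Vel × S2) :
    ‖v + s.y ξ - c‖ ^ 2 + ‖v + ξ.1 - s.y ξ - c‖ ^ 2 = ‖v - c‖ ^ 2 + ‖v + ξ.1 - c‖ ^ 2 := by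
  have h := s.inner_y ξ
  have e1 : v + s.y ξ - c = (v - c) + s.y ξ := by abel
  have e2 : v + ξ.1 - s.y ξ - c = (v - c) + ξ.1 - s.y ξ := by abel
  have e3 : v + ξ.1 - c = (v - c) + ξ.1 := by abel
  rw [e1, e2, e3, norm_sub_sq_real, norm_add_sq_real, norm_add_sq_real, inner_add_left, h]
  ring

lemma measurable_parC : Measurable parC := by
  unfold parC
  fun_prop

lemma inner_parC (ξ : Vel × S2) : inner ℝ ξ.1 (parC ξ) = ‖parC ξ‖ ^ 2 := by
  rw [parC, inner_smul_right, norm_smul, norm_S2, mul_one, Real.norm_eq_abs, sq_abs, sq]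

lemma norm_parC (ξ : Vel × S2) : ‖parC ξ‖ = |inner ℝ ξ.1 (ξ.2 : Vel)| := by
  rw [parC, norm_smul, norm_S2, mul_one, Real.norm_eq_abs]

lemma inner_parC_right (ξ : Vel × S2) :
    inner ℝ (parC ξ) (ξ.2 : Vel) = inner ℝ ξ.1 (ξ.2 : Vel) := by
  rw [parC, inner_smul_left]
  simp

/-- For each fixed ω this is the reflection in the plane orthogonal to ω. -/
lemma measurePreserving_parReflection :
    MeasurePreserving (fun ξ : Vel × S2 => (ξ.1 - (2 : ℝ) • parC ξ, ξ.2))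
      collMeasure collMeasure := by
  have h : MeasurePreserving
      (fun x : S2 × Vel => (x.1, x.2 - (2 : ℝ) • parC (x.2, x.1)))
      (sphereM.prod volume) (sphereM.prod volume) := by
    refine MeasurePreserving.skew_product (f := id)
      (g := fun (ω : S2) (z : Vel) => z - (2 : ℝ) • parC (z, ω)) (MeasurePreserving.id _) ?_
      (.of_forall fun ω => ?_)
    · have := measurable_parC
      exact measurable_snd.sub ((this.comp measurable_swap).const_smul (2 : ℝ))
    · have e := (Submodule.reflection (ℝ ∙ (ω : Vel))ᗮ).measurePreserving.map_eq
      convert e using 2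
      funext z
      rw [Submodule.reflection_orthogonal_apply, Submodule.reflection_singleton_apply, parC]
      simp [real_inner_comm, smul_smul]
      module
  exact (Measure.measurePreserving_swap.comp h).comp Measure.measurePreserving_swap

lemma measurePreserving_neg_fst :
    MeasurePreserving (fun ξ : Vel × S2 => (-ξ.1, ξ.2)) collMeasure collMeasure :=
  (Measure.measurePreserving_neg (volume : Measure Vel)).prod (MeasurePreserving.id _)

lemma measurePreserving_neg_snd :
    MeasurePreserving (fun ξ : Vel × S2 => (ξ.1, -ξ.2)) collMeasure collMeasure :=
  (MeasurePreserving.id (volume : Measure Vel)).prod measurePreserving_neg_sphere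

/-- The displacement `v' - v`. -/
noncomputable def parS : Shift where
  y := parC
  ρ ξ := (ξ.1 - (2 : ℝ) • parC ξ, -ξ.2)
  meas := measurable_parC
  mp := measurePreserving_neg_snd.comp measurePreserving_parReflection
  inner_y := inner_parC
  ρ_fst _ := rfl
  y_ρ ξ := by
    have h := inner_parC_right ξ
    simp only [parC, Metric.sphere, inner_sub_left, inner_smul_left] at h ⊢
    simp
    module
  inner_ρ ξ := by
    have h := inner_parC_right ξ
    simp only [coe_neg_sphere, inner_neg_right, inner_sub_left, inner_smul_left, h]
    simp
    ring

/-- The displacement `u' - v`. -/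
noncomputable def perpS : Shift where
  y ξ := ξ.1 - parC ξ
  ρ ξ := (-(ξ.1 - (2 : ℝ) • parC ξ), ξ.2)
  meas := measurable_fst.sub measurable_parC
  mp := measurePreserving_neg_fst.comp measurePreserving_parReflection
  inner_y ξ := by
    rw [inner_sub_right, inner_parC, norm_sub_sq_real, inner_parC, real_inner_self_eq_norm_sq]
    ring
  ρ_fst ξ := by simp only; module
  y_ρ ξ := by
    have h := inner_parC_right ξ
    simp only [parC, inner_neg_left, inner_sub_left, inner_smul_left] at h ⊢
    simp
    module
  inner_ρ ξ := by
    have h := inner_parC_right ξ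
    simp only [inner_neg_left, inner_sub_left, inner_smul_left, h]
    simp
    ring

/-- The displacement `u - v`. -/
noncomputable def fullS : Shift where
  y ξ := ξ.1
  ρ ξ := (-ξ.1, -ξ.2)
  meas := measurable_fst
  mp := measurePreserving_neg_snd.comp measurePreserving_neg_fst
  inner_y ξ := real_inner_self_eq_norm_sq _
  ρ_fst ξ := by simp only; module
  y_ρ ξ := rfl
  inner_ρ ξ := by simp

/-- The displacement `0`. -/
noncomputable def zeroS : Shift where
  y _ := 0
  ρ ξ := ξ
  meas := measurable_const
  mp := MeasurePreserving.id _
  inner_y ξ := by simp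
  ρ_fst ξ := by simp
  y_ρ ξ := by simp
  inner_ρ ξ := rfl

end Shifts

/-! ### The common majorant of the collision kernels. -/

section Majorant

/-- The weight `(1 + |v - c|²)^{-κ/2}`. -/
noncomputable def mW (κ : ℝ) (c v : Vel) : ℝ := (1 + ‖v - c‖ ^ 2) ^ (-(κ / 2))

/-- The Gaussian `e^{-δ|v - c|²}`. -/
noncomputable def gau (δ : ℝ) (c v : Vel) : ℝ := Real.exp (-(δ * ‖v - c‖ ^ 2))

/-- The majorant of the collision kernels. -/
noncomputable def maj (κ δ : ℝ) (c : Vel) (s : Shift) (v : Vel) (ξ : Vel × S2) : ℝ :=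
  mW κ c v * (‖ξ.1‖ ^ (κ - 1) * |inner ℝ ξ.1 (ξ.2 : Vel)|) *
    (gau δ c (v + ξ.1) * gau δ c (v + ξ.1 - s.y ξ))

/-- The integral operator with kernel `maj`, cut off to the set `E` of pairs of a velocity and a
displacement. -/
noncomputable def majOp (κ δ : ℝ) (c : Vel) (s : Shift) (E : Set (Vel × Vel)) (F : Vel → ℝ≥0∞)
    (v : Vel) : ℝ≥0∞ :=
  ∫⁻ ξ, ENNReal.ofReal (maj κ δ c s v ξ) *
    E.indicator (fun p => F (p.1 + p.2)) (v, s.y ξ) ∂collMeasure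

variable {κ δ : ℝ} {c : Vel}

@[fun_prop]
lemma continuous_mW : Continuous (mW κ c) := by
  unfold mW
  exact Continuous.rpow_const (by fun_prop) fun v => Or.inl (by positivity)

@[fun_prop]
lemma continuous_gau : Continuous (gau δ c) := by
  unfold gau
  fun_prop

lemma mW_pos (v : Vel) : 0 < mW κ c v := by unfold mW; positivity

lemma gau_pos (v : Vel) : 0 < gau δ c v := Real.exp_pos _

lemma gau_le_one (hδ : 0 < δ) (v : Vel) : gau δ c v ≤ 1 := by
  unfold gau
  exact Real.exp_le_one_iff.2 (by simp only [Left.neg_nonpos_iff]; positivity)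

lemma one_le_mW (hκ0 : κ < 0) (v : Vel) : 1 ≤ mW κ c v :=
  Real.one_le_rpow (by nlinarith [sq_nonneg ‖v - c‖]) (by linarith)

lemma maj_nonneg (s : Shift) (v : Vel) (ξ : Vel × S2) : 0 ≤ maj κ δ c s v ξ := by
  unfold maj
  have := (mW_pos (κ := κ) (c := c) v).le
  have h1 := (gau_pos (δ := δ) (c := c) (v + ξ.1)).le
  have h2 := (gau_pos (δ := δ) (c := c) (v + ξ.1 - s.y ξ)).le
  positivity

lemma measurable_maj (s : Shift) :
    Measurable fun x : Vel × (Vel × S2) => maj κ δ c s x.1 x.2 := by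
  have hy : Measurable fun x : Vel × (Vel × S2) => s.y x.2 := s.meas.comp measurable_snd
  have m1 : Measurable (mW κ c) := continuous_mW.measurable
  have m2 : Measurable (gau δ c) := continuous_gau.measurable
  unfold maj
  fun_prop

/-- By energy conservation |v + y − c|² ≤ |v − c|² + |u − c|² with u = v + z, so 1 + |v + y − c|² is
at most the product of the two corresponding weights. -/
lemma mW_add_le (hκ0 : κ < 0) (s : Shift) (v : Vel) (ξ : Vel × S2) :
    mW κ c (v + s.y ξ) ≤ mW κ c v * mW κ c (v + ξ.1) := by
  unfold mW
  rw [← Real.mul_rpow (by positivity) (by positivity)]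
  refine Real.rpow_le_rpow (by positivity) ?_ (by linarith)
  have h := s.energy v c ξ
  nlinarith [sq_nonneg ‖v + ξ.1 - s.y ξ - c‖,
    mul_nonneg (sq_nonneg ‖v - c‖) (sq_nonneg ‖v + ξ.1 - c‖)]

lemma exists_mW_mul_gau_le (hδ : 0 < δ) :
    ∃ C : ℝ, 0 < C ∧ ∀ v, mW κ c v * gau δ c v ≤ C * gau (δ / 2) c v := by
  obtain ⟨C, hC, h⟩ := exists_rpow_le_exp (a := -(κ / 2)) (half_pos hδ)
  refine ⟨C, hC, fun v => ?_⟩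
  have h1 := h (‖v - c‖ ^ 2) (by positivity)
  have h2 : gau δ c v = gau (δ / 2) c v * gau (δ / 2) c v := by
    unfold gau
    rw [← Real.exp_add]; ring_nf
  have h3 : Real.exp (δ / 2 * ‖v - c‖ ^ 2) * gau (δ / 2) c v = 1 := by
    unfold gau
    rw [← Real.exp_add]; simp
  have h4 := (gau_pos (δ := δ / 2) (c := c) v).le
  calc mW κ c v * gau δ c v ≤ C * Real.exp (δ / 2 * ‖v - c‖ ^ 2) * gau δ c v := by
        have := (gau_pos (δ := δ) (c := c) v).le
        unfold mW
        gcongr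
    _ = C * (Real.exp (δ / 2 * ‖v - c‖ ^ 2) * gau (δ / 2) c v) * gau (δ / 2) c v := by
        rw [h2]; ring
    _ = _ := by rw [h3, mul_one]

lemma rpow_mul_inner_le (κ : ℝ) (ξ : Vel × S2) :
    ‖ξ.1‖ ^ (κ - 1) * |inner ℝ ξ.1 (ξ.2 : Vel)| ≤ ‖ξ.1‖ ^ κ := by
  rcases eq_or_ne ξ.1 0 with h | h
  · rw [h, inner_zero_left, abs_zero, mul_zero]
    positivity
  · have h0 : 0 < ‖ξ.1‖ := norm_pos_iff.2 h
    have h1 := abs_real_inner_le_norm ξ.1 (ξ.2 : Vel)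
    rw [norm_S2, mul_one] at h1
    calc ‖ξ.1‖ ^ (κ - 1) * |inner ℝ ξ.1 (ξ.2 : Vel)| ≤ ‖ξ.1‖ ^ (κ - 1) * ‖ξ.1‖ := by gcongr
      _ = ‖ξ.1‖ ^ κ := by
        rw [← Real.rpow_add_one h0.ne']; ring_nf

lemma mW_mul_rpow (v : Vel) : mW κ c v * (1 + ‖v - c‖ ^ 2) ^ (κ / 2) = 1 := by
  unfold mW
  rw [← Real.rpow_add (by positivity)]
  simp

/-- The integral of `|z|^γ e^{-δ|v + z - c|²}` over the collision variables. -/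
lemma exists_lintegral_coll_gauss {γ : ℝ} (c : Vel) (hγ : -3 < γ) (hγ0 : γ ≤ 0) (hδ : 0 < δ) :
    ∃ C : ℝ≥0∞, C ≠ ⊤ ∧ ∀ v : Vel, ∫⁻ ξ, ENNReal.ofReal (‖ξ.1‖ ^ γ * gau δ c (v + ξ.1))
      ∂collMeasure ≤ C * ENNReal.ofReal ((1 + ‖v - c‖ ^ 2) ^ (γ / 2)) := by
  obtain ⟨C, hC, h⟩ := exists_lintegral_rpow_gauss hγ hγ0 hδ
  refine ⟨C * sphereM Set.univ, ENNReal.mul_ne_top hC (measure_ne_top _ _), fun v => ?_⟩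
  have m2 : Measurable (gau δ c) := continuous_gau.measurable
  rw [collMeasure, lintegral_prod _ (by fun_prop)]
  simp only [lintegral_const]
  rw [lintegral_mul_const _ (by fun_prop)]
  have e : ∀ z : Vel, ENNReal.ofReal (‖z‖ ^ γ * gau δ c (v + z)) = ENNReal.ofReal (‖z‖ ^ γ) *
      ENNReal.ofReal (Real.exp (-(δ * ‖(v - c) + z‖ ^ 2))) := by
    intro z
    rw [ENNReal.ofReal_mul (by positivity), gau]
    congr 6
    abel_nf
  simp only [e]
  calc _ ≤ (C * ENNReal.ofReal ((1 + ‖v - c‖ ^ 2) ^ (γ / 2))) * sphereM Set.univ := by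
        gcongr
        exact h (v - c)
    _ = _ := by ring

end Majorant


/-! ### Schur's test. -/

instance : SFinite collMeasure :=
  Measure.prod.instSFinite (μ := (volume : Measure Vel)) (ν := sphereM)

section Schur

variable {κ δ : ℝ} {c : Vel}

lemma lintegral_mul_sq_le {X : Type*} [MeasurableSpace X] (μ : Measure X) {k F : X → ℝ≥0∞}
    (hk : Measurable k) (hF : Measurable F) :
    (∫⁻ x, k x * F x ∂μ) ^ 2 ≤ (∫⁻ x, k x ∂μ) * ∫⁻ x, k x * F x ^ 2 ∂μ := by
  have hk2 : ∀ x, k x ^ (1 / 2 : ℝ) * k x ^ (1 / 2 : ℝ) = k x := fun x => by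
    rw [← ENNReal.rpow_add_of_nonneg _ _ (by norm_num) (by norm_num)]
    norm_num
  have h := ENNReal.lintegral_mul_le_Lp_mul_Lq μ Real.HolderConjugate.two_two
    (f := fun x => k x ^ (1 / 2 : ℝ)) (g := fun x => k x ^ (1 / 2 : ℝ) * F x)
    (by fun_prop) (by fun_prop)
  have e1 : ∀ x, ((fun x => k x ^ (1 / 2 : ℝ)) * fun x => k x ^ (1 / 2 : ℝ) * F x) x =
      k x * F x := fun x => by simp only [Pi.mul_apply]; rw [← mul_assoc, hk2]
  have e2 : ∀ x, (k x ^ (1 / 2 : ℝ)) ^ (2 : ℝ) = k x := fun x => by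
    rw [← ENNReal.rpow_mul]; norm_num
  have e3 : ∀ x, (k x ^ (1 / 2 : ℝ) * F x) ^ (2 : ℝ) = k x * F x ^ 2 := fun x => by
    rw [ENNReal.mul_rpow_of_nonneg _ _ (by norm_num), e2]; norm_num
  simp only [e1, e2, e3] at h
  refine (pow_le_pow_left' h 2).trans_eq ?_
  rw [mul_pow, ← ENNReal.rpow_natCast, ← ENNReal.rpow_natCast, ← ENNReal.rpow_mul,
    ← ENNReal.rpow_mul]
  norm_num

lemma measurable_maj_indicator (s : Shift) {E : Set (Vel × Vel)} (hE : MeasurableSet E)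
    {F : Vel → ℝ≥0∞} (hF : Measurable F) :
    Measurable fun x : Vel × (Vel × S2) => ENNReal.ofReal (maj κ δ c s x.1 x.2) *
      E.indicator (fun p => F (p.1 + p.2)) (x.1, s.y x.2) := by
  have h1 : Measurable (E.indicator (fun p : Vel × Vel => F (p.1 + p.2))) :=
    (hF.comp (measurable_fst.add measurable_snd)).indicator hE
  exact (measurable_maj s).ennreal_ofReal.mul
    (h1.comp (measurable_fst.prodMk (s.meas.comp measurable_snd)))

lemma measurable_majOp (s : Shift) {E : Set (Vel × Vel)} (hE : MeasurableSet E)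
    {F : Vel → ℝ≥0∞} (hF : Measurable F) : Measurable (majOp κ δ c s E F) :=
  (measurable_maj_indicator s hE hF).lintegral_prod_right'

lemma majOp_mono (s : Shift) {E E' : Set (Vel × Vel)} (h : E ⊆ E') (F : Vel → ℝ≥0∞) (v : Vel) :
    majOp κ δ c s E F v ≤ majOp κ δ c s E' F v := by
  unfold majOp
  gcongr

/-- Reversing the collision evaluates the kernel at v + y, where it carries the Gaussians of u and
of u − y. The weight there is at most mW(v) mW(u): the Gaussian of u absorbs the second factor, and
the decay of ∫ |z|^κ e^{-δ|u − c|²/2} cancels the first. -/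
lemma exists_column (s : Shift) (hκ : -3 < κ) (hκ0 : κ < 0) (hδ : 0 < δ) :
    ∃ C : ℝ≥0∞, C ≠ ⊤ ∧ ∀ v, ∫⁻ ξ, ENNReal.ofReal (maj κ δ c s (v - s.y ξ) ξ) ∂collMeasure ≤ C := by
  obtain ⟨C₁, hC₁, h1⟩ := exists_mW_mul_gau_le (κ := κ) (c := c) hδ
  obtain ⟨C, hC, h⟩ := exists_lintegral_coll_gauss c hκ hκ0.le (half_pos hδ)
  refine ⟨ENNReal.ofReal C₁ * C, ENNReal.mul_ne_top ENNReal.ofReal_ne_top hC, fun v => ?_⟩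
  have hm : Measurable fun ξ => ENNReal.ofReal (maj κ δ c s (v - s.y ξ) ξ) :=
    ((measurable_maj s).comp ((measurable_const.sub s.meas).prodMk measurable_id)).ennreal_ofReal
  rw [← s.mp.lintegral_comp hm]
  have key : ∀ ξ, maj κ δ c s (v - s.y (s.ρ ξ)) (s.ρ ξ) ≤
      mW κ c v * C₁ * (‖ξ.1‖ ^ κ * gau (δ / 2) c (v + ξ.1)) := by
    intro ξ
    unfold maj
    rw [s.y_ρ, sub_neg_eq_add, s.norm_ρ, s.inner_ρ, s.ρ_fst]
    have e1 : v + s.y ξ + (ξ.1 - (2 : ℝ) • s.y ξ) = v + ξ.1 - s.y ξ := by module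
    have e2 : v + ξ.1 - s.y ξ - -s.y ξ = v + ξ.1 := by module
    rw [e1, e2]
    have a1 := mW_add_le (c := c) hκ0 s v ξ
    have a2 := rpow_mul_inner_le κ ξ
    have a3 := gau_le_one (c := c) hδ (v + ξ.1 - s.y ξ)
    have a4 := h1 (v + ξ.1)
    have p1 := (gau_pos (δ := δ) (c := c) (v + ξ.1)).le
    have p2 := (gau_pos (δ := δ) (c := c) (v + ξ.1 - s.y ξ)).le
    have p3 := (mW_pos (κ := κ) (c := c) v).le
    have p4 := (mW_pos (κ := κ) (c := c) (v + ξ.1)).le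
    calc _ ≤ mW κ c v * mW κ c (v + ξ.1) * ‖ξ.1‖ ^ κ * (1 * gau δ c (v + ξ.1)) := by gcongr
      _ = mW κ c v * ‖ξ.1‖ ^ κ * (mW κ c (v + ξ.1) * gau δ c (v + ξ.1)) := by ring
      _ ≤ mW κ c v * ‖ξ.1‖ ^ κ * (C₁ * gau (δ / 2) c (v + ξ.1)) := by gcongr
      _ = _ := by ring
  have m2 : Measurable (gau (δ / 2) c) := continuous_gau.measurable
  refine (lintegral_mono fun ξ => ENNReal.ofReal_le_ofReal (key ξ)).trans ?_
  have p3 := (mW_pos (κ := κ) (c := c) v).le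
  simp only [ENNReal.ofReal_mul (mul_nonneg p3 hC₁.le)]
  rw [lintegral_const_mul _ (by fun_prop)]
  refine (mul_le_mul_right (h v) _).trans_eq ?_
  have e := congrArg ENNReal.ofReal (mW_mul_rpow (κ := κ) (c := c) v)
  rw [ENNReal.ofReal_mul p3, ENNReal.ofReal_one] at e
  rw [ENNReal.ofReal_mul p3]
  calc _ = (ENNReal.ofReal (mW κ c v) * ENNReal.ofReal ((1 + ‖v - c‖ ^ 2) ^ (κ / 2))) *
        (ENNReal.ofReal C₁ * C) := by ring
    _ = _ := by rw [e, one_mul]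

lemma exists_row (s : Shift) (hκ : -3 < κ) (hκ0 : κ < 0) (hδ : 0 < δ) :
    ∃ C : ℝ≥0∞, C ≠ ⊤ ∧ ∀ v, majOp κ δ c s Set.univ 1 v ≤ C := by
  obtain ⟨C, hC, h⟩ := exists_lintegral_coll_gauss c hκ hκ0.le hδ
  refine ⟨C, hC, fun v => ?_⟩
  have key : ∀ ξ, maj κ δ c s v ξ ≤ mW κ c v * (‖ξ.1‖ ^ κ * gau δ c (v + ξ.1)) := by
    intro ξ
    unfold maj
    have a2 := rpow_mul_inner_le κ ξ
    have a3 := gau_le_one (c := c) hδ (v + ξ.1 - s.y ξ)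
    have p1 := (gau_pos (δ := δ) (c := c) (v + ξ.1)).le
    have p2 := (gau_pos (δ := δ) (c := c) (v + ξ.1 - s.y ξ)).le
    have p3 := (mW_pos (κ := κ) (c := c) v).le
    calc _ ≤ mW κ c v * ‖ξ.1‖ ^ κ * (gau δ c (v + ξ.1) * 1) := by gcongr
      _ = _ := by ring
  have m2 : Measurable (gau δ c) := continuous_gau.measurable
  have p3 := (mW_pos (κ := κ) (c := c) v).le
  unfold majOp
  simp only [Set.indicator_univ, Pi.one_apply, mul_one]
  refine (lintegral_mono fun ξ => ENNReal.ofReal_le_ofReal (key ξ)).trans ?_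
  simp only [ENNReal.ofReal_mul p3]
  rw [lintegral_const_mul _ (by fun_prop)]
  refine (mul_le_mul_right (h v) _).trans_eq ?_
  have e := congrArg ENNReal.ofReal (mW_mul_rpow (κ := κ) (c := c) v)
  rw [ENNReal.ofReal_mul p3, ENNReal.ofReal_one] at e
  calc _ = (ENNReal.ofReal (mW κ c v) * ENNReal.ofReal ((1 + ‖v - c‖ ^ 2) ^ (κ / 2))) * C := by
        ring
    _ = _ := by rw [e, one_mul]

/-- Schur's test. -/
lemma lintegral_majOp_sq_le (s : Shift) {E : Set (Vel × Vel)} (hE : MeasurableSet E)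
    {F : Vel → ℝ≥0∞} (hF : Measurable F) {R C : ℝ≥0∞} (hR : ∀ v, majOp κ δ c s E 1 v ≤ R)
    (hC : ∀ v, ∫⁻ ξ, ENNReal.ofReal (maj κ δ c s (v - s.y ξ) ξ) ∂collMeasure ≤ C) :
    ∫⁻ v, majOp κ δ c s E F v ^ 2 ≤ R * C * ∫⁻ v, F v ^ 2 := by
  have mE : Measurable (E.indicator (1 : Vel × Vel → ℝ≥0∞)) := measurable_one.indicator hE
  have hmk : ∀ v, Measurable fun ξ => ENNReal.ofReal (maj κ δ c s v ξ) *
      E.indicator 1 (v, s.y ξ) := fun v =>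
    (((measurable_maj s).comp (measurable_const.prodMk measurable_id)).ennreal_ofReal).mul
      (mE.comp (measurable_const.prodMk s.meas))
  have h1 : ∀ v, majOp κ δ c s E F v ^ 2 ≤
      R * ∫⁻ ξ, ENNReal.ofReal (maj κ δ c s v ξ) * F (v + s.y ξ) ^ 2 ∂collMeasure := by
    intro v
    have e1 : majOp κ δ c s E F v = ∫⁻ ξ, (ENNReal.ofReal (maj κ δ c s v ξ) *
        E.indicator 1 (v, s.y ξ)) * F (v + s.y ξ) ∂collMeasure := by
      refine lintegral_congr fun ξ => ?_
      by_cases h : (v, s.y ξ) ∈ E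
      · simp [Set.indicator_of_mem h]
      · simp [Set.indicator_of_notMem h]
    rw [e1]
    refine (lintegral_mul_sq_le _ (hmk v) (hF.comp (measurable_const.add s.meas))).trans ?_
    gcongr
    · exact hR v
    · refine mul_le_of_le_one_right zero_le ?_
      by_cases h : (v, s.y ‹_›) ∈ E
      · simp [Set.indicator_of_mem h]
      · simp [Set.indicator_of_notMem h]
    · rfl
  have hmF : Measurable fun x : Vel × (Vel × S2) =>
      ENNReal.ofReal (maj κ δ c s x.1 x.2) * F (x.1 + s.y x.2) ^ 2 :=
    (measurable_maj s).ennreal_ofReal.mul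
      ((hF.comp (measurable_fst.add (s.meas.comp measurable_snd))).pow_const 2)
  have hmG : Measurable fun x : Vel × (Vel × S2) =>
      ENNReal.ofReal (maj κ δ c s (x.1 - s.y x.2) x.2) * F x.1 ^ 2 :=
    ((measurable_maj s).comp ((measurable_fst.sub (s.meas.comp measurable_snd)).prodMk
      measurable_snd)).ennreal_ofReal.mul ((hF.comp measurable_fst).pow_const 2)
  refine (lintegral_mono h1).trans ?_
  rw [lintegral_const_mul _ hmF.lintegral_prod_right', mul_assoc]
  gcongr
  rw [lintegral_lintegral_swap hmF.aemeasurable]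
  have h2 : ∀ ξ, ∫⁻ v, ENNReal.ofReal (maj κ δ c s v ξ) * F (v + s.y ξ) ^ 2 =
      ∫⁻ v, ENNReal.ofReal (maj κ δ c s (v - s.y ξ) ξ) * F v ^ 2 := by
    intro ξ
    rw [← lintegral_add_right_eq_self (fun v => ENNReal.ofReal (maj κ δ c s (v - s.y ξ) ξ) *
      F v ^ 2) (s.y ξ)]
    simp
  simp only [h2]
  rw [← lintegral_lintegral_swap hmG.aemeasurable, ← lintegral_const_mul _ (by fun_prop)]
  refine lintegral_mono fun v => ?_
  rw [lintegral_mul_const]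
  · gcongr
    exact hC v
  · exact ((measurable_maj s).comp
      ((measurable_const.sub s.meas).prodMk measurable_id)).ennreal_ofReal

end Schur

/-! ### Decay of the rows and smallness for small displacements. -/

section Decay

variable {κ δ : ℝ} {c : Vel}

lemma gau_mul_gau_le (hδ : 0 < δ) (A y : Vel) :
    gau δ c A * gau δ c (A - y) ≤ gau (δ / 2) c A * Real.exp (-(δ / 4 * ‖y‖ ^ 2)) := by
  unfold gau
  rw [← Real.exp_add, ← Real.exp_add]
  refine Real.exp_le_exp.2 ?_
  have h : ‖y‖ ≤ ‖A - c‖ + ‖A - y - c‖ := by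
    have := norm_sub_le (A - c) (A - y - c)
    rwa [show A - c - (A - y - c) = y by abel] at this
  have h2 : ‖y‖ ^ 2 ≤ 2 * ‖A - c‖ ^ 2 + 2 * ‖A - y - c‖ ^ 2 := by
    nlinarith [norm_nonneg y, sq_nonneg (‖A - c‖ - ‖A - y - c‖)]
  nlinarith [sq_nonneg ‖A - y - c‖, mul_le_mul_of_nonneg_left h2 hδ.le,
    mul_nonneg hδ.le (sq_nonneg ‖A - y - c‖)]

/-- Gain of decay and of smallness near the diagonal of the kernel. -/
lemma exists_row_decay (s : Shift) (hs : ∀ ξ, |inner ℝ ξ.1 (ξ.2 : Vel)| ≤ ‖s.y ξ‖)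
    (hκ : -3 < κ) (hκ0 : κ < 0) (hδ : 0 < δ) :
    ∃ (a : ℝ) (C : ℝ≥0∞), 0 < a ∧ C ≠ ⊤ ∧
      (∀ v, majOp κ δ c s Set.univ 1 v ≤ C * ENNReal.ofReal ((1 + ‖v - c‖ ^ 2) ^ (-(a / 2)))) ∧
      ∀ ε : ℝ, 0 ≤ ε → ∀ v, majOp κ δ c s {p | ‖p.2‖ < ε} 1 v ≤ C * ENNReal.ofReal (ε ^ a) := by
  -- a ≤ 1 allows |z·ω| ≤ |y|^a |z|^{1−a}, and a ≤ (κ + 3)/2 keeps κ − a > −3, so that the more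
  -- singular power is still integrable.
  set a := min 1 ((κ + 3) / 2) with ha
  have ha0 : 0 < a := lt_min one_pos (by linarith)
  have ha1 : a ≤ 1 := min_le_left _ _
  have ha2 : a ≤ (κ + 3) / 2 := min_le_right _ _
  obtain ⟨C₀, hC₀, h0⟩ := exists_rpow_le_exp (a := a) (c := δ / 4) (by positivity)
  obtain ⟨C, hC, h⟩ := exists_lintegral_coll_gauss (γ := κ - a) c (by linarith) (by linarith)
    (half_pos hδ)
  have hexp : ∀ y : ℝ, 0 ≤ y → y ^ a * Real.exp (-(δ / 4 * y ^ 2)) ≤ C₀ := by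
    intro y hy
    have h1 := h0 (y ^ 2) (by positivity)
    have h2 : y ^ a ≤ (1 + y ^ 2) ^ a :=
      Real.rpow_le_rpow hy (by nlinarith [sq_nonneg (y - 1)]) ha0.le
    calc y ^ a * Real.exp (-(δ / 4 * y ^ 2)) ≤
        C₀ * Real.exp (δ / 4 * y ^ 2) * Real.exp (-(δ / 4 * y ^ 2)) := by
          gcongr; exact h2.trans h1
      _ = C₀ := by rw [mul_assoc, ← Real.exp_add]; simp
  have key : ∀ v ξ, maj κ δ c s v ξ ≤ mW κ c v * (‖s.y ξ‖ ^ a *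
      Real.exp (-(δ / 4 * ‖s.y ξ‖ ^ 2))) * (‖ξ.1‖ ^ (κ - a) * gau (δ / 2) c (v + ξ.1)) := by
    intro v ξ
    unfold maj
    have a1 := gau_mul_gau_le (c := c) hδ (v + ξ.1) (s.y ξ)
    have p3 := (mW_pos (κ := κ) (c := c) v).le
    have p1 := (gau_pos (δ := δ / 2) (c := c) (v + ξ.1)).le
    have p4 := (gau_pos (δ := δ) (c := c) (v + ξ.1)).le
    have p5 := (gau_pos (δ := δ) (c := c) (v + ξ.1 - s.y ξ)).le
    have a2 : ‖ξ.1‖ ^ (κ - 1) * |inner ℝ ξ.1 (ξ.2 : Vel)| ≤ ‖ξ.1‖ ^ (κ - a) * ‖s.y ξ‖ ^ a := by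
      rcases eq_or_ne ξ.1 0 with hz | hz
      · rw [hz, inner_zero_left, abs_zero, mul_zero]
        positivity
      have hz0 : 0 < ‖ξ.1‖ := norm_pos_iff.2 hz
      have hy := s.norm_y_le ξ
      have e1 : ‖s.y ξ‖ ≤ ‖s.y ξ‖ ^ a * ‖ξ.1‖ ^ (1 - a) := by
        calc ‖s.y ξ‖ = ‖s.y ξ‖ ^ a * ‖s.y ξ‖ ^ (1 - a) := by
              rw [← Real.rpow_add_of_nonneg (norm_nonneg _) ha0.le (by linarith)]
              simp
          _ ≤ _ := by
              gcongr
      calc ‖ξ.1‖ ^ (κ - 1) * |inner ℝ ξ.1 (ξ.2 : Vel)|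
          ≤ ‖ξ.1‖ ^ (κ - 1) * (‖s.y ξ‖ ^ a * ‖ξ.1‖ ^ (1 - a)) := by
            gcongr; exact (hs ξ).trans e1
        _ = (‖ξ.1‖ ^ (κ - 1) * ‖ξ.1‖ ^ (1 - a)) * ‖s.y ξ‖ ^ a := by ring
        _ = _ := by rw [← Real.rpow_add hz0]; ring_nf
    calc _ ≤ mW κ c v * (‖ξ.1‖ ^ (κ - a) * ‖s.y ξ‖ ^ a) *
          (gau (δ / 2) c (v + ξ.1) * Real.exp (-(δ / 4 * ‖s.y ξ‖ ^ 2))) := by gcongr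
      _ = _ := by ring
  have m2 : Measurable (gau (δ / 2) c) := continuous_gau.measurable
  -- One estimate for both claims. The exponent κ − a gains (1 + |v − c|²)^{-a/2}; the factor |y|^a
  -- e^{-δ|y|²/4} is bounded by a constant always and by ε^a when |y| < ε.
  have row : ∀ (E : Set (Vel × Vel)) (v : Vel) (B : ℝ), 0 ≤ B →
      (∀ ξ, (v, s.y ξ) ∈ E → ‖s.y ξ‖ ^ a * Real.exp (-(δ / 4 * ‖s.y ξ‖ ^ 2)) ≤ B) →
      majOp κ δ c s E 1 v ≤ C * (ENNReal.ofReal B *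
        ENNReal.ofReal ((1 + ‖v - c‖ ^ 2) ^ (-(a / 2)))) := by
    intro E v B hB hE
    have p3 := (mW_pos (κ := κ) (c := c) v).le
    have h1 : ∀ ξ, ENNReal.ofReal (maj κ δ c s v ξ) *
        E.indicator (fun p => (1 : Vel → ℝ≥0∞) (p.1 + p.2)) (v, s.y ξ) ≤
        ENNReal.ofReal (mW κ c v * B) *
          ENNReal.ofReal (‖ξ.1‖ ^ (κ - a) * gau (δ / 2) c (v + ξ.1)) := by
      intro ξ
      by_cases hm : (v, s.y ξ) ∈ E
      · rw [Set.indicator_of_mem hm, Pi.one_apply, mul_one, ← ENNReal.ofReal_mul (by positivity)]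
        refine ENNReal.ofReal_le_ofReal ((key v ξ).trans ?_)
        have p1 := (gau_pos (δ := δ / 2) (c := c) (v + ξ.1)).le
        have := hE ξ hm
        gcongr
      · rw [Set.indicator_of_notMem hm, mul_zero]
        exact zero_le
    refine (lintegral_mono h1).trans ?_
    rw [lintegral_const_mul _ (by fun_prop)]
    refine (mul_le_mul_right (h v) _).trans_eq ?_
    have e : ENNReal.ofReal (mW κ c v) * ENNReal.ofReal ((1 + ‖v - c‖ ^ 2) ^ ((κ - a) / 2)) =
        ENNReal.ofReal ((1 + ‖v - c‖ ^ 2) ^ (-(a / 2))) := by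
      rw [← ENNReal.ofReal_mul p3, mW, ← Real.rpow_add (by positivity)]
      ring_nf
    rw [ENNReal.ofReal_mul p3, ← e]
    ring
  refine ⟨a, C * (ENNReal.ofReal C₀ + 1), ha0, ENNReal.mul_ne_top hC (by simp), fun v => ?_,
    fun ε hε v => ?_⟩
  · refine (row _ v C₀ hC₀.le fun ξ _ => hexp _ (norm_nonneg _)).trans ?_
    rw [← mul_assoc]
    gcongr
    exact le_self_add
  · refine (row _ v (ε ^ a) (by positivity) fun ξ hξ => ?_).trans ?_
    · have hξ' : ‖s.y ξ‖ < ε := hξ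
      calc _ ≤ ‖s.y ξ‖ ^ a * 1 := by
            gcongr
            exact Real.exp_le_one_iff.2 (by simp only [Left.neg_nonpos_iff]; positivity)
        _ ≤ ε ^ a := by rw [mul_one]; gcongr
    · have h2 : ENNReal.ofReal ((1 + ‖v - c‖ ^ 2) ^ (-(a / 2))) ≤ 1 := by
        rw [ENNReal.ofReal_le_one]
        exact Real.rpow_le_one_of_one_le_of_nonpos (by nlinarith [sq_nonneg ‖v - c‖])
          (by linarith)
      calc C * (ENNReal.ofReal (ε ^ a) * ENNReal.ofReal ((1 + ‖v - c‖ ^ 2) ^ (-(a / 2))))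
          ≤ C * (ENNReal.ofReal (ε ^ a) * 1) := by gcongr
        _ = C * 1 * ENNReal.ofReal (ε ^ a) := by ring
        _ ≤ _ := by gcongr; exact le_add_self

end Decay


/-! ### Splitting the majorant operators into a small part and a core. -/

/-- The pairs of a velocity in a ball and a displacement away from `0`. -/
def coreSet (c : Vel) (R ε : ℝ) : Set (Vel × Vel) := {p | ‖p.1 - c‖ ≤ R ∧ ε ≤ ‖p.2‖}

/-- The integral operator with kernel `maj` is small for large velocities, and it is the sum of a
small operator and one which is bounded from `L²` to `L^∞` on a ball. -/
def GoodShift (κ δ : ℝ) (c : Vel) (s : Shift) : Prop :=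
  (∀ η : ℝ≥0∞, η ≠ 0 → ∃ R : ℝ, 0 < R ∧ ∀ v, majOp κ δ c s {p | R < ‖p.1 - c‖} 1 v ≤ η) ∧
  ∀ η : ℝ≥0∞, η ≠ 0 → ∃ R ε : ℝ, 0 < R ∧ 0 < ε ∧
    (∀ v, majOp κ δ c s (coreSet c R ε)ᶜ 1 v ≤ η) ∧
    ∃ C : ℝ≥0∞, C ≠ ⊤ ∧ ∀ F : Vel → ℝ≥0∞, Measurable F → ∀ v,
      majOp κ δ c s (coreSet c R ε) F v ≤
        C * (Metric.closedBall c R).indicator 1 v * (∫⁻ x, F x ^ 2) ^ (1 / 2 : ℝ)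

section Good

variable {κ δ : ℝ} {c : Vel}

lemma measurableSet_coreSet (R ε : ℝ) : MeasurableSet (coreSet c R ε) := by
  have h1 : MeasurableSet {p : Vel × Vel | ‖p.1 - c‖ ≤ R} :=
    measurableSet_le (by fun_prop) (by fun_prop)
  have h2 : MeasurableSet {p : Vel × Vel | ε ≤ ‖p.2‖} :=
    measurableSet_le (by fun_prop) (by fun_prop)
  exact h1.inter h2

lemma measurableSet_far (R : ℝ) : MeasurableSet {p : Vel × Vel | R < ‖p.1 - c‖} :=
  measurableSet_lt (by fun_prop) (by fun_prop)

lemma measurable_maj_indicator_left (s : Shift) {E : Set (Vel × Vel)} (hE : MeasurableSet E)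
    {F : Vel → ℝ≥0∞} (hF : Measurable F) (v : Vel) :
    Measurable fun ξ : Vel × S2 => ENNReal.ofReal (maj κ δ c s v ξ) *
      E.indicator (fun p => F (p.1 + p.2)) (v, s.y ξ) := by
  have h1 : Measurable (E.indicator (fun p : Vel × Vel => F (p.1 + p.2))) :=
    (hF.comp (measurable_fst.add measurable_snd)).indicator hE
  exact (((measurable_maj s).comp (measurable_const.prodMk measurable_id)).ennreal_ofReal).mul
    (h1.comp (measurable_const.prodMk s.meas))

lemma majOp_le_add (s : Shift) {E E₁ E₂ : Set (Vel × Vel)} (h : E ⊆ E₁ ∪ E₂)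
    (hE₁ : MeasurableSet E₁) (v : Vel) :
    majOp κ δ c s E 1 v ≤ majOp κ δ c s E₁ 1 v + majOp κ δ c s E₂ 1 v := by
  unfold majOp
  have : Measurable fun ξ => ENNReal.ofReal (maj κ δ c s v ξ) *
      E₁.indicator (fun p => (1 : Vel → ℝ≥0∞) (p.1 + p.2)) (v, s.y ξ) :=
    measurable_maj_indicator_left s hE₁ measurable_one v
  rw [← lintegral_add_left this]
  refine lintegral_mono fun ξ => ?_
  rw [← mul_add]
  gcongr
  by_cases h0 : (v, s.y ξ) ∈ E
  · rcases h h0 with h1 | h1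
    · rw [Set.indicator_of_mem h0, Set.indicator_of_mem h1]; exact le_self_add
    · rw [Set.indicator_of_mem h0, Set.indicator_of_mem h1]; exact le_add_self
  · rw [Set.indicator_of_notMem h0]; exact zero_le

/-- Off the core either |v − c| > R or |y| < ε, and both regions are small by `exists_row_decay`. On
the core |z| ≥ |y| ≥ ε removes the singularity, v is bounded, and the kernel is at most a constant
times a Gaussian in z, which is the situation of `hl`. -/
lemma goodShift_of (s : Shift) (hs : ∀ ξ, |inner ℝ ξ.1 (ξ.2 : Vel)| ≤ ‖s.y ξ‖)
    (hl : ∀ δ ε : ℝ, 0 < δ → 0 < ε → ∃ C : ℝ≥0∞, C ≠ ⊤ ∧ ∀ F : Vel → ℝ≥0∞, Measurable F →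
      ∫⁻ ξ, ENNReal.ofReal (Real.exp (-(δ * ‖ξ.1‖ ^ 2))) *
        ({y : Vel | ε ≤ ‖y‖}.indicator F (s.y ξ)) ∂collMeasure ≤
        C * (∫⁻ x, F x ^ 2) ^ (1 / 2 : ℝ))
    (hκ : -3 < κ) (hκ0 : κ < 0) (hδ : 0 < δ) : GoodShift κ δ c s := by
  obtain ⟨a, C, ha, hC, hr1, hr2⟩ := exists_row_decay (c := c) s hs hκ hκ0 hδ
  have hlim : ∀ η : ℝ≥0∞, η ≠ 0 → ∃ R : ℝ, 0 < R ∧ C * ENNReal.ofReal (R ^ (-a)) ≤ η := by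
    intro η hη
    have h1 : Filter.Tendsto (fun R : ℝ => C * ENNReal.ofReal (R ^ (-a))) Filter.atTop
        (nhds (C * ENNReal.ofReal 0)) :=
      ENNReal.Tendsto.const_mul (ENNReal.tendsto_ofReal (tendsto_rpow_neg_atTop ha)) (Or.inr hC)
    rw [ENNReal.ofReal_zero, mul_zero] at h1
    obtain ⟨R, h2, h3⟩ := ((h1.eventually (gt_mem_nhds (pos_iff_ne_zero.2 hη))).and
      (Filter.eventually_gt_atTop 0)).exists
    exact ⟨R, h3, h2.le⟩
  have hfar : ∀ R : ℝ, 0 < R → ∀ v, majOp κ δ c s {p | R < ‖p.1 - c‖} 1 v ≤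
      C * ENNReal.ofReal (R ^ (-a)) := by
    intro R hR v
    by_cases hv : R < ‖v - c‖
    · refine ((majOp_mono s (Set.subset_univ _) 1 v).trans (hr1 v)).trans ?_
      gcongr
      have : R ^ (-a) = (R ^ 2) ^ (-(a / 2)) := by
        rw [← Real.rpow_natCast, ← Real.rpow_mul hR.le]
        push_cast
        ring_nf
      rw [this]
      exact Real.rpow_le_rpow_of_nonpos (by positivity) (by nlinarith) (by linarith)
    · have : majOp κ δ c s {p | R < ‖p.1 - c‖} 1 v = 0 := by
        unfold majOp
        simp [Set.indicator, hv]
      rw [this]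
      exact zero_le
  refine ⟨fun η hη => ?_, fun η hη => ?_⟩
  · obtain ⟨R, hR, h⟩ := hlim η hη
    exact ⟨R, hR, fun v => (hfar R hR v).trans h⟩
  · obtain ⟨R, hR, h⟩ := hlim (η / 2) (ENNReal.half_pos hη).ne'
    have hε : 0 < R⁻¹ := inv_pos.2 hR
    -- With ε = R⁻¹ the two smallness factors R^{-a} and ε^a coincide.
    refine ⟨R, R⁻¹, hR, hε, fun v => ?_, ?_⟩
    · refine (majOp_le_add s (E₁ := {p | R < ‖p.1 - c‖}) (E₂ := {p | ‖p.2‖ < R⁻¹}) ?_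
        (measurableSet_far R) v).trans ?_
      · intro p hp
        by_contra hcon
        simp only [Set.mem_union, not_or] at hcon
        exact hp ⟨not_lt.1 hcon.1, not_lt.1 hcon.2⟩
      · refine (add_le_add ((hfar R hR v).trans h) ((hr2 _ hε.le v).trans ?_)).trans_eq
          (ENNReal.add_halves η)
        rwa [Real.inv_rpow hR.le, ← Real.rpow_neg hR.le]
    · obtain ⟨C', hC', h'⟩ := hl (δ / 2) R⁻¹ (by positivity) hε
      set K := (1 + R ^ 2) ^ (-(κ / 2)) * R⁻¹ ^ κ * Real.exp (δ * R ^ 2) with hK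
      refine ⟨ENNReal.ofReal K * C', ENNReal.mul_ne_top ENNReal.ofReal_ne_top hC',
        fun F hF v => ?_⟩
      by_cases hv : v ∈ Metric.closedBall c R
      · rw [Set.indicator_of_mem hv, Pi.one_apply, mul_one]
        have hv' : ‖v - c‖ ≤ R := by rwa [mem_closedBall_iff_norm] at hv
        have h2 := h' (fun y => F (v + y)) (hF.comp (measurable_const.add measurable_id))
        rw [lintegral_add_left_eq_self (fun y => F y ^ 2) v] at h2
        rw [mul_assoc]
        refine le_trans ?_ (mul_le_mul_right h2 _)
        have hmI : Measurable ({y : Vel | R⁻¹ ≤ ‖y‖}.indicator fun y => F (v + y)) :=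
          (hF.comp (measurable_const.add measurable_id)).indicator
            (measurableSet_le measurable_const measurable_norm)
        have hmy := s.meas
        rw [← lintegral_const_mul _ (by fun_prop)]
        refine lintegral_mono fun ξ => ?_
        by_cases hy : R⁻¹ ≤ ‖s.y ξ‖
        · have m1 : (v, s.y ξ) ∈ coreSet c R R⁻¹ := ⟨hv', hy⟩
          have m2 : s.y ξ ∈ {y : Vel | R⁻¹ ≤ ‖y‖} := hy
          rw [Set.indicator_of_mem m1, Set.indicator_of_mem m2, ← mul_assoc,
            ← ENNReal.ofReal_mul (by positivity)]
          gcongr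
          have b1 : mW κ c v ≤ (1 + R ^ 2) ^ (-(κ / 2)) :=
            Real.rpow_le_rpow (by positivity) (by gcongr) (by linarith)
          have b2 : ‖ξ.1‖ ^ (κ - 1) * |inner ℝ ξ.1 (ξ.2 : Vel)| ≤ R⁻¹ ^ κ :=
            (rpow_mul_inner_le κ ξ).trans (Real.rpow_le_rpow_of_nonpos hε
              (hy.trans (s.norm_y_le ξ)) hκ0.le)
          have b3 : gau δ c (v + ξ.1) ≤
              Real.exp (δ * R ^ 2) * Real.exp (-(δ / 2 * ‖ξ.1‖ ^ 2)) := by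
            rw [gau, ← Real.exp_add]
            refine Real.exp_le_exp.2 ?_
            have t1 : ‖ξ.1‖ ≤ ‖v + ξ.1 - c‖ + R := by
              have := norm_sub_le (v + ξ.1 - c) (v - c)
              rw [show v + ξ.1 - c - (v - c) = ξ.1 by abel] at this
              linarith
            have t2 : ‖ξ.1‖ ^ 2 ≤ 2 * ‖v + ξ.1 - c‖ ^ 2 + 2 * R ^ 2 := by
              nlinarith [norm_nonneg ξ.1, sq_nonneg (‖v + ξ.1 - c‖ - R)]
            nlinarith
          have b4 := gau_le_one (c := c) hδ (v + ξ.1 - s.y ξ)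
          have p1 := (gau_pos (δ := δ) (c := c) (v + ξ.1)).le
          have p2 := (gau_pos (δ := δ) (c := c) (v + ξ.1 - s.y ξ)).le
          have p3 := (mW_pos (κ := κ) (c := c) v).le
          calc maj κ δ c s v ξ ≤ (1 + R ^ 2) ^ (-(κ / 2)) * R⁻¹ ^ κ *
                ((Real.exp (δ * R ^ 2) * Real.exp (-(δ / 2 * ‖ξ.1‖ ^ 2))) * 1) := by
                unfold maj
                gcongr
            _ = _ := by rw [hK]; ring
        · have m1 : (v, s.y ξ) ∉ coreSet c R R⁻¹ := fun h => hy h.2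
          rw [Set.indicator_of_notMem m1, mul_zero]
          exact zero_le
      · have : majOp κ δ c s (coreSet c R R⁻¹) F v = 0 := by
          unfold majOp
          have hn : ∀ y, (v, y) ∉ coreSet c R R⁻¹ := fun y h =>
            hv (by rw [mem_closedBall_iff_norm]; exact h.1)
          simp [Set.indicator, hn]
        rw [this]
        exact zero_le

lemma goodShift_parS (hκ : -3 < κ) (hκ0 : κ < 0) (hδ : 0 < δ) : GoodShift κ δ c parS := by
  refine goodShift_of parS (fun ξ => (norm_parC ξ).ge) (fun δ ε hδ hε => ?_) hκ hκ0 hδ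
  obtain ⟨C, hC, h⟩ := exists_line_bound hδ hε
  refine ⟨C, hC, fun F hF => ?_⟩
  have hI : Measurable ({y : Vel | ε ≤ ‖y‖}.indicator F) :=
    hF.indicator (measurableSet_le measurable_const measurable_norm)
  have hp := measurable_parC
  have hm : Measurable fun ξ : Vel × S2 => ENNReal.ofReal (Real.exp (-(δ * ‖ξ.1‖ ^ 2))) *
      ({y : Vel | ε ≤ ‖y‖}.indicator F (parC ξ)) := by fun_prop
  have h2 := h F hF
  rw [← lintegral_prod_symm _ hm.aemeasurable] at h2
  exact h2

lemma goodShift_fullS (hκ : -3 < κ) (hκ0 : κ < 0) (hδ : 0 < δ) : GoodShift κ δ c fullS := by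
  refine goodShift_of fullS (fun ξ => ?_) (fun δ ε hδ hε => ?_) hκ hκ0 hδ
  · have := abs_real_inner_le_norm ξ.1 (ξ.2 : Vel)
    rwa [norm_S2, mul_one] at this
  have hfin : ∫⁻ x : Vel, ENNReal.ofReal (Real.exp (-(δ * ‖x‖ ^ 2))) ^ 2 ≠ ⊤ := by
    have : ∫⁻ x : Vel, ENNReal.ofReal (Real.exp (-(δ * ‖x‖ ^ 2))) ^ 2 =
        ∫⁻ x : Vel, ENNReal.ofReal (Real.exp (-(2 * δ * ‖x‖ ^ 2))) := by
      refine lintegral_congr fun x => ?_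
      rw [sq, ← ENNReal.ofReal_mul (Real.exp_nonneg _), ← Real.exp_add]
      ring_nf
    rw [this]
    exact lintegral_gauss_ne_top (by positivity)
  refine ⟨(∫⁻ x : Vel, ENNReal.ofReal (Real.exp (-(δ * ‖x‖ ^ 2))) ^ 2) ^ (1 / 2 : ℝ) *
    sphereM Set.univ, ENNReal.mul_ne_top (ENNReal.rpow_ne_top_of_nonneg (by norm_num) hfin)
    (measure_ne_top _ _), fun F hF => ?_⟩
  have hm : Measurable fun ξ : Vel × S2 => ENNReal.ofReal (Real.exp (-(δ * ‖ξ.1‖ ^ 2))) *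
      F ξ.1 := by fun_prop
  calc _ ≤ ∫⁻ ξ : Vel × S2, ENNReal.ofReal (Real.exp (-(δ * ‖ξ.1‖ ^ 2))) * F ξ.1
        ∂collMeasure := by
        refine lintegral_mono fun ξ => ?_
        gcongr
        exact Set.indicator_le_self _ _ _
    _ = (∫⁻ z, ENNReal.ofReal (Real.exp (-(δ * ‖z‖ ^ 2))) * F z) * sphereM Set.univ := by
        rw [collMeasure, lintegral_prod _ hm.aemeasurable]
        simp only [lintegral_const]
        rw [lintegral_mul_const _ (by fun_prop)]
    _ ≤ _ := by
        rw [mul_right_comm]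
        gcongr
        exact lintegral_mul_le_sqrt (by fun_prop) hF.aemeasurable

/-- The displacement z − parC may vanish while z·ω does not, so `goodShift_of` is not applicable to
it. But for fixed v and z the majorant is |z·ω| times a function of y alone, and
`lintegral_sphere_swap` exchanges the two displacements under exactly this weight. This is why β is
first replaced by its bound. -/
lemma majOp_perpS {E : Set (Vel × Vel)} (hE : MeasurableSet E) {F : Vel → ℝ≥0∞}
    (hF : Measurable F) (v : Vel) :
    majOp κ δ c perpS E F v = majOp κ δ c parS E F v := by
  have hm : ∀ s : Shift, Measurable fun ξ : Vel × S2 => ENNReal.ofReal (maj κ δ c s v ξ) *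
      E.indicator (fun p => F (p.1 + p.2)) (v, s.y ξ) := fun s =>
    measurable_maj_indicator_left s hE hF v
  unfold majOp
  rw [collMeasure, lintegral_prod _ (hm _).aemeasurable, lintegral_prod _ (hm _).aemeasurable]
  refine lintegral_congr fun z => ?_
  have hI : Measurable (E.indicator (fun p : Vel × Vel => F (p.1 + p.2))) :=
    (hF.comp (measurable_fst.add measurable_snd)).indicator hE
  have m2 : Measurable (gau δ c) := continuous_gau.measurable
  have h := lintegral_sphere_swap (G := fun y => ENNReal.ofReal (mW κ c v * ‖z‖ ^ (κ - 1) *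
    (gau δ c (v + z) * gau δ c (v + z - y))) * E.indicator (fun p => F (p.1 + p.2)) (v, y))
    (by fun_prop) z
  have e : ∀ (s : Shift) (ω : S2), ENNReal.ofReal (maj κ δ c s v (z, ω)) *
      E.indicator (fun p => F (p.1 + p.2)) (v, s.y (z, ω)) =
      ENNReal.ofReal |inner ℝ z (ω : Vel)| * (ENNReal.ofReal (mW κ c v * ‖z‖ ^ (κ - 1) *
        (gau δ c (v + z) * gau δ c (v + z - s.y (z, ω)))) *
          E.indicator (fun p => F (p.1 + p.2)) (v, s.y (z, ω))) := by
    intro s ω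
    rw [← mul_assoc, ← ENNReal.ofReal_mul (abs_nonneg _), maj]
    congr 2
    ring
  simp only [e]
  exact h.symm

lemma GoodShift.congr {s s' : Shift} (h : GoodShift κ δ c s)
    (he : ∀ (E : Set (Vel × Vel)) (F : Vel → ℝ≥0∞), MeasurableSet E → Measurable F → ∀ v,
      majOp κ δ c s' E F v = majOp κ δ c s E F v) : GoodShift κ δ c s' := by
  refine ⟨fun η hη => ?_, fun η hη => ?_⟩
  · obtain ⟨R, hR, h1⟩ := h.1 η hη
    exact ⟨R, hR, fun v => by rw [he _ _ (measurableSet_far R) measurable_one]; exact h1 v⟩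
  · obtain ⟨R, ε, hR, hε, h1, C, hC, h2⟩ := h.2 η hη
    exact ⟨R, ε, hR, hε,
      fun v => by rw [he _ _ (measurableSet_coreSet R ε).compl measurable_one]; exact h1 v,
      C, hC, fun F hF v => by rw [he _ _ (measurableSet_coreSet R ε) hF]; exact h2 F hF v⟩

lemma goodShift_perpS (hκ : -3 < κ) (hκ0 : κ < 0) (hδ : 0 < δ) : GoodShift κ δ c perpS :=
  (goodShift_parS hκ hκ0 hδ).congr fun _ _ hE hF v => majOp_perpS hE hF v

end Good


/-! ### Integral operators dominated by the majorant: boundedness and finite rank approximation. -/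

/-- The integral operator `f ↦ ∫ P(v, ξ) f(v + y(ξ)) dξ`. -/
noncomputable def opFun (s : Shift) (P : Vel → Vel × S2 → ℝ) (f : Vel → ℝ) (v : Vel) : ℝ :=
  ∫ ξ, P v ξ * f (v + s.y ξ) ∂collMeasure

/-- The kernel `P` is dominated by `B * maj` and vanishes off `E`. -/
structure KerBdd (κ δ : ℝ) (c : Vel) (s : Shift) (E : Set (Vel × Vel)) (B : ℝ)
    (P : Vel → Vel × S2 → ℝ) : Prop where
  meas : Measurable (Function.uncurry P)
  nonneg : 0 ≤ B
  bound : ∀ v ξ, |P v ξ| ≤ B * maj κ δ c s v ξ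
  supp : ∀ v ξ, (v, s.y ξ) ∉ E → P v ξ = 0
  measSet : MeasurableSet E

section Operators

variable {κ δ : ℝ} {c : Vel} {s : Shift} {E : Set (Vel × Vel)} {B : ℝ} {P : Vel → Vel × S2 → ℝ}

lemma KerBdd.meas_left (h : KerBdd κ δ c s E B P) (v : Vel) : Measurable (P v) :=
  h.meas.comp (measurable_const.prodMk measurable_id)

lemma KerBdd.lintegral_le (h : KerBdd κ δ c s E B P) (f : Vel → ℝ) (v : Vel) :
    ∫⁻ ξ, ‖P v ξ * f (v + s.y ξ)‖ₑ ∂collMeasure ≤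
      ENNReal.ofReal B * majOp κ δ c s E (fun w => ‖f w‖ₑ) v := by
  unfold majOp
  rw [← lintegral_const_mul' _ _ ENNReal.ofReal_ne_top]
  refine lintegral_mono fun ξ => ?_
  by_cases hE : (v, s.y ξ) ∈ E
  · rw [Set.indicator_of_mem hE, enorm_mul, ← mul_assoc, ← ENNReal.ofReal_mul h.nonneg]
    gcongr
    rw [← ofReal_norm]
    exact ENNReal.ofReal_le_ofReal (h.bound v ξ)
  · rw [h.supp v ξ hE, zero_mul, enorm_zero]
    exact zero_le

lemma KerBdd.enorm_opFun_le (h : KerBdd κ δ c s E B P) (f : Vel → ℝ) (v : Vel) :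
    ‖opFun s P f v‖ₑ ≤ ENNReal.ofReal B * majOp κ δ c s E (fun w => ‖f w‖ₑ) v :=
  (enorm_integral_le_lintegral_enorm _).trans (h.lintegral_le f v)

lemma KerBdd.measurable_integrand (h : KerBdd κ δ c s E B P) {f : Vel → ℝ} (hf : Measurable f) :
    Measurable fun x : Vel × (Vel × S2) => P x.1 x.2 * f (x.1 + s.y x.2) :=
  h.meas.mul (hf.comp (measurable_fst.add (s.meas.comp measurable_snd)))

lemma KerBdd.measurable_integrand_left (h : KerBdd κ δ c s E B P) {f : Vel → ℝ}
    (hf : Measurable f) (v : Vel) : Measurable fun ξ => P v ξ * f (v + s.y ξ) :=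
  (h.meas_left v).mul (hf.comp (measurable_const.add s.meas))

lemma KerBdd.stronglyMeasurable_opFun (h : KerBdd κ δ c s E B P) {f : Vel → ℝ}
    (hf : Measurable f) : StronglyMeasurable (opFun s P f) :=
  (h.measurable_integrand hf).stronglyMeasurable.integral_prod_right'

/-- For each ξ the map v ↦ v + y(ξ) is a translation, so exceptional sets stay null; Tonelli
exchanges the order. It makes the operators well defined on classes of functions. -/
lemma ae_ae_shift (s : Shift) {p : Vel → Prop} (hp : ∀ᵐ w, p w) :
    ∀ᵐ v : Vel, ∀ᵐ ξ ∂collMeasure, p (v + s.y ξ) := by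
  obtain ⟨N, hN, hNm, hN0⟩ := exists_measurable_superset_of_null (ae_iff.1 hp)
  have hm : Measurable fun x : Vel × (Vel × S2) => N.indicator (1 : Vel → ℝ≥0∞) (x.1 + s.y x.2) :=
    (measurable_one.indicator hNm).comp (measurable_fst.add (s.meas.comp measurable_snd))
  have h0 : ∫⁻ v, ∫⁻ ξ, N.indicator (1 : Vel → ℝ≥0∞) (v + s.y ξ) ∂collMeasure ∂volume = 0 := by
    rw [lintegral_lintegral_swap hm.aemeasurable]
    have : ∀ ξ, ∫⁻ v, N.indicator (1 : Vel → ℝ≥0∞) (v + s.y ξ) = 0 := fun ξ => by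
      rw [lintegral_add_right_eq_self (fun v => N.indicator (1 : Vel → ℝ≥0∞) v) (s.y ξ),
        lintegral_indicator_one hNm, hN0]
    simp [this]
  rw [lintegral_eq_zero_iff hm.lintegral_prod_right'] at h0
  filter_upwards [h0] with v hv
  have hv' := (lintegral_eq_zero_iff ((measurable_one.indicator hNm).comp
    (measurable_const.add s.meas) : Measurable fun ξ => N.indicator (1 : Vel → ℝ≥0∞)
      (v + s.y ξ))).1 hv
  filter_upwards [hv'] with ξ hξ
  by_contra hcon
  have hmem : v + s.y ξ ∈ N := hN hcon
  simp [Set.indicator_of_mem hmem] at hξ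

lemma opFun_ae_congr (s : Shift) (P : Vel → Vel × S2 → ℝ) {f f' : Vel → ℝ}
    (h : f =ᵐ[volume] f') : opFun s P f =ᵐ[volume] opFun s P f' := by
  filter_upwards [ae_ae_shift s h] with v hv
  exact integral_congr_ae (hv.mono fun ξ hξ => by simp only [hξ])

lemma eLpNorm_two_sq_enorm (f : Vel → ℝ) : eLpNorm f 2 volume ^ 2 = ∫⁻ v, ‖f v‖ₑ ^ 2 := by
  rw [eLpNorm_two_sq]
  refine lintegral_congr fun v => ?_
  rw [← ofReal_norm, ← ENNReal.ofReal_pow (norm_nonneg _), Real.norm_eq_abs, sq_abs]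

lemma lintegral_majOp_eLpNorm_le (s : Shift) (hE : MeasurableSet E) {R C : ℝ≥0∞}
    (hR : ∀ v, majOp κ δ c s E 1 v ≤ R)
    (hC : ∀ v, ∫⁻ ξ, ENNReal.ofReal (maj κ δ c s (v - s.y ξ) ξ) ∂collMeasure ≤ C)
    {f : Vel → ℝ} (hf : Measurable f) :
    ∫⁻ v, majOp κ δ c s E (fun w => ‖f w‖ₑ) v ^ 2 ≤ R * C * eLpNorm f 2 volume ^ 2 := by
  rw [eLpNorm_two_sq_enorm]
  exact lintegral_majOp_sq_le s hE hf.enorm hR hC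

lemma KerBdd.eLpNorm_opFun_le (h : KerBdd κ δ c s E B P) {R C : ℝ≥0∞}
    (hR : ∀ v, majOp κ δ c s E 1 v ≤ R)
    (hC : ∀ v, ∫⁻ ξ, ENNReal.ofReal (maj κ δ c s (v - s.y ξ) ξ) ∂collMeasure ≤ C)
    {f : Vel → ℝ} (hf : Measurable f) :
    eLpNorm (opFun s P f) 2 volume ≤
      ENNReal.ofReal B * (R * C) ^ (1 / 2 : ℝ) * eLpNorm f 2 volume := by
  have h1 : eLpNorm (opFun s P f) 2 volume ^ 2 ≤
      (ENNReal.ofReal B * (R * C) ^ (1 / 2 : ℝ) * eLpNorm f 2 volume) ^ 2 := by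
    rw [eLpNorm_two_sq_enorm]
    calc ∫⁻ v, ‖opFun s P f v‖ₑ ^ 2
        ≤ ∫⁻ v, ENNReal.ofReal B ^ 2 * majOp κ δ c s E (fun w => ‖f w‖ₑ) v ^ 2 := by
          refine lintegral_mono fun v => ?_
          rw [← mul_pow]
          gcongr
          exact h.enorm_opFun_le f v
      _ ≤ ENNReal.ofReal B ^ 2 * (R * C * eLpNorm f 2 volume ^ 2) := by
          rw [lintegral_const_mul' _ _ (by simp)]
          gcongr
          exact lintegral_majOp_eLpNorm_le s h.measSet hR hC hf
      _ = _ := by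
          rw [mul_pow, mul_pow, ← ENNReal.rpow_natCast ((R * C) ^ (1 / 2 : ℝ)),
            ← ENNReal.rpow_mul]
          norm_num
          ring
  exact (ENNReal.pow_le_pow_left_iff two_ne_zero).1 h1

lemma KerBdd.ae_integrable (h : KerBdd κ δ c s E B P) (hκ : -3 < κ) (hκ0 : κ < 0) (hδ : 0 < δ)
    {f : Vel → ℝ} (hf : MemLp f 2 volume) (hfm : Measurable f) :
    ∀ᵐ v, Integrable (fun ξ => P v ξ * f (v + s.y ξ)) collMeasure := by
  obtain ⟨R, hR, h1⟩ := exists_row (c := c) s hκ hκ0 hδ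
  obtain ⟨C, hC, h2⟩ := exists_column (c := c) s hκ hκ0 hδ
  have h3 := lintegral_majOp_eLpNorm_le (c := c) s MeasurableSet.univ h1 h2 hfm
  have h4 : ∫⁻ v, majOp κ δ c s Set.univ (fun w => ‖f w‖ₑ) v ^ 2 ≠ ⊤ :=
    (h3.trans_lt (ENNReal.mul_lt_top (ENNReal.mul_lt_top hR.lt_top hC.lt_top)
      (ENNReal.pow_lt_top hf.2))).ne
  filter_upwards [ae_lt_top ((measurable_majOp s MeasurableSet.univ hfm.enorm).pow_const 2) h4]
    with v hv
  refine ⟨(h.measurable_integrand_left hfm v).aestronglyMeasurable, ?_⟩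
  refine (h.lintegral_le f v).trans_lt (ENNReal.mul_lt_top ENNReal.ofReal_lt_top ?_)
  refine (majOp_mono s (Set.subset_univ _) _ v).trans_lt ?_
  exact (ENNReal.pow_lt_top_iff.1 hv).resolve_right two_ne_zero

lemma L2V.measurable (f : L2V) : Measurable f := (Lp.stronglyMeasurable f).measurable

lemma KerBdd.exists_clm (h : KerBdd κ δ c s E B P) (hκ : -3 < κ) (hκ0 : κ < 0) (hδ : 0 < δ)
    {R C : ℝ≥0∞} (hRt : R ≠ ⊤) (hCt : C ≠ ⊤) (hR : ∀ v, majOp κ δ c s E 1 v ≤ R)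
    (hC : ∀ v, ∫⁻ ξ, ENNReal.ofReal (maj κ δ c s (v - s.y ξ) ξ) ∂collMeasure ≤ C) :
    ∃ T : L2V →L[ℝ] L2V, (∀ f, T f =ᵐ[volume] opFun s P f) ∧
      ‖T‖ ≤ B * ((R * C) ^ (1 / 2 : ℝ)).toReal := by
  refine exists_clm_of_ae (fun f => opFun s P f)
    (fun f => (h.stronglyMeasurable_opFun (L2V.measurable f)).aestronglyMeasurable)
    (fun f g => ?_) (fun a f => ?_) (mul_nonneg h.nonneg ENNReal.toReal_nonneg) (fun f => ?_)
  · filter_upwards [opFun_ae_congr s P (Lp.coeFn_add f g),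
      h.ae_integrable hκ hκ0 hδ (Lp.memLp f) (L2V.measurable f),
      h.ae_integrable hκ hκ0 hδ (Lp.memLp g) (L2V.measurable g)] with v h1 h2 h3
    rw [h1]
    unfold opFun
    rw [← integral_add h2 h3]
    simp only [Pi.add_apply, mul_add]
  · filter_upwards [opFun_ae_congr s P (Lp.coeFn_smul a f)] with v h1
    rw [h1]
    unfold opFun
    rw [← integral_const_mul]
    congr 1
    ext ξ
    simp only [Pi.smul_apply, smul_eq_mul]
    ring
  · rw [ENNReal.ofReal_mul h.nonneg, ENNReal.ofReal_toReal
      (ENNReal.rpow_ne_top_of_nonneg (by norm_num) (ENNReal.mul_ne_top hRt hCt))]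
    exact h.eLpNorm_opFun_le hR hC (L2V.measurable f)

lemma KerBdd.exists_op (h : KerBdd κ δ c s E B P) (hκ : -3 < κ) (hκ0 : κ < 0) (hδ : 0 < δ) :
    ∃ T : L2V →L[ℝ] L2V, ∀ f, T f =ᵐ[volume] opFun s P f := by
  obtain ⟨R, hR, h1⟩ := exists_row (c := c) s hκ hκ0 hδ
  obtain ⟨C, hC, h2⟩ := exists_column (c := c) s hκ hκ0 hδ
  obtain ⟨T, hT, -⟩ := h.exists_clm hκ hκ0 hδ hR hC
    (fun v => (majOp_mono s (Set.subset_univ _) 1 v).trans (h1 v)) h2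
  exact ⟨T, hT⟩

open Classical in
/-- The restriction of a kernel to a set of velocities and displacements. -/
noncomputable def cutKer (s : Shift) (E : Set (Vel × Vel)) (P : Vel → Vel × S2 → ℝ) (v : Vel)
    (ξ : Vel × S2) : ℝ := if (v, s.y ξ) ∈ E then P v ξ else 0

lemma KerBdd.cut (h : KerBdd κ δ c s Set.univ B P) (hE : MeasurableSet E) :
    KerBdd κ δ c s E B (cutKer s E P) := by
  classical
  refine ⟨?_, h.nonneg, fun v ξ => ?_, fun v ξ hv => if_neg hv, hE⟩
  · refine Measurable.ite ?_ h.meas measurable_const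
    exact (measurable_fst.prodMk (s.meas.comp measurable_snd)) hE
  · unfold cutKer
    split_ifs
    · exact h.bound v ξ
    · rw [abs_zero]
      exact mul_nonneg h.nonneg (maj_nonneg s v ξ)

lemma cutKer_add_compl (s : Shift) (E : Set (Vel × Vel)) (P : Vel → Vel × S2 → ℝ) (v : Vel)
    (ξ : Vel × S2) : cutKer s E P v ξ + cutKer s Eᶜ P v ξ = P v ξ := by
  unfold cutKer
  by_cases h : (v, s.y ξ) ∈ E <;> simp [h]

/-- Integral operators which are bounded from `L²` to `L^∞` on a ball are limits of operators of
finite rank. -/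
lemma KerBdd.mem_closure_finRank_core {R ε : ℝ} (h : KerBdd κ δ c s (coreSet c R ε) B P)
    {C : ℝ≥0∞} (hC : C ≠ ⊤) (hb : ∀ F : Vel → ℝ≥0∞, Measurable F → ∀ v,
      majOp κ δ c s (coreSet c R ε) F v ≤
        C * (Metric.closedBall c R).indicator 1 v * (∫⁻ x, F x ^ 2) ^ (1 / 2 : ℝ))
    {T : L2V →L[ℝ] L2V} (hT : ∀ f, T f =ᵐ[volume] opFun s P f) :
    T ∈ closure (finRank (Set.univ : Set L2V) : Set (L2V →L[ℝ] L2V)) := by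
  have hb2 : ∀ (f : Vel → ℝ), Measurable f → ∀ v,
      ∫⁻ ξ, ‖P v ξ * f (v + s.y ξ)‖ₑ ∂collMeasure ≤ ENNReal.ofReal B *
        (C * (Metric.closedBall c R).indicator 1 v * eLpNorm f 2 volume) := by
    intro f hf v
    have e : (∫⁻ x, ‖f x‖ₑ ^ 2) ^ (1 / 2 : ℝ) = eLpNorm f 2 volume := by
      rw [← eLpNorm_two_sq_enorm, ← ENNReal.rpow_natCast, ← ENNReal.rpow_mul]
      norm_num
    refine (h.lintegral_le f v).trans ?_
    gcongr
    rw [← e]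
    exact hb _ hf.enorm v
  have hfin : ∀ v, (Metric.closedBall c R).indicator (1 : Vel → ℝ≥0∞) v ≠ ⊤ := fun v => by
    by_cases hv : v ∈ Metric.closedBall c R
    · simp [Set.indicator_of_mem hv]
    · simp [Set.indicator_of_notMem hv]
  have hint : ∀ (f : Vel → ℝ), Measurable f → MemLp f 2 volume → ∀ v,
      Integrable (fun ξ => P v ξ * f (v + s.y ξ)) collMeasure := fun f hf hf2 v =>
    ⟨(h.measurable_integrand_left hf v).aestronglyMeasurable, (hb2 f hf v).trans_lt
      (ENNReal.mul_lt_top ENNReal.ofReal_lt_top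
        (ENNReal.mul_lt_top (ENNReal.mul_lt_top hC.lt_top (hfin v).lt_top) hf2.2))⟩
  -- The L² to L^∞ bound makes the value at every single v depend only on the class of f, so
  -- evaluation at v is a linear functional on L².
  have hzero : ∀ (f g : Vel → ℝ), Measurable f → Measurable g → f =ᵐ[volume] g → ∀ v,
      opFun s P f v = opFun s P g v := by
    intro f g hf hg hfg v
    have h0 : eLpNorm (f - g) 2 volume = 0 := by
      rw [eLpNorm_congr_ae (hfg.mono fun x hx => by simp [hx] : f - g =ᵐ[volume] 0)]
      simp
    have h1 := hb2 (f - g) (hf.sub hg) v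
    rw [h0, mul_zero, mul_zero, nonpos_iff_eq_zero,
      lintegral_eq_zero_iff (h.measurable_integrand_left (hf.sub hg) v).enorm] at h1
    refine integral_congr_ae (h1.mono fun ξ hξ => ?_)
    have h2 : P v ξ * (f - g) (v + s.y ξ) = 0 := by simpa using hξ
    simp only [Pi.sub_apply] at h2
    linarith
  have ev : ∀ v, ∃ l : L2V →ₗ[ℝ] ℝ, ∀ f : L2V, l f = opFun s P f v := fun v =>
    ⟨{ toFun := fun f => opFun s P f v
       map_add' := fun f g => by
        rw [hzero _ _ (L2V.measurable _) ((L2V.measurable f).add (L2V.measurable g))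
          (Lp.coeFn_add f g) v]
        unfold opFun
        rw [← integral_add (hint f (L2V.measurable f) (Lp.memLp f) v)
          (hint g (L2V.measurable g) (Lp.memLp g) v)]
        simp only [Pi.add_apply, mul_add]
       map_smul' := fun a f => by
        rw [hzero _ _ (L2V.measurable _) ((L2V.measurable f).const_smul a)
          (Lp.coeFn_smul a f) v, RingHom.id_apply, smul_eq_mul]
        unfold opFun
        rw [← integral_const_mul]
        congr 1
        ext ξ
        simp only [Pi.smul_apply, smul_eq_mul]
        ring }, fun f => rfl⟩
  choose ev hev using ev
  refine mem_closure_finRank_of_pointwise_bound ev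
    (c := fun v => B * C.toReal * (Metric.closedBall c R).indicator (1 : Vel → ℝ) v) ?_
    (fun v f => ?_) (fun f => ?_)
  · refine (MemLp.const_mul ?_ _)
    exact memLp_indicator_const 2 Metric.isClosed_closedBall.measurableSet 1
      (Or.inr measure_closedBall_lt_top.ne)
  · rw [hev, ← Real.norm_eq_abs, ← toReal_enorm]
    have h1 := (enorm_integral_le_lintegral_enorm _).trans (hb2 f (L2V.measurable f) v)
    have h2 := ENNReal.toReal_mono (ENNReal.mul_ne_top ENNReal.ofReal_ne_top
      (ENNReal.mul_ne_top (ENNReal.mul_ne_top hC (hfin v)) (Lp.memLp f).2.ne)) h1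
    refine h2.trans_eq ?_
    rw [ENNReal.toReal_mul, ENNReal.toReal_mul, ENNReal.toReal_mul,
      ENNReal.toReal_ofReal h.nonneg, ← Lp.norm_def]
    by_cases hv : v ∈ Metric.closedBall c R
    · simp [Set.indicator_of_mem hv]; ring
    · simp [Set.indicator_of_notMem hv]
  · refine (hT f).trans (.of_forall fun v => ?_)
    simp only [hev]

/-- Integral operators with a kernel dominated by `maj` are limits of operators of finite
rank. -/
lemma KerBdd.mem_closure_finRank (h : KerBdd κ δ c s Set.univ B P) (hs : GoodShift κ δ c s)
    (hκ : -3 < κ) (hκ0 : κ < 0) (hδ : 0 < δ)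
    {T : L2V →L[ℝ] L2V} (hT : ∀ f, T f =ᵐ[volume] opFun s P f) :
    T ∈ closure (finRank (Set.univ : Set L2V) : Set (L2V →L[ℝ] L2V)) := by
  obtain ⟨C, hC, h2⟩ := exists_column (c := c) s hκ hκ0 hδ
  rw [← closure_closure, Metric.mem_closure_iff]
  intro η hη
  -- With row bound η'/(C + 1) and column bound C, Schur's test bounds the part off the core by B
  -- √η' ≤ η/2.
  set η' : ℝ := (η / (2 * (B + 1))) ^ 2 with hη'
  have hB := h.nonneg
  have hη0 : 0 < η' := by positivity
  obtain ⟨R, ε, hR, hε, h3, C', hC', h4⟩ := hs.2 (ENNReal.ofReal η' / (C + 1)) (by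
    simp [ENNReal.div_eq_zero_iff, hη0, hC])
  have hEm := measurableSet_coreSet (c := c) R ε
  obtain ⟨T₁, hT₁⟩ := (h.cut hEm).exists_op hκ hκ0 hδ
  have hne : ENNReal.ofReal η' / (C + 1) ≠ ⊤ := ENNReal.div_ne_top ENNReal.ofReal_ne_top (by simp)
  obtain ⟨T₂, hT₂, hn⟩ := (h.cut hEm.compl).exists_clm hκ hκ0 hδ hne hC h3 h2
  refine ⟨T₁, (h.cut hEm).mem_closure_finRank_core hC' h4 hT₁, ?_⟩
  have e : T = T₁ + T₂ := by
    ext1 f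
    refine Lp.ext ?_
    rw [add_apply]
    filter_upwards [hT f, hT₁ f, hT₂ f, Lp.coeFn_add (T₁ f) (T₂ f),
      (h.cut hEm).ae_integrable hκ hκ0 hδ (Lp.memLp f) (L2V.measurable f),
      (h.cut hEm.compl).ae_integrable hκ hκ0 hδ (Lp.memLp f) (L2V.measurable f)]
      with v a1 a2 a3 a4 a5 a6
    rw [a4, Pi.add_apply, a1, a2, a3]
    unfold opFun
    rw [← integral_add a5 a6]
    simp only [← add_mul, cutKer_add_compl]
  rw [e, dist_eq_norm, add_sub_cancel_left]
  have hq : ((ENNReal.ofReal η' / (C + 1) * C) ^ (1 / 2 : ℝ)).toReal ≤ η / (2 * (B + 1)) := by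
    have h5 : ENNReal.ofReal η' / (C + 1) * C ≤ ENNReal.ofReal η' := by
      calc ENNReal.ofReal η' / (C + 1) * C ≤ ENNReal.ofReal η' / (C + 1) * (C + 1) := by
            gcongr; exact le_self_add
        _ = _ := ENNReal.div_mul_cancel (by simp) (by simp [hC])
    refine (ENNReal.toReal_mono (by simp) (ENNReal.rpow_le_rpow h5 (by norm_num))).trans_eq ?_
    rw [← ENNReal.toReal_rpow, ENNReal.toReal_ofReal hη0.le, hη',
      ← Real.sqrt_eq_rpow, Real.sqrt_sq (by positivity)]
  calc ‖T₂‖ ≤ B * (η / (2 * (B + 1))) := hn.trans (by gcongr)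
    _ = (B / (B + 1)) * (η / 2) := by field_simp
    _ ≤ 1 * (η / 2) := by
        gcongr
        rw [div_le_one (by positivity)]
        linarith
    _ < η := by linarith

end Operators


/-! ### Kernels in product form and their commutators with derivatives. -/

/-- `a` is smooth and all of its derivatives are `O(W)`. -/
def Tame (W a : Vel → ℝ) : Prop := Smooth a ∧ ∀ n, ∃ B, DerivBdd W n a B

lemma Tame.pd {W a : Vel → ℝ} (h : Tame W a) (i : Fin 3) : Tame W (partialD i a) :=
  ⟨h.1.pd i, fun n => (h.2 (n + 1)).imp fun _ hB => hB.2 i⟩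

lemma Tame.exists_bound {W a : Vel → ℝ} (h : Tame W a) (hW : ∀ v, 0 ≤ W v) :
    ∃ B, 0 ≤ B ∧ ∀ v, |a v| ≤ B * W v := by
  obtain ⟨B, hB⟩ := h.2 0
  exact ⟨|B|, abs_nonneg B, fun v =>
    (hB v).trans (mul_le_mul_of_nonneg_right (le_abs_self B) (hW v))⟩

/-- The kernel `b(ξ) a₀(v) a₁(u) a₂(v + u - w)`, where `w = v + y(ξ)`. -/
noncomputable def prodKer (s : Shift) (b : Vel × S2 → ℝ) (a₀ a₁ a₂ : Vel → ℝ) (v : Vel)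
    (ξ : Vel × S2) : ℝ :=
  b ξ * (a₀ v * (a₁ (v + ξ.1) * a₂ (v + ξ.1 - s.y ξ)))

section Fubini

variable {κ δ : ℝ} {c : Vel} {s : Shift} {B : ℝ} {P : Vel → Vel × S2 → ℝ}

lemma KerBdd.integrable_prod (h : KerBdd κ δ c s Set.univ B P) (hκ : -3 < κ) (hκ0 : κ < 0)
    (hδ : 0 < δ) {f g : Vel → ℝ} (hf : MemLp f 2 volume) (hfm : Measurable f)
    (hg : MemLp g 2 volume) (hgm : Measurable g) :
    Integrable (fun x : Vel × (Vel × S2) => P x.1 x.2 * f (x.1 + s.y x.2) * g x.1)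
      (volume.prod collMeasure) := by
  obtain ⟨R, hR, h1⟩ := exists_row (c := c) s hκ hκ0 hδ
  obtain ⟨C, hC, h2⟩ := exists_column (c := c) s hκ hκ0 hδ
  have h3 := lintegral_majOp_eLpNorm_le (c := c) s MeasurableSet.univ h1 h2 hfm
  have h4 : ∫⁻ v, majOp κ δ c s Set.univ (fun w => ‖f w‖ₑ) v ^ 2 < ⊤ :=
    h3.trans_lt (ENNReal.mul_lt_top (ENNReal.mul_lt_top hR.lt_top hC.lt_top)
      (ENNReal.pow_lt_top hf.2))
  have hm : Measurable fun x : Vel × (Vel × S2) => P x.1 x.2 * f (x.1 + s.y x.2) * g x.1 :=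
    (h.measurable_integrand hfm).mul (hgm.comp measurable_fst)
  refine ⟨hm.aestronglyMeasurable, ?_⟩
  rw [HasFiniteIntegral, lintegral_prod _ hm.enorm.aemeasurable]
  have h5 : ∀ v, ∫⁻ ξ, ‖P v ξ * f (v + s.y ξ) * g v‖ₑ ∂collMeasure ≤
      (ENNReal.ofReal B * majOp κ δ c s Set.univ (fun w => ‖f w‖ₑ) v) * ‖g v‖ₑ := by
    intro v
    simp only [enorm_mul _ (g v)]
    rw [lintegral_mul_const' _ _ enorm_ne_top]
    gcongr
    exact h.lintegral_le f v
  have hmm := measurable_majOp (κ := κ) (δ := δ) (c := c) s MeasurableSet.univ hfm.enorm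
  refine (lintegral_mono h5).trans_lt ?_
  simp only [mul_assoc]
  rw [lintegral_const_mul' _ _ ENNReal.ofReal_ne_top]
  refine ENNReal.mul_lt_top ENNReal.ofReal_lt_top
    ((lintegral_mul_le_sqrt hmm.aemeasurable hgm.enorm.aemeasurable).trans_lt
      (ENNReal.mul_lt_top (ENNReal.rpow_lt_top_of_nonneg (by norm_num) h4.ne)
        (ENNReal.rpow_lt_top_of_nonneg (by norm_num) ?_)))
  rw [← eLpNorm_two_sq_enorm]
  exact (ENNReal.pow_lt_top hg.2).ne

lemma KerBdd.integral_opFun_mul (h : KerBdd κ δ c s Set.univ B P) (hκ : -3 < κ) (hκ0 : κ < 0)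
    (hδ : 0 < δ) {f g : Vel → ℝ} (hf : MemLp f 2 volume) (hfm : Measurable f)
    (hg : MemLp g 2 volume) (hgm : Measurable g) :
    ∫ v, opFun s P f v * g v = ∫ ξ, (∫ v, P v ξ * f (v + s.y ξ) * g v ∂volume) ∂collMeasure := by
  rw [← integral_integral_swap (f := fun v ξ => P v ξ * f (v + s.y ξ) * g v)
    (h.integrable_prod hκ hκ0 hδ hf hfm hg hgm)]
  refine integral_congr_ae (.of_forall fun v => ?_)
  simp only [integral_mul_const, opFun]

lemma WDer.comp_add {i : Fin 3} {f f' : L2V} (h : WDer i f f') (w : Vel) :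
    WDer i (fun v => f (v + w)) (fun v => f' (v + w)) := by
  have hl : ∀ g : L2V, LocallyIntegrable (fun v => g (v + w)) volume := fun g =>
    ((Lp.memLp g).comp_measurePreserving (measurePreserving_add_right volume w)).locallyIntegrable
      (by norm_num)
  refine ⟨hl f, hl f', fun φ hφ hc => ?_⟩
  have h1 := h.2.2 (fun v => φ (v + -w)) (hφ.comp_add _) (HasCompactSupport.comp_add_const hc _)
  rw [partialD_comp_add, ← integral_add_right_eq_self _ w,
    ← integral_add_right_eq_self (fun v => f' v * φ (v + -w)) w] at h1
  simpa using h1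

end Fubini

section ProdKer

variable {κ δ : ℝ} {c : Vel} {s : Shift} {b : Vel × S2 → ℝ} {a₀ a₁ a₂ : Vel → ℝ}

lemma exists_kerBdd_prodKer (s : Shift) (hb : Measurable b) {β₀ : ℝ} (hβ₀ : 0 ≤ β₀)
    (hbB : ∀ ξ, |b ξ| ≤ β₀ * (‖ξ.1‖ ^ (κ - 1) * |inner ℝ ξ.1 (ξ.2 : Vel)|))
    (h₀ : Tame (mW κ c) a₀) (h₁ : Tame (gau δ c) a₁) (h₂ : Tame (gau δ c) a₂) :
    ∃ B, KerBdd κ δ c s Set.univ B (prodKer s b a₀ a₁ a₂) := by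
  obtain ⟨B₀, p0, b0⟩ := h₀.exists_bound fun v => (mW_pos v).le
  obtain ⟨B₁, p1, b1⟩ := h₁.exists_bound fun v => (gau_pos v).le
  obtain ⟨B₂, p2, b2⟩ := h₂.exists_bound fun v => (gau_pos v).le
  have m0 := h₀.1.continuous.measurable
  have m1 := h₁.1.continuous.measurable
  have m2 := h₂.1.continuous.measurable
  refine ⟨β₀ * B₀ * B₁ * B₂, ?_, by positivity, fun v ξ => ?_, fun v ξ h => ?_,
    MeasurableSet.univ⟩
  · have hy := s.meas
    unfold prodKer Function.uncurry
    fun_prop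
  · simp only [prodKer, abs_mul, maj]
    have q1 := (gau_pos (δ := δ) (c := c) (v + ξ.1)).le
    have q2 := (gau_pos (δ := δ) (c := c) (v + ξ.1 - s.y ξ)).le
    have q3 := (mW_pos (κ := κ) (c := c) v).le
    calc |b ξ| * (|a₀ v| * (|a₁ (v + ξ.1)| * |a₂ (v + ξ.1 - s.y ξ)|))
        ≤ (β₀ * (‖ξ.1‖ ^ (κ - 1) * |inner ℝ ξ.1 (ξ.2 : Vel)|)) * ((B₀ * mW κ c v) *
          ((B₁ * gau δ c (v + ξ.1)) * (B₂ * gau δ c (v + ξ.1 - s.y ξ)))) := by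
          gcongr
          · exact hbB ξ
          · exact b0 v
          · exact b1 _
          · exact b2 _
      _ = _ := by ring
  · exact absurd (Set.mem_univ _) h

lemma smooth_prodKer (h₀ : Smooth a₀) (h₁ : Smooth a₁) (h₂ : Smooth a₂) (ξ : Vel × S2) :
    Smooth fun v => prodKer s b a₀ a₁ a₂ v ξ := by
  have e1 := Smooth.comp_add h₁ ξ.1
  have e2 := Smooth.comp_add h₂ (ξ.1 - s.y ξ)
  simp only [← add_sub_assoc] at e2
  exact contDiff_const.mul (ContDiff.mul h₀ (ContDiff.mul e1 e2))

/-- For fixed ξ the variable v enters only through translates of a₀, a₁, a₂. The singular factor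
b(ξ) is never differentiated, and the product form is reproduced. -/
lemma partialD_prodKer (h₀ : Smooth a₀) (h₁ : Smooth a₁) (h₂ : Smooth a₂) (ξ : Vel × S2)
    (i : Fin 3) (v : Vel) : partialD i (fun v => prodKer s b a₀ a₁ a₂ v ξ) v =
      prodKer s b (partialD i a₀) a₁ a₂ v ξ + prodKer s b a₀ (partialD i a₁) a₂ v ξ +
        prodKer s b a₀ a₁ (partialD i a₂) v ξ := by
  have e1 := Smooth.comp_add h₁ ξ.1
  have e2 := Smooth.comp_add h₂ (ξ.1 - s.y ξ)
  have d2 := partialD_comp_add a₂ (ξ.1 - s.y ξ) i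
  simp only [← add_sub_assoc] at e2 d2
  have e12 : Smooth fun v => a₁ (v + ξ.1) * a₂ (v + ξ.1 - s.y ξ) := ContDiff.mul e1 e2
  have e012 : Smooth fun v => a₀ v * (a₁ (v + ξ.1) * a₂ (v + ξ.1 - s.y ξ)) := ContDiff.mul h₀ e12
  simp only [prodKer]
  rw [partialD_const_mul _ e012.differentiable, partialD_mul h₀.differentiable e12.differentiable,
    partialD_mul e1.differentiable e2.differentiable, partialD_comp_add, d2]
  ring

lemma integral_sum_four {X : Type*} [MeasurableSpace X] {μ : Measure X} {f g h k : X → ℝ}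
    (hf : Integrable f μ) (hg : Integrable g μ) (hh : Integrable h μ) (hk : Integrable k μ) :
    ∫ x, f x + (g x + h x + k x) ∂μ =
      (∫ x, f x ∂μ) + ((∫ x, g x ∂μ) + (∫ x, h x ∂μ) + ∫ x, k x ∂μ) := by
  have h1 : Integrable (fun x => g x + h x) μ := hg.add hh
  have h2 : Integrable (fun x => g x + h x + k x) μ := h1.add hk
  rw [integral_add hf h2, integral_add h1 hk, integral_add hg hh]

/-- After pairing with a test function and exchanging the integrals, integration by parts in v is
done for each ξ separately, where f(v + y(ξ)) is a mere translate of f. -/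
lemma wder_opFun_prodKer (hb : Measurable b) {β₀ : ℝ} (hβ₀ : 0 ≤ β₀)
    (hbB : ∀ ξ, |b ξ| ≤ β₀ * (‖ξ.1‖ ^ (κ - 1) * |inner ℝ ξ.1 (ξ.2 : Vel)|))
    (hκ : -3 < κ) (hκ0 : κ < 0) (hδ : 0 < δ)
    (h₀ : Tame (mW κ c) a₀) (h₁ : Tame (gau δ c) a₁) (h₂ : Tame (gau δ c) a₂) {i : Fin 3}
    {T T₀ T₁ T₂ : L2V →L[ℝ] L2V} (hT : ∀ f, T f =ᵐ[volume] opFun s (prodKer s b a₀ a₁ a₂) f)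
    (hT₀ : ∀ f, T₀ f =ᵐ[volume] opFun s (prodKer s b (partialD i a₀) a₁ a₂) f)
    (hT₁ : ∀ f, T₁ f =ᵐ[volume] opFun s (prodKer s b a₀ (partialD i a₁) a₂) f)
    (hT₂ : ∀ f, T₂ f =ᵐ[volume] opFun s (prodKer s b a₀ a₁ (partialD i a₂)) f)
    {f f' : L2V} (hf : WDer i f f') :
    WDer i (T f) (T f' + (T₀ f + T₁ f + T₂ f) : L2V) := by
  refine ⟨L2V.locallyIntegrable _, L2V.locallyIntegrable _, fun φ hφ hc => ?_⟩
  obtain ⟨B, k⟩ := exists_kerBdd_prodKer s hb hβ₀ hbB h₀ h₁ h₂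
  obtain ⟨B₀, k0⟩ := exists_kerBdd_prodKer s hb hβ₀ hbB (h₀.pd i) h₁ h₂
  obtain ⟨B₁, k1⟩ := exists_kerBdd_prodKer s hb hβ₀ hbB h₀ (h₁.pd i) h₂
  obtain ⟨B₂, k2⟩ := exists_kerBdd_prodKer s hb hβ₀ hbB h₀ h₁ (h₂.pd i)
  have mφ := memLp_test hφ.continuous hc 2
  have mf := L2V.measurable f
  have mf' := L2V.measurable f'
  have I0 := k0.integrable_prod hκ hκ0 hδ (Lp.memLp f) mf mφ hφ.continuous.measurable
  have I1 := k1.integrable_prod hκ hκ0 hδ (Lp.memLp f) mf mφ hφ.continuous.measurable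
  have I2 := k2.integrable_prod hκ hκ0 hδ (Lp.memLp f) mf mφ hφ.continuous.measurable
  have I' := k.integrable_prod hκ hκ0 hδ (Lp.memLp f') mf' mφ hφ.continuous.measurable
  have E0 := k0.integral_opFun_mul hκ hκ0 hδ (Lp.memLp f) mf mφ hφ.continuous.measurable
  have E1 := k1.integral_opFun_mul hκ hκ0 hδ (Lp.memLp f) mf mφ hφ.continuous.measurable
  have E2 := k2.integral_opFun_mul hκ hκ0 hδ (Lp.memLp f) mf mφ hφ.continuous.measurable
  have E' := k.integral_opFun_mul hκ hκ0 hδ (Lp.memLp f') mf' mφ hφ.continuous.measurable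
  have E := k.integral_opFun_mul hκ hκ0 hδ (Lp.memLp f) mf
    (memLp_test (hφ.pd i).continuous (hasCompactSupport_partialD hc i) 2)
    (hφ.pd i).continuous.measurable
  have L : ∫ v, T f v * partialD i φ v =
      ∫ v, opFun s (prodKer s b a₀ a₁ a₂) f v * partialD i φ v :=
    integral_congr_ae ((hT f).mono fun v hv => by simp only [hv])
  have hlm : ∀ (A : L2V) (F : Vel → ℝ), A =ᵐ[volume] F →
      ∫ v, A v * φ v = ∫ v, F v * φ v := fun A F h =>
    integral_congr_ae (h.mono fun v hv => by simp only [hv])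
  have hi : ∀ A : L2V, Integrable (fun v => A v * φ v) volume := fun A =>
    integrable_mul_test (L2V.locallyIntegrable A) hφ.continuous hc
  have R : ∫ v, (T f' + (T₀ f + T₁ f + T₂ f) : L2V) v * φ v =
      (∫ v, T f' v * φ v) + ((∫ v, T₀ f v * φ v) + (∫ v, T₁ f v * φ v) + ∫ v, T₂ f v * φ v) := by
    refine Eq.trans ?_ (integral_sum_four (hi _) (hi _) (hi _) (hi _))
    refine integral_congr_ae ?_
    filter_upwards [Lp.coeFn_add (T f') (T₀ f + T₁ f + T₂ f),
      Lp.coeFn_add (T₀ f + T₁ f) (T₂ f), Lp.coeFn_add (T₀ f) (T₁ f)] with v e1 e2 e3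
    rw [e1, Pi.add_apply, e2, Pi.add_apply, e3, Pi.add_apply]
    ring
  rw [L, R, hlm _ _ (hT f'), hlm _ _ (hT₀ f), hlm _ _ (hT₁ f), hlm _ _ (hT₂ f), E, E0, E1, E2, E']
  refine Eq.trans ?_ (congrArg Neg.neg (integral_sum_four I'.integral_prod_right
    I0.integral_prod_right I1.integral_prod_right I2.integral_prod_right))
  rw [← integral_neg]
  refine integral_congr_ae (.of_forall fun ξ => ?_)
  have hw := ((hf.comp_add (s.y ξ)).mul_smooth
    (smooth_prodKer (s := s) (b := b) h₀.1 h₁.1 h₂.1 ξ)).2.2 φ hφ hc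
  have hj : ∀ (g : L2V) {A : Vel → ℝ}, Smooth A →
      Integrable (fun v => A v * g (v + s.y ξ) * φ v) volume := by
    intro g A hA
    have hl : LocallyIntegrable (fun v => g (v + s.y ξ)) volume :=
      ((Lp.memLp g).comp_measurePreserving (measurePreserving_add_right volume _)).locallyIntegrable
        (by norm_num)
    refine (integrable_mul_test hl (φ := fun v => A v * φ v)
      (hA.continuous.mul hφ.continuous) hc.mul_left).congr (.of_forall fun v => ?_)
    ring
  have j0 := hj f (smooth_prodKer (s := s) (b := b) (h₀.1.pd i) h₁.1 h₂.1 ξ)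
  have j1 := hj f (smooth_prodKer (s := s) (b := b) h₀.1 (h₁.1.pd i) h₂.1 ξ)
  have j2 := hj f (smooth_prodKer (s := s) (b := b) h₀.1 h₁.1 (h₂.1.pd i) ξ)
  have j' := hj f' (smooth_prodKer (s := s) (b := b) h₀.1 h₁.1 h₂.1 ξ)
  simp only at hw ⊢
  rw [hw, ← integral_sum_four j' j0 j1 j2]
  congr 1
  refine integral_congr_ae (.of_forall fun v => ?_)
  simp only [partialD_prodKer h₀.1 h₁.1 h₂.1]
  ring

/-- The integral operators with a kernel in product form preserve the Sobolev regularity. -/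
lemma smoothOp_prodKer (hb : Measurable b) {β₀ : ℝ} (hβ₀ : 0 ≤ β₀)
    (hbB : ∀ ξ, |b ξ| ≤ β₀ * (‖ξ.1‖ ^ (κ - 1) * |inner ℝ ξ.1 (ξ.2 : Vel)|))
    (hκ : -3 < κ) (hκ0 : κ < 0) (hδ : 0 < δ) (n : ℕ)
    (h₀ : Tame (mW κ c) a₀) (h₁ : Tame (gau δ c) a₁) (h₂ : Tame (gau δ c) a₂)
    {T : L2V →L[ℝ] L2V} (hT : ∀ f, T f =ᵐ[volume] opFun s (prodKer s b a₀ a₁ a₂) f) :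
    SmoothOp n T := by
  induction n generalizing a₀ a₁ a₂ T with
  | zero => trivial
  | succ n ih =>
    intro i
    obtain ⟨B₀, k0⟩ := exists_kerBdd_prodKer s hb hβ₀ hbB (h₀.pd i) h₁ h₂
    obtain ⟨B₁, k1⟩ := exists_kerBdd_prodKer s hb hβ₀ hbB h₀ (h₁.pd i) h₂
    obtain ⟨B₂, k2⟩ := exists_kerBdd_prodKer s hb hβ₀ hbB h₀ h₁ (h₂.pd i)
    obtain ⟨T₀, hT₀⟩ := k0.exists_op hκ hκ0 hδ
    obtain ⟨T₁, hT₁⟩ := k1.exists_op hκ hκ0 hδ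
    obtain ⟨T₂, hT₂⟩ := k2.exists_op hκ hκ0 hδ
    exact ⟨T₀ + T₁ + T₂, ((ih (h₀.pd i) h₁ h₂ hT₀).add (ih h₀ (h₁.pd i) h₂ hT₁)).add
      (ih h₀ h₁ (h₂.pd i) hT₂),
      fun f f' hf => wder_opFun_prodKer hb hβ₀ hbB hκ hκ0 hδ h₀ h₁ h₂ hT hT₀ hT₁ hT₂ hf⟩

end ProdKer


/-! ### Algebra of derivative bounds. -/

section DerivBddAlgebra

variable {V W : Vel → ℝ} {n : ℕ} {a b : Vel → ℝ} {A B : ℝ}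

lemma DerivBdd.weaken (h : DerivBdd V n a A) (hVW : ∀ v, A * V v ≤ B * W v) :
    DerivBdd W n a B := by
  induction n generalizing a with
  | zero => exact fun v => (h v).trans (hVW v)
  | succ n ih => exact ⟨fun v => (h.1 v).trans (hVW v), fun i => ih (h.2 i)⟩

lemma DerivBdd.add (ha : Smooth a) (hb : Smooth b) (h : DerivBdd W n a A)
    (h' : DerivBdd W n b B) : DerivBdd W n (fun v => a v + b v) (A + B) := by
  have key : ∀ {a b : Vel → ℝ}, (∀ v, |a v| ≤ A * W v) → (∀ v, |b v| ≤ B * W v) → ∀ v,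
      |a v + b v| ≤ (A + B) * W v := fun h1 h2 v =>
    (abs_add_le _ _).trans (by linarith [h1 v, h2 v])
  induction n generalizing a b with
  | zero => exact key h h'
  | succ n ih =>
    refine ⟨key h.1 h'.1, fun i => ?_⟩
    rw [partialD_add ha.differentiable hb.differentiable]
    exact ih (ha.pd i) (hb.pd i) (h.2 i) (h'.2 i)

lemma DerivBdd.mul (hV : ∀ v, 0 ≤ V v) (hW : ∀ v, 0 ≤ W v) (hA : 0 ≤ A) (hB : 0 ≤ B)
    (ha : Smooth a) (hb : Smooth b) (h : DerivBdd V n a A) (h' : DerivBdd W n b B) :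
    DerivBdd (fun v => V v * W v) n (fun v => a v * b v) (2 ^ n * (A * B)) := by
  have key : ∀ {a b : Vel → ℝ}, (∀ v, |a v| ≤ A * V v) → (∀ v, |b v| ≤ B * W v) → ∀ (k : ℕ) v,
      |a v * b v| ≤ 2 ^ k * (A * B) * (V v * W v) := by
    intro a b h1 h2 k v
    have hk : (1 : ℝ) ≤ 2 ^ k := one_le_pow₀ (by norm_num)
    have h0 : 0 ≤ A * B * (V v * W v) := by have := hV v; have := hW v; positivity
    calc |a v * b v| = |a v| * |b v| := abs_mul _ _
      _ ≤ (A * V v) * (B * W v) :=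
        mul_le_mul (h1 v) (h2 v) (abs_nonneg _) (mul_nonneg hA (hV v))
      _ = 1 * (A * B * (V v * W v)) := by ring
      _ ≤ 2 ^ k * (A * B * (V v * W v)) := by gcongr
      _ = _ := by ring
  induction n generalizing a b with
  | zero => exact key h h' 0
  | succ n ih =>
    refine ⟨key h.1 h'.1 _, fun i => ?_⟩
    rw [partialD_mul ha.differentiable hb.differentiable]
    have h1 := DerivBdd.add (ContDiff.mul ha (hb.pd i)) (ContDiff.mul (ha.pd i) hb)
      (ih ha (hb.pd i) h.of_succ (h'.2 i)) (ih (ha.pd i) hb (h.2 i) h'.of_succ)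
    refine h1.weaken fun v => le_of_eq ?_
    rw [pow_succ]
    ring

lemma derivBdd_const (hW : ∀ v, 1 ≤ W v) (C : ℝ) : DerivBdd W n (fun _ => C) |C| := by
  have key : ∀ C D : ℝ, |C| ≤ |D| → ∀ v, |C| ≤ |D| * W v := fun C D h v => by
    nlinarith [hW v, abs_nonneg D]
  have gen : ∀ D : ℝ, |D| ≤ |C| → DerivBdd W n (fun _ => D) |C| := by
    induction n with
    | zero => exact fun D h => key D C h
    | succ n ih => exact fun D h => ⟨key D C h, fun i => by
        rw [partialD_const]; exact ih 0 (by simp)⟩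
  exact gen C le_rfl

end DerivBddAlgebra

section TameAlgebra

variable {V W : Vel → ℝ} {a b : Vel → ℝ}

lemma Tame.exists_nonneg (h : Tame W a) (hW : ∀ v, 0 ≤ W v) (n : ℕ) :
    ∃ B, 0 ≤ B ∧ DerivBdd W n a B := by
  obtain ⟨B, hB⟩ := h.2 n
  exact ⟨|B|, abs_nonneg B, hB.mono hW (le_abs_self B)⟩

lemma Tame.mul (hV : ∀ v, 0 ≤ V v) (hW : ∀ v, 0 ≤ W v) (h : Tame V a) (h' : Tame W b) :
    Tame (fun v => V v * W v) (fun v => a v * b v) := by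
  refine ⟨ContDiff.mul h.1 h'.1, fun n => ?_⟩
  obtain ⟨A, hA, h1⟩ := h.exists_nonneg hV n
  obtain ⟨B, hB, h2⟩ := h'.exists_nonneg hW n
  exact ⟨_, h1.mul hV hW hA hB h.1 h'.1 h2⟩

lemma Tame.add (h : Tame W a) (h' : Tame W b) : Tame W (fun v => a v + b v) := by
  refine ⟨ContDiff.add h.1 h'.1, fun n => ?_⟩
  obtain ⟨A, h1⟩ := h.2 n
  obtain ⟨B, h2⟩ := h'.2 n
  exact ⟨_, h1.add h.1 h'.1 h2⟩

lemma Tame.weaken (hV : ∀ v, 0 ≤ V v) (h : Tame V a) {C : ℝ} (hVW : ∀ v, V v ≤ C * W v) :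
    Tame W a := by
  refine ⟨h.1, fun n => ?_⟩
  obtain ⟨A, hA, h1⟩ := h.exists_nonneg hV n
  exact ⟨A * C, h1.weaken fun v => by rw [mul_assoc]; gcongr; exact hVW v⟩

lemma tame_const (C : ℝ) : Tame (fun _ => 1) (fun _ => C) :=
  ⟨contDiff_const, fun _ => ⟨_, derivBdd_const (fun _ => le_rfl) C⟩⟩

lemma Tame.const_mul (hW : ∀ v, 0 ≤ W v) (h : Tame W a) (C : ℝ) :
    Tame W (fun v => C * a v) := by
  have := Tame.mul (fun _ => zero_le_one) hW (tame_const C) h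
  simpa only [one_mul] using this

end TameAlgebra

/-! ### Derivative bounds for polynomial and Gaussian weights. -/

section Weights

variable (c : Vel)

/-- The function `(1 + |v - c|²)⁻¹`. -/
noncomputable def rInv (v : Vel) : ℝ := (1 + ‖v - c‖ ^ 2)⁻¹

lemma smooth_one_add_norm_sq : Smooth fun v : Vel => 1 + ‖v - c‖ ^ 2 :=
  contDiff_const.add ((contDiff_id.sub contDiff_const).norm_sq ℝ)

lemma hasFDerivAt_norm_sub_sq (v : Vel) :
    HasFDerivAt (fun v : Vel => ‖v - c‖ ^ 2) ((2 : ℝ) • innerSL ℝ (v - c)) v := by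
  have := ((hasFDerivAt_id (𝕜 := ℝ) v).sub_const c).norm_sq
  rw [← Nat.cast_smul_eq_nsmul ℝ] at this
  simpa using this

lemma inner_single_sub (v : Vel) (i : Fin 3) :
    inner ℝ (v - c) (EuclideanSpace.single i (1 : ℝ)) = coord c i v := by
  rw [EuclideanSpace.inner_single_right]
  simp [coord]

lemma partialD_comp_norm_sq {g : ℝ → ℝ} {g' : ℝ} {v : Vel} (i : Fin 3)
    (hg : HasDerivAt g g' (‖v - c‖ ^ 2)) :
    partialD i (fun v => g (‖v - c‖ ^ 2)) v = 2 * g' * coord c i v := by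
  have h := hg.comp_hasFDerivAt v (hasFDerivAt_norm_sub_sq c v)
  have h2 : fderiv ℝ (fun v => g (‖v - c‖ ^ 2)) v = g' • ((2 : ℝ) • innerSL ℝ (v - c)) := h.fderiv
  rw [partialD, h2]
  simp only [smul_apply, innerSL_apply_apply, inner_single_sub, smul_eq_mul]
  ring

lemma one_add_norm_sq_pos (v : Vel) : 0 < 1 + ‖v - c‖ ^ 2 := by positivity

lemma smooth_rInv : Smooth (rInv c) :=
  (smooth_one_add_norm_sq c).inv fun v => (one_add_norm_sq_pos c v).ne'

lemma partialD_rInv (i : Fin 3) :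
    partialD i (rInv c) = fun v => -2 * (rInv c v * (coord c i v * rInv c v)) := by
  ext v
  have h : HasDerivAt (fun s : ℝ => (1 + s)⁻¹) (-1 / (1 + ‖v - c‖ ^ 2) ^ 2) (‖v - c‖ ^ 2) :=
    ((hasDerivAt_id _).const_add 1).fun_inv (one_add_norm_sq_pos c v).ne'
  have := partialD_comp_norm_sq c i h
  rw [show rInv c = fun v => (1 + ‖v - c‖ ^ 2)⁻¹ from rfl, this]
  have := (one_add_norm_sq_pos c v).ne'
  field_simp

lemma partialD_coord_mul_rInv (i j : Fin 3) :
    partialD i (fun v => coord c j v * rInv c v) = fun v => (if i = j then 1 else 0) * rInv c v +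
      -2 * ((coord c j v * rInv c v) * (coord c i v * rInv c v)) := by
  rw [partialD_mul (smooth_coord c j).differentiable (smooth_rInv c).differentiable,
    partialD_coord, partialD_rInv]
  ext v
  ring

lemma abs_coord_sub_le (j : Fin 3) (v : Vel) : |coord c j v| ≤ ‖v - c‖ := by
  have := PiLp.norm_apply_le (v - c) j
  simpa [coord] using this

/-- The first derivatives of `rInv` and of x_j `rInv` are polynomials of degree at most two in these
same functions, so both families are bounded in one simultaneous induction. -/
lemma tame_rInv : Tame (fun _ => 1) (rInv c) ∧
    ∀ j, Tame (fun _ => 1) (fun v => coord c j v * rInv c v) := by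
  have h0 : ∀ v, |rInv c v| ≤ 1 := fun v => by
    rw [rInv, abs_of_pos (by positivity)]
    exact inv_le_one_of_one_le₀ (by nlinarith [sq_nonneg ‖v - c‖])
  have h1 : ∀ j v, |coord c j v * rInv c v| ≤ 1 := fun j v => by
    rw [abs_mul, rInv, abs_of_pos (a := (1 + ‖v - c‖ ^ 2)⁻¹) (by positivity), ← div_eq_mul_inv,
      div_le_one (by positivity)]
    nlinarith [abs_coord_sub_le c j v, sq_nonneg (‖v - c‖ - 1)]
  have hs := fun j => ContDiff.mul (smooth_coord c j) (smooth_rInv c)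
  have key : ∀ n : ℕ, (∃ B, 0 ≤ B ∧ DerivBdd (fun _ => 1) n (rInv c) B) ∧
      ∀ j, ∃ B, 0 ≤ B ∧ DerivBdd (fun _ => 1) n (fun v => coord c j v * rInv c v) B := by
    intro n
    induction n with
    | zero => exact ⟨⟨1, zero_le_one, fun v => by simpa using h0 v⟩,
        fun j => ⟨1, zero_le_one, fun v => by simpa using h1 j v⟩⟩
    | succ n ih =>
      obtain ⟨⟨A, hA, hr⟩, hp⟩ := ih
      choose B hB hp using hp
      have one : ∀ v : Vel, (0 : ℝ) ≤ (fun _ => 1) v := fun _ => zero_le_one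
      have S0 : 0 ≤ ∑ i, B i := Finset.sum_nonneg fun i _ => hB i
      have hpS : ∀ j, DerivBdd (fun _ => 1) n (fun v => coord c j v * rInv c v) (∑ i, B i) :=
        fun j => (hp j).mono one (Finset.single_le_sum (fun i _ => hB i) (Finset.mem_univ j))
      have cst : ∀ C : ℝ, DerivBdd (fun _ => 1) n (fun _ : Vel => C) |C| :=
        fun C => derivBdd_const (fun _ => le_rfl) C
      have cb : ∀ {C D K : ℝ} {f : Vel → ℝ}, 0 ≤ K → |C| ≤ D → Smooth f →
          DerivBdd (fun _ => 1) n f K →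
          DerivBdd (fun _ => 1) n (fun v => C * f v) (2 ^ n * (D * K)) := by
        intro C D K f hK hD hf h
        have h1 := ((cst C).mono one hD).mul one one ((abs_nonneg C).trans hD) hK contDiff_const hf h
        simpa only [one_mul] using h1
      have hrp := fun i => hr.mul one one hA S0 (smooth_rInv c) (hs i) (hpS i)
      have hpp := fun i j => (hpS j).mul one one S0 S0 (hs j) (hs i) (hpS i)
      simp only [one_mul] at hrp hpp
      refine ⟨⟨1 + 2 ^ n * (2 * (2 ^ n * (A * ∑ i, B i))), by positivity, ?_, fun i => ?_⟩,
        fun j => ⟨1 + (2 ^ n * (1 * A) + 2 ^ n * (2 * (2 ^ n * ((∑ i, B i) * ∑ i, B i)))),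
          by positivity, ?_, fun i => ?_⟩⟩
      · intro v
        have : 0 ≤ (2 : ℝ) ^ n * (2 * (2 ^ n * (A * ∑ i, B i))) := by positivity
        linarith [h0 v]
      · rw [partialD_rInv]
        exact (cb (D := 2) (by positivity) (by norm_num) (ContDiff.mul (smooth_rInv c) (hs i))
          (hrp i)).mono one (by linarith)
      · intro v
        have : 0 ≤ 2 ^ n * (1 * A) + 2 ^ n * (2 * (2 ^ n * ((∑ i, B i) * ∑ i, B i))) := by
          positivity
        linarith [h1 j v]
      · rw [partialD_coord_mul_rInv]
        refine (DerivBdd.add (contDiff_const.mul (smooth_rInv c))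
          (contDiff_const.mul (ContDiff.mul (hs j) (hs i)))
          (cb (D := 1) hA ?_ (smooth_rInv c) hr)
          (cb (D := 2) (by positivity) (by norm_num) (ContDiff.mul (hs j) (hs i))
            (hpp i j))).mono one (by linarith)
        split_ifs <;> simp
  exact ⟨⟨smooth_rInv c, fun n => (key n).1.imp fun _ h => h.2⟩,
    fun j => ⟨hs j, fun n => ((key n).2 j).imp fun _ h => h.2⟩⟩

lemma smooth_mW (κ : ℝ) : Smooth (mW κ c) :=
  (smooth_one_add_norm_sq c).rpow_const_of_ne fun v => (one_add_norm_sq_pos c v).ne'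

lemma partialD_mW (κ : ℝ) (i : Fin 3) :
    partialD i (mW κ c) = fun v => mW κ c v * (-κ * (coord c i v * rInv c v)) := by
  ext v
  have hp := one_add_norm_sq_pos c v
  have h : HasDerivAt (fun s : ℝ => (1 + s) ^ (-(κ / 2)))
      (-(κ / 2) * (1 + ‖v - c‖ ^ 2) ^ (-(κ / 2) - 1)) (‖v - c‖ ^ 2) := by
    have := ((hasDerivAt_id (‖v - c‖ ^ 2)).const_add 1).rpow_const (p := -(κ / 2)) (.inl hp.ne')
    simpa using this
  have := partialD_comp_norm_sq c i h
  rw [show mW κ c = fun v => (1 + ‖v - c‖ ^ 2) ^ (-(κ / 2)) from rfl, this, rInv,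
    Real.rpow_sub_one hp.ne']
  ring

/-- The logarithmic derivatives of the weight are multiples of xᵢ `rInv`, which is bounded with all
its derivatives. -/
lemma tame_mW (κ : ℝ) : Tame (mW κ c) (mW κ c) := by
  refine ⟨smooth_mW c κ, fun n => ?_⟩
  have hW : ∀ v, 0 ≤ mW κ c v := fun v => (mW_pos v).le
  have one : ∀ v : Vel, (0 : ℝ) ≤ (fun _ => 1) v := fun _ => zero_le_one
  suffices h : ∃ B, 0 ≤ B ∧ DerivBdd (mW κ c) n (mW κ c) B from h.imp fun _ h => h.2
  induction n with
  | zero => exact ⟨1, zero_le_one, fun v => by rw [abs_of_nonneg (hW v), one_mul]⟩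
  | succ n ih =>
    obtain ⟨B, hB, h⟩ := ih
    choose D hD hd using fun i =>
      (((tame_rInv c).2 i).const_mul (fun _ => zero_le_one) (-κ)).exists_nonneg one n
    have S0 : 0 ≤ ∑ i, D i := Finset.sum_nonneg fun i _ => hD i
    have h2 := fun i => h.mul hW one hB S0 (smooth_mW c κ)
      (contDiff_const.mul (ContDiff.mul (smooth_coord c i) (smooth_rInv c)))
      ((hd i).mono one (Finset.single_le_sum (fun i _ => hD i) (Finset.mem_univ i)))
    simp only [mul_one] at h2
    have e : 0 ≤ 2 ^ n * (B * ∑ i, D i) := by positivity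
    refine ⟨1 + 2 ^ n * (B * ∑ i, D i), by positivity, fun v => ?_, fun i => ?_⟩
    · rw [abs_of_nonneg (hW v)]
      nlinarith [hW v]
    · rw [partialD_mW]
      exact (h2 i).mono hW (by linarith)

lemma smooth_gau (s : ℝ) : Smooth (gau s c) := by
  have : Smooth fun v : Vel => ‖v - c‖ ^ 2 := (contDiff_id.sub contDiff_const).norm_sq ℝ
  exact ((contDiff_const.mul this).neg).exp

lemma partialD_gau (s : ℝ) (i : Fin 3) :
    partialD i (gau s c) = fun v => -2 * s * coord c i v * gau s c v := by
  ext v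
  have h : HasDerivAt (fun x : ℝ => Real.exp (-(s * x)))
      (Real.exp (-(s * ‖v - c‖ ^ 2)) * (-s)) (‖v - c‖ ^ 2) := by
    have := (((hasDerivAt_id (‖v - c‖ ^ 2)).const_mul s).neg).exp
    simpa using this
  have := partialD_comp_norm_sq c i h
  rw [show gau s c = fun v => Real.exp (-(s * ‖v - c‖ ^ 2)) from rfl, this]
  ring

lemma gau_mul_gau (s t : ℝ) (v : Vel) : gau s c v * gau t c v = gau (s + t) c v := by
  rw [gau, gau, gau, ← Real.exp_add]
  congr 1
  ring

lemma gau_anti {s t : ℝ} (h : s ≤ t) (v : Vel) : gau t c v ≤ gau s c v := by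
  unfold gau
  gcongr

lemma gau_zero (v : Vel) : gau 0 c v = 1 := by simp [gau]

/-- The derivatives of `exp(-t|v-c|²)` are bounded uniformly for bounded `t`. -/
lemma exists_derivBdd_gau (t₀ : ℝ) (n : ℕ) {δ : ℝ} (hδ : δ < 1) :
    ∃ B, 0 ≤ B ∧ ∀ t, 0 ≤ t → t ≤ t₀ → DerivBdd (gau (δ * t) c) n (gau t c) B := by
  have hW : ∀ s v, 0 ≤ gau s c v := fun s v => (gau_pos v).le
  have base : ∀ δ < 1, ∀ t, 0 ≤ t → ∀ v, |gau t c v| ≤ 1 * gau (δ * t) c v := by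
    intro δ hδ t ht v
    rw [abs_of_nonneg (hW t v), one_mul]
    exact gau_anti c (by nlinarith) v
  induction n generalizing δ with
  | zero => exact ⟨1, zero_le_one, fun t ht _ => base δ hδ t ht⟩
  | succ n ih =>
    -- Each differentiation gives up a part ε of the rate to pay for a linear factor, so the
    -- induction hypothesis is used at the larger rate δ + ε < 1.
    set ε := (1 - δ) / 2 with hε
    have hε0 : 0 < ε := by linarith
    obtain ⟨B, hB, h⟩ := ih (δ := δ + ε) (by linarith)
    set K := 1 + ε⁻¹ + √t₀ with hK
    have hK0 : 0 ≤ K := by positivity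
    -- One factor √t stays with the coordinate, since √t |xᵢ| ≤ 1 + t|x|² is dominated by a Gaussian
    -- of rate −εt uniformly in t; the other is at most √t₀.
    have lin : ∀ t, 0 ≤ t → t ≤ t₀ → ∀ i,
        DerivBdd (gau (-ε * t) c) n (fun v => √t * coord c i v) K := by
      intro t ht htt i
      have b0 : ∀ v, |√t * coord c i v| ≤ K * gau (-ε * t) c v := by
        intro v
        have e1 : |√t * coord c i v| ≤ 1 + t * ‖v - c‖ ^ 2 := by
          rw [abs_mul, abs_of_nonneg (Real.sqrt_nonneg t)]
          have h1 := abs_coord_sub_le c i v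
          have h2 := Real.sq_sqrt ht
          have h3 := Real.sqrt_nonneg t
          have h4 : √t * |coord c i v| ≤ √t * ‖v - c‖ := by gcongr
          nlinarith [sq_nonneg (√t * ‖v - c‖ - 1)]
        have e2 : 1 + ε * (t * ‖v - c‖ ^ 2) ≤ gau (-ε * t) c v := by
          have := Real.add_one_le_exp (ε * (t * ‖v - c‖ ^ 2))
          unfold gau
          rw [show -(-ε * t * ‖v - c‖ ^ 2) = ε * (t * ‖v - c‖ ^ 2) by ring]
          linarith
        have e3 : 0 ≤ t * ‖v - c‖ ^ 2 := by positivity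
        have e4 : 1 + t * ‖v - c‖ ^ 2 ≤ (1 + ε⁻¹) * (1 + ε * (t * ‖v - c‖ ^ 2)) := by
          have : ε⁻¹ * ε = 1 := inv_mul_cancel₀ hε0.ne'
          have p1 : 0 ≤ ε⁻¹ := by positivity
          have p2 : 0 ≤ ε * (t * ‖v - c‖ ^ 2) := by positivity
          nlinarith
        calc _ ≤ (1 + ε⁻¹) * (1 + ε * (t * ‖v - c‖ ^ 2)) := e1.trans e4
          _ ≤ K * gau (-ε * t) c v := by
            gcongr
            rw [hK]
            linarith [Real.sqrt_nonneg t₀]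
      have hone : ∀ v, 1 ≤ gau (-ε * t) c v := by
        intro v
        unfold gau
        rw [Real.one_le_exp_iff]
        have : 0 ≤ ε * t * ‖v - c‖ ^ 2 := by positivity
        linarith
      cases n with
      | zero => exact b0
      | succ n =>
        refine ⟨b0, fun j => ?_⟩
        rw [partialD_const_mul _ (smooth_coord c i).differentiable, partialD_coord]
        refine (derivBdd_const hone (√t * if j = i then 1 else 0)).mono (hW _) ?_
        have : √t ≤ √t₀ := Real.sqrt_le_sqrt htt
        have p1 : 0 ≤ ε⁻¹ := by positivity
        rw [abs_of_nonneg (by split_ifs <;> positivity)]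
        split_ifs
        · rw [hK]; linarith
        · simpa using hK0
    have h2 : ∀ t, 0 ≤ t → t ≤ t₀ → ∀ i, DerivBdd (gau (δ * t) c) n (partialD i (gau t c))
        (2 ^ n * (2 * √t₀ * (2 ^ n * (K * B)))) := by
      intro t ht htt i
      have h3 := (lin t ht htt i).mul (hW _) (hW _) hK0 hB
        (contDiff_const.mul (smooth_coord c i)) (smooth_gau c t) (h t ht htt)
      have h4 : DerivBdd (fun _ => 1) n (fun _ : Vel => -2 * √t) (2 * √t₀) := by
        refine (derivBdd_const (fun _ => le_rfl) _).mono (fun _ => zero_le_one) ?_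
        rw [abs_mul, abs_of_nonneg (Real.sqrt_nonneg t)]
        have : √t ≤ √t₀ := Real.sqrt_le_sqrt htt
        norm_num
        exact this
      have h5 := h4.mul (fun _ => zero_le_one) (fun v => mul_nonneg (hW _ v) (hW _ v))
        (by positivity) (by positivity) contDiff_const
        ((contDiff_const.mul (smooth_coord c i)).mul (smooth_gau c t)) h3
      have e1 : partialD i (gau t c) = fun v => -2 * √t * (√t * coord c i v * gau t c v) := by
        rw [partialD_gau]
        ext v
        linear_combination (2 * coord c i v * gau t c v) * Real.mul_self_sqrt ht
      rw [e1]
      refine h5.weaken fun v => le_of_eq ?_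
      rw [one_mul, gau_mul_gau]
      congr 2
      ring
    refine ⟨1 + 2 ^ n * (2 * √t₀ * (2 ^ n * (K * B))), by positivity, fun t ht htt =>
      ⟨fun v => (base δ hδ t ht v).trans ?_, fun i => (h2 t ht htt i).mono (hW _) (by linarith)⟩⟩
    gcongr
    · exact hW _ v
    · have : 0 ≤ 2 ^ n * (2 * √t₀ * (2 ^ n * (K * B))) := by positivity
      linarith

/-- Differentiation produces polynomial factors, so the dominating Gaussian must have a strictly
smaller rate. -/
lemma tame_gau {s δ : ℝ} (hs : 0 < s) (h : δ < s) : Tame (gau δ c) (gau s c) := by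
  refine ⟨smooth_gau c s, fun n => ?_⟩
  obtain ⟨B, -, hB⟩ := exists_derivBdd_gau c s n (δ := δ / s) (by rwa [div_lt_one hs])
  refine ⟨B, ?_⟩
  have := hB s hs.le le_rfl
  rwa [div_mul_cancel₀ _ hs.ne'] at this

end Weights


/-! ### The collision kernel, powers of the Maxwellian, and two-sided bounds of the collision
frequency. -/

/-- The standing assumptions on the collision kernel and on the Maxwellian. -/
structure Admissible (κ : ℝ) (β : ℝ → ℝ) (ρ T : ℝ) : Prop where
  lower : -3 < κ
  neg : κ < 0
  meas : Measurable β
  cutoff : ∃ β₀ : ℝ, 0 < β₀ ∧ ∀ θ ∈ Set.Icc 0 Real.pi, 0 ≤ β θ ∧ β θ ≤ β₀ * |Real.cos θ|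
  nontrivial : ¬ ∀ᵐ θ ∂(volume.restrict (Set.Icc 0 Real.pi)), β θ = 0
  density_pos : 0 < ρ
  temp_pos : 0 < T

/-- The collision kernel as a function of `u - v` and `ω`. -/
noncomputable def bker (κ : ℝ) (β : ℝ → ℝ) (ξ : Vel × S2) : ℝ := kernelB κ β (-ξ.1) ξ.2

/-- The normalizing constant of the Maxwellian. -/
noncomputable def maxConst (ρ T : ℝ) : ℝ := ρ / (2 * Real.pi * T) ^ (3 / 2 : ℝ)

section Kernel

variable {κ : ℝ} {β : ℝ → ℝ} {ρ T : ℝ}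

lemma measurable_bker (hβ : Measurable β) : Measurable (bker κ β) := by
  unfold bker kernelB InnerProductGeometry.angle
  have h : Measurable fun x : ℝ => Real.arccos x := Real.continuous_arccos.measurable
  fun_prop

lemma bker_shift (s : Shift) (ξ : Vel × S2) : bker κ β (s.ρ ξ) = bker κ β ξ := by
  simp only [bker, kernelB, InnerProductGeometry.angle, norm_neg, inner_neg_left, s.norm_ρ,
    s.inner_ρ, norm_S2]

lemma Admissible.bker_nonneg (h : Admissible κ β ρ T) (ξ : Vel × S2) : 0 ≤ bker κ β ξ := by
  obtain ⟨β₀, h0, h1⟩ := h.cutoff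
  exact mul_nonneg (by positivity)
    (h1 _ ⟨InnerProductGeometry.angle_nonneg _ _, InnerProductGeometry.angle_le_pi _ _⟩).1

/-- Since |cos θ| = |z·ω|/|z|, the cutoff assumption trades one power of |z| for |z·ω|, the weight
occurring in the majorant. -/
lemma Admissible.exists_abs_bker_le (h : Admissible κ β ρ T) : ∃ β₀, 0 ≤ β₀ ∧ ∀ ξ : Vel × S2,
    |bker κ β ξ| ≤ β₀ * (‖ξ.1‖ ^ (κ - 1) * |inner ℝ ξ.1 (ξ.2 : Vel)|) := by
  obtain ⟨β₀, h0, h1⟩ := h.cutoff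
  refine ⟨β₀, h0.le, fun ξ => ?_⟩
  rw [abs_of_nonneg (h.bker_nonneg ξ), bker, kernelB, norm_neg]
  rcases eq_or_ne ξ.1 0 with hz | hz
  · simp [hz, Real.zero_rpow h.neg.ne]
  · have hp : 0 < ‖ξ.1‖ := norm_pos_iff.2 hz
    have h2 := (h1 _ ⟨InnerProductGeometry.angle_nonneg (-ξ.1) (ξ.2 : Vel),
      InnerProductGeometry.angle_le_pi _ _⟩).2
    rw [InnerProductGeometry.cos_angle, norm_neg, norm_S2, mul_one, inner_neg_left, abs_div,
      abs_neg, abs_of_pos hp] at h2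
    calc _ ≤ ‖ξ.1‖ ^ κ * (β₀ * (|inner ℝ ξ.1 (ξ.2 : Vel)| / ‖ξ.1‖)) := by gcongr
      _ = _ := by rw [Real.rpow_sub_one hp.ne']; ring

lemma Admissible.const_pos (h : Admissible κ β ρ T) : 0 < maxConst ρ T := by
  have := h.density_pos
  have := h.temp_pos
  unfold maxConst
  positivity

variable {𝔲 : Vel}

lemma maxwellian_eq (v : Vel) :
    maxwellian ρ 𝔲 T v = maxConst ρ T * gau (1 / (2 * T)) 𝔲 v := by
  rw [maxwellian, maxConst, gau]
  congr 3
  ring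

lemma Admissible.maxwellian_rpow (h : Admissible κ β ρ T) (s : ℝ) (v : Vel) :
    maxwellian ρ 𝔲 T v ^ s = maxConst ρ T ^ s * gau (s / (2 * T)) 𝔲 v := by
  rw [maxwellian_eq, Real.mul_rpow h.const_pos.le (gau_pos v).le]
  congr 1
  rw [gau, gau, ← Real.exp_mul]
  congr 1
  ring

lemma Admissible.maxwellian_pos (h : Admissible κ β ρ T) (v : Vel) : 0 < maxwellian ρ 𝔲 T v := by
  rw [maxwellian_eq]
  exact mul_pos h.const_pos (gau_pos v)

lemma Admissible.tame_rpow (h : Admissible κ β ρ T) {s δ : ℝ} (hs : 0 < s) (hδ : δ < s / (2 * T)) :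
    Tame (gau δ 𝔲) (fun v => maxwellian ρ 𝔲 T v ^ s) := by
  have hT := h.temp_pos
  simp only [h.maxwellian_rpow]
  exact (tame_gau 𝔲 (by positivity) hδ).const_mul (fun v => (gau_pos v).le) _

/-- The energy conservation in terms of the Maxwellian. -/
lemma Admissible.maxwellian_mul_rpow (h : Admissible κ β ρ T) (s : Shift) (t : ℝ) (v : Vel)
    (ξ : Vel × S2) :
    maxwellian ρ 𝔲 T (v + s.y ξ) ^ t * maxwellian ρ 𝔲 T (v + ξ.1 - s.y ξ) ^ t =
      maxwellian ρ 𝔲 T v ^ t * maxwellian ρ 𝔲 T (v + ξ.1) ^ t := by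
  have e := s.energy v 𝔲 ξ
  have key : gau (t / (2 * T)) 𝔲 (v + s.y ξ) * gau (t / (2 * T)) 𝔲 (v + ξ.1 - s.y ξ) =
      gau (t / (2 * T)) 𝔲 v * gau (t / (2 * T)) 𝔲 (v + ξ.1) := by
    simp only [gau, ← Real.exp_add]
    congr 1
    linear_combination (-(t / (2 * T))) * e
  simp only [h.maxwellian_rpow]
  linear_combination maxConst ρ T ^ t * maxConst ρ T ^ t * key

lemma integral_collMeasure_add (v : Vel) (f : Vel × S2 → ℝ) :
    ∫ p, f p ∂collMeasure = ∫ ξ, f (v + ξ.1, ξ.2) ∂collMeasure := by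
  have hmp : MeasurePreserving (fun ξ : Vel × S2 => (v + ξ.1, ξ.2)) collMeasure collMeasure :=
    (measurePreserving_add_left (volume : Measure Vel) v).prod (MeasurePreserving.id _)
  have hme : MeasurableEmbedding (fun ξ : Vel × S2 => (v + ξ.1, ξ.2)) :=
    (MeasurableEquiv.addLeft v).measurableEmbedding.prodMap MeasurableEmbedding.id
  exact (hmp.integral_comp hme f).symm

lemma nu_eq (v : Vel) :
    nu κ β ρ 𝔲 T v = ∫ ξ, bker κ β ξ * maxwellian ρ 𝔲 T (v + ξ.1) ∂collMeasure := by
  rw [nu, integral_collMeasure_add v]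
  simp only [bker, sub_add_cancel_left]

lemma measurable_maxwellian : Measurable (maxwellian ρ 𝔲 T) := by
  unfold maxwellian
  fun_prop

lemma Admissible.nu_nonneg (h : Admissible κ β ρ T) (v : Vel) : 0 ≤ nu κ β ρ 𝔲 T v := by
  rw [nu_eq]
  exact integral_nonneg fun ξ => mul_nonneg (h.bker_nonneg ξ) (h.maxwellian_pos _).le

lemma Admissible.measurable_nu (h : Admissible κ β ρ T) : Measurable (nu κ β ρ 𝔲 T) := by
  have e : nu κ β ρ 𝔲 T = fun v => ∫ ξ, bker κ β ξ * maxwellian ρ 𝔲 T (v + ξ.1) ∂collMeasure :=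
    funext nu_eq
  rw [e]
  have h1 : Measurable (bker κ β) := measurable_bker h.meas
  have h2 : Measurable (maxwellian ρ 𝔲 T) := measurable_maxwellian
  have : Measurable fun x : Vel × (Vel × S2) => bker κ β x.2 * maxwellian ρ 𝔲 T (x.1 + x.2.1) := by
    fun_prop
  exact (this.stronglyMeasurable.integral_prod_right').measurable

lemma Admissible.exists_lintegral_nu_le (h : Admissible κ β ρ T) : ∃ C : ℝ, 0 < C ∧ ∀ v : Vel,
    ∫⁻ ξ, ENNReal.ofReal (bker κ β ξ * maxwellian ρ 𝔲 T (v + ξ.1)) ∂collMeasure ≤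
      ENNReal.ofReal (C * (mW κ 𝔲 v)⁻¹) := by
  obtain ⟨β₀, h0, h1⟩ := h.exists_abs_bker_le
  have hT := h.temp_pos
  have hA := h.const_pos
  obtain ⟨C, hC, h2⟩ := exists_lintegral_coll_gauss 𝔲 h.lower h.neg.le
    (δ := 1 / (2 * T)) (by positivity)
  refine ⟨β₀ * maxConst ρ T * C.toReal + 1, by positivity, fun v => ?_⟩
  have e : (mW κ 𝔲 v)⁻¹ = (1 + ‖v - 𝔲‖ ^ 2) ^ (κ / 2) :=
    inv_eq_of_mul_eq_one_right (mW_mul_rpow v)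
  calc _ ≤ ∫⁻ ξ, ENNReal.ofReal (β₀ * maxConst ρ T) *
          ENNReal.ofReal (‖ξ.1‖ ^ κ * gau (1 / (2 * T)) 𝔲 (v + ξ.1)) ∂collMeasure := by
        refine lintegral_mono fun ξ => ?_
        rw [← ENNReal.ofReal_mul (by positivity)]
        refine ENNReal.ofReal_le_ofReal ?_
        rw [maxwellian_eq]
        have g0 := (gau_pos (δ := 1 / (2 * T)) (c := 𝔲) (v + ξ.1)).le
        calc _ ≤ (β₀ * ‖ξ.1‖ ^ κ) * (maxConst ρ T * gau (1 / (2 * T)) 𝔲 (v + ξ.1)) := by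
              gcongr
              exact (le_abs_self _).trans ((h1 ξ).trans
                (mul_le_mul_of_nonneg_left (rpow_mul_inner_le κ ξ) h0))
          _ = _ := by ring
    _ = ENNReal.ofReal (β₀ * maxConst ρ T) *
          ∫⁻ ξ, ENNReal.ofReal (‖ξ.1‖ ^ κ * gau (1 / (2 * T)) 𝔲 (v + ξ.1)) ∂collMeasure :=
        lintegral_const_mul' _ _ ENNReal.ofReal_ne_top
    _ ≤ ENNReal.ofReal (β₀ * maxConst ρ T) *
          (C * ENNReal.ofReal ((1 + ‖v - 𝔲‖ ^ 2) ^ (κ / 2))) := by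
        gcongr
        exact h2 v
    _ = ENNReal.ofReal (β₀ * maxConst ρ T * C.toReal * (mW κ 𝔲 v)⁻¹) := by
        rw [e]
        conv_lhs => rw [← ENNReal.ofReal_toReal hC]
        rw [← ENNReal.ofReal_mul ENNReal.toReal_nonneg, ← ENNReal.ofReal_mul (by positivity)]
        congr 1
        ring
    _ ≤ _ := by
        have := mW_pos (κ := κ) (c := 𝔲) v
        gcongr
        linarith

lemma Admissible.integrable_nu (h : Admissible κ β ρ T) (v : Vel) :
    Integrable (fun ξ => bker κ β ξ * maxwellian ρ 𝔲 T (v + ξ.1)) collMeasure := by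
  obtain ⟨C, -, h1⟩ := h.exists_lintegral_nu_le (𝔲 := 𝔲)
  have h2 : Measurable (bker κ β) := measurable_bker h.meas
  have h3 : Measurable (maxwellian ρ 𝔲 T) := measurable_maxwellian
  refine ⟨(by fun_prop : Measurable _).aestronglyMeasurable, ?_⟩
  rw [hasFiniteIntegral_iff_ofReal
    (.of_forall fun ξ => mul_nonneg (h.bker_nonneg ξ) (h.maxwellian_pos _).le)]
  exact (h1 v).trans_lt ENNReal.ofReal_lt_top

lemma Admissible.ofReal_nu (h : Admissible κ β ρ T) (v : Vel) :
    ENNReal.ofReal (nu κ β ρ 𝔲 T v) =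
      ∫⁻ ξ, ENNReal.ofReal (bker κ β ξ * maxwellian ρ 𝔲 T (v + ξ.1)) ∂collMeasure := by
  rw [nu_eq]
  exact ofReal_integral_eq_lintegral_ofReal (h.integrable_nu v)
    (.of_forall fun ξ => mul_nonneg (h.bker_nonneg ξ) (h.maxwellian_pos _).le)

lemma Admissible.exists_nu_le (h : Admissible κ β ρ T) (𝔲 : Vel) :
    ∃ C : ℝ, 0 < C ∧ ∀ v, mW κ 𝔲 v * nu κ β ρ 𝔲 T v ≤ C := by
  obtain ⟨C, hC, h1⟩ := h.exists_lintegral_nu_le (𝔲 := 𝔲)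
  refine ⟨C, hC, fun v => ?_⟩
  have hm := mW_pos (κ := κ) (c := 𝔲) v
  have h2 := h1 v
  rw [← h.ofReal_nu, ENNReal.ofReal_le_ofReal_iff (by positivity)] at h2
  rw [← div_eq_mul_inv, le_div_iff₀ hm] at h2
  linarith

/-- Peetre's inequality gives mW(v) |z|^κ ≥ 2^{κ/2} (1 + |u − 𝔲|²)^{κ/2} with u = v + z, so the
integral over u is bounded below independently of v. The angular integral does not depend on the
direction of z and is positive because β is not almost everywhere zero. -/
lemma Admissible.exists_le_nu (h : Admissible κ β ρ T) (𝔲 : Vel) :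
    ∃ C : ℝ, 0 < C ∧ ∀ v, C ≤ mW κ 𝔲 v * nu κ β ρ 𝔲 T v := by
  obtain ⟨β₁, hβ₁, hc1⟩ := h.cutoff
  set a : ℝ≥0∞ := ∫⁻ ω : S2, ENNReal.ofReal (β (Real.arccos ((ω : Vel) 0))) ∂sphereM with ha
  set I : ℝ≥0∞ := ∫⁻ u : Vel, ENNReal.ofReal
    (2 ^ (κ / 2) * ((1 + ‖u - 𝔲‖ ^ 2) ^ (κ / 2) * maxwellian ρ 𝔲 T u)) with hI
  have ha0 : a ≠ 0 := by
    intro h0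
    refine h.nontrivial (ae_angle_of_lintegral_eq_zero h.meas ?_)
    rw [← h0, ha]
    refine lintegral_congr fun ω => ?_
    rw [abs_of_nonneg (hc1 _ ⟨Real.arccos_nonneg _, Real.arccos_le_pi _⟩).1]
  have hmm : Measurable (maxwellian ρ 𝔲 T) := measurable_maxwellian
  have hIm : Measurable fun u : Vel => ENNReal.ofReal
      (2 ^ (κ / 2) * ((1 + ‖u - 𝔲‖ ^ 2) ^ (κ / 2) * maxwellian ρ 𝔲 T u)) := by fun_prop
  have hI0 : I ≠ 0 := by
    rw [hI, Ne, lintegral_eq_zero_iff hIm]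
    intro h0
    obtain ⟨u, hu⟩ := h0.exists
    have := h.maxwellian_pos (𝔲 := 𝔲) u
    simp only [Pi.zero_apply, ENNReal.ofReal_eq_zero] at hu
    have : 0 < (2 : ℝ) ^ (κ / 2) * ((1 + ‖u - 𝔲‖ ^ 2) ^ (κ / 2) * maxwellian ρ 𝔲 T u) := by
      positivity
    linarith
  have key : ∀ v, a * I ≤ ENNReal.ofReal (mW κ 𝔲 v * nu κ β ρ 𝔲 T v) := by
    intro v
    have hm := mW_pos (κ := κ) (c := 𝔲) v
    have mb : Measurable (bker κ β) := measurable_bker h.meas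
    rw [ENNReal.ofReal_mul hm.le, h.ofReal_nu, ← lintegral_const_mul' _ _ ENNReal.ofReal_ne_top,
      collMeasure, lintegral_prod _ (by fun_prop), hI, ← lintegral_const_mul _ hIm,
      ← lintegral_add_left_eq_self _ v]
    refine lintegral_mono_ae ?_
    have h0 : ∀ᵐ z : Vel, z ≠ 0 := by simp [ae_iff]
    filter_upwards [h0] with z hz
    have e1 := lintegral_sphere_angle (Φ := fun θ => ENNReal.ofReal (β θ))
      h.meas.ennreal_ofReal (neg_ne_zero.2 hz)
    have hzp : 0 < ‖z‖ := norm_pos_iff.2 hz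
    have mz := h.maxwellian_pos (𝔲 := 𝔲) (v + z)
    rw [ha, ← e1, mul_comm, ← lintegral_const_mul' _ _ ENNReal.ofReal_ne_top]
    refine lintegral_mono fun ω => ?_
    have hb := (hc1 _ ⟨InnerProductGeometry.angle_nonneg (-z) (ω : Vel),
      InnerProductGeometry.angle_le_pi _ _⟩).1
    simp only
    rw [← ENNReal.ofReal_mul (by positivity), ← ENNReal.ofReal_mul hm.le]
    refine ENNReal.ofReal_le_ofReal ?_
    rw [bker, kernelB, norm_neg]
    simp only
    have e2 : (2 : ℝ) ^ (κ / 2) * (1 + ‖v + z - 𝔲‖ ^ 2) ^ (κ / 2) ≤ mW κ 𝔲 v * ‖z‖ ^ κ := by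
      have e3 : (1 + ‖z‖ ^ 2) ^ (κ / 2) ≤ ‖z‖ ^ κ := by
        calc (1 + ‖z‖ ^ 2) ^ (κ / 2) ≤ (‖z‖ ^ 2) ^ (κ / 2) :=
              Real.rpow_le_rpow_of_nonpos (by positivity) (by linarith) (by linarith [h.neg])
          _ = ‖z‖ ^ κ := by
              rw [← Real.rpow_natCast, ← Real.rpow_mul hzp.le]
              congr 1
              push_cast
              ring
      have e4 : (2 * (1 + ‖v + z - 𝔲‖ ^ 2)) ^ (κ / 2) ≤
          ((1 + ‖v - 𝔲‖ ^ 2)⁻¹ * (1 + ‖z‖ ^ 2)) ^ (κ / 2) := by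
        refine Real.rpow_le_rpow_of_nonpos (by positivity) ?_ (by linarith [h.neg])
        have e5 := one_add_norm_sq_le (-z) (v + z - 𝔲)
        rw [inv_mul_le_iff₀ (by positivity)]
        rw [norm_neg, show -z + (v + z - 𝔲) = v - 𝔲 by abel] at e5
        linarith
      rw [Real.mul_rpow (by norm_num) (by positivity), Real.mul_rpow (by positivity) (by positivity),
        Real.inv_rpow (by positivity), ← Real.rpow_neg (by positivity)] at e4
      exact e4.trans (mul_le_mul_of_nonneg_left e3 hm.le)
    calc _ = ((2 : ℝ) ^ (κ / 2) * (1 + ‖v + z - 𝔲‖ ^ 2) ^ (κ / 2)) *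
          (maxwellian ρ 𝔲 T (v + z) * β (InnerProductGeometry.angle (-z) (ω : Vel))) := by ring
      _ ≤ (mW κ 𝔲 v * ‖z‖ ^ κ) *
          (maxwellian ρ 𝔲 T (v + z) * β (InnerProductGeometry.angle (-z) (ω : Vel))) := by gcongr
      _ = _ := by ring
  -- Neither factor needs to be estimated from above: the product is finite since it is bounded by a
  -- real number.
  have hfin : a * I ≠ ⊤ := ((key 0).trans_lt ENNReal.ofReal_lt_top).ne
  refine ⟨(a * I).toReal, ENNReal.toReal_pos (mul_ne_zero ha0 hI0) hfin, fun v => ?_⟩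
  have := key v
  rwa [ENNReal.le_ofReal_iff_toReal_le hfin
    (mul_nonneg (mW_pos v).le (h.nu_nonneg v))] at this

lemma Admissible.nu_pos (h : Admissible κ β ρ T) (v : Vel) : 0 < nu κ β ρ 𝔲 T v := by
  obtain ⟨C, hC, h1⟩ := h.exists_le_nu 𝔲
  exact pos_of_mul_pos_right (hC.trans_le (h1 v)) (mW_pos v).le

end Kernel


/-! ### The decomposition of the linearized operator. -/

/-- The displacements in the three parts of the operator `ν - L`. -/
noncomputable def collS : Fin 3 → Shift := ![parS, perpS, fullS]

/-- The collision kernels of the three parts of the operator `ν - L`. -/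
noncomputable def collB (κ : ℝ) (β : ℝ → ℝ) (i : Fin 3) (ξ : Vel × S2) : ℝ :=
  (![1, 1, -1] : Fin 3 → ℝ) i * bker κ β ξ

/-- The kernels of the three parts of a weighted version of the operator `ν - L`. -/
noncomputable def collP (κ : ℝ) (β : ℝ → ℝ) (a₀ a₁ a₂ : Vel → ℝ) (i : Fin 3) :
    Vel → Vel × S2 → ℝ := prodKer (collS i) (collB κ β i) a₀ a₁ a₂

/-- The sum of the integral operators with kernels `P i`. -/
noncomputable def sumOp (P : Fin 3 → Vel → Vel × S2 → ℝ) (f : Vel → ℝ) (v : Vel) : ℝ :=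
  ∑ i, opFun (collS i) (P i) f v

/-- The kernels of the operator `ν - L`. -/
noncomputable def linP (κ : ℝ) (β : ℝ → ℝ) (ρ : ℝ) (𝔲 : Vel) (T : ℝ) :
    Fin 3 → Vel → Vel × S2 → ℝ :=
  collP κ β (fun _ => 1) (fun v => maxwellian ρ 𝔲 T v ^ (1 / 2 : ℝ))
    (fun v => maxwellian ρ 𝔲 T v ^ (1 / 2 : ℝ))

section Formula

variable {κ : ℝ} {β : ℝ → ℝ} {ρ T : ℝ} {𝔲 : Vel}

lemma vPost_add (v : Vel) (ξ : Vel × S2) : vPost v (v + ξ.1) ξ.2 = v + parC ξ := by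
  rw [vPost, parC, sub_add_cancel_left, inner_neg_left]
  module

lemma uPost_add (v : Vel) (ξ : Vel × S2) : uPost v (v + ξ.1) ξ.2 = v + (ξ.1 - parC ξ) := by
  rw [uPost, parC, sub_add_cancel_left, inner_neg_left]
  module

/-- Energy conservation gives √μ(u') √μ(v') = √μ(u) √μ(v). This frees the factor √μ(v), and the
remaining √μ(u') is the Maxwellian factor at u + v − w, where w = v' is the argument of f. -/
lemma Admissible.Qplus_left (h : Admissible κ β ρ T) (f : Vel → ℝ) (v : Vel) :
    Qplus κ β (maxwellian ρ 𝔲 T) (fun w => √(maxwellian ρ 𝔲 T w) * f w) v =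
      maxwellian ρ 𝔲 T v ^ (1 / 2 : ℝ) * opFun parS (linP κ β ρ 𝔲 T 0) f v := by
  rw [Qplus, integral_collMeasure_add v, opFun, ← integral_const_mul]
  refine integral_congr_ae (.of_forall fun ξ => ?_)
  have e := h.maxwellian_mul_rpow (𝔲 := 𝔲) parS (1 / 2) v ξ
  have e2 : ∀ w, maxwellian ρ 𝔲 T w = maxwellian ρ 𝔲 T w ^ (1 / 2 : ℝ) *
      maxwellian ρ 𝔲 T w ^ (1 / 2 : ℝ) := fun w => by
    rw [← Real.rpow_add (h.maxwellian_pos w)]; norm_num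
  have ey : (parS.y ξ) = parC ξ := rfl
  simp only [ey] at e
  simp only [vPost_add, uPost_add, sub_add_cancel_left, linP, collP, prodKer, collB, collS,
    Matrix.cons_val_zero, one_mul, ey, Real.sqrt_eq_rpow, add_sub_assoc] at e ⊢
  change bker κ β ξ * _ * _ = _
  linear_combination (bker κ β ξ * maxwellian ρ 𝔲 T (v + (ξ.1 - parC ξ)) ^ (1 / 2 : ℝ) *
    f (v + parC ξ)) * e + (bker κ β ξ * (maxwellian ρ 𝔲 T (v + parC ξ) ^ (1 / 2 : ℝ) *
    f (v + parC ξ))) * e2 (v + (ξ.1 - parC ξ))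

lemma Admissible.Qplus_right (h : Admissible κ β ρ T) (f : Vel → ℝ) (v : Vel) :
    Qplus κ β (fun w => √(maxwellian ρ 𝔲 T w) * f w) (maxwellian ρ 𝔲 T) v =
      maxwellian ρ 𝔲 T v ^ (1 / 2 : ℝ) * opFun perpS (linP κ β ρ 𝔲 T 1) f v := by
  rw [Qplus, integral_collMeasure_add v, opFun, ← integral_const_mul]
  refine integral_congr_ae (.of_forall fun ξ => ?_)
  have e := h.maxwellian_mul_rpow (𝔲 := 𝔲) perpS (1 / 2) v ξ
  have e2 : ∀ w, maxwellian ρ 𝔲 T w = maxwellian ρ 𝔲 T w ^ (1 / 2 : ℝ) *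
      maxwellian ρ 𝔲 T w ^ (1 / 2 : ℝ) := fun w => by
    rw [← Real.rpow_add (h.maxwellian_pos w)]; norm_num
  have ey : (perpS.y ξ) = ξ.1 - parC ξ := rfl
  have ez : v + ξ.1 - (ξ.1 - parC ξ) = v + parC ξ := by abel
  simp only [ey] at e
  simp only [vPost_add, uPost_add, sub_add_cancel_left, linP, collP, prodKer, collB, collS,
    Matrix.cons_val_one, Matrix.cons_val_zero, one_mul, ey, Real.sqrt_eq_rpow, ez] at e ⊢
  change bker κ β ξ * _ * _ = _
  linear_combination (bker κ β ξ * maxwellian ρ 𝔲 T (v + parC ξ) ^ (1 / 2 : ℝ) *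
    f (v + (ξ.1 - parC ξ))) * e + (bker κ β ξ * (maxwellian ρ 𝔲 T (v + (ξ.1 - parC ξ)) ^
    (1 / 2 : ℝ) * f (v + (ξ.1 - parC ξ)))) * e2 (v + parC ξ)

lemma Qminus_left (f : Vel → ℝ) (v : Vel) :
    Qminus κ β (maxwellian ρ 𝔲 T) (fun w => √(maxwellian ρ 𝔲 T w) * f w) v =
      maxwellian ρ 𝔲 T v ^ (1 / 2 : ℝ) * (nu κ β ρ 𝔲 T v * f v) := by
  simp only [Qminus, nu]
  rw [integral_mul_const, Real.sqrt_eq_rpow]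
  ring

lemma Admissible.Qminus_right (h : Admissible κ β ρ T) (f : Vel → ℝ) (v : Vel) :
    Qminus κ β (fun w => √(maxwellian ρ 𝔲 T w) * f w) (maxwellian ρ 𝔲 T) v =
      -(maxwellian ρ 𝔲 T v ^ (1 / 2 : ℝ) * opFun fullS (linP κ β ρ 𝔲 T 2) f v) := by
  rw [Qminus, integral_collMeasure_add v, opFun, ← integral_const_mul, ← integral_neg]
  refine integral_congr_ae (.of_forall fun ξ => ?_)
  have e2 : ∀ w, maxwellian ρ 𝔲 T w = maxwellian ρ 𝔲 T w ^ (1 / 2 : ℝ) *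
      maxwellian ρ 𝔲 T w ^ (1 / 2 : ℝ) := fun w => by
    rw [← Real.rpow_add (h.maxwellian_pos w)]; norm_num
  have ey : (fullS.y ξ) = ξ.1 := rfl
  have ez : v + ξ.1 - ξ.1 = v := by abel
  have e3 : (![1, 1, -1] : Fin 3 → ℝ) 2 = -1 := rfl
  have e4 : (![parS, perpS, fullS] : Fin 3 → Shift) 2 = fullS := rfl
  simp only [sub_add_cancel_left, linP, collP, prodKer, collB, collS, e3, e4,
    one_mul, ey, Real.sqrt_eq_rpow, ez]
  change bker κ β ξ * _ * _ = _
  linear_combination (bker κ β ξ * (maxwellian ρ 𝔲 T (v + ξ.1) ^ (1 / 2 : ℝ) * f (v + ξ.1))) * e2 v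

/-- The decomposition of the linearized operator into the collision frequency and an integral
operator. -/
lemma Admissible.linL_eq (h : Admissible κ β ρ T) (f : Vel → ℝ) (v : Vel) :
    linL κ β ρ 𝔲 T f v = nu κ β ρ 𝔲 T v * f v - sumOp (linP κ β ρ 𝔲 T) f v := by
  have hp : 0 < maxwellian ρ 𝔲 T v ^ (1 / 2 : ℝ) := Real.rpow_pos_of_pos (h.maxwellian_pos v) _
  -- The four integrals are never combined, so the identity holds for every f and every v without
  -- integrability assumptions.
  rw [linL, Q, Q, h.Qplus_left, h.Qplus_right, Qminus_left, h.Qminus_right, sumOp,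
    Fin.sum_univ_three, Real.sqrt_eq_rpow]
  have e0 : collS 0 = parS := rfl
  have e1 : collS 1 = perpS := rfl
  have e2 : collS 2 = fullS := rfl
  rw [e0, e1, e2]
  field_simp
  ring

lemma sumOp_ae_congr (P : Fin 3 → Vel → Vel × S2 → ℝ) {f f' : Vel → ℝ} (h : f =ᵐ[volume] f') :
    sumOp P f =ᵐ[volume] sumOp P f' := by
  filter_upwards [opFun_ae_congr (collS 0) (P 0) h, opFun_ae_congr (collS 1) (P 1) h,
    opFun_ae_congr (collS 2) (P 2) h] with v h0 h1 h2
  simp only [sumOp, Fin.sum_univ_three, h0, h1, h2]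

lemma Admissible.linL_ae_congr (h : Admissible κ β ρ T) {f f' : Vel → ℝ} (hf : f =ᵐ[volume] f') :
    linL κ β ρ 𝔲 T f =ᵐ[volume] linL κ β ρ 𝔲 T f' := by
  filter_upwards [sumOp_ae_congr (linP κ β ρ 𝔲 T) hf, hf] with v h1 h2
  rw [h.linL_eq, h.linL_eq, h1, h2]

end Formula

/-! ### Sums of the three integral operators. -/

section SumOp

variable {κ δ : ℝ} {c : Vel} {B : ℝ} {P : Fin 3 → Vel → Vel × S2 → ℝ}

lemma goodShift_collS (hκ : -3 < κ) (hκ0 : κ < 0) (hδ : 0 < δ) (i : Fin 3) :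
    GoodShift κ δ c (collS i) := by
  fin_cases i
  · exact goodShift_parS hκ hκ0 hδ
  · exact goodShift_perpS hκ hκ0 hδ
  · exact goodShift_fullS hκ hκ0 hδ

lemma exists_sumOp (h : ∀ i, KerBdd κ δ c (collS i) Set.univ B (P i)) (hκ : -3 < κ) (hκ0 : κ < 0)
    (hδ : 0 < δ) : ∃ T : L2V →L[ℝ] L2V, (∀ f, T f =ᵐ[volume] sumOp P f) ∧
      T ∈ closure (finRank (Set.univ : Set L2V) : Set (L2V →L[ℝ] L2V)) := by
  choose T hT using fun i => (h i).exists_op hκ hκ0 hδ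
  refine ⟨∑ i, T i, fun f => ?_, ?_⟩
  · rw [Fin.sum_univ_three]
    simp only [add_apply]
    filter_upwards [Lp.coeFn_add (T 0 f + T 1 f) (T 2 f), Lp.coeFn_add (T 0 f) (T 1 f),
      hT 0 f, hT 1 f, hT 2 f] with v h1 h2 e0 e1 e2
    rw [h1, Pi.add_apply, h2, Pi.add_apply, e0, e1, e2, sumOp, Fin.sum_univ_three]
  · have hcl : ∀ i, T i ∈ (finRank (Set.univ : Set L2V)).topologicalClosure := fun i =>
      (h i).mem_closure_finRank (goodShift_collS hκ hκ0 hδ i) hκ hκ0 hδ (hT i)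
    exact Submodule.sum_mem _ fun i _ => hcl i

lemma Admissible.exists_abs_collB_le {β : ℝ → ℝ} {ρ T : ℝ} (h : Admissible κ β ρ T) :
    ∃ β₀, 0 ≤ β₀ ∧ ∀ i (ξ : Vel × S2),
      |collB κ β i ξ| ≤ β₀ * (‖ξ.1‖ ^ (κ - 1) * |inner ℝ ξ.1 (ξ.2 : Vel)|) := by
  obtain ⟨β₀, h0, h1⟩ := h.exists_abs_bker_le
  refine ⟨β₀, h0, fun i ξ => ?_⟩
  have : |collB κ β i ξ| = |bker κ β ξ| := by
    fin_cases i <;> simp [collB]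
  rw [this]
  exact h1 ξ

lemma measurable_collB {β : ℝ → ℝ} (hβ : Measurable β) (i : Fin 3) : Measurable (collB κ β i) :=
  measurable_const.mul (measurable_bker hβ)

variable {β : ℝ → ℝ} {ρ T : ℝ} {a₀ a₁ a₂ : Vel → ℝ}

lemma KerBdd.weaken {s : Shift} {E : Set (Vel × Vel)} {B B' : ℝ} {P : Vel → Vel × S2 → ℝ}
    (h : KerBdd κ δ c s E B P) (hB : B ≤ B') : KerBdd κ δ c s E B' P :=
  ⟨h.meas, h.nonneg.trans hB, fun v ξ => (h.bound v ξ).trans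
    (mul_le_mul_of_nonneg_right hB (maj_nonneg s v ξ)), h.supp, h.measSet⟩

lemma Admissible.exists_kerBdd_collP (h : Admissible κ β ρ T)
    (h₀ : Tame (mW κ c) a₀) (h₁ : Tame (gau δ c) a₁) (h₂ : Tame (gau δ c) a₂) :
    ∃ B, ∀ i, KerBdd κ δ c (collS i) Set.univ B (collP κ β a₀ a₁ a₂ i) := by
  obtain ⟨β₀, hβ₀, hb⟩ := h.exists_abs_collB_le
  choose B hB using fun i =>
    exists_kerBdd_prodKer (collS i) (measurable_collB h.meas i) hβ₀ (hb i) h₀ h₁ h₂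
  exact ⟨∑ i, B i, fun i => (hB i).weaken
    (Finset.single_le_sum (fun j _ => (hB j).nonneg) (Finset.mem_univ i))⟩

/-- The integral operators with product kernels are compact and preserve regularity. -/
lemma Admissible.exists_op_collP (h : Admissible κ β ρ T) (hδ : 0 < δ)
    (h₀ : Tame (mW κ c) a₀) (h₁ : Tame (gau δ c) a₁) (h₂ : Tame (gau δ c) a₂) :
    ∃ T : L2V →L[ℝ] L2V, (∀ f, T f =ᵐ[volume] sumOp (collP κ β a₀ a₁ a₂) f) ∧
      T ∈ closure (finRank (Set.univ : Set L2V) : Set (L2V →L[ℝ] L2V)) ∧ ∀ n, SmoothOp n T := by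
  obtain ⟨β₀, hβ₀, hb⟩ := h.exists_abs_collB_le
  obtain ⟨B, hB⟩ := h.exists_kerBdd_collP h₀ h₁ h₂
  obtain ⟨T, hT, hTc⟩ := exists_sumOp hB h.lower h.neg hδ
  choose S hS using fun i => (hB i).exists_op h.lower h.neg hδ
  have hSn : ∀ i n, SmoothOp n (S i) := fun i n =>
    smoothOp_prodKer (measurable_collB h.meas i) hβ₀ (hb i) h.lower h.neg hδ n h₀ h₁ h₂ (hS i)
  have e : T = S 0 + S 1 + S 2 := by
    ext1 f
    refine Lp.ext ?_
    simp only [add_apply]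
    filter_upwards [Lp.coeFn_add (S 0 f + S 1 f) (S 2 f), Lp.coeFn_add (S 0 f) (S 1 f),
      hS 0 f, hS 1 f, hS 2 f, hT f] with v h1 h2 e0 e1 e2 e3
    rw [e3, h1, Pi.add_apply, h2, Pi.add_apply, e0, e1, e2, sumOp, Fin.sum_univ_three]
  refine ⟨T, hT, hTc, fun n => ?_⟩
  rw [e]
  exact ((hSn 0 n).add (hSn 1 n)).add (hSn 2 n)

end SumOp


/-! ### Absorbing the far part of the majorant operators. -/

section Absorption

variable {κ δ : ℝ} {c : Vel}

lemma ennreal_add_sq_le (a b : ℝ≥0∞) : (a + b) ^ 2 ≤ 2 * (a ^ 2 + b ^ 2) := by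
  induction a using ENNReal.recTopCoe with
  | top => simp
  | coe a =>
    induction b using ENNReal.recTopCoe with
    | top => simp
    | coe b =>
      have := add_sq_le (a := a) (b := b)
      exact_mod_cast this

lemma majOp_univ_eq_far (s : Shift) (F : Vel → ℝ≥0∞) {R : ℝ} {v : Vel} (hv : R < ‖v - c‖) :
    majOp κ δ c s Set.univ F v = majOp κ δ c s {p | R < ‖p.1 - c‖} F v := by
  unfold majOp
  refine lintegral_congr fun ξ => ?_
  rw [Set.indicator_of_mem (Set.mem_univ _), Set.indicator_of_mem (by exact hv)]

/-- A function which is dominated by the majorant operators can be controlled by its values on a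
ball. -/
lemma exists_absorption (hκ : -3 < κ) (hκ0 : κ < 0) (hδ : 0 < δ) {K : ℝ≥0∞} (hK : K ≠ ⊤) :
    ∃ R : ℝ, ∀ (F : Vel → ℝ) (X : Vel → ℝ≥0∞), Measurable F → AEMeasurable X volume →
      eLpNorm F 2 volume ≠ ⊤ → (∀ᵐ v, ‖v - c‖ ≤ R → ‖F v‖ₑ ≤ X v) →
      (∀ᵐ v, ‖F v‖ₑ ≤ X v + K * ∑ i, majOp κ δ c (collS i) Set.univ (fun w => ‖F w‖ₑ) v) →
      eLpNorm F 2 volume ^ 2 ≤ 4 * ∫⁻ v, X v ^ 2 := by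
  choose C hC hC2 using fun i => exists_column (c := c) (collS i) hκ hκ0 hδ
  have hS : ∑ i, C i ≠ ⊤ := by simpa using hC
  -- With this η the three far operators, whose squared norms enter with the factor 8K², contribute
  -- at most half of ‖F‖².
  set η : ℝ≥0∞ := (16 * (K ^ 2 * ∑ i, C i + 1))⁻¹ with hη
  have hden : 16 * (K ^ 2 * ∑ i, C i + 1) ≠ ⊤ := by finiteness
  have hη0 : η ≠ 0 := by rwa [hη, Ne, ENNReal.inv_eq_zero]
  choose R hR hR2 using fun i => (goodShift_collS (c := c) hκ hκ0 hδ i).1 η hη0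
  refine ⟨∑ i, R i, fun F X hF hX hFt hnear hall => ?_⟩
  set N := eLpNorm F 2 volume ^ 2 with hN
  have hNt : N ≠ ⊤ := ENNReal.pow_ne_top hFt
  have hNe : N = ∫⁻ v, ‖F v‖ₑ ^ 2 := eLpNorm_two_sq_enorm F
  set G : Fin 3 → Vel → ℝ≥0∞ := fun i =>
    majOp κ δ c (collS i) {p | R i < ‖p.1 - c‖} (fun w => ‖F w‖ₑ) with hG
  have hGm : ∀ i, Measurable (G i) := fun i =>
    measurable_majOp (collS i) (measurableSet_far (R i)) hF.enorm
  have hG2 : ∀ i, ∫⁻ v, G i v ^ 2 ≤ η * C i * N := fun i => by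
    rw [hNe]
    exact lintegral_majOp_sq_le (collS i) (measurableSet_far (R i)) hF.enorm (hR2 i) (hC2 i)
  have hRle : ∀ i, R i ≤ ∑ i, R i := fun i =>
    Finset.single_le_sum (fun j _ => (hR j).le) (Finset.mem_univ i)
  have hpt : ∀ᵐ v, ‖F v‖ₑ ≤ X v + K * ∑ i, G i v := by
    filter_upwards [hnear, hall] with v h1 h2
    rcases le_or_gt ‖v - c‖ (∑ i, R i) with hv | hv
    · exact (h1 hv).trans le_self_add
    · refine h2.trans (le_of_eq ?_)
      rw [Finset.sum_congr rfl fun i _ =>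
        majOp_univ_eq_far (collS i) (fun w => ‖F w‖ₑ) ((hRle i).trans_lt hv)]
  have hsq : ∀ᵐ v, ‖F v‖ₑ ^ 2 ≤ 2 * X v ^ 2 + 8 * K ^ 2 * ∑ i, G i v ^ 2 := by
    filter_upwards [hpt] with v hv
    calc ‖F v‖ₑ ^ 2 ≤ (X v + K * ∑ i, G i v) ^ 2 := by gcongr
      _ ≤ 2 * (X v ^ 2 + (K * ∑ i, G i v) ^ 2) := ennreal_add_sq_le _ _
      _ = 2 * X v ^ 2 + 2 * K ^ 2 * (G 0 v + G 1 v + G 2 v) ^ 2 := by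
        rw [Fin.sum_univ_three]; ring
      _ ≤ 2 * X v ^ 2 + 2 * K ^ 2 * (2 * (2 * (G 0 v ^ 2 + G 1 v ^ 2) + 2 * G 2 v ^ 2)) := by
        have h3 : (G 0 v + G 1 v + G 2 v) ^ 2 ≤
            2 * (2 * (G 0 v ^ 2 + G 1 v ^ 2) + 2 * G 2 v ^ 2) := by
          refine (ennreal_add_sq_le _ _).trans ?_
          gcongr
          · exact ennreal_add_sq_le _ _
          · exact le_mul_of_one_le_left' (by norm_num)
        gcongr
      _ = _ := by rw [Fin.sum_univ_three]; ring
  have hint : N ≤ 2 * (∫⁻ v, X v ^ 2) + 8 * K ^ 2 * ∑ i, η * C i * N := by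
    calc N ≤ ∫⁻ v, 2 * X v ^ 2 + 8 * K ^ 2 * ∑ i, G i v ^ 2 := by
          rw [hNe]; exact lintegral_mono_ae hsq
      _ = 2 * (∫⁻ v, X v ^ 2) + 8 * K ^ 2 * ∑ i, ∫⁻ v, G i v ^ 2 := by
          rw [lintegral_add_left' ((hX.pow_const 2).const_mul 2),
            lintegral_const_mul' _ _ (by norm_num), lintegral_const_mul' _ _ (by finiteness),
            lintegral_finsetSum _ fun i _ => (hGm i).pow_const 2]
      _ ≤ _ := by
          gcongr with i
          exact hG2 i
  have habs : 8 * K ^ 2 * ∑ i, η * C i * N ≤ 2⁻¹ * N := by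
    rw [← Finset.sum_mul, ← Finset.mul_sum]
    have e1 : 8 * K ^ 2 * ((η * ∑ i, C i) * N) = (8 * (K ^ 2 * ∑ i, C i) * η) * N := by ring
    rw [e1]
    gcongr
    rw [hη, ← div_eq_mul_inv]
    refine ENNReal.div_le_of_le_mul ?_
    calc 8 * (K ^ 2 * ∑ i, C i) ≤ 8 * (K ^ 2 * ∑ i, C i + 1) := by gcongr; exact le_self_add
      _ = 2⁻¹ * (16 * (K ^ 2 * ∑ i, C i + 1)) := by
        rw [← mul_assoc]
        congr 1
        rw [show (16 : ℝ≥0∞) = 2 * 8 by norm_num, ← mul_assoc,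
          ENNReal.inv_mul_cancel (by norm_num) (by norm_num), one_mul]
  have h5 : 2⁻¹ * N + 2⁻¹ * N ≤ 2 * (∫⁻ v, X v ^ 2) + 2⁻¹ * N := by
    rw [← add_mul, ENNReal.inv_two_add_inv_two, one_mul]
    exact hint.trans (by gcongr)
  -- The subtraction needs N finite; this is why the weights to which the lemma is applied are
  -- truncated.
  have h6 : 2⁻¹ * N ≤ 2 * ∫⁻ v, X v ^ 2 :=
    (ENNReal.add_le_add_iff_right (ENNReal.mul_ne_top (by norm_num) hNt)).1 h5
  calc N = 2 * (2⁻¹ * N) := by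
        rw [← mul_assoc, ENNReal.mul_inv_cancel (by norm_num) (by norm_num), one_mul]
    _ ≤ 2 * (2 * ∫⁻ v, X v ^ 2) := by gcongr
    _ = _ := by ring

end Absorption

/-! ### Decay of solutions of the linearized equation. -/

section Decay

variable {κ : ℝ} {β : ℝ → ℝ} {ρ T : ℝ} {𝔲 : Vel}

/-- The weight `(1 + |v - c|²)^{κ/4}`. -/
noncomputable def dW (κ : ℝ) (c v : Vel) : ℝ := mW κ c v ^ (-(1 / 2) : ℝ)

/-- The truncation of the weight `μ^{-p}`. -/
noncomputable def wTrunc (κ ρ : ℝ) (𝔲 : Vel) (T p : ℝ) (n : ℕ) (v : Vel) : ℝ :=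
  min (maxwellian ρ 𝔲 T v ^ (-p)) (n * dW κ 𝔲 v)

lemma dW_pos (c v : Vel) : 0 < dW κ c v := Real.rpow_pos_of_pos (mW_pos v) _

lemma dW_sq_mul (c v : Vel) : dW κ c v ^ 2 * mW κ c v = 1 := by
  have h := mW_pos (κ := κ) (c := c) v
  rw [dW, ← Real.rpow_natCast, ← Real.rpow_mul h.le]
  norm_num
  rw [Real.rpow_neg_one, inv_mul_cancel₀ h.ne']

lemma continuous_dW (c : Vel) : Continuous (dW κ c) :=
  continuous_mW.rpow_const fun v => .inl (mW_pos v).ne'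

lemma dW_le_mul (hκ0 : κ < 0) (c : Vel) (s : Shift) (v : Vel) (ξ : Vel × S2) :
    dW κ c v ≤ mW κ c (v + ξ.1) * dW κ c (v + s.y ξ) := by
  have h := mW_add_le (c := c) hκ0 s v ξ
  have p0 := mW_pos (κ := κ) (c := c) v
  have p1 := mW_pos (κ := κ) (c := c) (v + ξ.1)
  have p2 := mW_pos (κ := κ) (c := c) (v + s.y ξ)
  have one := one_le_mW (c := c) hκ0 (v + ξ.1)
  have h1 : (mW κ c v * mW κ c (v + ξ.1)) ^ (-(1 / 2) : ℝ) ≤ dW κ c (v + s.y ξ) :=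
    Real.rpow_le_rpow_of_nonpos p2 h (by norm_num)
  rw [Real.mul_rpow p0.le p1.le] at h1
  have h2 : 1 ≤ mW κ c (v + ξ.1) * mW κ c (v + ξ.1) ^ (-(1 / 2) : ℝ) := by
    rw [← Real.rpow_one_add' p1.le (by norm_num)]
    exact Real.one_le_rpow one (by norm_num)
  have p3 := dW_pos (κ := κ) c v
  calc dW κ c v ≤ dW κ c v * (mW κ c (v + ξ.1) * mW κ c (v + ξ.1) ^ (-(1 / 2) : ℝ)) :=
        le_mul_of_one_le_right p3.le h2
    _ = mW κ c (v + ξ.1) * (mW κ c v ^ (-(1 / 2) : ℝ) * mW κ c (v + ξ.1) ^ (-(1 / 2) : ℝ)) := by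
        rw [dW]; ring
    _ ≤ _ := by gcongr

lemma continuous_maxwellian : Continuous (maxwellian ρ 𝔲 T) := by
  unfold maxwellian
  fun_prop

lemma Admissible.continuous_rpow (h : Admissible κ β ρ T) (p : ℝ) :
    Continuous fun v => maxwellian ρ 𝔲 T v ^ p :=
  continuous_maxwellian.rpow_const fun v => .inl (h.maxwellian_pos v).ne'

lemma Admissible.rpow_pos (h : Admissible κ β ρ T) (p : ℝ) (v : Vel) :
    0 < maxwellian ρ 𝔲 T v ^ p := Real.rpow_pos_of_pos (h.maxwellian_pos v) _

lemma Admissible.rpow_eq_shift (h : Admissible κ β ρ T) (s : Shift) (p : ℝ) (v : Vel)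
    (ξ : Vel × S2) : maxwellian ρ 𝔲 T v ^ (-p) = maxwellian ρ 𝔲 T (v + s.y ξ) ^ (-p) *
      (maxwellian ρ 𝔲 T (v + ξ.1) ^ p * maxwellian ρ 𝔲 T (v + ξ.1 - s.y ξ) ^ (-p)) := by
  have e := h.maxwellian_mul_rpow (𝔲 := 𝔲) s (-p) v ξ
  have e1 : maxwellian ρ 𝔲 T (v + ξ.1) ^ (-p) * maxwellian ρ 𝔲 T (v + ξ.1) ^ p = 1 := by
    rw [← Real.rpow_add (h.maxwellian_pos _)]; simp
  linear_combination (-maxwellian ρ 𝔲 T (v + ξ.1) ^ p) * e - maxwellian ρ 𝔲 T v ^ (-p) * e1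

lemma Admissible.wTrunc_nonneg (h : Admissible κ β ρ T) (p : ℝ) (n : ℕ) (v : Vel) :
    0 ≤ wTrunc κ ρ 𝔲 T p n v :=
  le_min (h.rpow_pos _ v).le (mul_nonneg (Nat.cast_nonneg n) (dW_pos _ v).le)

/-- Both arguments of the minimum obey a shift inequality: the exponential one by energy
conservation, the polynomial one by `dW_le_mul`. The sum of the two factors serves the minimum
whichever argument attains it at v + y, with no dependence on n. -/
lemma Admissible.wTrunc_le_shift (h : Admissible κ β ρ T) (s : Shift) (p : ℝ) (n : ℕ) (v : Vel)
    (ξ : Vel × S2) : wTrunc κ ρ 𝔲 T p n v ≤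
      (maxwellian ρ 𝔲 T (v + ξ.1) ^ p * maxwellian ρ 𝔲 T (v + ξ.1 - s.y ξ) ^ (-p) +
        mW κ 𝔲 (v + ξ.1)) * wTrunc κ ρ 𝔲 T p n (v + s.y ξ) := by
  have p1 := mW_pos (κ := κ) (c := 𝔲) (v + ξ.1)
  have p2 := h.rpow_pos (𝔲 := 𝔲) p (v + ξ.1)
  have p3 := h.rpow_pos (𝔲 := 𝔲) (-p) (v + ξ.1 - s.y ξ)
  have p4 := h.rpow_pos (𝔲 := 𝔲) (-p) (v + s.y ξ)
  have p5 := dW_pos (κ := κ) 𝔲 (v + s.y ξ)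
  have hn : (0 : ℝ) ≤ n := Nat.cast_nonneg n
  unfold wTrunc
  rcases le_total (maxwellian ρ 𝔲 T (v + s.y ξ) ^ (-p)) (n * dW κ 𝔲 (v + s.y ξ)) with hle | hle
  · rw [min_eq_left hle]
    refine (min_le_left _ _).trans ?_
    rw [h.rpow_eq_shift s p v ξ, add_mul, mul_comm]
    have := mul_pos p1 p4
    linarith
  · rw [min_eq_right hle]
    refine (min_le_right _ _).trans ?_
    calc n * dW κ 𝔲 v ≤ n * (mW κ 𝔲 (v + ξ.1) * dW κ 𝔲 (v + s.y ξ)) := by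
          gcongr; exact dW_le_mul h.neg 𝔲 s v ξ
      _ = mW κ 𝔲 (v + ξ.1) * (n * dW κ 𝔲 (v + s.y ξ)) := by ring
      _ ≤ _ := by
          gcongr
          have := mul_pos p2 p3
          linarith

/-- The rate of the Gaussian decay of the weighted kernels. -/
noncomputable def decayRate (T p : ℝ) : ℝ := (1 / 2 - p) / (4 * T)

lemma Admissible.decayRate_pos (h : Admissible κ β ρ T) {p : ℝ} (hp1 : p < 1 / 2) :
    0 < decayRate T p := by
  have := h.temp_pos
  unfold decayRate
  have : 0 < 1 / 2 - p := by linarith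
  positivity

lemma Admissible.two_mul_decayRate_le (h : Admissible κ β ρ T) {p s : ℝ} (hs : 1 / 2 - p ≤ s) :
    2 * decayRate T p ≤ s / (2 * T) := by
  have := h.temp_pos
  rw [decayRate, show 2 * ((1 / 2 - p) / (4 * T)) = (1 / 2 - p) / (2 * T) by
    field_simp; ring]
  gcongr

/-- Moving the exponential weight through the kernel turns √μ(u) √μ(u − y) into μ^{1/2+p}(u)
μ^{1/2−p}(u − y), still Gaussian because p < 1/2. In the polynomial alternative the factor mW(u) is
absorbed by half of the Gaussian rate. -/
lemma Admissible.exists_kernel_bound (h : Admissible κ β ρ T) (𝔲 : Vel) {p : ℝ} (hp : 0 < p)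
    (hp1 : p < 1 / 2) : ∃ K : ℝ, 0 ≤ K ∧ ∀ n i v ξ,
      mW κ 𝔲 v * wTrunc κ ρ 𝔲 T p n v * |linP κ β ρ 𝔲 T i v ξ| ≤
        K * maj κ (decayRate T p) 𝔲 (collS i) v ξ * wTrunc κ ρ 𝔲 T p n (v + (collS i).y ξ) := by
  set δ := decayRate T p with hδ
  have hδ0 : 0 < δ := h.decayRate_pos hp1
  have hA := h.const_pos
  obtain ⟨β₀, hβ₀, hb⟩ := h.exists_abs_collB_le
  obtain ⟨C, hC, hmg⟩ := exists_mW_mul_gau_le (κ := κ) (c := 𝔲) (δ := 2 * δ) (by positivity)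
  rw [show 2 * δ / 2 = δ by ring] at hmg
  have hpow : ∀ s : ℝ, 1 / 2 - p ≤ s → ∀ v,
      maxwellian ρ 𝔲 T v ^ s ≤ maxConst ρ T ^ s * gau (2 * δ) 𝔲 v := by
    intro s hs v
    rw [h.maxwellian_rpow]
    gcongr
    exact gau_anti 𝔲 (h.two_mul_decayRate_le hs) v
  have hg : ∀ v, gau (2 * δ) 𝔲 v ≤ gau δ 𝔲 v := fun v => gau_anti 𝔲 (by linarith) v
  set A := maxConst ρ T with hAdef
  set K₁ := A ^ (1 / 2 + p) * A ^ (1 / 2 - p) with hK₁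
  set K₂ := (A ^ (1 / 2 : ℝ) * C) * A ^ (1 / 2 : ℝ) with hK₂
  refine ⟨β₀ * (K₁ + K₂), by positivity, fun n i v ξ => ?_⟩
  set s := collS i with hs
  set u := v + ξ.1 with hu
  set M : Vel → ℝ := maxwellian ρ 𝔲 T with hM
  have gu := (gau_pos (δ := δ) (c := 𝔲) u).le
  have guy := (gau_pos (δ := δ) (c := 𝔲) (u - s.y ξ)).le
  have k1 : M u ^ (1 / 2 : ℝ) * M (u - s.y ξ) ^ (1 / 2 : ℝ) * (M u ^ p * M (u - s.y ξ) ^ (-p)) ≤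
      K₁ * (gau δ 𝔲 u * gau δ 𝔲 (u - s.y ξ)) := by
    have e : M u ^ (1 / 2 : ℝ) * M (u - s.y ξ) ^ (1 / 2 : ℝ) * (M u ^ p * M (u - s.y ξ) ^ (-p)) =
        M u ^ (1 / 2 + p) * M (u - s.y ξ) ^ (1 / 2 - p) := by
      rw [Real.rpow_add (h.maxwellian_pos u), sub_eq_add_neg (1 / 2 : ℝ) p,
        Real.rpow_add (h.maxwellian_pos _)]
      ring
    rw [e]
    have a1 := (hpow (1 / 2 + p) (by linarith) u).trans
      (mul_le_mul_of_nonneg_left (hg u) (by positivity))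
    have a2 := (hpow (1 / 2 - p) le_rfl (u - s.y ξ)).trans
      (mul_le_mul_of_nonneg_left (hg _) (by positivity))
    calc _ ≤ (A ^ (1 / 2 + p) * gau δ 𝔲 u) * (A ^ (1 / 2 - p) * gau δ 𝔲 (u - s.y ξ)) :=
          mul_le_mul a1 a2 (h.rpow_pos _ _).le (by positivity)
      _ = _ := by rw [hK₁]; ring
  have k2 : M u ^ (1 / 2 : ℝ) * M (u - s.y ξ) ^ (1 / 2 : ℝ) * mW κ 𝔲 u ≤
      K₂ * (gau δ 𝔲 u * gau δ 𝔲 (u - s.y ξ)) := by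
    have m0 := (mW_pos (κ := κ) (c := 𝔲) u).le
    have a1 : M u ^ (1 / 2 : ℝ) * mW κ 𝔲 u ≤ A ^ (1 / 2 : ℝ) * C * gau δ 𝔲 u := by
      calc _ ≤ (A ^ (1 / 2 : ℝ) * gau (2 * δ) 𝔲 u) * mW κ 𝔲 u := by
            gcongr; exact hpow (1 / 2) (by linarith) u
        _ = A ^ (1 / 2 : ℝ) * (mW κ 𝔲 u * gau (2 * δ) 𝔲 u) := by ring
        _ ≤ A ^ (1 / 2 : ℝ) * (C * gau δ 𝔲 u) :=
            mul_le_mul_of_nonneg_left (hmg u) (by positivity)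
        _ = _ := by ring
    have a2 := (hpow (1 / 2) (by linarith) (u - s.y ξ)).trans
      (mul_le_mul_of_nonneg_left (hg _) (by positivity))
    calc _ = (M u ^ (1 / 2 : ℝ) * mW κ 𝔲 u) * M (u - s.y ξ) ^ (1 / 2 : ℝ) := by ring
      _ ≤ (A ^ (1 / 2 : ℝ) * C * gau δ 𝔲 u) * (A ^ (1 / 2 : ℝ) * gau δ 𝔲 (u - s.y ξ)) :=
          mul_le_mul a1 a2 (h.rpow_pos _ _).le (by positivity)
      _ = _ := by rw [hK₂]; ring
  have hw := h.wTrunc_le_shift (𝔲 := 𝔲) s p n v ξ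
  have hwn := h.wTrunc_nonneg (𝔲 := 𝔲) p n (v + s.y ξ)
  have hm := (mW_pos (κ := κ) (c := 𝔲) v).le
  have q1 := (h.rpow_pos (𝔲 := 𝔲) (1 / 2) u).le
  have q2 := (h.rpow_pos (𝔲 := 𝔲) (1 / 2) (u - s.y ξ)).le
  have hlin : |linP κ β ρ 𝔲 T i v ξ| =
      |collB κ β i ξ| * (M u ^ (1 / 2 : ℝ) * M (u - s.y ξ) ^ (1 / 2 : ℝ)) := by
    rw [linP, collP, prodKer, one_mul, abs_mul, abs_of_nonneg (mul_nonneg q1 q2)]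
  rw [hlin]
  have hbx := hb i ξ
  have hM1 : 0 ≤ M u := (h.maxwellian_pos u).le
  have hM2 : 0 ≤ M (u - s.y ξ) := (h.maxwellian_pos _).le
  have hmu := (mW_pos (κ := κ) (c := 𝔲) u).le
  calc mW κ 𝔲 v * wTrunc κ ρ 𝔲 T p n v *
        (|collB κ β i ξ| * (M u ^ (1 / 2 : ℝ) * M (u - s.y ξ) ^ (1 / 2 : ℝ)))
      ≤ mW κ 𝔲 v * ((M u ^ p * M (u - s.y ξ) ^ (-p) + mW κ 𝔲 u) *
          wTrunc κ ρ 𝔲 T p n (v + s.y ξ)) *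
        ((β₀ * (‖ξ.1‖ ^ (κ - 1) * |inner ℝ ξ.1 (ξ.2 : Vel)|)) *
          (M u ^ (1 / 2 : ℝ) * M (u - s.y ξ) ^ (1 / 2 : ℝ))) := by gcongr
    _ = mW κ 𝔲 v * (β₀ * (‖ξ.1‖ ^ (κ - 1) * |inner ℝ ξ.1 (ξ.2 : Vel)|)) *
        (M u ^ (1 / 2 : ℝ) * M (u - s.y ξ) ^ (1 / 2 : ℝ) * (M u ^ p * M (u - s.y ξ) ^ (-p)) +
          M u ^ (1 / 2 : ℝ) * M (u - s.y ξ) ^ (1 / 2 : ℝ) * mW κ 𝔲 u) *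
        wTrunc κ ρ 𝔲 T p n (v + s.y ξ) := by ring
    _ ≤ mW κ 𝔲 v * (β₀ * (‖ξ.1‖ ^ (κ - 1) * |inner ℝ ξ.1 (ξ.2 : Vel)|)) *
        (K₁ * (gau δ 𝔲 u * gau δ 𝔲 (u - s.y ξ)) + K₂ * (gau δ 𝔲 u * gau δ 𝔲 (u - s.y ξ))) *
        wTrunc κ ρ 𝔲 T p n (v + s.y ξ) := by gcongr
    _ = _ := by rw [maj]; ring

lemma Admissible.exists_sumOp_bound (h : Admissible κ β ρ T) (𝔲 : Vel) {p : ℝ} (hp : 0 < p)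
    (hp1 : p < 1 / 2) : ∃ K : ℝ≥0∞, K ≠ ⊤ ∧ ∀ (n : ℕ) (f : Vel → ℝ) (v : Vel),
      ‖mW κ 𝔲 v * wTrunc κ ρ 𝔲 T p n v * sumOp (linP κ β ρ 𝔲 T) f v‖ₑ ≤
        K * ∑ i, majOp κ (decayRate T p) 𝔲 (collS i) Set.univ
          (fun w => ‖wTrunc κ ρ 𝔲 T p n w * f w‖ₑ) v := by
  obtain ⟨K, hK, hb⟩ := h.exists_kernel_bound 𝔲 hp hp1
  refine ⟨ENNReal.ofReal K, ENNReal.ofReal_ne_top, fun n f v => ?_⟩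
  rw [sumOp, Finset.mul_sum, Finset.mul_sum]
  refine (enorm_sum_le _ _).trans (Finset.sum_le_sum fun i _ => ?_)
  rw [opFun, ← integral_const_mul]
  refine (enorm_integral_le_lintegral_enorm _).trans ?_
  unfold majOp
  rw [← lintegral_const_mul' _ _ ENNReal.ofReal_ne_top]
  refine lintegral_mono fun ξ => ?_
  have hw := h.wTrunc_nonneg (𝔲 := 𝔲) p n
  rw [Set.indicator_of_mem (Set.mem_univ _), ← mul_assoc (ENNReal.ofReal K),
    ← ENNReal.ofReal_mul hK]
  simp only
  rw [Real.enorm_eq_ofReal_abs, Real.enorm_eq_ofReal_abs, ← ENNReal.ofReal_mul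
    (mul_nonneg hK (maj_nonneg _ _ _))]
  refine ENNReal.ofReal_le_ofReal ?_
  rw [abs_mul, abs_mul, abs_mul, abs_mul, abs_of_nonneg (mW_pos v).le, abs_of_nonneg (hw v),
    abs_of_nonneg (hw _)]
  calc _ = (mW κ 𝔲 v * wTrunc κ ρ 𝔲 T p n v * |linP κ β ρ 𝔲 T i v ξ|) *
        |f (v + (collS i).y ξ)| := by ring
    _ ≤ _ * |f (v + (collS i).y ξ)| := mul_le_mul_of_nonneg_right (hb n i v ξ) (abs_nonneg _)
    _ = _ := by ring

/-- Multiplied by mW and the truncated weight, the equation bounds the weighted f by the source and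
by majorant operators applied to the weighted f itself, since mW ν is bounded below.
`exists_absorption` closes the estimate uniformly in n; on the ball the weight is comparable with
`dW`, which is where the a priori norm of f enters. Fatou's lemma lets n tend to infinity. -/
lemma Admissible.exists_decay (h : Admissible κ β ρ T) (𝔲 : Vel) {p : ℝ} (hp : 0 < p)
    (hp1 : p < 1 / 2) : ∃ D : ℝ≥0∞, D ≠ ⊤ ∧ ∀ f g : Vel → ℝ, Measurable f →
      AEStronglyMeasurable g volume → eLpNorm (fun v => dW κ 𝔲 v * f v) 2 volume ≠ ⊤ →
      (∀ᵐ v, nu κ β ρ 𝔲 T v * f v = sumOp (linP κ β ρ 𝔲 T) f v + g v) →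
      eLpNorm (fun v => maxwellian ρ 𝔲 T v ^ (-p) * f v) 2 volume ^ 2 ≤
        D * (eLpNorm (fun v => dW κ 𝔲 v * f v) 2 volume ^ 2 +
          eLpNorm (fun v => mW κ 𝔲 v * maxwellian ρ 𝔲 T v ^ (-p) * g v) 2 volume ^ 2) := by
  obtain ⟨K, hK, hb⟩ := h.exists_sumOp_bound 𝔲 hp hp1
  obtain ⟨c₀, hc₀, hν⟩ := h.exists_le_nu 𝔲
  set A : ℝ≥0∞ := ENNReal.ofReal c₀⁻¹ with hA
  obtain ⟨R, hR⟩ := exists_absorption (c := 𝔲) h.lower h.neg (h.decayRate_pos hp1)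
    (K := A * K) (ENNReal.mul_ne_top ENNReal.ofReal_ne_top hK)
  have hcont : Continuous fun v => maxwellian ρ 𝔲 T v ^ (-p) * (dW κ 𝔲 v)⁻¹ :=
    (h.continuous_rpow _).mul ((continuous_dW 𝔲).inv₀ fun v => (dW_pos 𝔲 v).ne')
  obtain ⟨L, hL⟩ := (isCompact_closedBall 𝔲 R).exists_bound_of_continuousOn hcont.continuousOn
  refine ⟨8 * (ENNReal.ofReal L ^ 2 + A ^ 2), by finiteness, fun f g hf hg hfin heq => ?_⟩
  set X : Vel → ℝ≥0∞ := fun v => ENNReal.ofReal L * ‖dW κ 𝔲 v * f v‖ₑ +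
    A * ‖mW κ 𝔲 v * maxwellian ρ 𝔲 T v ^ (-p) * g v‖ₑ with hX
  have md : Measurable fun v => dW κ 𝔲 v * f v := (continuous_dW 𝔲).measurable.mul hf
  have mg : AEMeasurable (fun v => mW κ 𝔲 v * maxwellian ρ 𝔲 T v ^ (-p) * g v) volume :=
    (continuous_mW.mul (h.continuous_rpow _)).measurable.aemeasurable.mul hg.aemeasurable
  have hXm : AEMeasurable X volume := (md.enorm.const_mul _).aemeasurable.add
    (mg.enorm.const_mul _)
  have hXi : ∫⁻ v, X v ^ 2 ≤ 2 * (ENNReal.ofReal L ^ 2 + A ^ 2) *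
      (eLpNorm (fun v => dW κ 𝔲 v * f v) 2 volume ^ 2 +
        eLpNorm (fun v => mW κ 𝔲 v * maxwellian ρ 𝔲 T v ^ (-p) * g v) 2 volume ^ 2) := by
    rw [eLpNorm_two_sq_enorm, eLpNorm_two_sq_enorm,
      ← lintegral_add_left (md.enorm.pow_const 2), ← lintegral_const_mul' _ _ (by finiteness)]
    refine lintegral_mono fun v => ?_
    refine (ennreal_add_sq_le _ _).trans ?_
    rw [mul_assoc (2 : ℝ≥0∞) (ENNReal.ofReal L ^ 2 + A ^ 2)]
    gcongr
    rw [mul_pow, mul_pow, mul_add]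
    gcongr
    · exact le_self_add
    · exact le_add_self
  have hwm : ∀ n, Measurable (wTrunc κ ρ 𝔲 T p n) := fun n =>
    ((h.continuous_rpow _).min (continuous_const.mul (continuous_dW 𝔲))).measurable
  have hw0 := h.wTrunc_nonneg (𝔲 := 𝔲) p
  have hn : ∀ n : ℕ, eLpNorm (fun v => wTrunc κ ρ 𝔲 T p n v * f v) 2 volume ^ 2 ≤
      4 * ∫⁻ v, X v ^ 2 := by
    intro n
    refine hR _ X ((hwm n).mul hf) hXm ?_ ?_ ?_
    -- The truncation at n `dW` gives the finiteness needed for absorption.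
    · have e : ∀ v, ‖wTrunc κ ρ 𝔲 T p n v * f v‖ ≤ n * ‖dW κ 𝔲 v * f v‖ := fun v => by
        rw [norm_mul, norm_mul, Real.norm_of_nonneg (hw0 n v), Real.norm_of_nonneg (dW_pos 𝔲 v).le,
          ← mul_assoc]
        gcongr
        exact min_le_right _ _
      refine ((eLpNorm_le_mul_eLpNorm_of_ae_le_mul (.of_forall e) 2).trans_lt ?_).ne
      exact ENNReal.mul_lt_top ENNReal.ofReal_lt_top hfin.lt_top
    · refine .of_forall fun v hv => ?_
      refine le_trans ?_ le_self_add
      have h1 := hL v (by rwa [Metric.mem_closedBall, dist_eq_norm])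
      have hd := dW_pos (κ := κ) 𝔲 v
      have hL0 : 0 ≤ L := (norm_nonneg _).trans h1
      rw [Real.norm_of_nonneg (mul_nonneg (h.rpow_pos _ v).le (inv_nonneg.2 hd.le)),
        ← div_eq_mul_inv, div_le_iff₀ hd] at h1
      rw [Real.enorm_eq_ofReal_abs, Real.enorm_eq_ofReal_abs, ← ENNReal.ofReal_mul hL0]
      refine ENNReal.ofReal_le_ofReal ?_
      rw [abs_mul, abs_mul, abs_of_nonneg (hw0 n v), abs_of_nonneg hd.le, ← mul_assoc]
      gcongr
      exact (min_le_left _ _).trans h1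
    · filter_upwards [heq] with v hv
      have hm := mW_pos (κ := κ) (c := 𝔲) v
      have e1 : ‖wTrunc κ ρ 𝔲 T p n v * f v‖ₑ ≤ A * ‖mW κ 𝔲 v * wTrunc κ ρ 𝔲 T p n v *
          (sumOp (linP κ β ρ 𝔲 T) f v + g v)‖ₑ := by
        rw [← hv, hA, Real.enorm_eq_ofReal_abs, Real.enorm_eq_ofReal_abs,
          ← ENNReal.ofReal_mul (by positivity)]
        refine ENNReal.ofReal_le_ofReal ?_
        rw [← div_eq_inv_mul, le_div_iff₀ hc₀,
          show mW κ 𝔲 v * wTrunc κ ρ 𝔲 T p n v * (nu κ β ρ 𝔲 T v * f v) =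
            (mW κ 𝔲 v * nu κ β ρ 𝔲 T v) * (wTrunc κ ρ 𝔲 T p n v * f v) by ring, abs_mul
          (mW κ 𝔲 v * nu κ β ρ 𝔲 T v), mul_comm]
        gcongr
        exact (hν v).trans (le_abs_self _)
      refine e1.trans ?_
      rw [mul_add, mul_assoc A K]
      calc _ ≤ A * (‖mW κ 𝔲 v * wTrunc κ ρ 𝔲 T p n v * sumOp (linP κ β ρ 𝔲 T) f v‖ₑ +
            ‖mW κ 𝔲 v * wTrunc κ ρ 𝔲 T p n v * g v‖ₑ) := by gcongr; exact enorm_add_le _ _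
        _ ≤ A * (K * ∑ i, majOp κ (decayRate T p) 𝔲 (collS i) Set.univ
              (fun w => ‖wTrunc κ ρ 𝔲 T p n w * f w‖ₑ) v +
            ‖mW κ 𝔲 v * maxwellian ρ 𝔲 T v ^ (-p) * g v‖ₑ) := by
          gcongr
          · exact hb n f v
          · rw [Real.enorm_eq_ofReal_abs, Real.enorm_eq_ofReal_abs]
            refine ENNReal.ofReal_le_ofReal ?_
            rw [abs_mul, abs_mul, abs_mul, abs_mul, abs_of_nonneg (hw0 n v),
              abs_of_pos (h.rpow_pos (-p) v)]
            gcongr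
            exact min_le_left _ _
        _ ≤ _ := by
          rw [mul_add, add_comm]
          gcongr
          exact le_add_self
  have hlim : ∀ v, Filter.Tendsto (fun n : ℕ => ‖wTrunc κ ρ 𝔲 T p n v * f v‖ₑ ^ 2) Filter.atTop
      (nhds (‖maxwellian ρ 𝔲 T v ^ (-p) * f v‖ₑ ^ 2)) := by
    intro v
    have hd := dW_pos (κ := κ) 𝔲 v
    obtain ⟨n₀, hn₀⟩ := exists_nat_ge (maxwellian ρ 𝔲 T v ^ (-p) / dW κ 𝔲 v)
    refine tendsto_const_nhds.congr' ?_
    filter_upwards [Filter.eventually_ge_atTop n₀] with n hnn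
    have h1 : maxwellian ρ 𝔲 T v ^ (-p) ≤ n * dW κ 𝔲 v := by
      rw [div_le_iff₀ hd] at hn₀
      refine hn₀.trans ?_
      gcongr
    rw [wTrunc, min_eq_left h1]
  calc eLpNorm (fun v => maxwellian ρ 𝔲 T v ^ (-p) * f v) 2 volume ^ 2
      = ∫⁻ v, Filter.liminf (fun n : ℕ => ‖wTrunc κ ρ 𝔲 T p n v * f v‖ₑ ^ 2) Filter.atTop := by
        rw [eLpNorm_two_sq_enorm]
        exact lintegral_congr fun v => (hlim v).liminf_eq.symm
    _ ≤ Filter.liminf (fun n : ℕ => ∫⁻ v, ‖wTrunc κ ρ 𝔲 T p n v * f v‖ₑ ^ 2) Filter.atTop :=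
        lintegral_liminf_le fun n => ((hwm n).mul hf).enorm.pow_const 2
    _ ≤ 4 * ∫⁻ v, X v ^ 2 := by
        refine Filter.liminf_le_of_frequently_le' (Filter.Frequently.of_forall fun n => ?_)
        rw [← eLpNorm_two_sq_enorm]
        exact hn n
    _ ≤ 4 * (2 * (ENNReal.ofReal L ^ 2 + A ^ 2) * _) := by gcongr
    _ = _ := by ring

end Decay


/-! ### The linearized operator on L² and its symmetrization. -/

lemma inner_L2V (f g : L2V) : inner ℝ f g = ∫ v, f v * g v := by
  rw [L2.inner_def]
  simp [mul_comm]

section LinearizedOperator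

variable {κ : ℝ} {β : ℝ → ℝ} {ρ T : ℝ}

lemma Admissible.tame_half (h : Admissible κ β ρ T) (𝔲 : Vel) {p : ℝ} (hp : 0 < p)
    (hp1 : p < 1 / 2) :
    Tame (gau (decayRate T p) 𝔲) (fun v => maxwellian ρ 𝔲 T v ^ (1 / 2 : ℝ)) := by
  have h1 := h.two_mul_decayRate_le (p := p) (s := 1 / 2) (by linarith)
  have h2 := h.decayRate_pos hp1
  exact h.tame_rpow (by norm_num) (by linarith)

lemma tame_one (hκ0 : κ < 0) (c : Vel) : Tame (mW κ c) (fun _ => 1) :=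
  (tame_const 1).weaken (fun _ => zero_le_one) (C := 1) fun v => by
    rw [one_mul]; exact one_le_mW hκ0 v

lemma Admissible.exists_nu_le_const (h : Admissible κ β ρ T) (𝔲 : Vel) :
    ∃ C : ℝ, 0 < C ∧ ∀ v, |nu κ β ρ 𝔲 T v| ≤ C := by
  obtain ⟨C, hC, h1⟩ := h.exists_nu_le 𝔲
  refine ⟨C, hC, fun v => ?_⟩
  rw [abs_of_nonneg (h.nu_nonneg v)]
  exact (le_mul_of_one_le_left (h.nu_nonneg v) (one_le_mW h.neg v)).trans (h1 v)

/-- The linearized collision operator as a bounded operator on `L²`. -/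
lemma Admissible.exists_linL_op (h : Admissible κ β ρ T) (𝔲 : Vel) :
    ∃ L : L2V →L[ℝ] L2V, ∀ (F : L2V) (f : Vel → ℝ), F =ᵐ[volume] f →
      L F =ᵐ[volume] linL κ β ρ 𝔲 T f := by
  obtain ⟨C, hC, hν⟩ := h.exists_nu_le_const 𝔲
  obtain ⟨A, hA, -⟩ := exists_mulOp h.measurable_nu.aestronglyMeasurable hC.le (.of_forall hν)
  have ht := h.tame_half 𝔲 (p := 1 / 4) (by norm_num) (by norm_num)
  obtain ⟨B, hB, -, -⟩ := h.exists_op_collP (h.decayRate_pos (p := 1 / 4) (by norm_num))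
    (tame_one h.neg 𝔲) ht ht
  refine ⟨A - B, fun F f hF => ?_⟩
  rw [sub_apply]
  filter_upwards [Lp.coeFn_sub (A F) (B F), hA F, hB F, h.linL_ae_congr hF] with v h1 h2 h3 h4
  rw [h1, Pi.sub_apply, h2, h3, ← h4, h.linL_eq]
  rfl

/-- The function `ν^{-1/2}`. -/
noncomputable def nuW (κ : ℝ) (β : ℝ → ℝ) (ρ : ℝ) (𝔲 : Vel) (T : ℝ) (v : Vel) : ℝ :=
  (√(nu κ β ρ 𝔲 T v))⁻¹

/-- The kernels of the operator `ν^{-1/2} (ν - L) ν^{-1/2}`. -/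
noncomputable def symP (κ : ℝ) (β : ℝ → ℝ) (ρ : ℝ) (𝔲 : Vel) (T : ℝ) (i : Fin 3) (v : Vel)
    (ξ : Vel × S2) : ℝ :=
  nuW κ β ρ 𝔲 T v * linP κ β ρ 𝔲 T i v ξ * nuW κ β ρ 𝔲 T (v + (collS i).y ξ)

variable {𝔲 : Vel}

lemma Admissible.measurable_nuW (h : Admissible κ β ρ T) : Measurable (nuW κ β ρ 𝔲 T) :=
  h.measurable_nu.sqrt.inv

lemma Admissible.nuW_pos (h : Admissible κ β ρ T) (v : Vel) : 0 < nuW κ β ρ 𝔲 T v :=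
  inv_pos.2 (Real.sqrt_pos.2 (h.nu_pos v))

lemma Admissible.nuW_sq_mul (h : Admissible κ β ρ T) (v : Vel) :
    nuW κ β ρ 𝔲 T v ^ 2 * nu κ β ρ 𝔲 T v = 1 := by
  rw [nuW, inv_pow, Real.sq_sqrt (h.nu_nonneg v), inv_mul_cancel₀ (h.nu_pos v).ne']

lemma Admissible.exists_nuW_sq_le (h : Admissible κ β ρ T) (𝔲 : Vel) :
    ∃ C : ℝ, 0 < C ∧ ∀ v, nuW κ β ρ 𝔲 T v ^ 2 ≤ C * mW κ 𝔲 v := by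
  obtain ⟨c₀, hc₀, hν⟩ := h.exists_le_nu 𝔲
  refine ⟨c₀⁻¹, by positivity, fun v => ?_⟩
  have h1 := h.nuW_sq_mul (𝔲 := 𝔲) v
  have h2 := hν v
  rw [← div_eq_inv_mul, le_div_iff₀ hc₀]
  have h3 := sq_nonneg (nuW κ β ρ 𝔲 T v)
  calc nuW κ β ρ 𝔲 T v ^ 2 * c₀ ≤ nuW κ β ρ 𝔲 T v ^ 2 * (mW κ 𝔲 v * nu κ β ρ 𝔲 T v) := by gcongr
    _ = nuW κ β ρ 𝔲 T v ^ 2 * nu κ β ρ 𝔲 T v * mW κ 𝔲 v := by ring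
    _ = _ := by rw [h1, one_mul]

lemma Admissible.exists_nuW_le (h : Admissible κ β ρ T) (𝔲 : Vel) :
    ∃ C : ℝ, 0 < C ∧ ∀ v, nuW κ β ρ 𝔲 T v ≤ C * mW κ 𝔲 v := by
  obtain ⟨C, hC, h1⟩ := h.exists_nuW_sq_le 𝔲
  refine ⟨C + 1, by positivity, fun v => ?_⟩
  have h2 := one_le_mW (c := 𝔲) h.neg v
  nlinarith [h1 v, sq_nonneg (nuW κ β ρ 𝔲 T v - 1), h.nuW_pos (𝔲 := 𝔲) v]

/-- The product is at most the mean of the two squares, which are bounded by multiples of mW(v) and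
mW(v + y); `mW_add_le` handles the second. So ν^{-1/2} on both sides costs no more than mW(v), up to
a weight in u that the Gaussian absorbs. -/
lemma Admissible.exists_nuW_mul_shift_le (h : Admissible κ β ρ T) (𝔲 : Vel) :
    ∃ C : ℝ, 0 < C ∧ ∀ (s : Shift) v ξ, nuW κ β ρ 𝔲 T v * nuW κ β ρ 𝔲 T (v + s.y ξ) ≤
      C * (mW κ 𝔲 v * mW κ 𝔲 (v + ξ.1)) := by
  obtain ⟨C, hC, h1⟩ := h.exists_nuW_sq_le 𝔲
  refine ⟨C, hC, fun s v ξ => ?_⟩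
  have m0 := mW_pos (κ := κ) (c := 𝔲) v
  have m1 := one_le_mW (c := 𝔲) h.neg (v + ξ.1)
  have h2 := mW_add_le (c := 𝔲) h.neg s v ξ
  have h3 := h1 v
  have h4 := h1 (v + s.y ξ)
  have h5 : C * mW κ 𝔲 (v + s.y ξ) ≤ C * (mW κ 𝔲 v * mW κ 𝔲 (v + ξ.1)) := by gcongr
  have h6 : C * mW κ 𝔲 v ≤ C * (mW κ 𝔲 v * mW κ 𝔲 (v + ξ.1)) := by
    gcongr; exact le_mul_of_one_le_right m0.le m1
  nlinarith [sq_nonneg (nuW κ β ρ 𝔲 T v - nuW κ β ρ 𝔲 T (v + s.y ξ))]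

lemma Admissible.measurable_linP (h : Admissible κ β ρ T) (i : Fin 3) :
    Measurable (Function.uncurry (linP κ β ρ 𝔲 T i)) := by
  have ht := h.tame_half 𝔲 (p := 1 / 4) (by norm_num) (by norm_num)
  obtain ⟨B, hB⟩ := h.exists_kerBdd_collP (tame_one h.neg 𝔲) ht ht
  exact (hB i).meas

lemma Admissible.exists_kerBdd_symP (h : Admissible κ β ρ T) (𝔲 : Vel) :
    ∃ B, ∀ i, KerBdd κ (decayRate T (1 / 4)) 𝔲 (collS i) Set.univ B (symP κ β ρ 𝔲 T i) := by
  set δ := decayRate T (1 / 4) with hδ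
  have hδ0 : 0 < δ := h.decayRate_pos (by norm_num)
  obtain ⟨β₀, hβ₀, hb⟩ := h.exists_abs_collB_le
  obtain ⟨C, hC, hν⟩ := h.exists_nuW_mul_shift_le 𝔲
  obtain ⟨C', hC', hmg⟩ := exists_mW_mul_gau_le (κ := κ) (c := 𝔲) (δ := 2 * δ) (by positivity)
  rw [show 2 * δ / 2 = δ by ring] at hmg
  set A := maxConst ρ T ^ (1 / 2 : ℝ) with hA
  have hA0 : 0 < A := Real.rpow_pos_of_pos h.const_pos _
  have hpow : ∀ v, maxwellian ρ 𝔲 T v ^ (1 / 2 : ℝ) ≤ A * gau (2 * δ) 𝔲 v := by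
    intro v
    rw [h.maxwellian_rpow]
    gcongr
    exact gau_anti 𝔲 (h.two_mul_decayRate_le (by norm_num)) v
  refine ⟨β₀ * (C * (A * (C' * A))), fun i => ⟨?_, by positivity, fun v ξ => ?_, fun v ξ hn =>
    absurd (Set.mem_univ _) hn, MeasurableSet.univ⟩⟩
  · have m1 := h.measurable_nuW (𝔲 := 𝔲)
    have m2 := h.measurable_linP (𝔲 := 𝔲) i
    have m3 := (collS i).meas
    exact ((m1.comp measurable_fst).mul m2).mul
      (m1.comp (measurable_fst.add (m3.comp measurable_snd)))
  · set s := collS i with hs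
    set u := v + ξ.1 with hu
    have q1 := (h.rpow_pos (𝔲 := 𝔲) (1 / 2) u).le
    have q2 := (h.rpow_pos (𝔲 := 𝔲) (1 / 2) (u - s.y ξ)).le
    have n1 := (h.nuW_pos (𝔲 := 𝔲) v).le
    have n2 := (h.nuW_pos (𝔲 := 𝔲) (v + s.y ξ)).le
    have m1 := (mW_pos (κ := κ) (c := 𝔲) v).le
    have m2 := (mW_pos (κ := κ) (c := 𝔲) u).le
    have g1 := (gau_pos (δ := δ) (c := 𝔲) u).le
    have g2 := (gau_pos (δ := 2 * δ) (c := 𝔲) u).le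
    have hlin : |symP κ β ρ 𝔲 T i v ξ| = |collB κ β i ξ| *
        ((nuW κ β ρ 𝔲 T v * nuW κ β ρ 𝔲 T (v + s.y ξ)) *
          (maxwellian ρ 𝔲 T u ^ (1 / 2 : ℝ) * maxwellian ρ 𝔲 T (u - s.y ξ) ^ (1 / 2 : ℝ))) := by
      rw [symP, linP, collP, prodKer, one_mul, abs_mul, abs_mul, abs_mul, abs_of_nonneg n1,
        abs_of_nonneg n2, abs_of_nonneg (mul_nonneg q1 q2)]
      ring
    have a1 : mW κ 𝔲 u * maxwellian ρ 𝔲 T u ^ (1 / 2 : ℝ) ≤ A * (C' * gau δ 𝔲 u) := by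
      calc _ ≤ mW κ 𝔲 u * (A * gau (2 * δ) 𝔲 u) := by gcongr; exact hpow u
        _ = A * (mW κ 𝔲 u * gau (2 * δ) 𝔲 u) := by ring
        _ ≤ _ := mul_le_mul_of_nonneg_left (hmg u) hA0.le
    have a2 : maxwellian ρ 𝔲 T (u - s.y ξ) ^ (1 / 2 : ℝ) ≤ A * gau δ 𝔲 (u - s.y ξ) :=
      (hpow _).trans (mul_le_mul_of_nonneg_left (gau_anti 𝔲 (by linarith) _) hA0.le)
    have hν1 := hν s v ξ
    have hb1 := hb i ξ
    rw [hlin]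
    calc _ ≤ (β₀ * (‖ξ.1‖ ^ (κ - 1) * |inner ℝ ξ.1 (ξ.2 : Vel)|)) *
          ((C * (mW κ 𝔲 v * mW κ 𝔲 u)) *
          (maxwellian ρ 𝔲 T u ^ (1 / 2 : ℝ) * maxwellian ρ 𝔲 T (u - s.y ξ) ^ (1 / 2 : ℝ))) :=
          mul_le_mul hb1 (mul_le_mul_of_nonneg_right hν1 (mul_nonneg q1 q2))
            (mul_nonneg (mul_nonneg n1 n2) (mul_nonneg q1 q2)) (by positivity)
      _ = (β₀ * (‖ξ.1‖ ^ (κ - 1) * |inner ℝ ξ.1 (ξ.2 : Vel)|)) * (C * mW κ 𝔲 v) *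
          ((mW κ 𝔲 u * maxwellian ρ 𝔲 T u ^ (1 / 2 : ℝ)) *
            maxwellian ρ 𝔲 T (u - s.y ξ) ^ (1 / 2 : ℝ)) := by ring
      _ ≤ (β₀ * (‖ξ.1‖ ^ (κ - 1) * |inner ℝ ξ.1 (ξ.2 : Vel)|)) * (C * mW κ 𝔲 v) *
          ((A * (C' * gau δ 𝔲 u)) * (A * gau δ 𝔲 (u - s.y ξ))) := by
          refine mul_le_mul_of_nonneg_left ?_ (by positivity)
          exact mul_le_mul a1 a2 q2 (by positivity)
      _ = _ := by rw [maj]; ring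

lemma sumOp_symP (f : Vel → ℝ) (v : Vel) : sumOp (symP κ β ρ 𝔲 T) f v =
    nuW κ β ρ 𝔲 T v * sumOp (linP κ β ρ 𝔲 T) (fun w => nuW κ β ρ 𝔲 T w * f w) v := by
  rw [sumOp, sumOp, Finset.mul_sum]
  refine Finset.sum_congr rfl fun i _ => ?_
  rw [opFun, opFun, ← integral_const_mul]
  refine integral_congr_ae (.of_forall fun ξ => ?_)
  simp only [symP]
  ring

/-- Detailed balance: the reversed collision starts from v + y, exchanges the two Maxwellian factors
and the two factors ν^{-1/2}, and leaves the collision kernel unchanged. -/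
lemma symP_shift (i : Fin 3) (v : Vel) (ξ : Vel × S2) :
    symP κ β ρ 𝔲 T i (v + (collS i).y ξ) ((collS i).ρ ξ) = symP κ β ρ 𝔲 T i v ξ := by
  set s := collS i with hs
  have e1 : v + s.y ξ + (s.ρ ξ).1 = v + ξ.1 - s.y ξ := by rw [s.ρ_fst]; module
  have e2 : v + ξ.1 - s.y ξ - -s.y ξ = v + ξ.1 := by abel
  simp only [symP, linP, collP, prodKer, collB, ← hs, bker_shift, e1, s.y_ρ, e2,
    add_neg_cancel_right]
  ring

lemma integral_collMeasure_ρ (s : Shift) {F : Vel × S2 → ℝ} (hF : StronglyMeasurable F) :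
    ∫ ξ, F (s.ρ ξ) ∂collMeasure = ∫ ξ, F ξ ∂collMeasure := by
  have h := integral_map (μ := collMeasure) s.mp.measurable.aemeasurable
    (f := F) hF.aestronglyMeasurable
  rw [s.mp.map_eq] at h
  exact h.symm

/-- The symmetrized operator is compact and self-adjoint. -/
lemma Admissible.exists_sym_op (h : Admissible κ β ρ T) (𝔲 : Vel) :
    ∃ S : L2V →L[ℝ] L2V, (∀ f, S f =ᵐ[volume] sumOp (symP κ β ρ 𝔲 T) f) ∧ IsCompactOperator S ∧
      ∀ f g, inner ℝ (S f) g = inner ℝ f (S g) := by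
  obtain ⟨B, hB⟩ := h.exists_kerBdd_symP 𝔲
  have hδ : 0 < decayRate T (1 / 4) := h.decayRate_pos (by norm_num)
  obtain ⟨S, hS, hSc⟩ := exists_sumOp hB h.lower h.neg hδ
  refine ⟨S, hS, isCompactOperator_of_mem_closure_finRank hSc, fun f g => ?_⟩
  have mf := L2V.measurable f
  have mg := L2V.measurable g
  have hi : ∀ (f g : L2V) i,
      Integrable (fun v => opFun (collS i) (symP κ β ρ 𝔲 T i) f v * g v) volume := by
    intro f g i
    have h1 := ((hB i).integrable_prod h.lower h.neg hδ (Lp.memLp f) (L2V.measurable f)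
      (Lp.memLp g) (L2V.measurable g)).integral_prod_left
    refine h1.congr (.of_forall fun v => ?_)
    simp only [integral_mul_const, opFun]
  have hexp : ∀ f g : L2V, inner ℝ (S f) g =
      ∑ i, ∫ v, opFun (collS i) (symP κ β ρ 𝔲 T i) f v * g v := by
    intro f g
    rw [inner_L2V, ← integral_finsetSum _ fun i _ => hi f g i]
    refine integral_congr_ae ?_
    filter_upwards [hS f] with v hv
    rw [hv, sumOp, Finset.sum_mul]
  rw [real_inner_comm (S g) f, hexp, hexp]
  refine Finset.sum_congr rfl fun i _ => ?_
  rw [(hB i).integral_opFun_mul h.lower h.neg hδ (Lp.memLp f) mf (Lp.memLp g) mg,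
    (hB i).integral_opFun_mul h.lower h.neg hδ (Lp.memLp g) mg (Lp.memLp f) mf]
  set s := collS i with hs
  have hsm : StronglyMeasurable fun ξ : Vel × S2 =>
      (∫ v, symP κ β ρ 𝔲 T i v ξ * f (v + s.y ξ) * g v ∂volume) := by
    have hm : Measurable fun x : Vel × (Vel × S2) =>
        symP κ β ρ 𝔲 T i x.1 x.2 * f (x.1 + s.y x.2) * g x.1 :=
      ((hB i).measurable_integrand mf).mul (mg.comp measurable_fst)
    exact hm.stronglyMeasurable.integral_prod_left'
  -- Reverse the collision, then translate v by y: the pairing turns into the one with f and g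
  -- exchanged.
  rw [← integral_collMeasure_ρ s hsm]
  refine integral_congr_ae (.of_forall fun ξ => ?_)
  simp only
  rw [← integral_add_right_eq_self _ (s.y ξ)]
  refine integral_congr_ae (.of_forall fun v => ?_)
  simp only [s.y_ρ, add_neg_cancel_right]
  rw [hs, symP_shift]
  ring

end LinearizedOperator


/-! ### Existence, decay and uniqueness of the pseudo-inverse. -/

section Solution

variable {κ : ℝ} {β : ℝ → ℝ} {ρ T : ℝ} {𝔲 : Vel}

lemma eLpNorm_le_of_abs_le {f g : Vel → ℝ} {C : ℝ} (h : ∀ v, |f v| ≤ C * |g v|) :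
    eLpNorm f 2 volume ≤ ENNReal.ofReal C * eLpNorm g 2 volume :=
  eLpNorm_le_mul_eLpNorm_of_ae_le_mul (.of_forall h) 2

lemma dW_le_one (hκ0 : κ < 0) (c v : Vel) : dW κ c v ≤ 1 :=
  Real.rpow_le_one_of_one_le_of_nonpos (one_le_mW hκ0 v) (by norm_num)

lemma Admissible.exists_dW_mul_nuW_le (h : Admissible κ β ρ T) (𝔲 : Vel) :
    ∃ C : ℝ, 0 < C ∧ ∀ v, dW κ 𝔲 v * nuW κ β ρ 𝔲 T v ≤ C := by
  obtain ⟨C, hC, h1⟩ := h.exists_nuW_sq_le 𝔲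
  refine ⟨C + 1, by positivity, fun v => ?_⟩
  have h2 := h1 v
  have h3 := dW_sq_mul (κ := κ) 𝔲 v
  have h4 : (dW κ 𝔲 v * nuW κ β ρ 𝔲 T v) ^ 2 ≤ C := by
    calc (dW κ 𝔲 v * nuW κ β ρ 𝔲 T v) ^ 2 = dW κ 𝔲 v ^ 2 * nuW κ β ρ 𝔲 T v ^ 2 := by ring
      _ ≤ dW κ 𝔲 v ^ 2 * (C * mW κ 𝔲 v) := by gcongr
      _ = C * (dW κ 𝔲 v ^ 2 * mW κ 𝔲 v) := by ring
      _ = C := by rw [h3, mul_one]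
  nlinarith [sq_nonneg (dW κ 𝔲 v * nuW κ β ρ 𝔲 T v - 1)]

lemma Admissible.exists_le_rpow_neg (h : Admissible κ β ρ T) (𝔲 : Vel) {p : ℝ} (hp : 0 < p) :
    ∃ C : ℝ, 0 < C ∧ ∀ v, 1 ≤ C * maxwellian ρ 𝔲 T v ^ (-p) := by
  refine ⟨maxConst ρ T ^ p, Real.rpow_pos_of_pos h.const_pos _, fun v => ?_⟩
  have hT := h.temp_pos
  rw [h.maxwellian_rpow, ← mul_assoc, ← Real.rpow_add h.const_pos, add_neg_cancel,
    Real.rpow_zero, one_mul, ← gau_zero 𝔲 v]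
  refine gau_anti 𝔲 ?_ v
  rw [neg_div, neg_nonpos]
  positivity

lemma Admissible.exists_L2_of_decay (h : Admissible κ β ρ T) (𝔲 : Vel) {p : ℝ} (hp : 0 < p) :
    ∃ C : ℝ, 0 < C ∧ ∀ f : Vel → ℝ, eLpNorm f 2 volume ≤
      ENNReal.ofReal C * eLpNorm (fun v => maxwellian ρ 𝔲 T v ^ (-p) * f v) 2 volume := by
  obtain ⟨C, hC, h1⟩ := h.exists_le_rpow_neg 𝔲 hp
  refine ⟨C, hC, fun f => eLpNorm_le_of_abs_le fun v => ?_⟩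
  rw [abs_mul, ← mul_assoc, abs_of_pos (h.rpow_pos _ v)]
  exact le_mul_of_one_le_left (abs_nonneg _) (h1 v)

lemma ennreal_le_of_sq_le {a b C : ℝ≥0∞} (h : a ^ 2 ≤ C * b ^ 2) : a ≤ (C + 1) * b := by
  refine (ENNReal.pow_le_pow_left_iff two_ne_zero).1 (h.trans ?_)
  rw [mul_pow]
  gcongr
  calc C ≤ C + 1 := le_self_add
    _ = (C + 1) * 1 := (mul_one _).symm
    _ ≤ (C + 1) * (C + 1) := by gcongr; exact le_add_self
    _ = _ := (sq _).symm

lemma Admissible.linL_eq_iff (h : Admissible κ β ρ T) {f g : Vel → ℝ} :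
    linL κ β ρ 𝔲 T f =ᵐ[volume] g ↔
      ∀ᵐ v, nu κ β ρ 𝔲 T v * f v = sumOp (linP κ β ρ 𝔲 T) f v + g v := by
  refine ⟨fun H => H.mono fun v hv => ?_, fun H => H.mono fun v hv => ?_⟩
  · rw [h.linL_eq] at hv
    linarith
  · rw [h.linL_eq]
    linarith

/-- The equation `f - S f = G` for the symmetrized operator solves the linearized equation. -/
lemma Admissible.linL_of_sym (h : Admissible κ β ρ T) {f g : Vel → ℝ}
    (hf : ∀ᵐ v, f v = sumOp (symP κ β ρ 𝔲 T) f v + nuW κ β ρ 𝔲 T v * g v) :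
    linL κ β ρ 𝔲 T (fun v => nuW κ β ρ 𝔲 T v * f v) =ᵐ[volume] g := by
  rw [h.linL_eq_iff]
  filter_upwards [hf] with v hv
  rw [sumOp_symP] at hv
  have e := h.nuW_sq_mul (𝔲 := 𝔲) v
  have e2 : nu κ β ρ 𝔲 T v * (nuW κ β ρ 𝔲 T v * f v) = (nuW κ β ρ 𝔲 T v ^ 2 * nu κ β ρ 𝔲 T v) *
      (sumOp (linP κ β ρ 𝔲 T) (fun w => nuW κ β ρ 𝔲 T w * f w) v + g v) := by
    conv_lhs => rw [hv]
    ring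
  rw [e2, e, one_mul]

/-- The Fredholm alternative for the symmetrized equation with source ν^{-1/2} g, followed by the
decay estimate for ν^{-1/2} f. Orthogonality to 𝒩 is not yet claimed. -/
lemma Admissible.exists_presolution (h : Admissible κ β ρ T) (𝔲 : Vel) {p : ℝ} (hp : 0 < p)
    (hp1 : p < 1 / 2) : ∃ D : ℝ≥0∞, D ≠ ⊤ ∧ ∀ g : Vel → ℝ, InNullPerp κ β ρ 𝔲 T g →
      eLpNorm (fun v => mW κ 𝔲 v * maxwellian ρ 𝔲 T v ^ (-p) * g v) 2 volume ≠ ⊤ →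
      ∃ f : Vel → ℝ, Measurable f ∧ linL κ β ρ 𝔲 T f =ᵐ[volume] g ∧
        eLpNorm (fun v => maxwellian ρ 𝔲 T v ^ (-p) * f v) 2 volume ≤
          D * eLpNorm (fun v => mW κ 𝔲 v * maxwellian ρ 𝔲 T v ^ (-p) * g v) 2 volume := by
  obtain ⟨S, hS, hSc, hsa⟩ := h.exists_sym_op 𝔲
  obtain ⟨CF, hCF, hF⟩ := exists_fredholm_solution hSc hsa
  obtain ⟨D, hD, hdec⟩ := h.exists_decay 𝔲 hp hp1
  obtain ⟨C₁, hC₁, h1⟩ := h.exists_dW_mul_nuW_le 𝔲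
  obtain ⟨C₂, hC₂, h2⟩ := h.exists_nuW_le 𝔲
  obtain ⟨C₃, hC₃, h3⟩ := h.exists_le_rpow_neg 𝔲 hp
  obtain ⟨C₄, hC₄, h4⟩ := h.exists_L2_of_decay 𝔲 hp
  have mnu := h.measurable_nuW (𝔲 := 𝔲)
  have hdn : ∀ f : Vel → ℝ, eLpNorm (fun v => dW κ 𝔲 v * (nuW κ β ρ 𝔲 T v * f v)) 2 volume ≤
      ENNReal.ofReal C₁ * eLpNorm f 2 volume := fun f => eLpNorm_le_of_abs_le fun v => by
    rw [← mul_assoc, abs_mul, abs_of_nonneg (mul_nonneg (dW_pos 𝔲 v).le (h.nuW_pos v).le)]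
    gcongr
    exact h1 v
  refine ⟨D * (ENNReal.ofReal (C₁ * (CF * (C₂ * C₃))) ^ 2 + 1) + 1, by finiteness,
    fun g hg hgt => ?_⟩
  set Y := eLpNorm (fun v => mW κ 𝔲 v * maxwellian ρ 𝔲 T v ^ (-p) * g v) 2 volume with hY
  have hGb : eLpNorm (fun v => nuW κ β ρ 𝔲 T v * g v) 2 volume ≤
      ENNReal.ofReal (C₂ * C₃) * Y := eLpNorm_le_of_abs_le fun v => by
    have m0 := mW_pos (κ := κ) (c := 𝔲) v
    have w0 := h.rpow_pos (𝔲 := 𝔲) (-p) v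
    rw [abs_mul, abs_mul, abs_mul, abs_of_pos (h.nuW_pos v), abs_of_pos m0, abs_of_pos w0]
    calc nuW κ β ρ 𝔲 T v * |g v| ≤ (C₂ * mW κ 𝔲 v) * |g v| := by gcongr; exact h2 v
      _ = (C₂ * mW κ 𝔲 v) * 1 * |g v| := by ring
      _ ≤ (C₂ * mW κ 𝔲 v) * (C₃ * maxwellian ρ 𝔲 T v ^ (-p)) * |g v| := by gcongr; exact h3 v
      _ = _ := by ring
  have hGm : MemLp (fun v => nuW κ β ρ 𝔲 T v * g v) 2 volume :=
    ⟨mnu.aestronglyMeasurable.mul hg.1.1, hGb.trans_lt (by finiteness)⟩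
  obtain ⟨f, hf, hfn⟩ := hF hGm.toLp (by
    -- A fixed vector f of S yields χ = ν^{-1/2} f with Lχ = 0, but a priori only ν^{1/2} χ is in
    -- L². The decay estimate with zero source puts χ in L², hence in 𝒩, and then ⟪ν^{-1/2} g, f⟫ =
    -- ∫ g χ = 0.
    intro f hf
    have hfm : Measurable fun v => nuW κ β ρ 𝔲 T v * f v := mnu.mul (L2V.measurable f)
    have hlin : linL κ β ρ 𝔲 T (fun v => nuW κ β ρ 𝔲 T v * f v) =ᵐ[volume] 0 := by
      refine h.linL_of_sym ?_
      have hSf := hS f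
      rw [hf] at hSf
      filter_upwards [hSf] with v hv
      rw [Pi.zero_apply, mul_zero, add_zero]
      exact hv
    have hd := hdec _ _ hfm aestronglyMeasurable_zero
      ((hdn f).trans_lt (ENNReal.mul_lt_top ENNReal.ofReal_lt_top (Lp.memLp f).2)).ne
      (h.linL_eq_iff.1 hlin)
    have hw : eLpNorm (fun v => maxwellian ρ 𝔲 T v ^ (-p) * (nuW κ β ρ 𝔲 T v * f v)) 2 volume < ⊤ := by
      have hlt : D * (eLpNorm (fun v => dW κ 𝔲 v * (nuW κ β ρ 𝔲 T v * f v)) 2 volume ^ 2 +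
          eLpNorm (fun v => mW κ 𝔲 v * maxwellian ρ 𝔲 T v ^ (-p) * (0 : Vel → ℝ) v) 2 volume ^ 2)
          < ⊤ := by
        simp only [Pi.zero_apply, mul_zero, eLpNorm_zero']
        have := (hdn f).trans_lt (ENNReal.mul_lt_top ENNReal.ofReal_lt_top (Lp.memLp f).2)
        finiteness
      have := hd.trans_lt hlt
      by_contra hc
      rw [not_lt, top_le_iff] at hc
      rw [hc] at this
      simp at this
    have hmem : MemLp (fun v => nuW κ β ρ 𝔲 T v * f v) 2 volume :=
      ⟨hfm.aestronglyMeasurable, (h4 _).trans_lt (ENNReal.mul_lt_top ENNReal.ofReal_lt_top hw)⟩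
    rw [inner_L2V, ← hg.2 _ ⟨hmem, hlin⟩]
    refine integral_congr_ae ?_
    filter_upwards [hGm.coeFn_toLp] with v hv
    rw [hv]
    ring)
  have hfm : Measurable fun v => nuW κ β ρ 𝔲 T v * f v := mnu.mul (L2V.measurable f)
  have hlin : linL κ β ρ 𝔲 T (fun v => nuW κ β ρ 𝔲 T v * f v) =ᵐ[volume] g := by
    refine h.linL_of_sym ?_
    have hsub := Lp.coeFn_sub f (S f)
    rw [hf] at hsub
    filter_upwards [hsub, hS f, hGm.coeFn_toLp] with v e1 e2 e3
    rw [e3, Pi.sub_apply, e2] at e1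
    linarith
  refine ⟨_, hfm, hlin, ?_⟩
  have hfY : eLpNorm f 2 volume ≤ ENNReal.ofReal (CF * (C₂ * C₃)) * Y := by
    have e1 : eLpNorm f 2 volume = ENNReal.ofReal ‖f‖ := by
      rw [Lp.norm_def, ENNReal.ofReal_toReal (Lp.memLp f).2.ne]
    have e2 : ENNReal.ofReal ‖hGm.toLp‖ = eLpNorm (fun v => nuW κ β ρ 𝔲 T v * g v) 2 volume := by
      rw [Lp.norm_toLp, ENNReal.ofReal_toReal hGm.2.ne]
    rw [e1]
    calc _ ≤ ENNReal.ofReal (CF * ‖hGm.toLp‖) := ENNReal.ofReal_le_ofReal hfn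
      _ = ENNReal.ofReal CF * ENNReal.ofReal ‖hGm.toLp‖ := ENNReal.ofReal_mul hCF.le
      _ ≤ ENNReal.ofReal CF * (ENNReal.ofReal (C₂ * C₃) * Y) := by rw [e2]; gcongr
      _ = _ := by rw [← mul_assoc, ← ENNReal.ofReal_mul hCF.le]
  have hdW : eLpNorm (fun v => dW κ 𝔲 v * (nuW κ β ρ 𝔲 T v * f v)) 2 volume ≤
      ENNReal.ofReal (C₁ * (CF * (C₂ * C₃))) * Y := by
    refine (hdn f).trans ?_
    rw [ENNReal.ofReal_mul hC₁.le, mul_assoc]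
    gcongr
  have hfin := hdec _ g hfm hg.1.1 (hdW.trans_lt (by finiteness)).ne (h.linL_eq_iff.1 hlin)
  refine ennreal_le_of_sq_le (hfin.trans ?_)
  rw [mul_assoc, add_mul, one_mul, ← mul_pow]
  gcongr

/-- The existence and the decay of the pseudo-inverse. -/
lemma Admissible.exists_solution (h : Admissible κ β ρ T) (𝔲 : Vel) {p : ℝ} (hp : 0 < p)
    (hp1 : p < 1 / 2) : ∃ D : ℝ≥0∞, D ≠ ⊤ ∧ ∀ g : Vel → ℝ, InNullPerp κ β ρ 𝔲 T g →
      eLpNorm (fun v => mW κ 𝔲 v * maxwellian ρ 𝔲 T v ^ (-p) * g v) 2 volume ≠ ⊤ →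
      ∃ f : Vel → ℝ, Measurable f ∧ IsLinv κ β ρ 𝔲 T g f ∧
        eLpNorm (fun v => maxwellian ρ 𝔲 T v ^ (-p) * f v) 2 volume ≤
          D * eLpNorm (fun v => mW κ 𝔲 v * maxwellian ρ 𝔲 T v ^ (-p) * g v) 2 volume := by
  obtain ⟨D₁, hD₁, hpre⟩ := h.exists_presolution 𝔲 hp hp1
  obtain ⟨D, hD, hdec⟩ := h.exists_decay 𝔲 hp hp1
  obtain ⟨C₄, hC₄, h4⟩ := h.exists_L2_of_decay 𝔲 hp
  obtain ⟨L, hL⟩ := h.exists_linL_op 𝔲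
  refine ⟨D * ((ENNReal.ofReal C₄ * D₁) ^ 2 + 1) + 1, by finiteness, fun g hg hgt => ?_⟩
  obtain ⟨f, hfm, hfg, hfb⟩ := hpre g hg hgt
  set Y := eLpNorm (fun v => mW κ 𝔲 v * maxwellian ρ 𝔲 T v ^ (-p) * g v) 2 volume with hY
  have hfY : eLpNorm f 2 volume ≤ ENNReal.ofReal C₄ * D₁ * Y := by
    rw [mul_assoc]
    exact (h4 f).trans (by gcongr)
  have hf2 : MemLp f 2 volume := ⟨hfm.aestronglyMeasurable, hfY.trans_lt (by finiteness)⟩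
  set N : Submodule ℝ L2V := L.ker with hN
  have hNc : IsClosed (N : Set L2V) := L.isClosed_ker
  have : CompleteSpace N := hNc.completeSpace_coe
  -- Subtracting the projection changes neither L f nor increases the L² norm. The weighted bound is
  -- not inherited by F and is recovered by a second use of `Admissible.exists_decay`.
  set P : L2V := N.starProjection hf2.toLp with hP
  set F : L2V := hf2.toLp - P with hF
  have hPN : L P = 0 := by
    have : P ∈ N := Submodule.starProjection_apply_mem N _
    exact this
  have hFL : L F = L hf2.toLp := by rw [hF, map_sub, hPN, sub_zero]
  have hlin : linL κ β ρ 𝔲 T F =ᵐ[volume] g := by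
    have e1 := hL F F (Filter.EventuallyEq.refl _ _)
    have e2 := hL hf2.toLp f hf2.coeFn_toLp
    rw [hFL] at e1
    exact (e1.symm.trans e2).trans hfg
  have hFn : ‖F‖ ≤ ‖hf2.toLp‖ := by
    have e : F = Nᗮ.starProjection hf2.toLp := by
      rw [Submodule.starProjection_orthogonal_val]
    rw [e]
    exact Submodule.norm_starProjection_apply_le _ _
  have hFY : eLpNorm F 2 volume ≤ ENNReal.ofReal C₄ * D₁ * Y := by
    have e1 : eLpNorm F 2 volume = ENNReal.ofReal ‖F‖ := by
      rw [Lp.norm_def, ENNReal.ofReal_toReal (Lp.memLp F).2.ne]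
    have e2 : ENNReal.ofReal ‖hf2.toLp‖ = eLpNorm f 2 volume := by
      rw [Lp.norm_toLp, ENNReal.ofReal_toReal hf2.2.ne]
    rw [e1]
    exact (ENNReal.ofReal_le_ofReal hFn).trans (e2.le.trans hfY)
  have hdW : eLpNorm (fun v => dW κ 𝔲 v * F v) 2 volume ≤ ENNReal.ofReal C₄ * D₁ * Y := by
    refine le_trans ?_ hFY
    have := eLpNorm_mul_le (a := dW κ 𝔲) (f := F) (C := 1)
      (.of_forall fun v => by rw [abs_of_pos (dW_pos 𝔲 v)]; exact dW_le_one h.neg 𝔲 v) 2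
    simpa using this
  have hfin := hdec _ g (L2V.measurable F) hg.1.1 (hdW.trans_lt (by finiteness)).ne
    (h.linL_eq_iff.1 hlin)
  refine ⟨F, L2V.measurable F, ⟨⟨Lp.memLp F, fun χ hχ => ?_⟩, hlin⟩, ?_⟩
  · have hχN : hχ.1.toLp ∈ N := by
      have e : L hχ.1.toLp = 0 := by
        refine Lp.ext ?_
        exact ((hL hχ.1.toLp χ hχ.1.coeFn_toLp).trans hχ.2).trans (Lp.coeFn_zero _ _ _).symm
      exact e
    have horth : F ∈ Nᗮ := Submodule.sub_starProjection_mem_orthogonal _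
    have h0 := (Submodule.mem_orthogonal' N F).1 horth _ hχN
    rw [← h0, inner_L2V]
    refine integral_congr_ae ?_
    filter_upwards [hχ.1.coeFn_toLp] with v hv
    rw [hv]
  · refine ennreal_le_of_sq_le (hfin.trans ?_)
    rw [mul_assoc, add_mul, one_mul, ← mul_pow]
    gcongr

lemma Admissible.isLinv_unique (h : Admissible κ β ρ T) {g f₁ f₂ : Vel → ℝ}
    (h₁ : IsLinv κ β ρ 𝔲 T g f₁) (h₂ : IsLinv κ β ρ 𝔲 T g f₂) : f₁ =ᵐ[volume] f₂ := by
  obtain ⟨L, hL⟩ := h.exists_linL_op 𝔲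
  have m1 := h₁.1.1
  have m2 := h₂.1.1
  set d : L2V := m1.toLp - m2.toLp with hd
  have hLd : L d = 0 := by
    rw [hd, map_sub, sub_eq_zero]
    refine Lp.ext ?_
    exact ((hL _ f₁ m1.coeFn_toLp).trans h₁.2).trans
      ((hL _ f₂ m2.coeFn_toLp).trans h₂.2).symm
  have hnull : InNull κ β ρ 𝔲 T d := by
    refine ⟨Lp.memLp d, ?_⟩
    have := hL d d (Filter.EventuallyEq.refl _ _)
    rw [hLd] at this
    exact this.symm.trans (Lp.coeFn_zero _ _ _)
  have hin : ∀ {f : Vel → ℝ} (hf : MemLp f 2 volume), InNullPerp κ β ρ 𝔲 T f →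
      inner ℝ hf.toLp d = 0 := by
    intro f hf hp
    rw [inner_L2V, ← hp.2 d hnull]
    refine integral_congr_ae ?_
    filter_upwards [hf.coeFn_toLp] with v hv
    rw [hv]
  have h0 : inner ℝ d d = 0 := by
    conv_lhs => rw [hd]
    rw [inner_sub_left, ← hd, hin m1 h₁.1, hin m2 h₂.1, sub_zero]
  have hd0 : d = 0 := inner_self_eq_zero.1 h0
  have heq : m1.toLp = m2.toLp := sub_eq_zero.1 hd0
  exact (MemLp.toLp_eq_toLp_iff m1 m2).1 heq

lemma Admissible.isLinv_congr (h : Admissible κ β ρ T) {g f₁ f₂ : Vel → ℝ}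
    (h₁ : IsLinv κ β ρ 𝔲 T g f₁) (he : f₁ =ᵐ[volume] f₂) : IsLinv κ β ρ 𝔲 T g f₂ := by
  refine ⟨⟨h₁.1.1.ae_eq he, fun χ hχ => ?_⟩, (h.linL_ae_congr he).symm.trans h₁.2⟩
  rw [← h₁.1.2 χ hχ]
  refine integral_congr_ae ?_
  filter_upwards [he] with v hv
  rw [hv]

end Solution


/-! ### Regularity of weighted solutions and of the weighted source. -/

section Regularity

variable {κ : ℝ} {β : ℝ → ℝ} {ρ T : ℝ} {𝔲 : Vel}

/-- Conjugation of the linearized operator with a power of the Maxwellian. -/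
lemma Admissible.weighted_sumOp (h : Admissible κ β ρ T) (p : ℝ) (f : Vel → ℝ) (v : Vel) :
    mW κ 𝔲 v * (maxwellian ρ 𝔲 T v ^ (-p) * sumOp (linP κ β ρ 𝔲 T) f v) =
      sumOp (collP κ β (mW κ 𝔲) (fun w => maxwellian ρ 𝔲 T w ^ (1 / 2 + p))
        (fun w => maxwellian ρ 𝔲 T w ^ (1 / 2 - p)))
        (fun w => maxwellian ρ 𝔲 T w ^ (-p) * f w) v := by
  rw [sumOp, sumOp, Finset.mul_sum, Finset.mul_sum]
  refine Finset.sum_congr rfl fun i _ => ?_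
  rw [opFun, opFun, ← integral_const_mul, ← integral_const_mul]
  refine integral_congr_ae (.of_forall fun ξ => ?_)
  set s := collS i with hs
  have e := h.rpow_eq_shift (𝔲 := 𝔲) s p v ξ
  simp only [linP, collP, prodKer, one_mul, ← hs, sub_eq_add_neg (1 / 2 : ℝ) p]
  rw [Real.rpow_add (h.maxwellian_pos _), Real.rpow_add (h.maxwellian_pos _), e]
  ring

/-- Multiplication by mW ν is a product kernel operator with displacement zero, after splitting μ(u)
into two square roots. The derivatives of ν then need no separate treatment. -/
lemma Admissible.exists_nu_op (h : Admissible κ β ρ T) (𝔲 : Vel) :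
    ∃ A : L2V →L[ℝ] L2V, (∀ n, SmoothOp n A) ∧
      ∀ f : L2V, A f =ᵐ[volume] fun v => mW κ 𝔲 v * nu κ β ρ 𝔲 T v * f v := by
  have hδ : 0 < decayRate T (1 / 4) := h.decayRate_pos (by norm_num)
  have ht := h.tame_half 𝔲 (p := 1 / 4) (by norm_num) (by norm_num)
  obtain ⟨β₀, hβ₀, hb⟩ := h.exists_abs_bker_le
  obtain ⟨B, hB⟩ := exists_kerBdd_prodKer zeroS (measurable_bker h.meas) hβ₀ hb
    (tame_mW 𝔲 κ) ht ht
  obtain ⟨A, hA⟩ := hB.exists_op h.lower h.neg hδ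
  refine ⟨A, fun n => smoothOp_prodKer (measurable_bker h.meas) hβ₀ hb h.lower h.neg hδ n
    (tame_mW 𝔲 κ) ht ht hA, fun f => (hA f).trans (.of_forall fun v => ?_)⟩
  have hy : ∀ ξ, zeroS.y ξ = 0 := fun _ => rfl
  simp only [opFun, prodKer, hy, add_zero, sub_zero]
  rw [nu_eq, integral_mul_const, ← integral_const_mul]
  congr 1
  refine integral_congr_ae (.of_forall fun ξ => ?_)
  have e2 : maxwellian ρ 𝔲 T (v + ξ.1) ^ (1 / 2 : ℝ) * maxwellian ρ 𝔲 T (v + ξ.1) ^ (1 / 2 : ℝ) =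
      maxwellian ρ 𝔲 T (v + ξ.1) := by
    rw [← Real.rpow_add (h.maxwellian_pos _)]; norm_num
  simp only [e2]
  ring

/-- The regularity of the weighted solutions. -/
lemma Admissible.exists_regularity (h : Admissible κ β ρ T) (𝔲 : Vel) {p : ℝ} (hp : 0 < p)
    (hp1 : p < 1 / 2) (n : ℕ) : ∃ M : ℝ, 0 ≤ M ∧ ∀ (f g : Vel → ℝ) (H G : L2V) (C : ℝ),
      linL κ β ρ 𝔲 T f =ᵐ[volume] g → H =ᵐ[volume] (fun v => maxwellian ρ 𝔲 T v ^ (-p) * f v) →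
      G =ᵐ[volume] (fun v => mW κ 𝔲 v * maxwellian ρ 𝔲 T v ^ (-p) * g v) → SobE n G C →
      SobE n H (M * (‖H‖ + C)) := by
  obtain ⟨A, hAs, hA⟩ := h.exists_nu_op 𝔲
  have hδ : 0 < decayRate T p := h.decayRate_pos hp1
  have t1 : Tame (gau (decayRate T p) 𝔲) (fun w => maxwellian ρ 𝔲 T w ^ (1 / 2 + p)) :=
    h.tame_rpow (by linarith) (by
      linarith [h.two_mul_decayRate_le (p := p) (s := 1 / 2 + p) (by linarith)])
  have t2 : Tame (gau (decayRate T p) 𝔲) (fun w => maxwellian ρ 𝔲 T w ^ (1 / 2 - p)) :=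
    h.tame_rpow (by linarith) (by
      linarith [h.two_mul_decayRate_le (p := p) (s := 1 / 2 - p) le_rfl])
  obtain ⟨K, hK, hKc, hKs⟩ := h.exists_op_collP hδ (tame_mW 𝔲 κ) t1 t2
  obtain ⟨c₀, hc₀, hνl⟩ := h.exists_le_nu 𝔲
  obtain ⟨C₀, hC₀, hνu⟩ := h.exists_nu_le 𝔲
  have hcC : c₀ ≤ C₀ := (hνl 0).trans (hνu 0)
  -- With this scaling c mW ν takes values in [ε, 1], so 1 − c mW ν has norm at most 1 − ε.
  set c := C₀⁻¹ with hc
  have hc0 : 0 < c := inv_pos.2 hC₀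
  set ε := c * c₀ with hε
  have hε0 : 0 < ε := by positivity
  have hε1 : ε ≤ 1 := by
    rw [hε, hc, ← div_eq_inv_mul]
    exact (div_le_one hC₀).2 hcC
  -- K need not be small, but up to less than ε/(2c) it is an operator F built from test functions.
  -- The rest of cK fits into the contraction, and F H is smooth with bounds by ‖H‖ alone.
  obtain ⟨F, hF, hFn⟩ := exists_finRank_approx dense_testSet hKc (ε := ε / (2 * c))
    (by positivity)
  set A' : L2V →L[ℝ] L2V := ContinuousLinearMap.id ℝ L2V - c • A with hA'
  have hA'n : ‖A'‖ ≤ 1 - ε := by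
    have hb : ∀ᵐ v, |1 - c * (mW κ 𝔲 v * nu κ β ρ 𝔲 T v)| ≤ 1 - ε := by
      refine .of_forall fun v => ?_
      have e1 : c * (mW κ 𝔲 v * nu κ β ρ 𝔲 T v) ≤ 1 := by
        rw [hc, ← div_eq_inv_mul]
        exact (div_le_one hC₀).2 (hνu v)
      have e2 : ε ≤ c * (mW κ 𝔲 v * nu κ β ρ 𝔲 T v) := mul_le_mul_of_nonneg_left (hνl v) hc0.le
      rw [abs_of_nonneg (by linarith)]
      linarith
    have hm : AEStronglyMeasurable (fun v => 1 - c * (mW κ 𝔲 v * nu κ β ρ 𝔲 T v)) volume := by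
      have m1 : Measurable (mW κ 𝔲) := continuous_mW.measurable
      have m2 := h.measurable_nu (𝔲 := 𝔲)
      exact (by fun_prop : Measurable _).aestronglyMeasurable
    obtain ⟨U, hU, hUn⟩ := exists_mulOp hm (by linarith) hb
    have e : A' = U := by
      ext1 f
      refine Lp.ext ?_
      rw [hA', sub_apply, smul_apply, ContinuousLinearMap.id_apply]
      filter_upwards [Lp.coeFn_sub f (c • A f), Lp.coeFn_smul c (A f), hA f, hU f]
        with v h1 h2 h3 h4
      rw [h1, Pi.sub_apply, h2, Pi.smul_apply, h3, h4, smul_eq_mul]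
      ring
    rw [e]
    exact hUn
  set Φ : L2V →L[ℝ] L2V := A' + c • (K - F) with hΦ
  have hΦn : ‖Φ‖ < 1 := by
    have e1 : ‖c • (K - F)‖ < ε / 2 := by
      rw [norm_smul, Real.norm_of_nonneg hc0.le]
      calc c * ‖K - F‖ < c * (ε / (2 * c)) := by gcongr
        _ = ε / 2 := by field_simp
    calc ‖Φ‖ ≤ ‖A'‖ + ‖c • (K - F)‖ := norm_add_le _ _
      _ < 1 := by linarith
  have hΦs : SmoothOp n Φ := ((smoothOp_id n).sub ((hAs n).smul c)).add
    (((hKs n).sub (smoothOp_of_mem_finRank n hF)).smul c)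
  obtain ⟨M, hM, hreg⟩ := SmoothOp.exists_regularity n hΦn hΦs
  obtain ⟨M', hM', hFb⟩ := exists_sobE_of_mem_finRank n hF
  refine ⟨M * (c * (M' + 1)), by positivity, fun f g H G C hL hH hG hGC => ?_⟩
  have hC : 0 ≤ C := (norm_nonneg _).trans hGC.norm_le
  have heq : H = Φ H + (c • F H + c • G) := by
    have key : A H = K H + G := by
      refine Lp.ext ?_
      filter_upwards [Lp.coeFn_add (K H) G, hA H, hK H, hH, hG, h.linL_eq_iff.1 hL,
        sumOp_ae_congr (collP κ β (mW κ 𝔲) (fun w => maxwellian ρ 𝔲 T w ^ (1 / 2 + p))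
          (fun w => maxwellian ρ 𝔲 T w ^ (1 / 2 - p))) hH] with v e1 e2 e3 e4 e5 e6 e7
      rw [e1, Pi.add_apply, e2, e3, e7, e5, e4, ← h.weighted_sumOp]
      linear_combination (mW κ 𝔲 v * maxwellian ρ 𝔲 T v ^ (-p)) * e6
    have e1 : Φ H = H - c • A H + c • (K H - F H) := by
      rw [hΦ, hA']
      simp only [add_apply, sub_apply, smul_apply, ContinuousLinearMap.id_apply]
    rw [e1, key]
    module
  have hs := ((hFb H).smul c).add (hGC.smul c)
  refine (hreg H _ _ heq hs).mono ?_
  rw [abs_of_pos hc0, mul_assoc]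
  refine mul_le_mul_of_nonneg_left ?_ hM
  have := norm_nonneg H
  nlinarith [mul_nonneg hc0.le hC, mul_nonneg hc0.le this, mul_nonneg (mul_nonneg hc0.le hM') hC]

/-- The weighted derivatives control the derivatives of the weighted function. -/
lemma Admissible.exists_sobW_source (h : Admissible κ β ρ T) (𝔲 : Vel) {p : ℝ} (hp : 0 < p)
    (n : ℕ) : ∃ K : ℝ≥0∞, K ≠ ⊤ ∧ ∀ (g : Vel → ℝ) (Y : ℝ≥0∞), Y ≠ ⊤ →
      SobW (fun v => mW κ 𝔲 v * maxwellian ρ 𝔲 T v ^ (-p)) n g Y →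
      SobW (fun _ => 1) n (fun v => mW κ 𝔲 v * maxwellian ρ 𝔲 T v ^ (-p) * g v) (K * Y) := by
  have hT := h.temp_pos
  have hA := Real.rpow_pos_of_pos h.const_pos (-p)
  have e : (fun v => maxwellian ρ 𝔲 T v ^ (-p)) =
      fun v => maxConst ρ T ^ (-p) * gau (-p / (2 * T)) 𝔲 v := by
    ext v
    exact h.maxwellian_rpow _ v
  have hsm : Smooth fun v => maxwellian ρ 𝔲 T v ^ (-p) := by
    rw [e]
    exact contDiff_const.mul (smooth_gau 𝔲 _)
  have hpd : ∀ j, partialD j (fun v => maxwellian ρ 𝔲 T v ^ (-p)) =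
      fun v => (p / T) * coord 𝔲 j v * maxwellian ρ 𝔲 T v ^ (-p) := by
    intro j
    rw [e, partialD_const_mul _ (smooth_gau 𝔲 _).differentiable, partialD_gau]
    ext v
    rw [h.maxwellian_rpow, show p / T = -2 * (-p / (2 * T)) by field_simp]
    ring
  -- The logarithmic gradient of the weight is (−κ `rInv` + p/T)(v − 𝔲); as κ < 0 the scalar factor
  -- is at least p/T > 0, as the Hardy inequality requires.
  refine exists_sobW_weight (W := fun v => mW κ 𝔲 v * maxwellian ρ 𝔲 T v ^ (-p))
    (ρ := fun v => -κ * rInv 𝔲 v + p / T) 𝔲 (ContDiff.mul (smooth_mW 𝔲 κ) hsm)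
    (fun v => mul_pos (mW_pos v) (h.rpow_pos _ v)) (fun j v => ?_) (c₀ := p / T) (by positivity)
    (fun v => ?_) n (contDiff_const.mul (smooth_rInv 𝔲) |>.add contDiff_const) ?_
  · rw [partialD_mul (smooth_mW 𝔲 κ).differentiable hsm.differentiable, partialD_mW, hpd]
    ring
  · have : 0 ≤ -κ * rInv 𝔲 v := mul_nonneg (by linarith [h.neg]) (by unfold rInv; positivity)
    linarith
  · exact (((tame_rInv 𝔲).1.const_mul (fun _ => zero_le_one) (-κ)).add (tame_const _)).2

/-- Uniform bounds for the multipliers `μ^s`. -/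
lemma Admissible.exists_derivBdd_rpow (h : Admissible κ β ρ T) (𝔲 : Vel) (s₀ : ℝ) (n : ℕ) :
    ∃ B : ℝ, ∀ s, 0 ≤ s → s ≤ s₀ →
      DerivBdd (fun _ => 1) n (fun v => maxwellian ρ 𝔲 T v ^ s) B := by
  have hT := h.temp_pos
  obtain ⟨B, hB, hb⟩ := exists_derivBdd_gau 𝔲 (s₀ / (2 * T)) n (δ := 0) one_pos
  have hcont : Continuous fun s : ℝ => maxConst ρ T ^ s :=
    Real.continuous_const_rpow h.const_pos.ne'
  obtain ⟨A, hA⟩ := (isCompact_Icc (a := (0 : ℝ)) (b := s₀)).exists_bound_of_continuousOn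
    hcont.continuousOn
  refine ⟨2 ^ n * (|A| * B), fun s hs hs0 => ?_⟩
  have e : (fun v => maxwellian ρ 𝔲 T v ^ s) =
      fun v => maxConst ρ T ^ s * gau (s / (2 * T)) 𝔲 v := by
    ext v
    exact h.maxwellian_rpow _ v
  have h1 := hb (s / (2 * T)) (by positivity) (by gcongr)
  rw [zero_mul, show gau 0 𝔲 = fun _ => 1 from funext fun v => gau_zero 𝔲 v] at h1
  have h2 : DerivBdd (fun _ => 1) n (fun _ : Vel => maxConst ρ T ^ s) |A| := by
    refine (derivBdd_const (fun _ => le_rfl) _).mono (fun _ => zero_le_one) ?_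
    exact (hA s ⟨hs, hs0⟩).trans (le_abs_self A)
  rw [e]
  have h3 := h2.mul (fun _ => zero_le_one) (fun _ => zero_le_one) (abs_nonneg A) hB
    contDiff_const (smooth_gau 𝔲 _) h1
  simpa only [one_mul] using h3

end Regularity


/-! ### The Sobolev embedding for multi-index derivatives. -/

section SobolevMultiIndex

lemma IsWeakDeriv.congr {α : Fin 3 → ℕ} {f g f' : Vel → ℝ} (h : IsWeakDeriv α f f')
    (hfg : f =ᵐ[volume] g) : IsWeakDeriv α g f' := by
  refine ⟨h.1.congr hfg, h.2.1, fun φ hφ hc => ?_⟩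
  rw [← h.2.2 φ hφ hc]
  refine integral_congr_ae ?_
  filter_upwards [hfg] with v hv
  rw [hv]

lemma IsWeakDeriv.ae_eq {f f' : Vel → ℝ} (h : IsWeakDeriv 0 f f') : f =ᵐ[volume] f' := by
  refine ae_eq_of_integral_contDiff_smul_eq h.1 h.2.1 fun φ hφ hc => ?_
  have := h.2.2 φ hφ hc
  simp only [Pi.zero_apply, Finset.sum_const_zero, pow_zero, one_mul] at this
  have e : multiD 0 φ = φ := rfl
  rw [e] at this
  simpa only [smul_eq_mul, mul_comm] using this

/-- The Sobolev embedding in terms of multi-indices. -/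
lemma exists_sobolev_multiIdx : ∃ C : ℝ, 0 < C ∧ ∀ (N : ℕ), 2 ≤ N → ∀ (f : Vel → ℝ)
    (d : (Fin 3 → ℕ) → Vel → ℝ), (∀ α ∈ multiIdx N, IsWeakDeriv α f (d α)) →
    (∀ α ∈ multiIdx N, MemLp (d α) 2 volume) →
    ∃ F : Vel → ℝ, Continuous F ∧ F =ᵐ[volume] f ∧ ∀ v, ENNReal.ofReal |F v| ≤
      ENNReal.ofReal C * ∑ α ∈ multiIdx N, eLpNorm (d α) 2 volume := by
  obtain ⟨C, hC, hS⟩ := exists_sobolev_embedding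
  -- 13 = 1 + 3 + 9 counts f, its first derivatives and its ordered second derivatives, each bounded
  -- by the whole sum.
  refine ⟨C * 13, by positivity, fun N hN f d hd hm => ?_⟩
  have i0 : (0 : Fin 3 → ℕ) ∈ multiIdx N := by rw [mem_multiIdx]; simp
  have i1 : ∀ i, (0 : Fin 3 → ℕ) + Pi.single i 1 ∈ multiIdx N := fun i => by
    rw [mem_multiIdx]; simp; omega
  have i2 : ∀ i j, (0 : Fin 3 → ℕ) + Pi.single i 1 + Pi.single j 1 ∈ multiIdx N := fun i j => by
    rw [mem_multiIdx]; simp [Finset.sum_add_distrib]; omega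
  obtain ⟨F, hF, hFe, hFb⟩ := hS (hm _ i0).toLp (fun i => (hm _ (i1 i)).toLp)
    (fun i j => (hm _ (i2 i j)).toLp)
    (fun i => ((hd _ i0).wder (hd _ (i1 i))).congr (hm _ i0).coeFn_toLp.symm
      (hm _ (i1 i)).coeFn_toLp.symm)
    (fun i j => ((hd _ (i1 i)).wder (hd _ (i2 i j))).congr (hm _ (i1 i)).coeFn_toLp.symm
      (hm _ (i2 i j)).coeFn_toLp.symm)
  refine ⟨F, hF, (hFe.trans (hm _ i0).coeFn_toLp).trans (hd _ i0).ae_eq.symm, fun v => ?_⟩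
  set S := ∑ α ∈ multiIdx N, eLpNorm (d α) 2 volume with hSdef
  have hSt : S ≠ ⊤ := (ENNReal.sum_lt_top.2 fun α hα => (hm α hα).2).ne
  have hle : ∀ α (hα : α ∈ multiIdx N), ‖(hm α hα).toLp‖ ≤ S.toReal := fun α hα => by
    rw [Lp.norm_toLp]
    exact ENNReal.toReal_mono hSt
      (Finset.single_le_sum (f := fun α => eLpNorm (d α) 2 volume) (fun _ _ => zero_le) hα)
  have hb : |F v| ≤ C * 13 * S.toReal := by
    refine (hFb v).trans ?_
    rw [mul_assoc]
    refine mul_le_mul_of_nonneg_left ?_ hC.le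
    have e1 : ∑ i : Fin 3, ‖(hm _ (i1 i)).toLp‖ ≤ ∑ _i : Fin 3, S.toReal :=
      Finset.sum_le_sum fun i _ => hle _ (i1 i)
    have e2 : ∑ i : Fin 3, ∑ j : Fin 3, ‖(hm _ (i2 i j)).toLp‖ ≤
        ∑ _i : Fin 3, ∑ _j : Fin 3, S.toReal :=
      Finset.sum_le_sum fun i _ => Finset.sum_le_sum fun j _ => hle _ (i2 i j)
    have e0 := hle _ i0
    simp only [Finset.sum_const, Finset.card_univ, Fintype.card_fin, nsmul_eq_mul] at e1 e2
    push_cast at e1 e2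
    linarith
  calc ENNReal.ofReal |F v| ≤ ENNReal.ofReal (C * 13 * S.toReal) := ENNReal.ofReal_le_ofReal hb
    _ = _ := by rw [ENNReal.ofReal_mul (by positivity), ENNReal.ofReal_toReal hSt]

end SobolevMultiIndex

/-! ### The weighted Sobolev estimate at the exponent q'. -/

section Estimate

variable {κ : ℝ} {β : ℝ → ℝ} {ρ T : ℝ}

/-- The weighted Sobolev estimate of the pseudo-inverse. -/
lemma Admissible.exists_weighted_estimate (h : Admissible κ β ρ T) (𝔲 : Vel) {p : ℝ} (hp : 0 < p)
    (hp1 : p < 1 / 2) (N : ℕ) : ∃ D : ℝ≥0∞, D ≠ ⊤ ∧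
      ∀ (g : Vel → ℝ) (dg : (Fin 3 → ℕ) → Vel → ℝ) (X : ℝ≥0∞), InNullPerp κ β ρ 𝔲 T g →
      (∀ α ∈ multiIdx N, IsWeakDeriv α g (dg α)) → X ≠ ⊤ →
      (∀ α ∈ multiIdx N, eLpNorm (fun v =>
        (nu κ β ρ 𝔲 T v)⁻¹ * maxwellian ρ 𝔲 T v ^ (-p) * dg α v) 2 volume ≤ X) →
      ∃ (f : Vel → ℝ) (H : L2V), IsLinv κ β ρ 𝔲 T g f ∧
        H =ᵐ[volume] (fun v => maxwellian ρ 𝔲 T v ^ (-p) * f v) ∧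
        SobW (fun _ => 1) N H (D * X) := by
  obtain ⟨C₀, hC₀, hν⟩ := h.exists_nu_le 𝔲
  obtain ⟨K, hK, hsrc⟩ := h.exists_sobW_source 𝔲 hp N
  obtain ⟨D, hD, hsol⟩ := h.exists_solution 𝔲 hp hp1
  obtain ⟨M, hM, hreg⟩ := h.exists_regularity 𝔲 hp hp1 N
  refine ⟨ENNReal.ofReal M * ((D + 1) * (K * ENNReal.ofReal C₀)), by finiteness,
    fun g dg X hg hdg hX hb => ?_⟩
  -- mW ≤ C₀ ν⁻¹ replaces the weight ν⁻¹ of the hypothesis by the smooth one.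
  set Y := ENNReal.ofReal C₀ * X with hY
  have hYt : Y ≠ ⊤ := by finiteness
  have hW : ∀ α ∈ multiIdx N, eLpNorm (fun v =>
      mW κ 𝔲 v * maxwellian ρ 𝔲 T v ^ (-p) * dg α v) 2 volume ≤ Y := by
    intro α hα
    refine (eLpNorm_le_of_abs_le (C := C₀) fun v => ?_).trans
      (mul_le_mul_right (hb α hα) (ENNReal.ofReal C₀))
    have hνp := h.nu_pos (𝔲 := 𝔲) v
    have hmp := mW_pos (κ := κ) (c := 𝔲) v
    have hwp := h.rpow_pos (𝔲 := 𝔲) (-p) v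
    rw [abs_mul, abs_mul, abs_mul, abs_mul, abs_of_pos hmp, abs_of_pos hwp,
      abs_of_pos (inv_pos.2 hνp), ← mul_assoc, ← mul_assoc]
    gcongr
    rw [← div_eq_mul_inv, le_div_iff₀ hνp]
    exact hν v
  have hG := hsrc g Y hYt (sobW_of_isWeakDeriv hdg hW)
  have hKY : K * Y ≠ ⊤ := by finiteness
  have hGb := hG.base
  simp only [one_mul] at hGb
  have hGm : MemLp (fun v => mW κ 𝔲 v * maxwellian ρ 𝔲 T v ^ (-p) * g v) 2 volume :=
    ⟨hGb.1, hGb.2.trans_lt hKY.lt_top⟩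
  obtain ⟨f, hfm, hf, hfb⟩ := hsol g hg hGm.2.ne
  have hfb' : eLpNorm (fun v => maxwellian ρ 𝔲 T v ^ (-p) * f v) 2 volume ≤ D * (K * Y) :=
    hfb.trans (by gcongr; exact hGb.2)
  have hHm : MemLp (fun v => maxwellian ρ 𝔲 T v ^ (-p) * f v) 2 volume :=
    ⟨((h.continuous_rpow _).aestronglyMeasurable.mul hfm.aestronglyMeasurable),
      hfb'.trans_lt (by finiteness)⟩
  refine ⟨f, hHm.toLp, hf, hHm.coeFn_toLp, ?_⟩
  have hs := hreg f g hHm.toLp hGm.toLp _ hf.2 hHm.coeFn_toLp hGm.coeFn_toLp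
    (hG.sobE hKY hGm.coeFn_toLp)
  refine hs.sobW.mono ?_
  have hn : ‖hHm.toLp‖ ≤ (D * (K * Y)).toReal := by
    rw [Lp.norm_toLp]
    exact ENNReal.toReal_mono (by finiteness) hfb'
  calc ENNReal.ofReal (M * (‖hHm.toLp‖ + (K * Y).toReal))
      ≤ ENNReal.ofReal (M * ((D * (K * Y)).toReal + (K * Y).toReal)) := by gcongr
    _ = ENNReal.ofReal M * (D * (K * Y) + K * Y) := by
      rw [ENNReal.ofReal_mul hM, ENNReal.ofReal_add ENNReal.toReal_nonneg ENNReal.toReal_nonneg,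
        ENNReal.ofReal_toReal (by finiteness), ENNReal.ofReal_toReal hKY]
    _ = _ := by rw [hY]; ring

end Estimate

end Boltzmann

/-! ### Conclusion: from the exponent q' to every smaller q. -/

theorem proposition2p1
    (κ : ℝ) (hκ : -3 < κ) (hκ0 : κ < 0)
    (β : ℝ → ℝ) (hβm : Measurable β)
    (hβ : ∃ β₀ : ℝ, 0 < β₀ ∧ ∀ θ ∈ Set.Icc 0 Real.pi, 0 ≤ β θ ∧ β θ ≤ β₀ * |Real.cos θ|)
    (hβ0 : ¬ ∀ᵐ θ ∂(volume.restrict (Set.Icc 0 Real.pi)), β θ = 0)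
    (ρ : ℝ) (hρ : 0 < ρ) (𝔲 : Vel) (T : ℝ) (hT : 0 < T)
    (N : ℕ) (hN : 2 ≤ N) (q' : ℝ) (hq' : 0 < q') (hq'1 : q' < 1) :
    ∃ C₁ C₂ : ℝ, 0 < C₁ ∧ 0 < C₂ ∧
      ∀ q : ℝ, 0 < q → q < q' →
      ∀ (g : Vel → ℝ) (dg : (Fin 3 → ℕ) → Vel → ℝ),
        InNullPerp κ β ρ 𝔲 T g →
        (∀ α ∈ multiIdx N, IsWeakDeriv α g (dg α)) →
        (∑ α ∈ multiIdx N, eLpNorm (fun v =>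
          (nu κ β ρ 𝔲 T v)⁻¹ * maxwellian ρ 𝔲 T v ^ (-(q' / 2)) * dg α v) 2 volume < ⊤) →
        -- the pseudo-inverse `h = L⁻¹ g` exists, has a continuous representative, is unique,
        ∃ h : Vel → ℝ, Continuous h ∧ IsLinv κ β ρ 𝔲 T g h ∧
          (∀ h₁ : Vel → ℝ, IsLinv κ β ρ 𝔲 T g h₁ → h₁ =ᵐ[volume] h) ∧
          -- and `dH α` is the weak derivative `∂_v^α (μ^{-q/2} h)`
          ∃ dH : (Fin 3 → ℕ) → Vel → ℝ,
            (∀ α ∈ multiIdx N,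
              IsWeakDeriv α (fun v => maxwellian ρ 𝔲 T v ^ (-(q / 2)) * h v) (dH α)) ∧
            (∀ v : Vel, ENNReal.ofReal |maxwellian ρ 𝔲 T v ^ (-(q / 2)) * h v| ≤
              ENNReal.ofReal C₁ * ∑ α ∈ multiIdx N, eLpNorm (dH α) 2 volume) ∧
            ENNReal.ofReal C₁ * ∑ α ∈ multiIdx N, eLpNorm (dH α) 2 volume ≤
              ENNReal.ofReal C₂ * ∑ α ∈ multiIdx N, eLpNorm (fun v =>
                (nu κ β ρ 𝔲 T v)⁻¹ * maxwellian ρ 𝔲 T v ^ (-(q' / 2)) * dg α v) 2 volume := by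
  have adm : Admissible κ β ρ T := ⟨hκ, hκ0, hβm, hβ, hβ0, hρ, hT⟩
  obtain ⟨C₁, hC₁, hsob⟩ := exists_sobolev_multiIdx
  obtain ⟨D, hD, hest⟩ := adm.exists_weighted_estimate 𝔲 (p := q' / 2) (by linarith)
    (by linarith) N
  -- One bound for all exponents in [0, q'/2], to which (q' − q)/2 belongs; this makes C₂
  -- independent of q.
  obtain ⟨B, hB⟩ := adm.exists_derivBdd_rpow 𝔲 (q' / 2) N
  set E : ℝ≥0∞ := ENNReal.ofReal C₁ *
    ((multiIdx N).card * (2 ^ N * ENNReal.ofReal B * D)) with hE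
  have hEt : E ≠ ⊤ := by finiteness
  refine ⟨C₁, E.toReal + 1, hC₁, by positivity, fun q hq hqq g dg hg hdg hfin => ?_⟩
  set X := ∑ α ∈ multiIdx N, eLpNorm (fun v =>
    (nu κ β ρ 𝔲 T v)⁻¹ * maxwellian ρ 𝔲 T v ^ (-(q' / 2)) * dg α v) 2 volume with hX
  obtain ⟨f, H, hf, hH, hHs⟩ := hest g dg X hg hdg hfin.ne fun α hα =>
    Finset.single_le_sum (f := fun α => eLpNorm (fun v =>
      (nu κ β ρ 𝔲 T v)⁻¹ * maxwellian ρ 𝔲 T v ^ (-(q' / 2)) * dg α v) 2 volume)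
      (fun _ _ => zero_le) hα
  have hsm : Smooth fun v => maxwellian ρ 𝔲 T v ^ ((q' - q) / 2) :=
    (adm.tame_rpow (𝔲 := 𝔲) (δ := 0) (by linarith) (by
      have : 0 < q' - q := by linarith
      positivity)).1
  have hmul := SobW.mul hsm (hB ((q' - q) / 2) (by linarith) (by linarith)) continuous_const hHs
  have hZt : 2 ^ N * ENNReal.ofReal B * (D * X) ≠ ⊤ := by
    have := hfin.ne
    finiteness
  have hex : ∀ α, ∃ d : Vel → ℝ, α ∈ multiIdx N →
      IsWeakDeriv α (fun v => maxwellian ρ 𝔲 T v ^ ((q' - q) / 2) * H v) d ∧ MemLp d 2 volume ∧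
        eLpNorm d 2 volume ≤ 2 ^ N * ENNReal.ofReal B * (D * X) := by
    intro α
    by_cases hα : α ∈ multiIdx N
    · obtain ⟨d, hd⟩ := hmul.exists_isWeakDeriv hZt hα
      exact ⟨d, fun _ => hd⟩
    · exact ⟨0, fun h => absurd h hα⟩
  choose dH hdH using hex
  -- F is the continuous representative of μ^{(q'−q)/2} H = μ^{-q/2} f, so the continuous
  -- representative of the pseudo-inverse is μ^{q/2} F.
  obtain ⟨F, hFc, hFe, hFb⟩ := hsob N hN _ dH (fun α hα => (hdH α hα).1)
    (fun α hα => (hdH α hα).2.1)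
  have hcancel : ∀ v, maxwellian ρ 𝔲 T v ^ (-(q / 2)) * (maxwellian ρ 𝔲 T v ^ (q / 2) * F v) =
      F v := fun v => by
    rw [← mul_assoc, ← Real.rpow_add (adm.maxwellian_pos v), neg_add_cancel, Real.rpow_zero,
      one_mul]
  have hfF : f =ᵐ[volume] fun v => maxwellian ρ 𝔲 T v ^ (q / 2) * F v := by
    filter_upwards [hFe, hH] with v h1 h2
    rw [h1, h2, ← mul_assoc, ← mul_assoc, ← Real.rpow_add (adm.maxwellian_pos v),
      ← Real.rpow_add (adm.maxwellian_pos v)]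
    rw [show q / 2 + (q' - q) / 2 + -(q' / 2) = 0 by ring, Real.rpow_zero, one_mul]
  have hlin := adm.isLinv_congr hf hfF
  refine ⟨fun v => maxwellian ρ 𝔲 T v ^ (q / 2) * F v, (adm.continuous_rpow _).mul hFc, hlin,
    fun h₁ hh₁ => adm.isLinv_unique hh₁ hlin, dH, fun α hα => ?_, fun v => ?_, ?_⟩
  · simp only [hcancel]
    exact (hdH α hα).1.congr hFe.symm
  · rw [hcancel]
    exact hFb v
  · calc ENNReal.ofReal C₁ * ∑ α ∈ multiIdx N, eLpNorm (dH α) 2 volume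
        ≤ ENNReal.ofReal C₁ *
            ∑ _α ∈ multiIdx N, 2 ^ N * ENNReal.ofReal B * (D * X) := by
          gcongr with α hα
          exact (hdH α hα).2.2
      _ = E * X := by
          rw [Finset.sum_const, nsmul_eq_mul, hE]
          ring
      _ ≤ ENNReal.ofReal (E.toReal + 1) * X := by
          gcongr
          rw [← ENNReal.ofReal_toReal hEt]
          exact ENNReal.ofReal_le_ofReal (by rw [ENNReal.toReal_ofReal ENNReal.toReal_nonneg]; linarith)
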